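/- Let $\mathbb R^{2,1}$ be Minkowski space with the form $\langle x,y\rangle=-x_0y_0+x_1y_1+x_2y_2$, and let $\mathbb H^2=\{x:\langle x,x\rangle=-1,\ x_0>0\}$. Let $S$ be a closed connected oriented hyperbolic surface with fundamental group $\Gamma$ and holonomy $\rho:\Gamma\to SO_0(2,1)$, so that $S=\mathbb H^2/\rho(\Gamma)$, and let $V\subset S$ be a finite non-empty set. For a $\rho$-cocycle $\tau$ (that is, $\tau(\gamma\mu)=\rho(\gamma)\tau(\mu)+\tau(\gamma)$) let $\rho_\tau(\gamma)x=\rho(\gamma)x+\tau(\gamma)$, let $\tilde\Omega^+(\rho,\tau)\subset\mathbb R^{2,1}$ be the largest open convex future-complete $\rho_\tau$-invariant set on which $\rho_\tau$ acts freely and properly discontinuously, and let $\Omega^+(\rho,\tau)$ be its quotient. Let $\mathcal P_c(\rho,V)$ be the space of pairs $(\tau,f)$, where $\tau$ is a cocycle up to coboundaries and $f:V\to\Omega^+(\rho,\tau)$ is a map whose image is in strictly convex position (no lifted marked point is a convex combination of other lifted marked points). Near the class of $(\tau,\tilde f)$, where $\tilde f$ is a lift of $f$ to $\mathbb R^{2,1}$,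 this space is the quotient of an open subset of the finite-dimensional vector space $Z^1(\rho)\times(\mathbb R^{2,1})^V$ by the translations of $\mathbb R^{2,1}$; hence its tangent space is the quotient of $Z^1(\rho)\times(\mathbb R^{2,1})^V$ by the vectors $\bigl((w-\rho(\gamma)w)_{\gamma\in\Gamma},(w)_{v\in V}\bigr)$, $w\in\mathbb R^{2,1}$. Let $\mathcal M_-(S,V)$ be the space of flat metrics on $S$ with set of cone points $V$ and negative singular curvatures, up to isometries fixing $V$ and isotopic to the identity; its charts are given by the edge lengths of geodesic triangulations with vertex set $V$. Let $\mathcal I_\rho:\mathcal P_c(\rho,V)\to\mathcal M_-(S,V)$ send $(\tau,f)$ to the induced intrinsic metric on the boundary of the convex hull of $f(V)$. **(1)** The differential $d\mathcal I_\rho$ is non-degenerate: at every point of $\mathcal P_c(\rho,V)$, in the chart of $\mathcal M_-(S,V)$ given by any triangulation with vertex set $V$ that subdivides the face cellulation of the boundary of the convex hull, the map $\mathcal I_\rho$ is differentiable and its differential is injective on the tangent space of $\mathcal P_c(\rho,V)$. Now let $G$ be a convex geodesic cellulation of $S$ (all corner angles lie in $(0,\pi)$), in which edges of zero length are allowed: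 an edge of zero length still has a direction, it is included in the cyclic order and in the corner angles at its endpoints, and the edges of zero length form a forest. Let $\tilde G$ be the lift of $G$ to $\mathbb H^2$. Orient the edges equivariantly and let $n_e\in\mathbb R^{2,1}$ be the oriented unit normal of the line that contains the edge $e$ of $\tilde G$. For a vertex $v$ and an incident edge $e$ put $\sigma_{ve}=1$ if $v$ is the source of $e$ and $\sigma_{ve}=-1$ if it is the target, and put $\lambda_{ve}=\tan(\alpha_1/2)+\tan(\alpha_2/2)$, where $\alpha_1,\alpha_2$ are the angles of the two corners at $v$ that contain $e$. **(2)** Let $(\dot e)$ be a $\rho$-equivariant family of vectors of $\mathbb R^{2,1}$ indexed by the edges of $\tilde G$, such that $$\langle\dot e,n_e\rangle=0\ \text{ for every edge } e,\qquad \langle n_{e},\dot e'\rangle+\langle\dot e,n_{e'}\rangle=0\ \text{ for every corner with sides } e,e',\qquad \Bigl\langle\sum_{e\ni v}\lambda_{ve}\sigma_{ve}\,\dot e,\ v\Bigr\rangle=0\ \text{ for every vertex } v.$$ Then $\dot e=0$ for every edge $e$. **(3)** Consequently, every infinitesimal deformation of $G$ on the fixed hyperbolic surface $S$ that preserves all corner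 angles at first order is trivial: if $\rho$-equivariant variations $\dot v$ of the vertices and $\dot e$ of the unit normals satisfy $\langle\dot v,v\rangle=0$, $\langle\dot e,n_e\rangle=0$, $\langle\dot v,n_e\rangle+\langle v,\dot e\rangle=0$ for every vertex $v$ of an edge $e$, and $\langle n_e,\dot e'\rangle+\langle\dot e,n_{e'}\rangle=0$ for every corner with sides $e,e'$, then all $\dot v$ and all $\dot e$ are zero. -/

import Mathlib

open Topology

namespace HypRigidity

noncomputable section

/-! ### Minkowski space `ℝ^{2,1}`, the hyperbolic plane, closed hyperbolic surfaces -/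

/-- The vector space underlying Minkowski space `ℝ^{2,1}`; `x 0` is the time coordinate. -/
abbrev Mink : Type := Fin 3 → ℝ

/-- The Minkowski bilinear form `-x₀y₀ + x₁y₁ + x₂y₂`. -/
def mink (x y : Mink) : ℝ := -(x 0 * y 0) + x 1 * y 1 + x 2 * y 2

/-- The Lorentzian cross product: `mink (lcross x y) z = det (x, y, z)`. If `x` lies on the
hyperbolic plane and `u` is a unit tangent vector at `x`, then `lcross x u` is `u` turned by a
quarter turn counterclockwise in the tangent plane at `x`. -/
def lcross (x y : Mink) : Mink :=
  ![-(x 1 * y 2 - x 2 * y 1), x 2 * y 0 - x 0 * y 2, x 0 * y 1 - x 1 * y 0]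

/-- The hyperbolic plane: the future sheet of the two-sheeted hyperboloid. -/
def hyperbolicPlane : Set Mink := {x | mink x x = -1 ∧ 0 < x 0}

/-- `ρ` takes its values in `SO₀(2,1)` and is the holonomy of a closed hyperbolic surface: `Γ`
acts through `ρ` freely, properly discontinuously and cocompactly on the hyperbolic plane. So the
quotient is a closed connected oriented hyperbolic surface `S` with fundamental group `Γ`. -/
structure IsHyperbolicHolonomy {Γ : Type*} [Group Γ] (ρ : Γ →* (Mink ≃ₗ[ℝ] Mink)) : Prop where
  mink_map : ∀ γ x y, mink (ρ γ x) (ρ γ y) = mink x y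
  det_eq_one : ∀ γ, LinearMap.det (ρ γ : Mink →ₗ[ℝ] Mink) = 1
  map_plane : ∀ γ, ∀ x ∈ hyperbolicPlane, ρ γ x ∈ hyperbolicPlane
  free : ∀ γ, γ ≠ 1 → ∀ x ∈ hyperbolicPlane, ρ γ x ≠ x
  properlyDiscontinuous : ∀ K : Set Mink, IsCompact K → K ⊆ hyperbolicPlane →
    {γ : Γ | ((ρ γ '' K) ∩ K).Nonempty}.Finite
  cocompact : ∃ K : Set Mink, IsCompact K ∧ K ⊆ hyperbolicPlane ∧
    ∀ x ∈ hyperbolicPlane, ∃ γ, ∃ y ∈ K, ρ γ y = x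

/-! ### Flat spacetimes with marked points -/

section Spacetimes

variable {Γ : Type*} [Group Γ] (ρ : Γ →* (Mink ≃ₗ[ℝ] Mink))

/-- The space `Z¹(ρ)` of `ρ`-cocycles, with the topology of pointwise convergence (when `Γ` is
finitely generated this space is finite-dimensional, and this is its vector space topology). -/
def cocycles : Submodule ℝ (Γ → Mink) where
  carrier := {τ | ∀ γ μ, τ (γ * μ) = ρ γ (τ μ) + τ γ}
  zero_mem' := by intro γ μ; simp
  add_mem' := by
    intro a b ha hb γ μ
    simp only [Pi.add_apply, ha γ μ, hb γ μ, map_add]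
    abel
  smul_mem' := by
    intro c a ha γ μ
    simp only [Pi.smul_apply, ha γ μ, map_smul, smul_add]

variable {ρ} in
/-- The affine isometry `ρ_τ(γ)` of Minkowski space. -/
def affineAct (τ : cocycles ρ) (γ : Γ) (x : Mink) : Mink := ρ γ x + (τ : Γ → Mink) γ

/-- The open future timelike cone. -/
def futureCone : Set Mink := {w | mink w w < 0 ∧ 0 < w 0}

variable {ρ} in
/-- An open convex future-complete `ρ_τ`-invariant set on which `Γ` acts through `ρ_τ` freely and
properly discontinuously. -/
structure IsFutureInvariantDomain (τ : cocycles ρ) (U : Set Mink) : Prop where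
  isOpen : IsOpen U
  convex : Convex ℝ U
  future : ∀ x ∈ U, ∀ w ∈ futureCone, x + w ∈ U
  invariant : ∀ γ, ∀ x ∈ U, affineAct τ γ x ∈ U
  free : ∀ γ, γ ≠ 1 → ∀ x ∈ U, affineAct τ γ x ≠ x
  properlyDiscontinuous : ∀ K : Set Mink, IsCompact K → K ⊆ U →
    {γ : Γ | ((affineAct τ γ '' K) ∩ K).Nonempty}.Finite

variable {ρ} in
/-- The domain `Ω̃⁺(ρ, τ)`, the largest of all open convex future-complete invariant sets with a
free and properly discontinuous action. Its quotient is the flat spacetime `Ω⁺(ρ, τ)`. -/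
def futureDomain (τ : cocycles ρ) : Set Mink := ⋃₀ {U | IsFutureInvariantDomain τ U}

/-- Lifted data of a spacetime with marked points and linear holonomy `ρ`: a cocycle and, for each
`v : V`, the position of one chosen lift of the marked point `v`. -/
abbrev MarkedData (V : Type*) : Type _ := cocycles ρ × (V → Mink)

variable {ρ} {V : Type*}

/-- The equivariant vertex marking map. The full preimage of the marked set in the universal cover
is identified with `Γ × V`. -/
def liftedMarking (p : MarkedData ρ V) (a : Γ × V) : Mink := affineAct p.1 a.1 (p.2 a.2)

/-- The space of lifted data that represent elements of `P_c(ρ, V)`: the marked points lie in the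
spacetime, and they are in strictly convex position. -/
def convexMarkedData (ρ : Γ →* (Mink ≃ₗ[ℝ] Mink)) (V : Type*) : Set (MarkedData ρ V) :=
  {p | (∀ v, p.2 v ∈ futureDomain p.1) ∧
    ∀ a : Γ × V, liftedMarking p a ∉ convexHull ℝ (liftedMarking p '' {a}ᶜ)}

/-- The lift to Minkowski space of the boundary of the convex hull of the marked points. -/
def hullBoundary (p : MarkedData ρ V) : Set Mink :=
  frontier (convexHull ℝ (Set.range (liftedMarking p)))

/-- The tangent directions at `p` that are trivial in `P_c(ρ, V)`: those of the action of the
translations of Minkowski space (this action changes the cocycle by coboundaries). The tangent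
space of `P_c(ρ, V)` at the class of `p` is the quotient of `MarkedData ρ V` by these. -/
def trivialDirections (ρ : Γ →* (Mink ≃ₗ[ℝ] Mink)) (V : Type*) : Set (MarkedData ρ V) :=
  {q | ∃ w : Mink, (∀ γ, (q.1 : Γ → Mink) γ = w - ρ γ w) ∧ ∀ v, q.2 v = w}

/-- The action of `Γ` on the lifted marked points. -/
def translate (γ : Γ) : Γ × V ≃ Γ × V := (Equiv.mulLeft γ).prodCongr (Equiv.refl V)

/-- `T` is (the set of triangles of) a `Γ`-invariant triangulation of the lifted hull boundary
by straight triangles, with the lifted marked points as vertices; in other words, a triangulation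
subdividing the face cellulation. -/
structure IsFaceTriangulation (p : MarkedData ρ V) (T : Set (Finset (Γ × V))) : Prop where
  card_eq : ∀ t ∈ T, t.card = 3
  invariant : ∀ γ, ∀ t ∈ T, t.map (translate γ).toEmbedding ∈ T
  subset_boundary : ∀ t ∈ T, convexHull ℝ (liftedMarking p '' (t : Set (Γ × V))) ⊆ hullBoundary p
  cover : ∀ x ∈ hullBoundary p, ∃ t ∈ T, x ∈ convexHull ℝ (liftedMarking p '' (t : Set (Γ × V)))
  inter : ∀ t ∈ T, ∀ s ∈ T,
    convexHull ℝ (liftedMarking p '' (t : Set (Γ × V))) ∩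
        convexHull ℝ (liftedMarking p '' (s : Set (Γ × V))) ⊆
      convexHull ℝ (liftedMarking p '' ((t : Set (Γ × V)) ∩ (s : Set (Γ × V))))

/-- The pairs of distinct endpoints of the edges of a triangulation. -/
def edges (T : Set (Finset (Γ × V))) : Set ((Γ × V) × (Γ × V)) :=
  {e | e.1 ≠ e.2 ∧ ∃ t ∈ T, e.1 ∈ t ∧ e.2 ∈ t}

/-! ### Flat metrics in the charts given by edge lengths -/

/-- The closed simplex with vertex set `t`, in barycentric coordinates. -/
def simplex (t : Finset (Γ × V)) : Set (Γ × V → ℝ) :=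
  {x | (∀ a, 0 ≤ x a) ∧ (∀ a, a ∉ t → x a = 0) ∧ ∑ a ∈ t, x a = 1}

/-- The geometric realization of the complex whose maximal simplices are the elements of `T`. -/
def realization (T : Set (Finset (Γ × V))) : Set (Γ × V → ℝ) := ⋃ t ∈ T, simplex t

/-- The squared Euclidean distance of two points of the simplex `t`, when this simplex is given the
flat metric with edge lengths `l`. -/
def flatSq (l : (Γ × V) × (Γ × V) → ℝ) (t : Finset (Γ × V)) (x y : Γ × V → ℝ) : ℝ :=
  -(1 / 2) * ∑ a ∈ t, ∑ b ∈ t, l (a, b) ^ 2 * (x a - y a) * (x b - y b)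

open Classical in
/-- The induced metric on the boundary of the convex hull of the marked points is the flat metric
that has the coordinates `l` in the chart given by the triangulation `T`. That is, `l` gives
invariant edge lengths, and the surface glued from the flat triangles with these edge lengths is
isometric to the hull boundary with its induced intrinsic metric, by an equivariant isometry `h`
that respects the vertex markings. As both surfaces are polyhedral, an isometry of their intrinsic
metrics is the same as a homeomorphism which maps, isometrically and affinely, each piece of a
finite subdivision of each triangle to a flat convex piece of the hull boundary. -/
def InducedMetricHasLengths (p : MarkedData ρ V) (T : Set (Finset (Γ × V)))
    (l : (Γ × V) × (Γ × V) → ℝ) : Prop :=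
  (∀ a, l (a, a) = 0) ∧ (∀ a b, l (a, b) = l (b, a)) ∧ (∀ e ∈ edges T, 0 < l e) ∧
  (∀ γ a b, l (translate γ a, translate γ b) = l (a, b)) ∧
  ∃ h : (Γ × V → ℝ) → Mink,
    Set.BijOn h (realization T) (hullBoundary p) ∧
    (∀ γ, ∀ x ∈ realization T, h (fun a => x ((translate γ).symm a)) = affineAct p.1 γ (h x)) ∧
    (∀ a, h (Pi.single a 1) = liftedMarking p a) ∧
    ∀ t ∈ T, ContinuousOn h (simplex t) ∧
      ∃ 𝒦 : Set (Set (Γ × V → ℝ)), 𝒦.Finite ∧ ⋃₀ 𝒦 = simplex t ∧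
        ∀ K ∈ 𝒦, IsClosed K ∧ Convex ℝ K ∧
          ∀ x ∈ K, ∀ y ∈ K, mink (h x - h y) (h x - h y) = flatSq l t x y

/-- The differential of the induced metric map `I_ρ : P_c(ρ, V) → M₋(S, V)` at the class of `p`
exists and is injective, in the chart of `M₋(S, V)` given by the triangulation `T`: near `p` the
induced metrics have edge lengths `Φ` in this chart, the function `Φ` is differentiable at `p`, and
the derivatives of all edge lengths vanish exactly in the directions that are trivial in
`P_c(ρ, V)`. -/
def HasInjectiveDifferential (p : MarkedData ρ V) (T : Set (Finset (Γ × V))) : Prop :=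
  ∃ (Φ : (Γ × V) × (Γ × V) → MarkedData ρ V → ℝ)
    (L : (Γ × V) × (Γ × V) → MarkedData ρ V →L[ℝ] ℝ),
    (∀ᶠ q in 𝓝 p, InducedMetricHasLengths q T (fun e => Φ e q)) ∧
    (∀ e ∈ edges T, HasFDerivAt (Φ e) (L e) p) ∧
    ∀ q : MarkedData ρ V, (∀ e ∈ edges T, L e q = 0) ↔ q ∈ trivialDirections ρ V

end Spacetimes

/-! ### Convex geodesic cellulations, possibly with edges of zero length -/

section Cellulations

variable {Γ : Type*} [Group Γ] (ρ : Γ →* (Mink ≃ₗ[ℝ] Mink))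
  (W D : Type*) [MulAction Γ W] [MulAction Γ D]

/-- The lift to the hyperbolic plane of a geodesic graph on the hyperbolic surface `S`, with
vertices `W` and with darts (oriented edges) `D`; edges of zero length are allowed, but they have
directions. Each vertex carries the cyclic order of the darts around it. -/
structure GeodesicGraph where
  /-- the source of a dart -/
  src : D → W
  /-- the dart with the reversed orientation -/
  rev : Equiv.Perm D
  /-- the next dart with the same source, counterclockwise -/
  next : Equiv.Perm D
  /-- the position of a vertex -/
  pos : W → Mink
  /-- the unit tangent vector of a dart at its source -/
  dir : D → Mink
  /-- the length of a dart -/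
  len : D → ℝ
  /-- the angle of the corner between `d` and `next d` -/
  angle : D → ℝ
  src_smul : ∀ (γ : Γ) d, src (γ • d) = γ • src d
  rev_smul : ∀ (γ : Γ) d, rev (γ • d) = γ • rev d
  next_smul : ∀ (γ : Γ) d, next (γ • d) = γ • next d
  pos_smul : ∀ (γ : Γ) v, pos (γ • v) = ρ γ (pos v)
  dir_smul : ∀ (γ : Γ) d, dir (γ • d) = ρ γ (dir d)
  finite_quotient : ∃ s : Set D, s.Finite ∧ ∀ d, ∃ γ : Γ, ∃ d₀ ∈ s, γ • d₀ = d
  rev_rev : ∀ d, rev (rev d) = d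
  rev_ne : ∀ d, rev d ≠ d
  src_next : ∀ d, src (next d) = src d
  /-- the darts with a given source form a single cycle of `next` -/
  sameCycle_next : ∀ d d', src d = src d' → next.SameCycle d d'
  pos_mem : ∀ v, pos v ∈ hyperbolicPlane
  mink_dir : ∀ d, mink (dir d) (dir d) = 1
  mink_pos_dir : ∀ d, mink (pos (src d)) (dir d) = 0
  len_nonneg : ∀ d, 0 ≤ len d
  pos_rev : ∀ d, pos (src (rev d)) =
    Real.cosh (len d) • pos (src d) + Real.sinh (len d) • dir d
  dir_rev : ∀ d, dir (rev d) =
    -(Real.sinh (len d) • pos (src d) + Real.cosh (len d) • dir d)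
  dir_next : ∀ d, dir (next d) =
    Real.cos (angle d) • dir d + Real.sin (angle d) • lcross (pos (src d)) (dir d)

variable {ρ W D}

namespace GeodesicGraph

variable (G : GeodesicGraph ρ W D)

/-- The unit normal, to the left, of the oriented line that contains the dart `d`. -/
def normal (d : D) : Mink := lcross (G.pos (G.src d)) (G.dir d)

/-- The next dart along the boundary of the face to the left of a dart. -/
def faceNext : Equiv.Perm D := G.rev.trans G.next.symm

/-- The boundary of the face to the left of the dart `d`, as a set of darts. -/
def face (d : D) : Set D := {d' | G.faceNext.SameCycle d d'}

/-- The closed face to the left of the dart `d` (if it is convex), as the intersection of the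
half-planes to the left of its sides. -/
def tile (d : D) : Set Mink :=
  {x | x ∈ hyperbolicPlane ∧ ∀ d' ∈ G.face d, 0 ≤ mink x (G.normal d')}

/-- The open face to the left of the dart `d`. -/
def openTile (d : D) : Set Mink :=
  {x | x ∈ hyperbolicPlane ∧ ∀ d' ∈ G.face d, 0 < mink x (G.normal d')}

/-- The graph of the edges of zero length. -/
def zeroGraph : SimpleGraph W :=
  SimpleGraph.fromRel fun v w => ∃ d, G.src d = v ∧ G.src (G.rev d) = w ∧ G.len d = 0

/-- The geodesic graph is (the lift of) a convex geodesic cellulation of the closed hyperbolic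
surface, in which edges may have length zero. -/
structure IsConvexCellulation : Prop where
  angle_pos : ∀ d, 0 < G.angle d
  angle_lt_pi : ∀ d, G.angle d < Real.pi
  /-- the corners at a vertex fill the full angle exactly once -/
  sum_angle : ∀ v, ∑ᶠ (d : D) (_ : G.src d = v), G.angle d = 2 * Real.pi
  /-- every face is a compact convex polygon bounded by its darts -/
  face_finite : ∀ d, (G.face d).Finite
  face_convex : ∀ d, ∀ d' ∈ G.face d, G.pos (G.src d') ∈ G.tile d
  openTile_nonempty : ∀ d, (G.openTile d).Nonempty
  /-- the faces tile the hyperbolic plane -/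
  tile_cover : ∀ x ∈ hyperbolicPlane, ∃ d, x ∈ G.tile d
  openTile_disjoint : ∀ d d' x, x ∈ G.openTile d → x ∈ G.openTile d' → d' ∈ G.face d
  /-- distinct edges of positive length are realized by distinct segments -/
  dart_injective : ∀ d d', 0 < G.len d → 0 < G.len d' →
    G.pos (G.src d) = G.pos (G.src d') → G.dir d = G.dir d' → d = d'
  /-- the subgraph of the edges of zero length is a forest: it has no loops, no multiple edges
  and no longer cycles -/
  zero_loopless : ∀ d, G.len d = 0 → G.src (G.rev d) ≠ G.src d
  zero_simple : ∀ d d', G.len d = 0 → G.len d' = 0 → G.src d = G.src d' →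
    G.src (G.rev d) = G.src (G.rev d') → d = d'
  zero_acyclic : G.zeroGraph.IsAcyclic

/-- The coefficient `tan (α₁ / 2) + tan (α₂ / 2)`, where `α₁` and `α₂` are the angles of the two
corners that contain the dart `d` at its source. -/
def coeff (d : D) : ℝ :=
  Real.tan (G.angle d / 2) + Real.tan (G.angle (G.next.symm d) / 2)

/-- An equivariant field of vectors on the edges. It assigns opposite vectors to the two
orientations of an edge, as the unit normals do. -/
structure IsEdgeField (e : D → Mink) : Prop where
  smul : ∀ (γ : Γ) d, e (γ • d) = ρ γ (e d)
  rev : ∀ d, e (G.rev d) = -e d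

/-- The linear system for the variations `e` of the unit normals of the edges: the normals remain
unit, the angles of the corners do not change, and at every vertex the linear relation expressing
that the edges remain concurrent holds. (The outgoing darts at a vertex carry the normals
multiplied by the orientation signs.) -/
structure SolvesSystem (e : D → Mink) : Prop where
  unit : ∀ d, mink (e d) (G.normal d) = 0
  corner : ∀ d, mink (G.normal d) (e (G.next d)) + mink (e d) (G.normal (G.next d)) = 0
  vertex : ∀ v, mink (∑ᶠ (d : D) (_ : G.src d = v), G.coeff d • e d) (G.pos v) = 0

/-- An infinitesimal deformation of the cellulation on the fixed hyperbolic surface: equivariant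
variations `u` of the vertices in the hyperbolic plane and `e` of the unit normals of the edges,
such that, at first order, the vertices remain on the lines that contain their edges. -/
structure IsInfinitesimalDeformation (u : W → Mink) (e : D → Mink) : Prop where
  edgeField : G.IsEdgeField e
  smul : ∀ (γ : Γ) v, u (γ • v) = ρ γ (u v)
  tangent : ∀ v, mink (u v) (G.pos v) = 0
  unit : ∀ d, mink (e d) (G.normal d) = 0
  incident : ∀ d, mink (u (G.src d)) (G.normal d) + mink (G.pos (G.src d)) (e d) = 0

/-- The variation `e` of the unit normals preserves the angles of all corners at first order: it
does not change the scalar products of the normals, which are the cosines of these angles. -/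
def PreservesAngles (e : D → Mink) : Prop :=
  ∀ d, mink (G.normal d) (e (G.next d)) + mink (e d) (G.normal (G.next d)) = 0

end GeodesicGraph

end Cellulations

end

end HypRigidity

open HypRigidity

namespace HypRigidity

/-! ### Lorentzian linear algebra -/

/-! Both halves of the theorem rest on discrete maximum principles over finitely many cells modulo
`Γ`.

Angle system. For a dart `d` put q = ⟨e, dir⟩ and p = ⟨e, pos⟩ at its source. The corner equations
say that q is the same for all darts at a vertex (`mink_dir_eq`). Seen from the other end of the
edge, q becomes sinh(len) p + cosh(len) q (`mink_dir_rev`). The vertex equation is a relation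
between the p's with positive weights, so some dart has p ≥ 0. At a positive maximum of q such a
dart would give a larger value at its other end, unless its length is zero. The argument then
continues along zero edges without backtracking, which is impossible in a forest with finitely many
vertices at each position (`no_zero_path`). Hence q = 0; the same path argument then gives p = 0.
For (3), the weights tan(α₁/2) + tan(α₂/2) are the coefficients of a linear relation between the
normals at a vertex (`sum_coeff_normal`), so a deformation that keeps the angles solves the system.

Differential of the induced metric. Let Z be the lifted marked points. Suppose that a variation q of
the data kills the derivatives of all edge lengths. A triangulated convex polygon is infinitesimally
rigid in its plane, so each two-dimensional face with unit normal ν turns in its plane with an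
angular velocity κ(ν) (`IsFacet.exists_twist`). If ν' is the neighbour across the side from a to b,
oriented counterclockwise, then κ(ν') = r (κ(ν) - s ⟨ν, q_b - q_a⟩) with r > 1 and s > 0. At a
positive maximum of κ the height ⟨ν, q⟩ would strictly increase all the way round the face
(`not_exists_max_twist`). So κ = 0, every face is merely translated, and the translation vector is
constant because it is a locally constant function on the connected cone of normals.

The map itself must also be differentiated, although faces with more than three vertices may break
in different ways near p. Over a face of p, the hull boundary for nearby data is triangulated by
some lower hull T', which depends on the data. Its triangles are developed into the plane as a
convex polygon y close to the original one (`exists_development`). The prescribed triangulation T is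
drawn straight in y as well, and this identifies the two metrics (`exists_faceMap`). The heights
above the old face plane enter the squared lengths only quadratically, so the distances in y have
the same first derivative as the Minkowski lengths of the edges, whichever T' occurs
(`IsFacet.eventually_faceMap`, `hasFDerivAt_of_sq_sub_edgeSq`). Pieces over different faces agree on
common sides and are glued equivariantly.

All this needs control of infinitely many marked points at once. Cocompactness bounds the growth of
cocycles by the displacement of the base point o. A future domain with a properly discontinuous
action is not the whole space, and this forces its orbits to grow linearly to the future: Z at γ
lies causally above c γ(o) - C o (`exists_growth`). This `UniformGrowth` is stable under small
changes of the data. It makes support normals timelike, contact sets finite, and contact sets upper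
semicontinuous in the data and the normal. Compactness modulo `Γ` then leaves finitely many faces
and one neighbourhood of p that serves all of them. -/

theorem mink_comm (x y : Mink) : mink x y = mink y x := by simp only [mink]; ring

theorem mink_add_left (x y z : Mink) : mink (x + y) z = mink x z + mink y z := by
  simp only [mink, Pi.add_apply]; ring

theorem mink_add_right (x y z : Mink) : mink x (y + z) = mink x y + mink x z := by
  simp only [mink, Pi.add_apply]; ring

theorem mink_sub_left (x y z : Mink) : mink (x - y) z = mink x z - mink y z := by
  simp only [mink, Pi.sub_apply]; ring

theorem mink_sub_right (x y z : Mink) : mink x (y - z) = mink x y - mink x z := by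
  simp only [mink, Pi.sub_apply]; ring

theorem mink_neg_left (x y : Mink) : mink (-x) y = -mink x y := by
  simp only [mink, Pi.neg_apply]; ring

theorem mink_neg_right (x y : Mink) : mink x (-y) = -mink x y := by
  simp only [mink, Pi.neg_apply]; ring

theorem mink_smul_left (c : ℝ) (x y : Mink) : mink (c • x) y = c * mink x y := by
  simp only [mink, Pi.smul_apply, smul_eq_mul]; ring

theorem mink_smul_right (c : ℝ) (x y : Mink) : mink x (c • y) = c * mink x y := by
  simp only [mink, Pi.smul_apply, smul_eq_mul]; ring

@[simp] theorem mink_zero_left (x : Mink) : mink 0 x = 0 := by simp [mink]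

@[simp] theorem mink_zero_right (x : Mink) : mink x 0 = 0 := by simp [mink]

theorem mink_sum_left {ι : Type*} (s : Finset ι) (f : ι → Mink) (x : Mink) :
    mink (∑ i ∈ s, f i) x = ∑ i ∈ s, mink (f i) x := by
  classical
  induction s using Finset.induction_on with
  | empty => simp
  | insert a s ha ih => rw [Finset.sum_insert ha, Finset.sum_insert ha, mink_add_left, ih]

theorem mink_sum_right {ι : Type*} (s : Finset ι) (f : ι → Mink) (x : Mink) :
    mink x (∑ i ∈ s, f i) = ∑ i ∈ s, mink x (f i) := by
  simp only [mink_comm x, mink_sum_left]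

@[fun_prop] theorem continuous_mink : Continuous fun p : Mink × Mink => mink p.1 p.2 := by
  unfold mink; fun_prop

@[fun_prop] theorem continuous_mink_comp {X : Type*} [TopologicalSpace X] {f g : X → Mink}
    (hf : Continuous f) (hg : Continuous g) : Continuous fun x => mink (f x) (g x) :=
  continuous_mink.comp (hf.prodMk hg)

/-- Any linear functional is represented by the Minkowski form. -/
theorem exists_mink_eq (f : Mink →L[ℝ] ℝ) : ∃ n : Mink, ∀ x, f x = mink n x := by
  refine ⟨![-f (Pi.single 0 1), f (Pi.single 1 1), f (Pi.single 2 1)], fun x => ?_⟩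
  have hx : x = x 0 • (Pi.single 0 1 : Mink) + x 1 • (Pi.single 1 1 : Mink)
      + x 2 • (Pi.single 2 1 : Mink) := by
    ext i; fin_cases i <;> simp
  conv_lhs => rw [hx]
  simp only [map_add, map_smul, smul_eq_mul, mink]
  simp
  ring

/-- The base point of the hyperbolic plane. -/
def origin : Mink := ![1, 0, 0]

@[simp] theorem origin_zero : origin 0 = 1 := rfl
@[simp] theorem origin_one : origin 1 = 0 := rfl
@[simp] theorem origin_two : origin 2 = 0 := rfl

@[simp] theorem mink_origin_left (x : Mink) : mink origin x = -x 0 := by simp [mink]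

@[simp] theorem mink_origin_right (x : Mink) : mink x origin = -x 0 := by simp [mink]

theorem origin_mem : origin ∈ hyperbolicPlane := by simp [hyperbolicPlane]

/-- The closed future causal cone. -/
def closedCone : Set Mink := {x | mink x x ≤ 0 ∧ 0 ≤ x 0}

theorem isOpen_futureCone : IsOpen futureCone :=
  (isOpen_lt (continuous_mink_comp continuous_id continuous_id) continuous_const).inter
    (isOpen_lt continuous_const (continuous_apply 0))

theorem mem_closedCone_of_plane {x : Mink} (hx : x ∈ hyperbolicPlane) : x ∈ closedCone :=
  ⟨by rw [hx.1]; norm_num, hx.2.le⟩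

theorem mem_futureCone_of_plane {x : Mink} (hx : x ∈ hyperbolicPlane) : x ∈ futureCone :=
  ⟨by rw [hx.1]; norm_num, hx.2⟩

theorem mem_closedCone_of_future {x : Mink} (hx : x ∈ futureCone) : x ∈ closedCone :=
  ⟨hx.1.le, hx.2.le⟩

/-- Cauchy–Schwarz for the spatial parts, whose lengths are bounded by the time coordinates. -/
theorem mink_nonpos {a b : Mink} (ha : a ∈ closedCone) (hb : b ∈ closedCone) : mink a b ≤ 0 := by
  obtain ⟨ha, ha0⟩ := ha
  obtain ⟨hb, hb0⟩ := hb
  simp only [mink] at *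
  have h : a 1 * b 1 + a 2 * b 2 ≤ a 0 * b 0 := by
    apply le_of_sq_le_sq _ (mul_nonneg ha0 hb0)
    have h1 : a 1 ^ 2 + a 2 ^ 2 ≤ a 0 ^ 2 := by nlinarith
    have h2 : b 1 ^ 2 + b 2 ^ 2 ≤ b 0 ^ 2 := by nlinarith
    have h3 := mul_le_mul h1 h2 (by positivity) (by positivity)
    nlinarith [sq_nonneg (a 1 * b 2 - a 2 * b 1)]
  linarith

theorem mink_neg_of_future {a b : Mink} (ha : a ∈ closedCone) (ha' : a ≠ 0) (hb : b ∈ futureCone) :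
    mink a b < 0 := by
  obtain ⟨ha, ha0⟩ := ha
  obtain ⟨hb, hb0⟩ := hb
  simp only [mink] at *
  have ha0' : 0 < a 0 := by
    rcases ha0.lt_or_eq with h | h
    · exact h
    · exfalso
      apply ha'
      rw [← h] at ha
      have h1 : a 1 = 0 := by nlinarith [sq_nonneg (a 1), sq_nonneg (a 2)]
      have h2 : a 2 = 0 := by nlinarith [sq_nonneg (a 1), sq_nonneg (a 2)]
      ext i; fin_cases i <;> simp [← h, h1, h2]
  have h : a 1 * b 1 + a 2 * b 2 < a 0 * b 0 := by
    apply lt_of_pow_lt_pow_left₀ 2 (by positivity)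
    have h1 : a 1 ^ 2 + a 2 ^ 2 ≤ a 0 ^ 2 := by nlinarith
    have h2 : b 1 ^ 2 + b 2 ^ 2 < b 0 ^ 2 := by nlinarith
    have h3 : (a 1 ^ 2 + a 2 ^ 2) * (b 1 ^ 2 + b 2 ^ 2) ≤ a 0 ^ 2 * (b 1 ^ 2 + b 2 ^ 2) :=
      mul_le_mul_of_nonneg_right h1 (by positivity)
    have h4 : a 0 ^ 2 * (b 1 ^ 2 + b 2 ^ 2) < a 0 ^ 2 * b 0 ^ 2 :=
      mul_lt_mul_of_pos_left h2 (by positivity)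
    nlinarith [sq_nonneg (a 1 * b 2 - a 2 * b 1)]
  linarith

theorem future_ne_zero {x : Mink} (hx : x ∈ futureCone) : x ≠ 0 := by
  rintro rfl; simpa using hx.2

theorem closedCone_add {a b : Mink} (ha : a ∈ closedCone) (hb : b ∈ closedCone) :
    a + b ∈ closedCone := by
  refine ⟨?_, add_nonneg ha.2 hb.2⟩
  rw [mink_add_left, mink_add_right, mink_add_right, mink_comm b a]
  linarith [mink_nonpos ha hb, ha.1, hb.1]

theorem closedCone_smul {a : Mink} {c : ℝ} (hc : 0 ≤ c) (ha : a ∈ closedCone) :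
    c • a ∈ closedCone := by
  refine ⟨?_, mul_nonneg hc ha.2⟩
  rw [mink_smul_left, mink_smul_right]
  nlinarith [ha.1, mul_nonneg hc hc]

theorem futureCone_smul {a : Mink} {c : ℝ} (hc : 0 < c) (ha : a ∈ futureCone) :
    c • a ∈ futureCone := by
  refine ⟨?_, mul_pos hc ha.2⟩
  rw [mink_smul_left, mink_smul_right]
  nlinarith [mul_pos hc hc, mul_neg_of_pos_of_neg (mul_pos hc hc) ha.1]

theorem futureCone_add {a b : Mink} (ha : a ∈ futureCone) (hb : b ∈ closedCone) :
    a + b ∈ futureCone := by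
  refine ⟨?_, add_pos_of_pos_of_nonneg ha.2 hb.2⟩
  rw [mink_add_left, mink_add_right, mink_add_right, mink_comm b a]
  linarith [mink_nonpos (mem_closedCone_of_future ha) hb, ha.1, hb.1]

theorem convex_futureCone : Convex ℝ futureCone := by
  intro x hx y hy a b ha hb hab
  rcases ha.lt_or_eq with h | h
  · exact futureCone_add (futureCone_smul h hx) (closedCone_smul hb (mem_closedCone_of_future hy))
  · have : b = 1 := by linarith
    simpa [← h, this] using hy

/-- A future timelike vector is a positive multiple of a point of the hyperbolic plane. -/
theorem exists_normalize {n : Mink} (hn : n ∈ futureCone) :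
    ∃ c : ℝ, 0 < c ∧ c • n ∈ hyperbolicPlane := by
  have h : 0 < -mink n n := by linarith [hn.1]
  have hs := Real.sqrt_pos.2 h
  refine ⟨(Real.sqrt (-mink n n))⁻¹, inv_pos.2 hs, ?_, mul_pos (inv_pos.2 hs) hn.2⟩
  rw [mink_smul_left, mink_smul_right]
  field_simp
  rw [Real.sq_sqrt h.le, neg_neg]

theorem sq_le_of_closedCone {x : Mink} (hx : x ∈ closedCone) : x 1 ^ 2 + x 2 ^ 2 ≤ x 0 ^ 2 := by
  have := hx.1
  simp only [mink] at this
  nlinarith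

theorem norm_le_of_closedCone {x : Mink} (hx : x ∈ closedCone) : ‖x‖ ≤ x 0 := by
  rw [pi_norm_le_iff_of_nonneg hx.2]
  have h := sq_le_of_closedCone hx
  intro i
  rw [Real.norm_eq_abs]
  fin_cases i
  · exact (abs_of_nonneg hx.2).le
  · exact abs_le_of_sq_le_sq (by change x 1 ^ 2 ≤ _; nlinarith [sq_nonneg (x 2)]) hx.2
  · exact abs_le_of_sq_le_sq (by change x 2 ^ 2 ≤ _; nlinarith [sq_nonneg (x 1)]) hx.2

theorem abs_apply_le_norm (x : Mink) (i : Fin 3) : |x i| ≤ ‖x‖ := by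
  simpa using norm_le_pi_norm x i

theorem abs_mink_le (x y : Mink) : |mink x y| ≤ 3 * ‖x‖ * ‖y‖ := by
  have h : ∀ i, |x i * y i| ≤ ‖x‖ * ‖y‖ := fun i => by
    rw [abs_mul]
    exact mul_le_mul (abs_apply_le_norm x i) (abs_apply_le_norm y i) (abs_nonneg _) (norm_nonneg _)
  have h0 := abs_le.1 (h 0)
  have h1 := abs_le.1 (h 1)
  have h2 := abs_le.1 (h 2)
  rw [abs_le]
  simp only [mink]
  constructor <;> linarith

/-- Applied to `x` and `-x`, this turns order properties of the causal cone into two-sided bounds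
for arbitrary vectors. -/
theorem add_norm_origin_mem (x : Mink) {c : ℝ} (hc : 3 * ‖x‖ ≤ c) :
    x + c • origin ∈ closedCone := by
  have h0 := abs_le.1 (abs_apply_le_norm x 0)
  have h1 := sq_le_sq' (abs_le.1 (abs_apply_le_norm x 1)).1 (abs_le.1 (abs_apply_le_norm x 1)).2
  have h2 := sq_le_sq' (abs_le.1 (abs_apply_le_norm x 2)).1 (abs_le.1 (abs_apply_le_norm x 2)).2
  have hn := norm_nonneg x
  have h3 : 2 * ‖x‖ ≤ x 0 + c := by linarith
  constructor
  · simp only [mink, Pi.add_apply, Pi.smul_apply, smul_eq_mul, origin_zero, origin_one, origin_two]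
    nlinarith [mul_self_le_mul_self (by positivity) h3]
  · simp; linarith

/-- A causal vector with small product with the null vector `k` is close to the line of `k`. -/
theorem norm_sub_null_sq_le {f k : Mink} (hf : f ∈ closedCone) (hk : mink k k = 0) (hk0 : k 0 = 1) :
    ‖f - f 0 • k‖ ^ 2 ≤ 2 * f 0 * (-mink k f) := by
  have hf1 := sq_le_of_closedCone hf
  have hk1 : k 1 ^ 2 + k 2 ^ 2 = 1 := by simp only [mink, hk0] at hk; nlinarith
  have e0 : (f - f 0 • k) 0 = 0 := by simp [hk0]
  have key : (f - f 0 • k) 1 ^ 2 + (f - f 0 • k) 2 ^ 2 ≤ 2 * f 0 * (-mink k f) := by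
    simp only [mink, hk0, Pi.sub_apply, Pi.smul_apply, smul_eq_mul]
    have : f 0 ^ 2 * (k 1 ^ 2 + k 2 ^ 2) = f 0 ^ 2 := by rw [hk1, mul_one]
    nlinarith
  have h0 : 0 ≤ 2 * f 0 * (-mink k f) := le_trans (by positivity) key
  rw [← Real.sqrt_le_sqrt_iff h0, Real.sqrt_sq (norm_nonneg _)]
  rw [pi_norm_le_iff_of_nonneg (Real.sqrt_nonneg _)]
  intro i
  apply Real.le_sqrt_of_sq_le
  rw [Real.norm_eq_abs, sq_abs]
  fin_cases i
  · change (f - f 0 • k) 0 ^ 2 ≤ _; rw [e0]; simpa using h0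
  · change (f - f 0 • k) 1 ^ 2 ≤ _; nlinarith [sq_nonneg ((f - f 0 • k) 2)]
  · change (f - f 0 • k) 2 ^ 2 ≤ _; nlinarith [sq_nonneg ((f - f 0 • k) 1)]

/-- A vector outside the closed future cone has positive product with some future null vector. -/
theorem exists_null_of_notMem {x : Mink} (hx : x ∉ closedCone) :
    ∃ k : Mink, mink k k = 0 ∧ k 0 = 1 ∧ 0 < mink k x := by
  set r := Real.sqrt (x 1 ^ 2 + x 2 ^ 2) with hr
  have hr2 : r ^ 2 = x 1 ^ 2 + x 2 ^ 2 := Real.sq_sqrt (by positivity)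
  have hrx : x 0 < r := by
    by_contra! h
    have hr0 : 0 ≤ r := Real.sqrt_nonneg _
    refine hx ⟨?_, hr0.trans h⟩
    simp only [mink]; nlinarith
  rcases (Real.sqrt_nonneg _ : 0 ≤ r).lt_or_eq with h | h
  · replace h : 0 < r := h
    refine ⟨![1, x 1 / r, x 2 / r], ?_, rfl, ?_⟩
    · simp only [mink, Matrix.cons_val]
      field_simp
      linarith
    · have : mink ![1, x 1 / r, x 2 / r] x = -x 0 + (x 1 ^ 2 + x 2 ^ 2) / r := by
        simp only [mink, Matrix.cons_val]; ring
      rw [this, ← hr2, pow_two, mul_div_assoc, div_self h.ne']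
      linarith
  · refine ⟨![1, 1, 0], by simp [mink], rfl, ?_⟩
    replace h : 0 = r := h
    have h1 : x 1 = 0 := by nlinarith [sq_nonneg (x 1), sq_nonneg (x 2)]
    simp [mink, h1]
    linarith

theorem null_mem_closedCone {k : Mink} (hk : mink k k = 0) (hk0 : k 0 = 1) : k ∈ closedCone :=
  ⟨hk.le, by rw [hk0]; norm_num⟩

/-- A future vector outside the closed cone has positive product with some point of the plane. -/
theorem mem_closedCone_iff_plane {x : Mink} :
    x ∈ closedCone ↔ ∀ y ∈ hyperbolicPlane, mink x y ≤ 0 := by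
  refine ⟨fun hx y hy => mink_nonpos hx (mem_closedCone_of_plane hy), fun h => ?_⟩
  by_contra hx
  obtain ⟨k, hk, hk0, hkx⟩ := exists_null_of_notMem hx
  -- Tilt `k` into the open cone by so little that the product with `x` stays positive: the change
  -- is at most half of `mink k x`.
  set η := mink k x / (2 * (|x 0| + 1)) with hη
  have hpos : 0 < |x 0| + 1 := by positivity
  have hη0 : 0 < η := by positivity
  have hy : k + η • origin ∈ futureCone := by
    rw [add_comm]
    exact futureCone_add (futureCone_smul hη0 (mem_futureCone_of_plane origin_mem))
      (null_mem_closedCone hk hk0)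
  obtain ⟨c, hc, hcy⟩ := exists_normalize hy
  have h1 := h _ hcy
  rw [mink_smul_right, mink_add_right, mink_smul_right, mink_origin_right, mink_comm x k] at h1
  have h2 : 0 < mink k x + η * -x 0 := by
    have : η * x 0 < mink k x := by
      have h3 : η * (|x 0| + 1) = mink k x / 2 := by rw [hη]; field_simp
      have h4 : η * x 0 ≤ η * (|x 0| + 1) :=
        mul_le_mul_of_nonneg_left (by linarith [le_abs_self (x 0)]) hη0.le
      linarith
    linarith
  nlinarith

/-- The future points of the plane spanned by a null vector and its reflection. -/
theorem exists_plane_near_null {k : Mink} (hk : mink k k = 0) (hk0 : k 0 = 1) {t : ℝ} (ht : 0 < t) :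
    ∃ w ∈ hyperbolicPlane, -mink k w = t ∧ w 0 = t / 2 + 1 / (2 * t) := by
  have hk1 : k 1 ^ 2 + k 2 ^ 2 = 1 := by simp only [mink, hk0] at hk; nlinarith
  have hw : ∀ s r : ℝ, mink ![s, r * k 1, r * k 2] ![s, r * k 1, r * k 2] = -s ^ 2 + r ^ 2 := by
    intro s r
    simp only [mink, Matrix.cons_val]
    linear_combination r ^ 2 * hk1
  have hkw : ∀ s r : ℝ, -mink k ![s, r * k 1, r * k 2] = s - r := by
    intro s r
    simp only [mink, Matrix.cons_val, hk0]
    linear_combination -r * hk1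
  refine ⟨![t / 2 + 1 / (2 * t), (1 / (2 * t) - t / 2) * k 1, (1 / (2 * t) - t / 2) * k 2],
    ⟨?_, ?_⟩, ?_, rfl⟩
  · rw [hw]; field_simp; ring
  · change 0 < t / 2 + 1 / (2 * t); positivity
  · rw [hkw]; ring

end HypRigidity

namespace HypRigidity

/-! ### The action of a cocompact group on Minkowski space -/

/-- A future timelike vector dominates any vector, up to a factor. -/
theorem exists_smul_sub_mem {a : Mink} (ha : a ∈ futureCone) (b : Mink) :
    ∃ M : ℝ, 0 < M ∧ M • a - b ∈ closedCone := by
  have h : Filter.Tendsto (fun ε : ℝ => a - ε • b) (𝓝[>] 0) (𝓝 a) := by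
    have : Filter.Tendsto (fun ε : ℝ => a - ε • b) (𝓝 0) (𝓝 (a - (0 : ℝ) • b)) :=
      (by fun_prop : Continuous fun ε : ℝ => a - ε • b).tendsto 0
    rw [zero_smul, sub_zero] at this
    exact this.mono_left nhdsWithin_le_nhds
  obtain ⟨ε, hε, hε0⟩ := ((h.eventually (isOpen_futureCone.mem_nhds ha)).and
    self_mem_nhdsWithin).exists
  refine ⟨ε⁻¹, inv_pos.2 hε0, ?_⟩
  have := closedCone_smul (inv_pos.2 hε0).le (mem_closedCone_of_future hε)
  rwa [smul_sub, smul_smul, inv_mul_cancel₀ (ne_of_gt hε0), one_smul] at this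

theorem mink_le_of_sub_mem {a b n : Mink} (hn : n ∈ closedCone) (h : a - b ∈ closedCone) :
    -mink n b ≤ -mink n a := by
  have := mink_nonpos hn h
  rw [mink_sub_right] at this
  linarith

theorem isCompact_plane_le (M : ℝ) : IsCompact {x | x ∈ hyperbolicPlane ∧ x 0 ≤ M} := by
  have : {x | x ∈ hyperbolicPlane ∧ x 0 ≤ M}
      = Metric.closedBall 0 M ∩ {x | mink x x = -1 ∧ 0 ≤ x 0} ∩ {x | x 0 ≤ M} := by
    ext x
    constructor
    · rintro ⟨hx, hxM⟩
      exact ⟨⟨by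
        rw [mem_closedBall_zero_iff]
        exact (norm_le_of_closedCone (mem_closedCone_of_plane hx)).trans hxM, hx.1, hx.2.le⟩, hxM⟩
    · rintro ⟨⟨-, hx, hx0⟩, hxM⟩
      refine ⟨⟨hx, lt_of_le_of_ne hx0 fun h => ?_⟩, hxM⟩
      simp only [mink, ← h] at hx
      nlinarith [sq_nonneg (x 1), sq_nonneg (x 2)]
  rw [this]
  exact ((isCompact_closedBall _ _).inter_right
    ((isClosed_eq (continuous_mink_comp continuous_id continuous_id) continuous_const).inter
    (isClosed_le continuous_const (continuous_apply 0)))).inter_right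
    (isClosed_le (continuous_apply 0) continuous_const)

section

variable {Γ : Type*} [Group Γ] {ρ : Γ →* (Mink ≃ₗ[ℝ] Mink)}

theorem rho_mul_apply (γ μ : Γ) (x : Mink) : ρ (γ * μ) x = ρ γ (ρ μ x) := by
  rw [map_mul]; rfl

@[simp] theorem rho_one_apply (x : Mink) : ρ 1 x = x := by rw [map_one]; rfl

@[simp] theorem rho_inv_apply (γ : Γ) (x : Mink) : ρ γ⁻¹ (ρ γ x) = x := by
  rw [← rho_mul_apply, inv_mul_cancel, rho_one_apply]

@[simp] theorem rho_apply_inv (γ : Γ) (x : Mink) : ρ γ (ρ γ⁻¹ x) = x := by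
  rw [← rho_mul_apply, mul_inv_cancel, rho_one_apply]

/-- The height of `γ`: the hyperbolic cosine of the displacement of the base point. -/
noncomputable def height (ρ : Γ →* (Mink ≃ₗ[ℝ] Mink)) (γ : Γ) : ℝ := ρ γ origin 0

variable (hρ : IsHyperbolicHolonomy ρ)
include hρ

theorem mink_rho_left (γ : Γ) (x y : Mink) : mink (ρ γ x) y = mink x (ρ γ⁻¹ y) := by
  rw [← hρ.mink_map γ x (ρ γ⁻¹ y), rho_apply_inv]

theorem mink_rho_right (γ : Γ) (x y : Mink) : mink x (ρ γ y) = mink (ρ γ⁻¹ x) y := by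
  rw [mink_comm, mink_rho_left hρ, mink_comm]

theorem map_closedCone (γ : Γ) {x : Mink} (hx : x ∈ closedCone) : ρ γ x ∈ closedCone := by
  rw [mem_closedCone_iff_plane] at hx ⊢
  intro y hy
  rw [mink_rho_left hρ]
  exact hx _ (hρ.map_plane _ _ hy)

theorem map_futureCone (γ : Γ) {x : Mink} (hx : x ∈ futureCone) : ρ γ x ∈ futureCone := by
  obtain ⟨c, hc, h⟩ := exists_normalize hx
  have := futureCone_smul (inv_pos.2 hc) (mem_futureCone_of_plane (hρ.map_plane γ _ h))
  rwa [map_smul, smul_smul, inv_mul_cancel₀ hc.ne', one_smul] at this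

theorem origin_map_mem (γ : Γ) : ρ γ origin ∈ hyperbolicPlane := hρ.map_plane γ _ origin_mem

theorem height_inv (γ : Γ) : height ρ γ⁻¹ = height ρ γ := by
  have := mink_rho_left hρ γ origin origin
  rw [mink_origin_left, mink_origin_right] at this
  unfold height
  linarith

theorem height_pos (γ : Γ) : 0 < height ρ γ := (origin_map_mem hρ γ).2

theorem one_le_height (γ : Γ) : 1 ≤ height ρ γ := by
  have h := (origin_map_mem hρ γ).1
  have h0 := height_pos hρ γ
  unfold height at *
  simp only [mink] at h
  nlinarith [sq_nonneg (ρ γ origin 1), sq_nonneg (ρ γ origin 2)]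

theorem finite_height_le (R : ℝ) : {γ : Γ | height ρ γ ≤ R}.Finite := by
  refine (hρ.properlyDiscontinuous _ (isCompact_plane_le (max R 1)) fun x hx => hx.1).subset
    fun γ hγ => ?_
  exact ⟨ρ γ origin, ⟨origin, ⟨origin_mem, by simp⟩, rfl⟩,
    origin_map_mem hρ γ, le_trans hγ (le_max_left _ _)⟩

/-- Every point of the hyperbolic plane is close to the orbit of the base point. -/
theorem exists_orbit_near : ∃ M : ℝ, 1 ≤ M ∧ ∀ w ∈ hyperbolicPlane, ∃ γ : Γ,
    M • w - ρ γ origin ∈ closedCone ∧ M • ρ γ origin - w ∈ closedCone := by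
  obtain ⟨K, hK, hKp, hcov⟩ := hρ.cocompact
  obtain ⟨B, hB⟩ := hK.isBounded.exists_norm_le
  -- On the compact set 1 ≤ y₀ ≤ |B|, and `M > 2 y₀` makes both `M • y - origin` and `M • origin -
  -- y` causal.
  refine ⟨2 * |B| + 1, by linarith [abs_nonneg B], fun w hw => ?_⟩
  obtain ⟨γ, y, hy, rfl⟩ := hcov w hw
  have hyp := hKp hy
  have hy0 : y 0 ≤ |B| :=
    (le_abs_self _).trans ((abs_apply_le_norm y 0).trans ((hB y hy).trans (le_abs_self _)))
  have hy1 : 1 ≤ y 0 := by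
    have h1 := hyp.1
    have h2 := hyp.2
    simp only [mink] at h1
    nlinarith [sq_nonneg (y 1), sq_nonneg (y 2)]
  refine ⟨γ, ?_, ?_⟩
  · rw [← map_smul, ← map_sub]
    apply map_closedCone hρ
    constructor
    · simp only [mink_sub_left, mink_sub_right, mink_smul_left, mink_smul_right, hyp.1,
        mink_origin_left, mink_origin_right, Pi.sub_apply, Pi.smul_apply, smul_eq_mul, origin_zero]
      nlinarith [abs_nonneg B]
    · simp only [Pi.sub_apply, Pi.smul_apply, smul_eq_mul, origin_zero]
      nlinarith [abs_nonneg B]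
  · rw [← map_smul, ← map_sub]
    apply map_closedCone hρ
    constructor
    · simp only [mink_sub_left, mink_sub_right, mink_smul_left, mink_smul_right, hyp.1,
        mink_origin_left, mink_origin_right, Pi.sub_apply, Pi.smul_apply, smul_eq_mul, origin_zero]
      nlinarith [abs_nonneg B]
    · simp only [Pi.sub_apply, Pi.smul_apply, smul_eq_mul, origin_zero]
      linarith [abs_nonneg B]

/-- Both `x` and `-x` lie above `-(3 * ‖x‖) • origin` in the causal order, and `ρ γ` preserves this
order. -/
theorem abs_mink_rho_le (γ : Γ) {n : Mink} (hn : n ∈ closedCone) (x : Mink) :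
    |mink n (ρ γ x)| ≤ 3 * ‖x‖ * (-mink n (ρ γ origin)) := by
  have h1 := mink_nonpos hn (map_closedCone hρ γ (add_norm_origin_mem x le_rfl))
  have h2 := mink_nonpos hn (map_closedCone hρ γ (add_norm_origin_mem (-x) (by rw [norm_neg])))
  simp only [map_add, map_neg, map_smul, mink_add_right, mink_neg_right, mink_smul_right] at h1 h2
  rw [abs_le]
  constructor <;> linarith

theorem norm_rho_le (γ : Γ) (x : Mink) : ‖ρ γ x‖ ≤ 3 * ‖x‖ * height ρ γ := by
  have h1 := norm_le_of_closedCone (map_closedCone hρ γ (add_norm_origin_mem x le_rfl))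
  have h2 := norm_le_of_closedCone
    (map_closedCone hρ γ (add_norm_origin_mem (-x) (by rw [norm_neg])))
  have e : ρ γ x = (1 / 2 : ℝ) • (ρ γ (x + (3 * ‖x‖) • origin) - ρ γ (-x + (3 * ‖x‖) • origin)) := by
    simp only [map_add, map_neg, map_smul]
    module
  have h3 : ‖ρ γ x‖ ≤ 1 / 2 * (‖ρ γ (x + (3 * ‖x‖) • origin)‖ + ‖ρ γ (-x + (3 * ‖x‖) • origin)‖) := by
    conv_lhs => rw [e]
    rw [norm_smul]
    refine mul_le_mul (by norm_num) (norm_sub_le _ _) (norm_nonneg _) (by norm_num)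
  refine h3.trans ?_
  have h4 : ρ γ (x + (3 * ‖x‖) • origin) 0 + ρ γ (-x + (3 * ‖x‖) • origin) 0
      = 2 * (3 * ‖x‖ * height ρ γ) := by
    simp only [map_add, map_neg, map_smul, Pi.add_apply, Pi.neg_apply, Pi.smul_apply, smul_eq_mul,
      height]
    ring
  linarith

/-- Heights can be halved by elements of a finite set. -/
theorem exists_halving : ∃ S : Set Γ, S.Finite ∧ ∃ R : ℝ, ∀ γ : Γ,
    height ρ γ ≤ R ∨ ∃ s ∈ S, height ρ (γ * s) ≤ height ρ γ / 2 := by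
  obtain ⟨M, hM, hcov⟩ := exists_orbit_near hρ
  refine ⟨{s | height ρ s ≤ M * (4 * M)}, finite_height_le hρ _, 4 * M, fun γ => ?_⟩
  by_cases hγ : height ρ γ ≤ 4 * M
  · exact Or.inl hγ
  right
  push Not at hγ
  set x := ρ γ⁻¹ origin with hx
  have hxp : x ∈ hyperbolicPlane := origin_map_mem hρ _
  have hx0 : x 0 = height ρ γ := by rw [← height_inv hρ]; rfl
  set r := Real.sqrt (x 1 ^ 2 + x 2 ^ 2) with hr
  have hr2 : r ^ 2 = x 1 ^ 2 + x 2 ^ 2 := Real.sq_sqrt (by positivity)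
  have hrx : x 0 ^ 2 - r ^ 2 = 1 := by have := hxp.1; simp only [mink] at this; nlinarith
  have hr0 : 0 < r := by
    rcases (Real.sqrt_nonneg _ : 0 ≤ r).lt_or_eq with h | h
    · exact h
    · change 0 = r at h
      rw [← h] at hrx; nlinarith
  have hM0 : 0 < M := by linarith
  -- `c` and `s` are the hyperbolic cosine and sine of log(4M), so `y` is the point at this distance
  -- from the base point in the direction of `x`. An orbit point near `y` is a step of bounded
  -- height that shortens `γ` by at least a factor of two.
  set c := (4 * M + 1 / (4 * M)) / 2 with hc
  set s := (4 * M - 1 / (4 * M)) / 2 with hs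
  have hcs : c ^ 2 - s ^ 2 = 1 := by rw [hc, hs]; field_simp; ring
  have hs0 : 0 < s := by
    rw [hs]
    have : 1 / (4 * M) ≤ 1 := by rw [div_le_one (by positivity)]; linarith
    linarith
  have hc0 : 0 < c := by rw [hc]; positivity
  set y : Mink := ![c, s * x 1 / r, s * x 2 / r] with hy
  have hyp : y ∈ hyperbolicPlane := by
    refine ⟨?_, hc0⟩
    have : mink y y = -c ^ 2 + s ^ 2 * (x 1 ^ 2 + x 2 ^ 2) / r ^ 2 := by
      simp only [mink, hy, Matrix.cons_val]; ring
    rw [this, ← hr2, mul_div_assoc, div_self (by positivity)]; linarith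
  have hxy : -mink x y = x 0 * c - r * s := by
    have : -mink x y = x 0 * c - s * (x 1 ^ 2 + x 2 ^ 2) / r := by
      simp only [mink, hy, Matrix.cons_val]; ring
    rw [this, ← hr2]; field_simp
  obtain ⟨σ, h1, h2⟩ := hcov y hyp
  refine ⟨σ, ?_, ?_⟩
  · have h3 := mink_le_of_sub_mem (mem_closedCone_of_plane origin_mem) h1
    simp only [mink_origin_left, Pi.smul_apply, smul_eq_mul, neg_neg] at h3
    refine h3.trans (mul_le_mul_of_nonneg_left ?_ hM0.le)
    change c ≤ 4 * M
    rw [hc]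
    have : 1 / (4 * M) ≤ 1 := by rw [div_le_one (by positivity)]; linarith
    linarith
  · have h3 := mink_le_of_sub_mem (mem_closedCone_of_plane hxp) h1
    have h4 : height ρ (γ * σ) = -mink x (ρ σ origin) := by
      rw [hx, mink_rho_left hρ, inv_inv, ← rho_mul_apply, mink_origin_left, neg_neg]; rfl
    rw [h4]
    refine h3.trans ?_
    rw [mink_smul_right, ← mul_neg, hxy, ← hx0]
    have hrx' : r ≤ x 0 := by nlinarith [hxp.2]
    have hd : (x 0 - r) * x 0 ≤ 1 := by nlinarith [hxp.2]
    have hcs' : c - s = 1 / (4 * M) := by rw [hc, hs]; ring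
    have hs4 : s ≤ 2 * M := by
      rw [hs]
      have : 0 < 1 / (4 * M) := by positivity
      linarith
    have e : x 0 * c - r * s = x 0 * (1 / (4 * M)) + (x 0 - r) * s := by rw [← hcs']; ring
    rw [e]
    have hxM : 4 * M < x 0 := by rw [hx0]; exact hγ
    have h5 : (x 0 - r) * s ≤ (x 0 - r) * (2 * M) := mul_le_mul_of_nonneg_left hs4 (by linarith)
    have h6 : (x 0 - r) * (4 * M) ≤ 1 := by nlinarith
    have h7 : M * (x 0 * (1 / (4 * M))) = x 0 / 4 := by field_simp
    have h8 : M * ((x 0 - r) * s) ≤ M * (1 / 2) := mul_le_mul_of_nonneg_left (by linarith) hM0.le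
    rw [mul_add, h7]
    linarith

/-- A cocycle that is small on a suitable finite set has small linear growth. -/
theorem exists_cocycle_bound : ∃ S : Set Γ, S.Finite ∧ ∀ (τ : cocycles ρ) (ε : ℝ),
    (∀ s ∈ S, ‖(τ : Γ → Mink) s‖ ≤ ε) → ∀ γ, ‖(τ : Γ → Mink) γ‖ ≤ 3 * ε * height ρ γ := by
  obtain ⟨S, hS, R, hSR⟩ := exists_halving hρ
  refine ⟨{γ | height ρ γ ≤ R} ∪ (·⁻¹) '' S ∪ {1}, ((finite_height_le hρ R).union
    (hS.image _)).union (Set.finite_singleton _), fun τ ε hε => ?_⟩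
  have hε0 : 0 ≤ ε := (norm_nonneg _).trans (hε 1 (Or.inr rfl))
  -- Induction on the dyadic scale of the height. Splitting off `s` costs at most `3 * ε * height (γ
  -- * s)`, which is half of the target since the height is halved; the induction hypothesis gives
  -- the other half. This is why the constant does not grow.
  have key : ∀ k : ℕ, ∀ γ, height ρ γ ≤ 2 ^ k → ‖(τ : Γ → Mink) γ‖ ≤ 3 * ε * height ρ γ := by
    intro k
    induction k with
    | zero =>
      intro γ hγ
      rcases hSR γ with h | ⟨s, -, h⟩
      · refine (hε γ (Or.inl (Or.inl h))).trans ?_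
        nlinarith [one_le_height hρ γ]
      · have := one_le_height hρ (γ * s)
        norm_num at hγ
        linarith
    | succ k ih =>
      intro γ hγ
      rcases hSR γ with h | ⟨s, hs, h⟩
      · refine (hε γ (Or.inl (Or.inl h))).trans ?_
        nlinarith [one_le_height hρ γ]
      · have h1 := ih (γ * s) (by rw [pow_succ] at hγ; linarith)
        have h2 := hε s⁻¹ (Or.inl (Or.inr ⟨s, hs, rfl⟩))
        have h3 : (τ : Γ → Mink) γ = ρ (γ * s) ((τ : Γ → Mink) s⁻¹) + (τ : Γ → Mink) (γ * s) := by
          have := τ.2 (γ * s) s⁻¹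
          rwa [mul_inv_cancel_right] at this
        rw [h3]
        refine (norm_add_le _ _).trans ?_
        have h4 := norm_rho_le hρ (γ * s) ((τ : Γ → Mink) s⁻¹)
        have h5 : 3 * ‖(τ : Γ → Mink) s⁻¹‖ * height ρ (γ * s) ≤ 3 * ε * height ρ (γ * s) :=
          mul_le_mul_of_nonneg_right (by linarith) (height_pos hρ _).le
        have h6 : ε * height ρ (γ * s) ≤ ε * (height ρ γ / 2) := mul_le_mul_of_nonneg_left h hε0
        linarith
  intro γ
  obtain ⟨k, hk⟩ := pow_unbounded_of_one_lt (height ρ γ) (one_lt_two)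
  exact key k γ hk.le

omit hρ in
theorem cocycle_one (τ : cocycles ρ) : (τ : Γ → Mink) 1 = 0 := by
  have := τ.2 1 1
  simpa using this

omit hρ in
theorem cocycle_inv (τ : cocycles ρ) (γ : Γ) : (τ : Γ → Mink) γ⁻¹ = -ρ γ⁻¹ ((τ : Γ → Mink) γ) := by
  have := τ.2 γ⁻¹ γ
  rw [inv_mul_cancel, cocycle_one] at this
  exact eq_neg_of_add_eq_zero_right this.symm

/-- Growth of cocycles relative to an arbitrary causal direction. -/
theorem exists_cocycle_mink_bound : ∃ S : Set Γ, S.Finite ∧ ∃ C : ℝ, 0 < C ∧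
    ∀ (τ : cocycles ρ) (ε : ℝ), (∀ s ∈ S, ‖(τ : Γ → Mink) s‖ ≤ ε) → ∀ γ, ∀ n ∈ closedCone,
      |mink n ((τ : Γ → Mink) γ)| ≤ C * ε * (n 0 + -mink n (ρ γ origin)) := by
  obtain ⟨S, hS, hSb⟩ := exists_cocycle_bound hρ
  obtain ⟨M, hM, hcov⟩ := exists_orbit_near hρ
  have hM0 : 0 < M := by linarith
  refine ⟨S ∪ {1}, hS.union (Set.finite_singleton _), 9 * M * M, by positivity,
    fun τ ε hε γ => ?_⟩
  have hε0 : 0 ≤ ε := (norm_nonneg _).trans (hε 1 (Or.inr rfl))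
  have hb := hSb τ ε fun s hs => hε s (Or.inl hs)
  -- Move `n` close to the base point by `μ⁻¹`. The cocycle identity replaces the value at `γ` by
  -- the values at `μ⁻¹ * γ` and `μ⁻¹`, whose heights are comparable to `-mink n (ρ γ origin)` and
  -- `n 0`.
  have plane : ∀ n ∈ hyperbolicPlane,
      |mink n ((τ : Γ → Mink) γ)| ≤ 9 * M * M * ε * (n 0 + -mink n (ρ γ origin)) := by
    intro n hn
    obtain ⟨μ, h1, h2⟩ := hcov n hn
    set d := ρ μ⁻¹ n with hd
    have hdn : n = ρ μ d := by rw [hd, rho_apply_inv]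
    have hdp : d ∈ hyperbolicPlane := hρ.map_plane _ _ hn
    have hd0 : ‖d‖ ≤ M := by
      refine (norm_le_of_closedCone (mem_closedCone_of_plane hdp)).trans ?_
      have := mink_nonpos (mem_closedCone_of_plane (origin_map_mem hρ μ)) h2
      rw [mink_sub_right, mink_smul_right, (origin_map_mem hρ μ).1, mink_rho_left hρ,
        mink_origin_left] at this
      change ρ μ⁻¹ n 0 ≤ M
      linarith
    have e : ρ μ⁻¹ ((τ : Γ → Mink) γ) = (τ : Γ → Mink) (μ⁻¹ * γ) - (τ : Γ → Mink) μ⁻¹ := by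
      rw [τ.2 μ⁻¹ γ]; abel
    rw [hdn, mink_rho_left hρ, e, ← hdn]
    have h3 := abs_mink_le d ((τ : Γ → Mink) (μ⁻¹ * γ) - (τ : Γ → Mink) μ⁻¹)
    have h4 := norm_sub_le ((τ : Γ → Mink) (μ⁻¹ * γ)) ((τ : Γ → Mink) μ⁻¹)
    have h5 := hb (μ⁻¹ * γ)
    have h6 := hb μ⁻¹
    have h7 : height ρ (μ⁻¹ * γ) ≤ M * -mink n (ρ γ origin) := by
      have := mink_le_of_sub_mem (mem_closedCone_of_plane (origin_map_mem hρ γ)) h1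
      rw [mink_smul_right, ← mul_neg, mink_comm _ n] at this
      refine le_trans (le_of_eq ?_) this
      rw [mink_comm, mink_rho_left hρ, ← rho_mul_apply, mink_origin_left, neg_neg]; rfl
    have h8 : height ρ μ⁻¹ ≤ M * n 0 := by
      rw [height_inv hρ]
      have := mink_le_of_sub_mem (mem_closedCone_of_plane origin_mem) h1
      simpa [height] using this
    have h9 : ‖(τ : Γ → Mink) (μ⁻¹ * γ) - (τ : Γ → Mink) μ⁻¹‖
        ≤ 3 * ε * (M * (n 0 + -mink n (ρ γ origin))) := by
      have := mul_le_mul_of_nonneg_left (add_le_add h7 h8) (by positivity : 0 ≤ 3 * ε)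
      linarith
    refine h3.trans ?_
    have h10 := mul_le_mul (mul_le_mul_of_nonneg_left hd0 (by norm_num : (0 : ℝ) ≤ 3)) h9
      (norm_nonneg _) (by positivity)
    linarith
  have future : ∀ n ∈ futureCone,
      |mink n ((τ : Γ → Mink) γ)| ≤ 9 * M * M * ε * (n 0 + -mink n (ρ γ origin)) := by
    intro n hn
    obtain ⟨c, hc, hcn⟩ := exists_normalize hn
    have := plane _ hcn
    rw [mink_smul_left, mink_smul_left, abs_mul, abs_of_pos hc, Pi.smul_apply, smul_eq_mul] at this
    have h : c * |mink n ((τ : Γ → Mink) γ)|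
        ≤ c * (9 * M * M * ε * (n 0 + -mink n (ρ γ origin))) := by linarith
    exact le_of_mul_le_mul_left h hc
  intro n hn
  -- The inequality is homogeneous in `n`, which gave timelike `n`; null `n` are limits of timelike
  -- vectors.
  have lim : ∀ η : ℝ, 0 < η → |mink (n + η • origin) ((τ : Γ → Mink) γ)|
      ≤ 9 * M * M * ε * ((n + η • origin) 0 + -mink (n + η • origin) (ρ γ origin)) := fun η hη =>
    future _ (by
      rw [add_comm]
      exact futureCone_add (futureCone_smul hη (mem_futureCone_of_plane origin_mem)) hn)
  have c0 : Continuous fun η : ℝ => n + η • origin := by fun_prop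
  have c1 : Continuous fun η : ℝ => |mink (n + η • origin) ((τ : Γ → Mink) γ)| :=
    (continuous_mink_comp c0 continuous_const).abs
  have c2 : Continuous fun η : ℝ =>
      9 * M * M * ε * ((n + η • origin) 0 + -mink (n + η • origin) (ρ γ origin)) :=
    continuous_const.mul (((continuous_apply 0).comp c0).add
      (continuous_mink_comp c0 continuous_const).neg)
  have := le_of_tendsto_of_tendsto ((c1.tendsto 0).mono_left (nhdsWithin_le_nhds (s := Set.Ioi 0)))
    ((c2.tendsto 0).mono_left nhdsWithin_le_nhds)
    (by filter_upwards [self_mem_nhdsWithin] with η hη using lim η hη)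
  simpa using this

end

end HypRigidity

namespace HypRigidity

/-! ### Invariant domains: growth of orbits -/

/-- The orthogonal complement of a timelike vector is spacelike. -/
theorem eq_zero_of_mink_eq_zero {d c : Mink} (hc : c ∈ futureCone) (h : mink d c = 0)
    (hd : mink d d ≤ 0) : d = 0 := by
  by_contra h0
  rcases le_total 0 (d 0) with hd0 | hd0
  · exact (mink_neg_of_future ⟨hd, hd0⟩ h0 hc).ne h
  · have : mink (-d) c < 0 := mink_neg_of_future
      ⟨by rw [mink_neg_left, mink_neg_right]; simpa using hd, by simpa using hd0⟩
      (neg_ne_zero.2 h0) hc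
    rw [mink_neg_left, h] at this
    simp at this

theorem one_lt_neg_mink {a b : Mink} (ha : a ∈ hyperbolicPlane) (hb : b ∈ hyperbolicPlane)
    (hab : a ≠ b) : 1 < -mink a b := by
  by_contra! h
  refine hab (sub_eq_zero.1 (eq_zero_of_mink_eq_zero (c := a + b)
    (futureCone_add (mem_futureCone_of_plane ha) (mem_closedCone_of_plane hb)) ?_ ?_))
  · rw [mink_sub_left, mink_add_right, mink_add_right, ha.1, hb.1, mink_comm b a]; ring
  · rw [mink_sub_left, mink_sub_right, mink_sub_right, ha.1, hb.1, mink_comm b a]; linarith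

/-- Large causal vectors with bounded product with `k` point in the direction of `k`. -/
theorem exists_large_mink {k y : Mink} (hk : mink k k = 0) (hk0 : k 0 = 1) (hy : 0 < mink k y)
    {B : ℝ} (hB : 0 ≤ B) : ∃ R : ℝ, 0 < R ∧ ∀ f ∈ closedCone, -mink k f ≤ B → R ≤ f 0 →
      f 0 * (mink k y / 2) ≤ mink f y := by
  set a := mink k y with ha
  -- For `f 0` beyond this bound, the deviation of `f` from the line of `k` given by
  -- `norm_sub_null_sq_le` costs at most half of the main term `f 0 * a`.
  refine ⟨72 * ‖y‖ ^ 2 * B / a ^ 2 + 1, by positivity, fun f hf hfB hfR => ?_⟩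
  have hf0 := hf.2
  have h1 := norm_sub_null_sq_le hf hk hk0
  have h2 : ‖f - f 0 • k‖ ^ 2 ≤ 2 * f 0 * B := h1.trans (mul_le_mul_of_nonneg_left hfB (by linarith))
  have h3 : mink f y = f 0 * a + mink (f - f 0 • k) y := by
    rw [mink_sub_left, mink_smul_left]; ring
  have h4 := neg_le_of_abs_le (abs_mink_le (f - f 0 • k) y)
  have h5 : 3 * ‖f - f 0 • k‖ * ‖y‖ ≤ f 0 * (a / 2) := by
    apply le_of_sq_le_sq _ (by positivity)
    have h6 : 72 * ‖y‖ ^ 2 * B ≤ f 0 * a ^ 2 := by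
      have h7 := mul_le_mul_of_nonneg_right (le_trans (le_add_of_nonneg_right zero_le_one) hfR)
        (by positivity : 0 ≤ a ^ 2)
      rwa [div_mul_cancel₀ _ (by positivity)] at h7
    have h8 := mul_le_mul_of_nonneg_right h2 (by positivity : 0 ≤ 9 * ‖y‖ ^ 2)
    have h9 := mul_le_mul_of_nonneg_left h6 hf0
    nlinarith
  linarith

section

variable {Γ : Type*} [Group Γ] {ρ : Γ →* (Mink ≃ₗ[ℝ] Mink)} (hρ : IsHyperbolicHolonomy ρ)
include hρ

/-- The orbit of the base point approaches every null direction conically. -/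
theorem exists_conical {k : Mink} (hk : mink k k = 0) (hk0 : k 0 = 1) : ∃ C : ℝ, 0 < C ∧
    ∀ ε : ℝ, 0 < ε → ∃ γ : Γ, -mink k (ρ γ origin) ≤ ε ∧
      height ρ γ * -mink k (ρ γ origin) ≤ C ∧ ε⁻¹ ≤ height ρ γ := by
  obtain ⟨M, hM, hcov⟩ := exists_orbit_near hρ
  have hM0 : 0 < M := by linarith
  refine ⟨M * M, by positivity, fun ε hε => ?_⟩
  set t := min 1 (ε / (2 * M)) with ht
  have ht0 : 0 < t := by positivity
  have ht1 : t ≤ 1 := min_le_left _ _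
  have htε : 2 * M * t ≤ ε := by
    have := mul_le_mul_of_nonneg_left (min_le_right 1 (ε / (2 * M))) (by positivity : 0 ≤ 2 * M)
    rwa [mul_div_cancel₀ _ (by positivity)] at this
  -- The point `w` lies on the ray from the base point to the end `k`. There the product with `k` is
  -- of size `t` and the time coordinate is of size `1 / t`; an orbit point near `w` inherits both
  -- up to the factor `M`.
  obtain ⟨w, hw, hkw, hw0⟩ := exists_plane_near_null hk hk0 ht0
  obtain ⟨γ, h1, h2⟩ := hcov w hw
  have hkc := null_mem_closedCone hk hk0
  have h3 := mink_le_of_sub_mem hkc h1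
  rw [mink_smul_right, ← mul_neg, hkw] at h3
  have h4 := mink_le_of_sub_mem (mem_closedCone_of_plane origin_mem) h1
  simp only [mink_origin_left, Pi.smul_apply, smul_eq_mul, neg_neg] at h4
  have h5 := mink_le_of_sub_mem (mem_closedCone_of_plane origin_mem) h2
  simp only [mink_origin_left, Pi.smul_apply, smul_eq_mul, neg_neg] at h5
  have hw1 : w 0 * t ≤ 1 := by
    rw [hw0]; field_simp; nlinarith
  have hw2 : 1 / (2 * t) ≤ w 0 := by rw [hw0]; linarith
  refine ⟨γ, by nlinarith, ?_, ?_⟩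
  · have h6 : 0 ≤ -mink k (ρ γ origin) := by
      linarith [mink_nonpos hkc (mem_closedCone_of_plane (origin_map_mem hρ γ))]
    have h7 := mul_le_mul h4 h3 h6 (by nlinarith [hw.2])
    change ρ γ origin 0 * _ ≤ _
    nlinarith [mul_pos hM0 hM0]
  · change ε⁻¹ ≤ ρ γ origin 0
    rw [inv_le_iff_one_le_mul₀ hε]
    have h8 : 1 ≤ 2 * t * w 0 := by rw [div_le_iff₀ (by positivity)] at hw2; linarith
    have h9 : w 0 * (2 * M * t) ≤ w 0 * ε := mul_le_mul_of_nonneg_left htε hw.2.le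
    have h10 : w 0 * ε ≤ M * ρ γ origin 0 * ε := mul_le_mul_of_nonneg_right h5 hε.le
    have : M * 1 ≤ M * (ρ γ origin 0 * ε) := by nlinarith
    exact le_of_mul_le_mul_left this hM0

/-- A vector that has nonpositive product with an orbit of timelike vectors is causal. -/
theorem mem_closedCone_of_orbit {n y : Mink} (hn : n ∈ futureCone)
    (h : ∀ γ : Γ, mink (ρ γ n) y ≤ 0) : y ∈ closedCone := by
  by_contra hy
  obtain ⟨k, hk, hk0, hky⟩ := exists_null_of_notMem hy
  obtain ⟨M₁, hM₁, h1⟩ := exists_smul_sub_mem (mem_futureCone_of_plane origin_mem) n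
  obtain ⟨M₂, hM₂, h2⟩ := exists_smul_sub_mem hn origin
  obtain ⟨R, hR, hRf⟩ := exists_large_mink hk hk0 hky zero_le_one
  obtain ⟨C, hC, hcon⟩ := exists_conical hρ hk hk0
  obtain ⟨γ, hγ1, -, hγ2⟩ := hcon (min M₁⁻¹ (M₂ * R)⁻¹) (by positivity)
  have hf := map_closedCone hρ γ (mem_closedCone_of_future hn)
  have e1 := mink_le_of_sub_mem (null_mem_closedCone hk hk0) (by
    rw [← map_smul, ← map_sub]; exact map_closedCone hρ γ h1 :
      M₁ • ρ γ origin - ρ γ n ∈ closedCone)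
  have e2 := mink_le_of_sub_mem (mem_closedCone_of_plane origin_mem) (by
    rw [← map_smul, ← map_sub]; exact map_closedCone hρ γ h2 :
      M₂ • ρ γ n - ρ γ origin ∈ closedCone)
  simp only [mink_origin_left, Pi.smul_apply, smul_eq_mul, neg_neg] at e2
  rw [mink_smul_right, ← mul_neg] at e1
  have h3 : -mink k (ρ γ n) ≤ 1 := by
    refine e1.trans ?_
    have := mul_le_mul_of_nonneg_left (hγ1.trans (min_le_left _ _)) hM₁.le
    rwa [mul_inv_cancel₀ hM₁.ne'] at this
  have h4 : R ≤ ρ γ n 0 := by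
    have h5 : (M₂ * R) ≤ (min M₁⁻¹ (M₂ * R)⁻¹)⁻¹ := by
      rw [le_inv_comm₀ (by positivity) (by positivity)]; exact min_le_right _ _
    have h6 : M₂ * R ≤ M₂ * ρ γ n 0 := (h5.trans hγ2).trans e2
    exact le_of_mul_le_mul_left h6 hM₂
  have := hRf _ hf h3 h4
  have h7 := h γ
  have : 0 < ρ γ n 0 * (mink k y / 2) := mul_pos (hR.trans_le h4) (by linarith)
  linarith

/-- A cocompact group has no parabolic elements. An isometry that fixes the null vector `k`
displaces points close to the end `k` by arbitrarily little, but after moving such a point into a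
compact set only finitely many conjugates are possible, and these have displacement bounded below.
-/
theorem eq_one_of_fixes_null {k : Mink} (hk : mink k k = 0) (hk0 : k 0 = 1) {γ : Γ}
    (hγ : ρ γ k = k) : γ = 1 := by
  by_contra hne
  obtain ⟨M, hM, hcov⟩ := exists_orbit_near hρ
  have hM0 : 0 < M := by linarith
  -- displacement of points close to the end `k`
  set k' : Mink := ![1, -k 1, -k 2] with hk'
  have hk1 : k 1 ^ 2 + k 2 ^ 2 = 1 := by simp only [mink, hk0] at hk; nlinarith
  have hkk' : mink k k' = -2 := by
    simp only [mink, hk', hk0, Matrix.cons_val]; linear_combination -hk1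
  have hk'k' : mink k' k' = 0 := by
    simp only [mink, hk', Matrix.cons_val]; linear_combination hk1
  have hkA : mink k (ρ γ k') = -2 := by
    have := hρ.mink_map γ k k'
    rwa [hγ, hkk'] at this
  set b := |mink k' (ρ γ k')| with hb
  have hw : ∀ t : ℝ, 0 < t → (1 / (2 * t)) • k + (t / 2) • k' ∈ hyperbolicPlane := by
    intro t ht
    refine ⟨?_, ?_⟩
    · simp only [mink_add_left, mink_add_right, mink_smul_left, mink_smul_right, hk, hk'k',
        mink_comm k' k, hkk']
      field_simp; ring
    · have : ((1 / (2 * t)) • k + (t / 2) • k') 0 = 1 / (2 * t) + t / 2 := by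
        simp [hk', hk0]
      rw [this]; positivity
  have hdisp : ∀ t : ℝ, 0 < t → -mink ((1 / (2 * t)) • k + (t / 2) • k')
      (ρ γ ((1 / (2 * t)) • k + (t / 2) • k')) ≤ 1 + t ^ 2 * b := by
    intro t ht
    have : mink ((1 / (2 * t)) • k + (t / 2) • k') (ρ γ ((1 / (2 * t)) • k + (t / 2) • k'))
        = -1 + t ^ 2 / 4 * mink k' (ρ γ k') := by
      simp only [map_add, map_smul, hγ, mink_add_left, mink_add_right, mink_smul_left,
        mink_smul_right, hk, hkA, mink_comm k' k, hkk']
      field_simp; ring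
    rw [this]
    have h1 := neg_abs_le (mink k' (ρ γ k'))
    nlinarith [sq_nonneg t, abs_nonneg (mink k' (ρ γ k'))]
  set D : Set Mink := {x | x ∈ hyperbolicPlane ∧ x 0 ≤ M} with hD
  have hDc : IsCompact D := isCompact_plane_le M
  set F : Set Γ := {δ | height ρ δ ≤ M * M * (1 + b)} \ {1} with hF
  have hFfin : F.Finite := (finite_height_le hρ _).subset Set.sdiff_subset
  -- A nontrivial element has no fixed point in the plane, so its displacement has a positive
  -- minimum on the compact set `D`; one `η` serves the finite set `F`.
  have hη : ∀ δ ∈ F, ∀ᶠ η : ℝ in 𝓝[>] 0, ∀ x ∈ D, 1 + η < -mink x (ρ δ x) := by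
    intro δ hδ
    rcases D.eq_empty_or_nonempty with he | hne
    · simp [he]
    obtain ⟨x, hx, hmin⟩ := hDc.exists_isMinOn hne
      (f := fun x => -mink x (ρ δ x)) (by
        refine (continuous_mink_comp continuous_id ?_).neg.continuousOn
        exact (ρ δ : Mink →ₗ[ℝ] Mink).continuous_of_finiteDimensional)
    have h1 := one_lt_neg_mink hx.1 (hρ.map_plane δ _ hx.1) (hρ.free δ hδ.2 _ hx.1).symm
    have h2 : ∀ᶠ η : ℝ in 𝓝[>] 0, η < -mink x (ρ δ x) - 1 :=
      (eventually_lt_nhds (by linarith : (0 : ℝ) < -mink x (ρ δ x) - 1)).filter_mono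
        nhdsWithin_le_nhds
    filter_upwards [h2] with η hη y hy
    have := hmin hy
    simp only [Set.mem_ofPred_eq] at this
    linarith
  obtain ⟨η, hη1, hη0⟩ := (((Filter.eventually_all_finite hFfin).2 hη).and
    self_mem_nhdsWithin).exists
  replace hη0 : 0 < η := hη0
  set t := min 1 (η / (b + 1)) with ht
  have hb0 : 0 ≤ b := abs_nonneg _
  have ht0 : 0 < t := by positivity
  have ht1 : t ≤ 1 := min_le_left _ _
  have htb : t ^ 2 * b ≤ η := by
    have h1 : t * (b + 1) ≤ η := by
      have := mul_le_mul_of_nonneg_right (min_le_right 1 (η / (b + 1))) (by positivity : 0 ≤ b + 1)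
      rwa [div_mul_cancel₀ _ (by positivity)] at this
    nlinarith
  have htb1 : t ^ 2 * b ≤ b := mul_le_of_le_one_left hb0 (pow_le_one₀ ht0.le ht1)
  set w := (1 / (2 * t)) • k + (t / 2) • k' with hwdef
  have hd := hdisp t ht0
  rw [← hwdef] at hd
  obtain ⟨σ, h1, h2⟩ := hcov w (hw t ht0)
  have hwp := hw t ht0
  rw [← hwdef] at hwp
  have hconj : ∀ x y, mink (ρ σ⁻¹ x) (ρ (σ⁻¹ * γ * σ) y) = mink x (ρ γ (ρ σ y)) := by
    intro x y
    rw [rho_mul_apply, rho_mul_apply, hρ.mink_map]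
  have hxD : ρ σ⁻¹ w ∈ D := by
    refine ⟨hρ.map_plane _ _ hwp, ?_⟩
    have := mink_nonpos (mem_closedCone_of_plane (origin_map_mem hρ σ)) h2
    rw [mink_sub_right, mink_smul_right, (origin_map_mem hρ σ).1, mink_rho_left hρ,
      mink_origin_left] at this
    linarith
  have hδF : σ⁻¹ * γ * σ ∈ F := by
    refine ⟨?_, fun h => hne ?_⟩
    · have e : height ρ (σ⁻¹ * γ * σ) = -mink (ρ σ origin) (ρ γ (ρ σ origin)) := by
        rw [← hconj, rho_inv_apply, mink_origin_left, neg_neg]; rfl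
      change height ρ _ ≤ _
      rw [e]
      have hc := map_closedCone hρ γ h1
      rw [map_sub, map_smul] at hc
      have e1 := mink_le_of_sub_mem (mem_closedCone_of_plane (origin_map_mem hρ σ)) hc
      have e2 := mink_le_of_sub_mem (mem_closedCone_of_plane (hρ.map_plane γ _ hwp)) h1
      rw [mink_smul_right] at e1 e2
      rw [mink_comm _ (ρ σ origin), mink_comm _ w] at e2
      have e3 : -mink (ρ σ origin) (ρ γ w) ≤ M * (1 + b) := by
        refine e2.trans ?_
        rw [← mul_neg]
        exact mul_le_mul_of_nonneg_left (hd.trans (by linarith)) hM0.le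
      have e4 := mul_le_mul_of_nonneg_left e3 hM0.le
      linarith
    · have : σ⁻¹ * γ * σ = 1 := h
      have h3 : γ = σ * (σ⁻¹ * γ * σ) * σ⁻¹ := by group
      rw [h3, this]; group
  have := hη1 _ hδF _ hxD
  rw [hconj, rho_apply_inv] at this
  linarith

theorem exists_ne_one : ∃ γ : Γ, γ ≠ 1 := by
  have hk : mink (![1, 1, 0] : Mink) ![1, 1, 0] = 0 := by simp [mink]
  obtain ⟨C, -, h⟩ := exists_conical hρ hk rfl
  obtain ⟨γ, -, -, h1⟩ := h (1 / 2) (by norm_num)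
  refine ⟨γ, ?_⟩
  rintro rfl
  norm_num [height] at h1

/-- Two orthogonal future null vectors are parallel. -/
theorem not_commutative : ¬∀ γ μ : Γ, γ * μ = μ * γ := by
  intro hcomm
  obtain ⟨γ, hγ⟩ := exists_ne_one hρ
  obtain ⟨M, hM, hcov⟩ := exists_orbit_near hρ
  -- If the group is commutative, the displacement of `γ` is constant along the orbit of the base
  -- point, hence bounded on the whole plane. A bounded displacement fixes every null direction.
  have hbound : ∀ w ∈ hyperbolicPlane, -mink w (ρ γ w) ≤ M * M * height ρ γ := by
    intro w hw
    obtain ⟨μ, -, h2⟩ := hcov w hw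
    have e1 := mink_le_of_sub_mem (mem_closedCone_of_plane (hρ.map_plane γ _ hw)) h2
    have hc := map_closedCone hρ γ h2
    rw [map_sub, map_smul] at hc
    have e2 := mink_le_of_sub_mem (mem_closedCone_of_plane (origin_map_mem hρ μ)) hc
    rw [mink_smul_right] at e1 e2
    rw [mink_comm _ w, mink_comm _ (ρ μ origin)] at e1
    have e3 : mink (ρ μ origin) (ρ γ (ρ μ origin)) = -height ρ γ := by
      rw [← rho_mul_apply, hcomm, rho_mul_apply, hρ.mink_map, mink_origin_left]; rfl
    rw [e3] at e2
    nlinarith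
  have hnull : ∀ k : Mink, mink k k = 0 → k 0 = 1 → mink k (ρ γ k) = 0 := by
    intro k hk hk0
    have hkc := null_mem_closedCone hk hk0
    have hk1 : k 1 ^ 2 + k 2 ^ 2 = 1 := by simp only [mink, hk0] at hk; nlinarith
    by_contra hne
    have hneg : 0 < -mink k (ρ γ k) :=
      neg_pos.2 (lt_of_le_of_ne (mink_nonpos hkc (map_closedCone hρ γ hkc)) hne)
    set B := M * M * height ρ γ with hB
    have hB0 : 0 < B := mul_pos (by nlinarith) (height_pos hρ γ)
    set k' : Mink := ![1, -k 1, -k 2] with hk'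
    have hk'c : k' ∈ closedCone := null_mem_closedCone (by
      simp only [mink, hk', Matrix.cons_val]; linear_combination hk1) rfl
    have hkk' : mink k k' = -2 := by
      simp only [mink, hk', hk0, Matrix.cons_val]; linear_combination -hk1
    obtain ⟨s, hs⟩ := exists_gt (max 1 (B / -mink k (ρ γ k)))
    have hs1 : 1 < s := (le_max_left _ _).trans_lt hs
    have hs0 : 0 < s := by linarith
    have hs2 : B < s * -mink k (ρ γ k) := by
      have := (le_max_right 1 (B / -mink k (ρ γ k))).trans_lt hs
      rwa [div_lt_iff₀ hneg] at this
    set w := s • k + (1 / (4 * s)) • k' with hw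
    have hwp : w ∈ hyperbolicPlane := by
      refine ⟨?_, ?_⟩
      · have hk'k' : mink k' k' = 0 := by
          simp only [mink, hk', Matrix.cons_val]; linear_combination hk1
        simp only [hw, mink_add_left, mink_add_right, mink_smul_left, mink_smul_right, hk, hk'k',
          mink_comm k' k, hkk']
        field_simp; ring
      · have : w 0 = s + 1 / (4 * s) := by
          rw [hw, Pi.add_apply, Pi.smul_apply, Pi.smul_apply, hk0, hk']; simp
        rw [this]; positivity
    have h1 := hbound w hwp
    have h2 := mink_nonpos (closedCone_smul hs0.le hkc)
      (map_closedCone hρ γ (closedCone_smul (by positivity : 0 ≤ 1 / (4 * s)) hk'c))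
    have h3 := mink_nonpos (closedCone_smul (by positivity : 0 ≤ 1 / (4 * s)) hk'c)
      (map_closedCone hρ γ (mem_closedCone_of_plane hwp))
    have h4 : mink w (ρ γ w) = s * (s * mink k (ρ γ k))
        + mink (s • k) (ρ γ ((1 / (4 * s)) • k')) + mink ((1 / (4 * s)) • k') (ρ γ w) := by
      conv_lhs => rw [hw]
      rw [mink_add_left, ← hw]
      congr 1
      rw [hw, map_add, mink_add_right, map_smul, mink_smul_left, mink_smul_right]
    nlinarith
  have hpar : ∀ k : Mink, mink k k = 0 → k 0 = 1 → ρ γ k = (ρ γ k 0) • k := by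
    intro k hk hk0
    have h := norm_sub_null_sq_le (map_closedCone hρ γ (null_mem_closedCone hk hk0)) hk hk0
    rw [hnull k hk hk0, neg_zero, mul_zero] at h
    have : ‖ρ γ k - ρ γ k 0 • k‖ = 0 := by nlinarith [norm_nonneg (ρ γ k - ρ γ k 0 • k)]
    exact sub_eq_zero.1 (norm_eq_zero.1 this)
  -- Three null directions suffice: their eigenvalues have pairwise products one, so they are all
  -- one, and the base point is half of `k₁ + k₂`.
  set k₁ : Mink := ![1, 1, 0] with hk₁
  set k₂ : Mink := ![1, -1, 0] with hk₂
  set k₃ : Mink := ![1, 0, 1] with hk₃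
  have n1 : mink k₁ k₁ = 0 := by simp [mink, hk₁]
  have n2 : mink k₂ k₂ = 0 := by simp [mink, hk₂]
  have n3 : mink k₃ k₃ = 0 := by simp [mink, hk₃]
  have p1 := hpar k₁ n1 rfl
  have p2 := hpar k₂ n2 rfl
  have p3 := hpar k₃ n3 rfl
  set c₁ := ρ γ k₁ 0
  set c₂ := ρ γ k₂ 0
  set c₃ := ρ γ k₃ 0
  have m12 := hρ.mink_map γ k₁ k₂
  have m13 := hρ.mink_map γ k₁ k₃
  have m23 := hρ.mink_map γ k₂ k₃
  have hc1 : 0 ≤ c₁ := (map_closedCone hρ γ (null_mem_closedCone n1 rfl)).2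
  rw [p1, p2, mink_smul_left, mink_smul_right] at m12
  rw [p1, p3, mink_smul_left, mink_smul_right] at m13
  rw [p2, p3, mink_smul_left, mink_smul_right] at m23
  simp [mink, hk₁, hk₂, hk₃] at m12 m13 m23
  have a12 : c₁ * c₂ = 1 := by linarith
  have a13 : c₁ * c₃ = 1 := by linarith
  have a23 : c₂ * c₃ = 1 := by linarith
  have c1ne : c₁ ≠ 0 := by rintro h; rw [h] at a12; norm_num at a12
  have e23 : c₂ = c₃ := mul_left_cancel₀ c1ne (a12.trans a13.symm)
  have hc2 : 0 < c₂ := by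
    rcases hc1.lt_or_eq with h | h
    · by_contra! h'; nlinarith
    · exact absurd h.symm c1ne
  have c2 : c₂ = 1 := by rw [← e23] at a23; nlinarith
  have c1 : c₁ = 1 := by rw [c2] at a12; linarith
  refine hρ.free γ hγ origin origin_mem ?_
  have : origin = (1 / 2 : ℝ) • (k₁ + k₂) := by
    ext i; fin_cases i <;> norm_num [origin, hk₁, hk₂]
  rw [this, map_smul, map_add, p1, p2, c1, c2, one_smul, one_smul]

/-- The group preserves no null line. -/
theorem exists_not_parallel {k : Mink} (hk : mink k k = 0) (hk0 : k 0 = 1) :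
    ∃ γ : Γ, mink k (ρ γ k) < 0 := by
  by_contra! hcon
  have hkc := null_mem_closedCone hk hk0
  have hpar : ∀ γ : Γ, ρ γ k = (ρ γ k 0) • k := by
    intro γ
    have hz : mink k (ρ γ k) = 0 := le_antisymm (mink_nonpos hkc (map_closedCone hρ γ hkc)) (hcon γ)
    have h := norm_sub_null_sq_le (map_closedCone hρ γ hkc) hk hk0
    rw [hz, neg_zero, mul_zero] at h
    have : ‖ρ γ k - ρ γ k 0 • k‖ = 0 := by nlinarith [norm_nonneg (ρ γ k - ρ γ k 0 • k)]
    exact sub_eq_zero.1 (norm_eq_zero.1 this)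
  -- If the null line is invariant, the action on it is by scalars, so commutators fix `k` itself.
  -- They are trivial by `eq_one_of_fixes_null`, and the group would be commutative.
  have hswap : ∀ γ μ : Γ, ρ (γ * μ) k = ρ (μ * γ) k := by
    intro γ μ
    rw [rho_mul_apply, rho_mul_apply, hpar μ, map_smul]
    conv_rhs => rw [hpar γ, map_smul, hpar μ]
    conv_lhs => rw [hpar γ]
    exact smul_comm _ _ _
  refine not_commutative hρ fun γ μ => ?_
  have : (μ * γ)⁻¹ * (γ * μ) = 1 := by
    apply eq_one_of_fixes_null hρ hk hk0
    rw [rho_mul_apply, hswap, rho_inv_apply]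
  exact (inv_mul_eq_one.1 this).symm

end

end HypRigidity

/-! ### Future-complete domains are proper, and orbits in them grow linearly -/

namespace HypRigidity

section

variable {Γ : Type*} [Group Γ] {ρ : Γ →* (Mink ≃ₗ[ℝ] Mink)} (hρ : IsHyperbolicHolonomy ρ)
include hρ

theorem exists_cocycle_growth (τ : cocycles ρ) : ∃ E : ℝ, 0 < E ∧ ∀ γ, ∀ n ∈ closedCone,
    |mink n ((τ : Γ → Mink) γ)| ≤ E * (n 0 + -mink n (ρ γ origin)) := by
  obtain ⟨S, hS, C, hC, h⟩ := exists_cocycle_mink_bound hρ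
  obtain ⟨B, hB⟩ := (hS.image fun s => ‖(τ : Γ → Mink) s‖).bddAbove
  refine ⟨C * max B 1, by positivity, fun γ n hn => h τ (max B 1) (fun s hs => ?_) γ n hn⟩
  exact (hB ⟨s, hs, rfl⟩).trans (le_max_left _ _)

omit hρ in
theorem affineAct_mul (τ : cocycles ρ) (γ μ : Γ) (x : Mink) :
    affineAct τ (γ * μ) x = affineAct τ γ (affineAct τ μ x) := by
  simp only [affineAct, τ.2 γ μ, rho_mul_apply, map_add]; abel

omit hρ in
theorem affineAct_one (τ : cocycles ρ) (x : Mink) : affineAct τ 1 x = x := by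
  simp [affineAct, cocycle_one]

omit hρ in
theorem affineAct_sub (τ : cocycles ρ) (γ : Γ) (x y : Mink) :
    affineAct τ γ x - affineAct τ γ y = ρ γ (x - y) := by
  simp only [affineAct, map_sub]; abel

set_option maxHeartbeats 1000000 in
/-- The affine action is not properly discontinuous on the whole Minkowski space. -/
theorem not_isFutureInvariantDomain_univ (τ : cocycles ρ) :
    ¬IsFutureInvariantDomain τ Set.univ := by
  intro hU
  obtain ⟨E, hE, hEb⟩ := exists_cocycle_growth hρ τ
  -- The factor `E + 1` beats the growth of the cocycle by one unit, so the orbit `Z` is bounded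
  -- below in every causal direction.
  set Z : Γ → Mink := fun γ => affineAct τ γ ((E + 1) • origin) with hZ
  have hZmul : ∀ γ μ, Z (γ * μ) = ρ γ (Z μ) + (τ : Γ → Mink) γ := fun γ μ => affineAct_mul τ γ μ _
  have hZb : ∀ γ, ∀ n ∈ closedCone, mink n (Z γ) ≤ E * n 0 - -mink n (ρ γ origin) := by
    intro γ n hn
    have h1 := (abs_le.1 (hEb γ n hn)).2
    have h2 : mink n (Z γ) = (E + 1) * mink n (ρ γ origin) + mink n ((τ : Γ → Mink) γ) := by
      simp only [hZ, affineAct, map_smul, mink_add_right, mink_smul_right]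
    rw [h2]; linarith
  have hZb' : ∀ γ, ∀ n ∈ closedCone, mink n (Z γ) ≤ E * n 0 := by
    intro γ n hn
    have := mink_nonpos hn (mem_closedCone_of_plane (origin_map_mem hρ γ))
    linarith [hZb γ n hn]
  -- the point below `Z 1` at which the envelope of the orbit is touched
  set 𝒩 : Set Mink := {k | mink k k = 0 ∧ k 0 = 1} with h𝒩
  have h𝒩c : IsCompact 𝒩 := by
    refine (isCompact_closedBall (0 : Mink) 1).of_isClosed_subset
      ((isClosed_eq (continuous_mink_comp continuous_id continuous_id) continuous_const).inter
        (isClosed_eq (continuous_apply 0) continuous_const)) fun k hk => ?_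
    rw [mem_closedBall_zero_iff]
    exact (norm_le_of_closedCone (null_mem_closedCone hk.1 hk.2)).trans hk.2.le
  have h𝒩ne : 𝒩.Nonempty := ⟨![1, 1, 0], by simp [mink], rfl⟩
  have hbdd : ∀ k ∈ 𝒩, BddAbove (Set.range fun γ => mink k (Z γ - Z 1)) := by
    rintro k ⟨hk, hk0⟩
    refine ⟨E * k 0 - mink k (Z 1), ?_⟩
    rintro _ ⟨γ, rfl⟩
    have := hZb' γ k (null_mem_closedCone hk hk0)
    simp only [mink_sub_right]
    linarith
  -- Each null direction `k` gives the bound ⟨k, ·⟩ ≤ sup ⟨k, Z γ⟩. Descending vertically from `Z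
  -- 1`, the first bound to become sharp belongs to the `k` with the smallest supremum. The minimum
  -- is attained because a supremum of continuous functions is lower semicontinuous and the null
  -- circle is compact.
  obtain ⟨k₀, hk₀, hmin⟩ := LowerSemicontinuousOn.exists_isMinOn
    (f := fun k => ⨆ γ, mink k (Z γ - Z 1)) h𝒩ne h𝒩c
    (lowerSemicontinuousOn_ciSup hbdd fun γ =>
      (continuous_mink_comp continuous_id continuous_const).lowerSemicontinuous.lowerSemicontinuousOn _)
  set s := ⨆ γ, mink k₀ (Z γ - Z 1) with hs
  set x := Z 1 - s • origin with hx
  have htouch : ∀ γ, mink k₀ (Z γ) ≤ mink k₀ x := by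
    intro γ
    have h1 : mink k₀ (Z γ - Z 1) ≤ s := le_ciSup (hbdd k₀ hk₀) γ
    rw [mink_sub_right] at h1
    rw [hx, mink_sub_right, mink_smul_right, mink_origin_right, hk₀.2]
    linarith
  have hbelow : ∀ k ∈ 𝒩, ∀ δ > 0, ∃ γ, mink k x ≤ mink k (Z γ) + δ := by
    intro k hk δ hδ
    have h1 : s ≤ ⨆ γ, mink k (Z γ - Z 1) := hmin hk
    obtain ⟨γ, hγ⟩ := exists_lt_of_lt_ciSup (lt_of_lt_of_le (sub_lt_self s hδ) h1)
    refine ⟨γ, ?_⟩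
    rw [mink_sub_right] at hγ
    rw [hx, mink_sub_right, mink_smul_right, mink_origin_right, hk.2]
    linarith
  -- By minimality of `k₀` the point `x` violates no null bound, and the family of these bounds is
  -- invariant under the action. So the orbit of `x` inherits the lower bound of the orbit `Z`.
  have horb : ∀ γ, affineAct τ γ x + E • origin ∈ closedCone := by
    intro γ
    by_contra hcon
    obtain ⟨k, hk, hk0, hkx⟩ := exists_null_of_notMem hcon
    have hkc := null_mem_closedCone hk hk0
    rw [mink_add_right, mink_smul_right, mink_origin_right, hk0] at hkx
    set m := ρ γ⁻¹ k with hm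
    have hmc : m ∈ closedCone := map_closedCone hρ _ hkc
    have hm0 : 0 < m 0 := by
      rcases hmc.2.lt_or_eq with h | h
      · exact h
      · exfalso
        have h1 := norm_le_of_closedCone hmc
        rw [← h] at h1
        have h2 : m = 0 := norm_le_zero_iff.1 h1
        rw [hm, map_eq_zero_iff _ (ρ γ⁻¹).injective] at h2
        rw [h2] at hk0
        simp at hk0
    have hmN : (m 0)⁻¹ • m ∈ 𝒩 := by
      refine ⟨?_, by simp [hm0.ne']⟩
      rw [mink_smul_left, mink_smul_right, hm, hρ.mink_map, hk]; simp
    set d := mink k (affineAct τ γ x) - E with hd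
    have hd0 : 0 < d := by rw [hd]; linarith
    obtain ⟨μ, hμ⟩ := hbelow _ hmN ((m 0)⁻¹ * (d / 2)) (by positivity)
    rw [mink_smul_left, mink_smul_left, ← mul_add] at hμ
    have hμ' := le_of_mul_le_mul_left hμ (inv_pos.2 hm0)
    have h1 : mink k (affineAct τ γ x) = mink m x + mink k ((τ : Γ → Mink) γ) := by
      rw [affineAct, mink_add_right, mink_rho_right hρ]
    have h2 : mink k (Z (γ * μ)) = mink m (Z μ) + mink k ((τ : Γ → Mink) γ) := by
      rw [hZmul, mink_add_right, mink_rho_right hρ]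
    have h3 := hZb' (γ * μ) k hkc
    rw [hk0, h2] at h3
    linarith
  -- the orbit of `x` returns along a conical sequence
  obtain ⟨C₁, hC₁, hcon⟩ := exists_conical hρ hk₀.1 hk₀.2
  have hk₀c := null_mem_closedCone hk₀.1 hk₀.2
  set C₂ := 3 * ‖Z 1‖ + E with hC₂
  set C₃ := ‖x‖ + 3 * E + E with hC₃
  have hτn : ∀ γ, |(τ : Γ → Mink) γ 0| ≤ E * (1 + height ρ γ) := by
    intro γ
    have := hEb γ origin (mem_closedCone_of_plane origin_mem)
    simpa [height] using this
  -- Since the null plane through `x` bounds the orbit `Z`, the point `f` stays near the ray of `σ⁻¹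
  -- k₀`. Applying `σ` stretches this ray by `δ⁻¹`, while the image of `f` is of the order of
  -- `height ρ σ`. Hence `f 0` is controlled by the product `height ρ σ * δ`, which is bounded along
  -- a conical sequence.
  have hret : ∀ σ : Γ, height ρ σ * -mink k₀ (ρ σ origin) ≤ C₁ →
      (affineAct τ σ⁻¹ x + E • origin) 0 ≤ 2 * (C₁ * C₃) + (3 * C₁) ^ 2 * (2 * C₂) := by
    intro σ hσ
    set δ := -mink k₀ (ρ σ origin) with hδ
    have hδ0 : 0 < δ := by
      rw [hδ, neg_pos]
      refine mink_neg_of_future hk₀c ?_ (mem_futureCone_of_plane (origin_map_mem hρ σ))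
      rintro h
      have := hk₀.2
      rw [h] at this
      simp at this
    set m := ρ σ⁻¹ k₀ with hm
    have hm0 : m 0 = δ := by
      have := mink_rho_right hρ σ k₀ origin
      rw [mink_origin_right] at this
      rw [hδ, this, neg_neg]
    have hmc : m ∈ closedCone := map_closedCone hρ _ hk₀c
    set f := affineAct τ σ⁻¹ x + E • origin with hf
    have hfc : f ∈ closedCone := horb σ⁻¹
    have hmf : -mink m f ≤ C₂ * δ := by
      have h1 : mink m (affineAct τ σ⁻¹ x) = mink k₀ x + mink m ((τ : Γ → Mink) σ⁻¹) := by
        rw [affineAct, mink_add_right, hm, hρ.mink_map]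
      have h2 : mink m (Z 1) = mink k₀ (Z σ) + mink m ((τ : Γ → Mink) σ⁻¹) := by
        rw [← inv_mul_cancel σ, hZmul, mink_add_right, hm, hρ.mink_map]
      have h3 : mink m (Z 1) ≤ mink m (affineAct τ σ⁻¹ x) := by rw [h1, h2]; linarith [htouch σ]
      have h4 := neg_le_of_abs_le (abs_mink_le m (Z 1))
      have h5 : ‖m‖ ≤ δ := hm0 ▸ norm_le_of_closedCone hmc
      have h6 : 3 * ‖m‖ * ‖Z 1‖ ≤ 3 * δ * ‖Z 1‖ := by gcongr
      rw [hf, mink_add_right, mink_smul_right, mink_origin_right, hm0, hC₂]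
      linarith
    set k := δ⁻¹ • m with hk
    have hkk : mink k k = 0 := by
      rw [hk, mink_smul_left, mink_smul_right, hm, hρ.mink_map, hk₀.1]; simp
    have hk0 : k 0 = 1 := by rw [hk, Pi.smul_apply, hm0, smul_eq_mul, inv_mul_cancel₀ hδ0.ne']
    have hkf : -mink k f ≤ C₂ := by
      rw [hk, mink_smul_left, ← mul_neg, inv_mul_le_iff₀ hδ0]; linarith
    have hr := norm_sub_null_sq_le hfc hkk hk0
    set r := f - f 0 • k with hrdef
    have hr2 : ‖r‖ ^ 2 ≤ 2 * f 0 * C₂ :=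
      hr.trans (mul_le_mul_of_nonneg_left hkf (by linarith [hfc.2]))
    have hfr : f = f 0 • k + r := by rw [hrdef]; abel
    have h1 : ρ σ f 0 = f 0 * δ⁻¹ + ρ σ r 0 := by
      conv_lhs => rw [hfr]
      have e : ρ σ k = δ⁻¹ • k₀ := by rw [hk, map_smul, hm, rho_apply_inv]
      rw [map_add, map_smul, e]
      simp [hk₀.2]
    have h2 : ρ σ f 0 = x 0 - (τ : Γ → Mink) σ 0 + E * height ρ σ := by
      have e : ρ σ f = x - (τ : Γ → Mink) σ + E • ρ σ origin := by
        rw [hf, affineAct, cocycle_inv, map_add, map_smul, map_add, map_neg, rho_apply_inv,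
          rho_apply_inv]
        abel
      rw [e]; simp [height]
    have hN1 := one_le_height hρ σ
    have hN0 := height_pos hρ σ
    have h3 : -(3 * ‖r‖ * height ρ σ) ≤ ρ σ r 0 :=
      neg_le_of_abs_le ((abs_apply_le_norm _ 0).trans (norm_rho_le hρ σ r))
    have h4 := neg_le_of_abs_le (hτn σ)
    have h5 := (le_abs_self _).trans (abs_apply_le_norm x 0)
    have hx0 := norm_nonneg x
    have h6 : f 0 * δ⁻¹ ≤ (C₃ + 3 * ‖r‖) * height ρ σ := by
      have : ‖x‖ ≤ ‖x‖ * height ρ σ := le_mul_of_one_le_right hx0 hN1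
      have : E ≤ E * height ρ σ := le_mul_of_one_le_right hE.le hN1
      rw [hC₃]
      nlinarith
    have hC₃0 : 0 ≤ C₃ := by positivity
    have h7 : f 0 ≤ (C₃ + 3 * ‖r‖) * C₁ := by
      have h8 := mul_le_mul_of_nonneg_right h6 hδ0.le
      rw [inv_mul_cancel_right₀ hδ0.ne'] at h8
      have h9 := mul_le_mul_of_nonneg_left hσ (by positivity : 0 ≤ C₃ + 3 * ‖r‖)
      linarith
    have hC₂0 : 0 ≤ C₂ := by positivity
    have hf0 := hfc.2
    -- absorb the square root
    have h10 : 2 * (3 * C₁ * ‖r‖) ≤ f 0 + (3 * C₁) ^ 2 * (2 * C₂) := by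
      rcases hC₂0.lt_or_eq with hpos | hz
      · have h11 : 0 ≤ (‖r‖ - 3 * C₁ * (2 * C₂)) ^ 2 := sq_nonneg _
        have h12 : 2 * (3 * C₁ * ‖r‖) * (2 * C₂) ≤ (f 0 + (3 * C₁) ^ 2 * (2 * C₂)) * (2 * C₂) := by
          nlinarith
        exact le_of_mul_le_mul_right h12 (by linarith)
      · rw [← hz] at hr2 ⊢
        have : ‖r‖ = 0 := by nlinarith [norm_nonneg r]
        rw [this]; linarith
    linarith
  set R := 2 * (C₁ * C₃) + (3 * C₁) ^ 2 * (2 * C₂) + E + ‖x‖ with hR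
  have hfin := hU.properlyDiscontinuous (Metric.closedBall 0 R) (isCompact_closedBall _ _)
    (Set.subset_univ _)
  have hpos : ∀ γ ∈ {γ : Γ | ((affineAct τ γ '' Metric.closedBall 0 R)
      ∩ Metric.closedBall 0 R).Nonempty}, ∀ᶠ ε : ℝ in 𝓝[>] 0, ε < -mink k₀ (ρ γ⁻¹ origin) := by
    intro γ _
    refine (eventually_lt_nhds ?_).filter_mono nhdsWithin_le_nhds
    rw [neg_pos]
    refine mink_neg_of_future hk₀c ?_ (mem_futureCone_of_plane (origin_map_mem hρ _))
    rintro h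
    have := hk₀.2
    rw [h] at this
    simp at this
  -- Proper discontinuity leaves finitely many returning elements, each with positive product with
  -- `k₀`. A conical element with smaller product returns as well, a contradiction.
  obtain ⟨ε, hε, hε0⟩ := (((Filter.eventually_all_finite hfin).2 hpos).and
    self_mem_nhdsWithin).exists
  obtain ⟨σ, hσ1, hσ2, -⟩ := hcon ε hε0
  have hC₂0 : 0 ≤ C₂ := by positivity
  have hC₃0 : 0 ≤ C₃ := by positivity
  have hmem : σ⁻¹ ∈ {γ : Γ | ((affineAct τ γ '' Metric.closedBall 0 R)
      ∩ Metric.closedBall 0 R).Nonempty} := by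
    refine ⟨affineAct τ σ⁻¹ x, ⟨x, ?_, rfl⟩, ?_⟩
    · rw [mem_closedBall_zero_iff, hR]
      have : 0 ≤ 2 * (C₁ * C₃) + (3 * C₁) ^ 2 * (2 * C₂) + E := by positivity
      linarith
    · rw [mem_closedBall_zero_iff]
      have h1 := norm_le_of_closedCone (horb σ⁻¹)
      have h2 := hret σ hσ2
      have h3 : ‖E • origin‖ ≤ E := by
        rw [norm_smul, Real.norm_of_nonneg hE.le]
        have := norm_le_of_closedCone (mem_closedCone_of_plane origin_mem)
        rw [origin_zero] at this
        nlinarith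
      have h4 : ‖affineAct τ σ⁻¹ x‖ ≤ ‖affineAct τ σ⁻¹ x + E • origin‖ + ‖E • origin‖ := by
        have := norm_sub_le (affineAct τ σ⁻¹ x + E • origin) (E • origin)
        rwa [add_sub_cancel_right] at this
      have := norm_nonneg x
      linarith
  have := hε _ hmem
  rw [inv_inv] at this
  linarith

/-- The orbit of a point of an invariant domain grows linearly to the future. -/
theorem exists_growth {τ : cocycles ρ} {U : Set Mink} (hU : IsFutureInvariantDomain τ U) {x : Mink}
    (hx : x ∈ U) : ∃ C c : ℝ, 0 < c ∧ ∀ γ, ∀ n ∈ closedCone,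
      mink n (affineAct τ γ x) ≤ C * n 0 - c * -mink n (ρ γ origin) := by
  obtain ⟨E, hE, hEb⟩ := exists_cocycle_growth hρ τ
  have hne : ∃ z, z ∉ U := by
    by_contra! h
    refine not_isFutureInvariantDomain_univ hρ τ ?_
    rwa [Set.eq_univ_of_forall h] at hU
  obtain ⟨z, hz⟩ := hne
  obtain ⟨f, hf⟩ := geometric_hahn_banach_open_point hU.convex hU.isOpen hz
  obtain ⟨n₀, hn₀⟩ := exists_mink_eq f
  have hn₀b : ∀ y ∈ U, mink n₀ y ≤ mink n₀ z := fun y hy => by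
    rw [← hn₀, ← hn₀]; exact (hf y hy).le
  have hn₀ne : n₀ ≠ 0 := by
    rintro rfl
    have := hf x hx
    rw [hn₀, hn₀] at this
    simp at this
  -- A functional bounded above on a future-complete set cannot be positive on a future vector.
  have hn₀c : n₀ ∈ closedCone := by
    rw [mem_closedCone_iff_plane]
    intro y hy
    by_contra! hpos
    set s := (mink n₀ z - mink n₀ x) / mink n₀ y + 1 with hs
    have hz0 : 0 ≤ mink n₀ z - mink n₀ x := sub_nonneg.2 (hn₀b x hx)
    have hs0 : 0 < s := by positivity
    have h1 := hn₀b _ (hU.future x hx _ (futureCone_smul hs0 (mem_futureCone_of_plane hy)))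
    rw [mink_add_right, mink_smul_right, hs, add_mul, div_mul_cancel₀ _ hpos.ne'] at h1
    linarith
  -- a timelike vector bounded on `U`
  have htime : ∃ n₁ ∈ futureCone, ∃ B, ∀ y ∈ U, mink n₁ y ≤ B := by
    by_cases hneg : mink n₀ n₀ < 0
    · refine ⟨n₀, ⟨hneg, lt_of_le_of_ne hn₀c.2 fun h => hn₀ne ?_⟩, _, hn₀b⟩
      have := norm_le_of_closedCone hn₀c
      rw [← h] at this
      exact norm_le_zero_iff.1 this
    · have hnull : mink n₀ n₀ = 0 := le_antisymm hn₀c.1 (not_lt.1 hneg)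
      have hpos : 0 < n₀ 0 := by
        refine lt_of_le_of_ne hn₀c.2 fun h => hn₀ne ?_
        have := norm_le_of_closedCone hn₀c
        rw [← h] at this
        exact norm_le_zero_iff.1 this
      -- A null normal and a non-parallel translate of it are both bounded on the invariant set `U`,
      -- and their sum is timelike.
      obtain ⟨γ, hγ⟩ := exists_not_parallel hρ (k := (n₀ 0)⁻¹ • n₀)
        (by rw [mink_smul_left, mink_smul_right, hnull]; simp) (by simp [hpos.ne'])
      rw [map_smul, mink_smul_left, mink_smul_right, ← mul_assoc] at hγ
      have hγ' : mink n₀ (ρ γ n₀) < 0 := by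
        by_contra! h
        have : 0 ≤ (n₀ 0)⁻¹ * (n₀ 0)⁻¹ * mink n₀ (ρ γ n₀) := by positivity
        linarith
      refine ⟨n₀ + ρ γ n₀, ⟨?_, ?_⟩, mink n₀ z + mink n₀ z + mink (ρ γ n₀) ((τ : Γ → Mink) γ),
        fun y hy => ?_⟩
      · rw [mink_add_left, mink_add_right, mink_add_right, hρ.mink_map, hnull,
          mink_comm (ρ γ n₀) n₀]
        linarith
      · exact add_pos_of_pos_of_nonneg hpos (map_closedCone hρ γ hn₀c).2
      · have h1 := hn₀b _ (hU.invariant γ⁻¹ y hy)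
        have h2 : mink (ρ γ n₀) y
            = mink n₀ (affineAct τ γ⁻¹ y) + mink (ρ γ n₀) ((τ : Γ → Mink) γ) := by
          rw [affineAct, cocycle_inv, mink_add_right, mink_neg_right, ← mink_rho_left hρ,
            ← mink_rho_left hρ]
          ring
        rw [mink_add_left, h2]
        linarith [hn₀b y hy]
  obtain ⟨n₁, hn₁, B, hB⟩ := htime
  obtain ⟨M, hM, hMo⟩ := exists_smul_sub_mem hn₁ origin
  set C := (|B| + E * (n₁ 0)) * M + E with hC
  have hUc : ∀ y ∈ U, y + C • origin ∈ closedCone := by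
    intro y hy
    refine mem_closedCone_of_orbit hρ hn₁ fun μ => ?_
    have h1 := hB _ (hU.invariant μ⁻¹ y hy)
    have h2 : mink (ρ μ n₁) y
        = mink n₁ (affineAct τ μ⁻¹ y) + mink (ρ μ n₁) ((τ : Γ → Mink) μ) := by
      rw [affineAct, cocycle_inv, mink_add_right, mink_neg_right, ← mink_rho_left hρ,
        ← mink_rho_left hρ]
      ring
    have hm := map_closedCone hρ μ (mem_closedCone_of_future hn₁)
    have h3 := (abs_le.1 (hEb μ (ρ μ n₁) hm)).2
    rw [hρ.mink_map, mink_origin_right, neg_neg] at h3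
    have h4 : 1 ≤ M * ρ μ n₁ 0 := by
      have := map_closedCone hρ μ hMo
      rw [map_sub, map_smul] at this
      have h5 := this.2
      simp only [Pi.sub_apply, Pi.smul_apply, smul_eq_mul] at h5
      have h6 : 1 ≤ ρ μ origin 0 := one_le_height hρ μ
      linarith
    rw [mink_add_right, mink_smul_right, mink_origin_right, h2, hC]
    have h7 : (|B| + E * n₁ 0) * 1 ≤ (|B| + E * n₁ 0) * (M * ρ μ n₁ 0) :=
      mul_le_mul_of_nonneg_left h4 (by have := hn₁.2; positivity)
    linarith [le_abs_self B]
  -- room below `x`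
  have hroom : ∃ η : ℝ, 0 < η ∧ x - η • origin ∈ U := by
    have h : Filter.Tendsto (fun η : ℝ => x - η • origin) (𝓝[>] 0) (𝓝 x) := by
      have : Filter.Tendsto (fun η : ℝ => x - η • origin) (𝓝 0) (𝓝 (x - (0 : ℝ) • origin)) :=
        (by fun_prop : Continuous fun η : ℝ => x - η • origin).tendsto 0
      rw [zero_smul, sub_zero] at this
      exact this.mono_left nhdsWithin_le_nhds
    obtain ⟨η, hη, hη0⟩ := ((h.eventually (hU.isOpen.mem_nhds hx)).and
      self_mem_nhdsWithin).exists
    exact ⟨η, hη0, hη⟩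
  obtain ⟨η, hη0, hη⟩ := hroom
  -- The orbit of the lower point `x - η • origin` still lies above `-C • origin`; the difference `η
  -- • ρ γ origin` is the linear gain.
  refine ⟨C, η, hη0, fun γ n hn => ?_⟩
  have h1 := mink_nonpos hn (hUc _ (hU.invariant γ _ hη))
  have h2 : affineAct τ γ (x - η • origin) = affineAct τ γ x - η • ρ γ origin := by
    simp only [affineAct, map_sub, map_smul]; abel
  rw [h2, mink_add_right, mink_sub_right, mink_smul_right, mink_smul_right, mink_origin_right] at h1
  linarith

end

end HypRigidity

namespace HypRigidity

/-! ### Marked points and their support planes -/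

section

variable {Γ : Type*} [Group Γ] {ρ : Γ →* (Mink ≃ₗ[ℝ] Mink)} {V : Type*}

theorem liftedMarking_translate (q : MarkedData ρ V) (γ : Γ) (a : Γ × V) :
    liftedMarking q (translate γ a) = affineAct q.1 γ (liftedMarking q a) :=
  affineAct_mul q.1 γ a.1 (q.2 a.2)

theorem liftedMarking_translate_sub (q : MarkedData ρ V) (γ : Γ) (a b : Γ × V) :
    liftedMarking q (translate γ a) - liftedMarking q (translate γ b)
      = ρ γ (liftedMarking q a - liftedMarking q b) := by
  rw [liftedMarking_translate, liftedMarking_translate, affineAct_sub]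

theorem liftedMarking_add (q r : MarkedData ρ V) (a : Γ × V) :
    liftedMarking (q + r) a = liftedMarking q a + liftedMarking r a := by
  simp only [liftedMarking, affineAct, Prod.fst_add, Prod.snd_add, Pi.add_apply, map_add,
    Submodule.coe_add]
  abel

theorem liftedMarking_smul (c : ℝ) (q : MarkedData ρ V) (a : Γ × V) :
    liftedMarking (c • q) a = c • liftedMarking q a := by
  simp only [liftedMarking, affineAct, Prod.smul_fst, Prod.smul_snd, Pi.smul_apply, map_smul,
    Submodule.coe_smul, smul_add]

theorem continuous_liftedMarking (a : Γ × V) :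
    Continuous fun q : MarkedData ρ V => liftedMarking q a := by
  have h : Continuous (ρ a.1 : Mink → Mink) :=
    (ρ a.1 : Mink →ₗ[ℝ] Mink).continuous_of_finiteDimensional
  exact (h.comp ((continuous_apply a.2).comp continuous_snd)).add
    ((continuous_apply a.1).comp (continuous_subtype_val.comp continuous_fst))

/-- The position of a lifted marked point, as a continuous linear function of the data. -/
noncomputable def markingCLM (ρ : Γ →* (Mink ≃ₗ[ℝ] Mink)) (a : Γ × V) :
    MarkedData ρ V →L[ℝ] Mink where
  toFun q := liftedMarking q a
  map_add' q r := liftedMarking_add q r a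
  map_smul' c q := liftedMarking_smul c q a
  cont := continuous_liftedMarking a

theorem liftedMarking_sub (q r : MarkedData ρ V) (a : Γ × V) :
    liftedMarking (q - r) a = liftedMarking q a - liftedMarking r a :=
  (markingCLM ρ a).map_sub q r

/-- All orbits of marked points grow linearly to the future. -/
def UniformGrowth (q : MarkedData ρ V) (C c : ℝ) : Prop :=
  ∀ γ v, ∀ n ∈ closedCone,
    mink n (liftedMarking q (γ, v)) ≤ C * n 0 - c * -mink n (ρ γ origin)

/-- The marked points on the support plane with normal `n`. -/
def contact (q : MarkedData ρ V) (n : Mink) : Set (Γ × V) :=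
  {a | ∀ b, mink n (liftedMarking q b) ≤ mink n (liftedMarking q a)}

theorem contact_smul {c : ℝ} (hc : 0 < c) (q : MarkedData ρ V) (n : Mink) :
    contact q (c • n) = contact q n := by
  ext a
  simp only [contact, Set.mem_ofPred_eq, mink_smul_left]
  exact forall_congr' fun b => mul_le_mul_iff_right₀ hc

theorem mink_eq_of_contact {q : MarkedData ρ V} {n : Mink} {a b : Γ × V} (ha : a ∈ contact q n)
    (hb : b ∈ contact q n) : mink n (liftedMarking q a) = mink n (liftedMarking q b) :=
  le_antisymm (hb a) (ha b)

theorem mem_contact_of_eq {q : MarkedData ρ V} {n : Mink} {a b : Γ × V} (ha : a ∈ contact q n)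
    (h : mink n (liftedMarking q a) = mink n (liftedMarking q b)) : b ∈ contact q n :=
  fun c => (ha c).trans h.le

variable (hρ : IsHyperbolicHolonomy ρ)
include hρ

theorem mem_contact_translate {q : MarkedData ρ V} {n : Mink} {γ : Γ} {a : Γ × V} :
    translate γ a ∈ contact q (ρ γ n) ↔ a ∈ contact q n := by
  have key : ∀ b, mink (ρ γ n) (liftedMarking q (translate γ b))
      = mink n (liftedMarking q b) + mink (ρ γ n) ((q.1 : Γ → Mink) γ) := by
    intro b
    rw [liftedMarking_translate, affineAct, mink_add_right, hρ.mink_map]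
  constructor
  · intro h b
    have := h (translate γ b)
    rw [key, key] at this
    linarith
  · intro h b
    obtain ⟨b', rfl⟩ := (translate γ).surjective b
    rw [key, key]
    linarith [h b']

theorem contact_map (q : MarkedData ρ V) (n : Mink) (γ : Γ) :
    contact q (ρ γ n) = translate γ '' contact q n := by
  ext a
  constructor
  · intro ha
    obtain ⟨b, rfl⟩ := (translate γ).surjective a
    exact ⟨b, (mem_contact_translate hρ).1 ha, rfl⟩
  · rintro ⟨b, hb, rfl⟩
    exact (mem_contact_translate hρ).2 hb

theorem exists_uniformGrowth [Finite V] {p : MarkedData ρ V} (hp : p ∈ convexMarkedData ρ V) :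
    ∃ C c : ℝ, 0 < C ∧ 0 < c ∧ UniformGrowth p C c := by
  cases nonempty_fintype V
  have h : ∀ v, ∃ C c : ℝ, 0 < c ∧ ∀ γ, ∀ n ∈ closedCone,
      mink n (affineAct p.1 γ (p.2 v)) ≤ C * n 0 - c * -mink n (ρ γ origin) := by
    intro v
    obtain ⟨U, hU, hv⟩ := hp.1 v
    exact exists_growth hρ hU hv
  choose C c hc hb using h
  obtain ⟨C', hC'⟩ := (Set.finite_range C).bddAbove
  have hc' : ∃ c' : ℝ, 0 < c' ∧ ∀ v, c' ≤ c v := by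
    have : ∀ᶠ x : ℝ in 𝓝[>] 0, ∀ v, x ≤ c v := Filter.eventually_all.2 fun v =>
      (eventually_le_nhds (hc v)).filter_mono nhdsWithin_le_nhds
    obtain ⟨x, hx, hx0⟩ := (this.and self_mem_nhdsWithin).exists
    exact ⟨x, hx0, hx⟩
  obtain ⟨c', hc0, hc'⟩ := hc'
  refine ⟨max C' 1, c', by positivity, hc0, fun γ v n hn => (hb v γ n hn).trans ?_⟩
  have h1 : C v ≤ max C' 1 := (hC' ⟨v, rfl⟩).trans (le_max_left _ _)
  have h2 := mink_nonpos hn (mem_closedCone_of_plane (origin_map_mem hρ γ))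
  have h3 := mul_le_mul_of_nonneg_right h1 hn.2
  have h4 := mul_le_mul_of_nonneg_right (hc' v) (neg_nonneg.2 h2)
  linarith

/-- A cocycle that is small on a suitable finite set grows slowly in all causal directions
simultaneously. Half of the rate `c` pays for the change of the cocycle and of the base positions,
so finitely many conditions on `q` suffice. -/
theorem eventually_uniformGrowth [Finite V] {p : MarkedData ρ V} {C c : ℝ} (hc : 0 < c)
    (hp : UniformGrowth p C c) : ∀ᶠ q in 𝓝 p, UniformGrowth q (C + c / 2) (c / 2) := by
  obtain ⟨S, hS, K, hK, hKb⟩ := exists_cocycle_mink_bound hρ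
  set ε := c / (2 * (K + 3)) with hε
  have hε0 : 0 < ε := by positivity
  have hεK : (K + 3) * ε = c / 2 := by rw [hε]; field_simp
  have e1 : ∀ᶠ q : MarkedData ρ V in 𝓝 p, ∀ s ∈ S, ‖((q.1 - p.1 : cocycles ρ) : Γ → Mink) s‖ < ε := by
    refine (Filter.eventually_all_finite hS).2 fun s _ => ?_
    have hcont : Continuous fun q : MarkedData ρ V => ‖((q.1 - p.1 : cocycles ρ) : Γ → Mink) s‖ := by
      refine Continuous.norm ((continuous_apply s).comp (continuous_subtype_val.comp ?_))
      exact continuous_fst.sub continuous_const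
    exact hcont.continuousAt.eventually_lt continuousAt_const (by simpa using hε0)
  have e2 : ∀ᶠ q : MarkedData ρ V in 𝓝 p, ∀ v, ‖q.2 v - p.2 v‖ < ε := by
    refine Filter.eventually_all.2 fun v => ?_
    have hcont : Continuous fun q : MarkedData ρ V => ‖q.2 v - p.2 v‖ :=
      (((continuous_apply v).comp continuous_snd).sub continuous_const).norm
    exact hcont.continuousAt.eventually_lt continuousAt_const (by simpa using hε0)
  filter_upwards [e1, e2] with q h1 h2 γ v n hn
  have h3 := (abs_le.1 (hKb (q.1 - p.1) ε (fun s hs => (h1 s hs).le) γ n hn)).2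
  have h4 := (abs_le.1 (abs_mink_rho_le hρ γ hn (q.2 v - p.2 v))).2
  have h5 := hp γ v n hn
  have h6 := mink_nonpos hn (mem_closedCone_of_plane (origin_map_mem hρ γ))
  have h7 : mink n (liftedMarking q (γ, v)) = mink n (liftedMarking p (γ, v))
      + mink n (ρ γ (q.2 v - p.2 v)) + mink n (((q.1 - p.1 : cocycles ρ) : Γ → Mink) γ) := by
    simp only [liftedMarking, affineAct, map_sub, mink_add_right, mink_sub_right,
      AddSubgroupClass.coe_sub, Pi.sub_apply]
    ring
  have h8 : 3 * ‖q.2 v - p.2 v‖ * -mink n (ρ γ origin) ≤ 3 * ε * -mink n (ρ γ origin) :=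
    mul_le_mul_of_nonneg_right (by linarith [h2 v]) (by linarith)
  have h9 : K * ε ≤ c / 2 := by rw [← hεK]; nlinarith
  have h10 := mul_le_mul_of_nonneg_right h9 hn.2
  rw [h7]
  have h11 : (3 * ε + K * ε) * -mink n (ρ γ origin) = c / 2 * -mink n (ρ γ origin) := by
    rw [← hεK]; ring
  linarith

/-- For normals close to a given one, only finitely many marked points are not far below. -/
theorem exists_finite_below [Finite V] {n₀ : Mink} (hn₀ : n₀ ∈ futureCone) {C c : ℝ} (hC : 0 ≤ C)
    (hc : 0 < c) (M : ℝ) : ∃ J : Set (Γ × V), J.Finite ∧ ∀ᶠ n in 𝓝 n₀, n ∈ futureCone ∧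
      ∀ q : MarkedData ρ V, UniformGrowth q C c → ∀ a ∉ J, mink n (liftedMarking q a) < M := by
  obtain ⟨K, hK, h⟩ := exists_smul_sub_mem hn₀ origin
  have hK' : (K + 1) • n₀ - origin ∈ futureCone := by
    rw [add_smul, one_smul, add_sub_right_comm, add_comm]
    exact futureCone_add hn₀ h
  -- For normals near `n₀`, the height of `γ` is at most `K + 1` times `-mink n (ρ γ origin)`.
  -- Beyond height `R` the linear loss therefore exceeds `C * n 0` and brings the value below `M`.
  set R := (K + 1) * (C * (n₀ 0 + 1) + |M| + 1) / c with hR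
  refine ⟨{γ | height ρ γ ≤ R} ×ˢ Set.univ, (finite_height_le hρ R).prod Set.finite_univ, ?_⟩
  have e1 : ∀ᶠ n in 𝓝 n₀, (K + 1) • n - origin ∈ futureCone :=
    ((by fun_prop : Continuous fun n : Mink => (K + 1) • n - origin).continuousAt.eventually
      (isOpen_futureCone.mem_nhds hK'))
  have e2 : ∀ᶠ n : Mink in 𝓝 n₀, n 0 < n₀ 0 + 1 :=
    (continuous_apply 0).continuousAt.eventually_lt continuousAt_const (by linarith)
  filter_upwards [e1, e2, isOpen_futureCone.mem_nhds hn₀] with n h1 h2 h3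
  refine ⟨h3, fun q hq a ha => ?_⟩
  obtain ⟨γ, v⟩ := a
  have hγ : R < height ρ γ := by
    by_contra! hle
    exact ha ⟨hle, Set.mem_univ _⟩
  have h4 := hq γ v n (mem_closedCone_of_future h3)
  have h5 := mink_le_of_sub_mem (mem_closedCone_of_plane (origin_map_mem hρ γ))
    (mem_closedCone_of_future h1)
  rw [mink_smul_right, mink_origin_right, neg_neg, mink_comm _ n] at h5
  have h6 : (K + 1) * (C * (n₀ 0 + 1) + |M| + 1) < height ρ γ * c := by
    rwa [hR, div_lt_iff₀ hc] at hγ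
  have h7 : height ρ γ * c ≤ (K + 1) * (c * -mink n (ρ γ origin)) := by
    have := mul_le_mul_of_nonneg_right h5 hc.le
    change ρ γ origin 0 * c ≤ _
    linarith
  have h8 : C * (n₀ 0 + 1) + |M| + 1 < c * -mink n (ρ γ origin) :=
    lt_of_mul_lt_mul_left (h6.trans_le h7) (by linarith)
  have h9 : C * n 0 ≤ C * (n₀ 0 + 1) := mul_le_mul_of_nonneg_left h2.le hC
  linarith [neg_abs_le M]

/-- Only finitely many marked points reach the level of a given one, so the maximum is attained, and
finitely often. -/
theorem contact_finite_nonempty [Finite V] [Nonempty V] {q : MarkedData ρ V} {C c : ℝ}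
    (hC : 0 ≤ C) (hc : 0 < c) (hq : UniformGrowth q C c) {n : Mink} (hn : n ∈ futureCone) :
    (contact q n).Finite ∧ (contact q n).Nonempty := by
  obtain ⟨v⟩ := ‹Nonempty V›
  set a₀ : Γ × V := (1, v)
  obtain ⟨J, hJ, h⟩ := exists_finite_below (V := V) hρ hn hC hc (mink n (liftedMarking q a₀))
  have hJb := h.self_of_nhds.2 q hq
  have ha₀ : a₀ ∈ J := by
    by_contra hcon
    exact lt_irrefl _ (hJb a₀ hcon)
  refine ⟨hJ.subset fun a ha => ?_, ?_⟩
  · by_contra hcon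
    exact absurd (ha a₀) (not_le.2 (hJb a hcon))
  · obtain ⟨a, ha, hmax⟩ := hJ.exists_maximalFor (fun a => mink n (liftedMarking q a)) J ⟨a₀, ha₀⟩
    have hle : ∀ b ∈ J, mink n (liftedMarking q b) ≤ mink n (liftedMarking q a) := by
      intro b hb
      rcases le_total (mink n (liftedMarking q b)) (mink n (liftedMarking q a)) with h | h
      · exact h
      · exact hmax hb h
    refine ⟨a, fun b => ?_⟩
    by_cases hb : b ∈ J
    · exact hle b hb
    · exact (hJb b hb).le.trans (hle a₀ ha₀)

/-- Contact sets are upper semicontinuous. -/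
theorem eventually_contact_subset [Finite V] [Nonempty V] {p : MarkedData ρ V} {C c : ℝ}
    (hC : 0 < C) (hc : 0 < c) (hp : UniformGrowth p C c) {n₀ : Mink} (hn₀ : n₀ ∈ futureCone) :
    ∀ᶠ x : MarkedData ρ V × Mink in 𝓝 (p, n₀), contact x.1 x.2 ⊆ contact p n₀ := by
  obtain ⟨v⟩ := ‹Nonempty V›
  set a₀ : Γ × V := (1, v)
  set M := mink n₀ (liftedMarking p a₀) - 1 with hM
  obtain ⟨J, hJ, h⟩ := exists_finite_below (V := V) hρ hn₀ (by positivity : 0 ≤ C + c / 2)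
    (half_pos hc) M
  rw [nhds_prod_eq]
  have hcont : ∀ a, Continuous fun x : MarkedData ρ V × Mink => mink x.2 (liftedMarking x.1 a) :=
    fun a => continuous_mink_comp continuous_snd
      ((continuous_liftedMarking a).comp continuous_fst)
  have e1 : ∀ᶠ x : MarkedData ρ V × Mink in 𝓝 p ×ˢ 𝓝 n₀, M < mink x.2 (liftedMarking x.1 a₀) := by
    rw [← nhds_prod_eq]
    exact continuousAt_const.eventually_lt (hcont a₀).continuousAt (by simp [hM])
  have e2 : ∀ᶠ x : MarkedData ρ V × Mink in 𝓝 p ×ˢ 𝓝 n₀, ∀ a ∈ J, a ∉ contact p n₀ →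
      a ∉ contact x.1 x.2 := by
    refine (Filter.eventually_all_finite hJ).2 fun a _ => ?_
    by_cases ha : a ∈ contact p n₀
    · exact Filter.Eventually.of_forall fun x h => absurd ha h
    · simp only [contact, Set.mem_ofPred_eq, not_forall, not_le] at ha
      obtain ⟨b, hb⟩ := ha
      rw [← nhds_prod_eq]
      filter_upwards [(hcont a).continuousAt.eventually_lt (hcont b).continuousAt hb] with x hx _ h
      exact absurd (h b) (not_le.2 hx)
  filter_upwards [e1, e2, (eventually_uniformGrowth hρ hc hp).prod_mk h] with x h1 h2 h3 a ha
  by_contra hcon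
  by_cases haJ : a ∈ J
  · exact h2 a haJ hcon ha
  · have h4 := h3.2.2 x.1 h3.1 a haJ
    have h5 := ha a₀
    linarith

/-- A normal of a support plane is future timelike. -/
theorem support_mem_futureCone [Nonempty V] {q : MarkedData ρ V} {C c : ℝ} (hC : 0 < C)
    (hc : 0 < c) (hq : UniformGrowth q C c) {n x : Mink} (hn : n ≠ 0)
    (hx : x ∈ closure (convexHull ℝ (Set.range (liftedMarking q))))
    (hnx : ∀ b, mink n (liftedMarking q b) ≤ mink n x) : n ∈ futureCone := by
  obtain ⟨v⟩ := ‹Nonempty V›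
  obtain ⟨E, hE, hEb⟩ := exists_cocycle_growth hρ q.1
  have hbelow : ∀ γ, liftedMarking q (γ, v) - c • ρ γ origin + C • origin ∈ closedCone := by
    intro γ
    rw [mem_closedCone_iff_plane]
    intro y hy
    have := hq γ v y (mem_closedCone_of_plane hy)
    rw [mink_comm, mink_add_right, mink_sub_right, mink_smul_right, mink_smul_right,
      mink_origin_right]
    linarith
  -- A non-causal `n` has positive product with some null `k`. Marked points along a conical
  -- sequence towards `k` then have unbounded product with `n`.
  have hncc : n ∈ closedCone := by
    by_contra hcon
    obtain ⟨k, hk, hk0, hkn⟩ := exists_null_of_notMem hcon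
    have hkc := null_mem_closedCone hk hk0
    obtain ⟨R, hR, hRf⟩ := exists_large_mink hk hk0 hkn
      (by positivity : 0 ≤ 3 * ‖q.2 v‖ + E * (1 + 1) + C)
    obtain ⟨C₁, hC₁, hcn⟩ := exists_conical hρ hk hk0
    set X := |mink n x| + C * |n 0| with hX
    set Y := max R (2 * X / mink k n + 1) with hY
    have hY0 : 0 < Y := lt_max_of_lt_left hR
    obtain ⟨γ, h1, -, h2⟩ := hcn (min 1 (c / Y)) (by positivity)
    set f := liftedMarking q (γ, v) + C • origin with hf
    have hfc : f ∈ closedCone := by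
      have := closedCone_add (hbelow γ)
        (closedCone_smul hc.le (mem_closedCone_of_plane (origin_map_mem hρ γ)))
      convert this using 1
      rw [hf]; abel
    have h0 := mink_nonpos hkc (mem_closedCone_of_plane (origin_map_mem hρ γ))
    have h11 : -mink k (ρ γ origin) ≤ 1 := h1.trans (min_le_left _ _)
    have hkf : -mink k f ≤ 3 * ‖q.2 v‖ + E * (1 + 1) + C := by
      have a1 := neg_le_of_abs_le (abs_mink_rho_le hρ γ hkc (q.2 v))
      have a2 := neg_le_of_abs_le (hEb γ k hkc)
      rw [hk0] at a2
      have a3 : mink k f = mink k (ρ γ (q.2 v)) + mink k ((q.1 : Γ → Mink) γ) - C := by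
        rw [hf, mink_add_right, mink_smul_right, mink_origin_right, hk0, liftedMarking, affineAct,
          mink_add_right]
        ring
      have a4 : 3 * ‖q.2 v‖ * -mink k (ρ γ origin) ≤ 3 * ‖q.2 v‖ * 1 :=
        mul_le_mul_of_nonneg_left h11 (by positivity)
      have a5 : E * (1 + -mink k (ρ γ origin)) ≤ E * (1 + 1) :=
        mul_le_mul_of_nonneg_left (by linarith) hE.le
      linarith
    have hf0 : Y ≤ f 0 := by
      have a1 := (hbelow γ).2
      simp only [Pi.add_apply, Pi.sub_apply, Pi.smul_apply, smul_eq_mul, origin_zero] at a1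
      have a2 : Y / c ≤ height ρ γ := by
        refine le_trans ?_ h2
        rw [le_inv_comm₀ (by positivity) (by positivity), inv_div]
        exact min_le_right _ _
      rw [div_le_iff₀ hc] at a2
      simp only [hf, Pi.add_apply, Pi.smul_apply, smul_eq_mul, origin_zero]
      change _ ≤ ρ γ origin 0 * c at a2
      linarith
    have h3 := hRf f hfc hkf ((le_max_left _ _).trans hf0)
    have h4 : mink f n ≤ X := by
      rw [mink_comm, hf, mink_add_right, mink_smul_right, mink_origin_right, hX]
      have := hnx (γ, v)
      have a1 := le_abs_self (mink n x)
      have a2 := mul_le_mul_of_nonneg_left (neg_le_abs (n 0)) hC.le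
      linarith
    have h5 : 2 * X / mink k n + 1 ≤ f 0 := (le_max_right _ _).trans hf0
    have h6 : X < f 0 * (mink k n / 2) := by
      have := mul_lt_mul_of_pos_right (lt_of_lt_of_le (lt_add_one _) h5) hkn
      rw [div_mul_cancel₀ _ hkn.ne'] at this
      linarith
    linarith
  have hn0 : 0 < n 0 := by
    refine lt_of_le_of_ne hncc.2 fun h => hn ?_
    have := norm_le_of_closedCone hncc
    rw [← h] at this
    exact norm_le_zero_iff.1 this
  by_contra hnf
  have hnull : mink n n = 0 :=
    le_antisymm hncc.1 (not_lt.1 fun h => hnf ⟨h, hn0⟩)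
  set k := (n 0)⁻¹ • n with hkdef
  have hk : mink k k = 0 := by rw [hkdef, mink_smul_left, mink_smul_right, hnull]; simp
  have hk0 : k 0 = 1 := by simp [hkdef, hn0.ne']
  have hkc := null_mem_closedCone hk hk0
  have hkx : ∀ b, mink k (liftedMarking q b) ≤ mink k x := by
    intro b
    rw [hkdef, mink_smul_left, mink_smul_left]
    exact mul_le_mul_of_nonneg_left (hnx b) (inv_pos.2 hn0).le
  obtain ⟨C₁, hC₁, hcn⟩ := exists_conical hρ hk hk0
  -- A null support plane would be strict in a quantitative way. Along conical elements `σ` the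
  -- vector `σ⁻¹ k` tends to zero, so the constant term of `UniformGrowth` for `σ⁻¹ k` disappears,
  -- while the linear term is unchanged by equivariance.
  have claim : ∀ γ w, mink k (liftedMarking q (γ, w)) + c * -mink k (ρ γ origin) ≤ mink k x := by
    intro γ w
    refine le_of_forall_pos_le_add fun ε hε => ?_
    have hK : 0 < C + 3 * ‖q.2 v‖ := by positivity
    obtain ⟨σ, h1, -⟩ := hcn (ε / (C + 3 * ‖q.2 v‖)) (by positivity)
    rw [le_div_iff₀ hK] at h1
    have a1 := hq (σ⁻¹ * γ) w (ρ σ⁻¹ k) (map_closedCone hρ _ hkc)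
    have a2 : mink (ρ σ⁻¹ k) (ρ (σ⁻¹ * γ) origin) = mink k (ρ γ origin) := by
      rw [rho_mul_apply, hρ.mink_map]
    have a3 : mink k (liftedMarking q (γ, w))
        = mink (ρ σ⁻¹ k) (liftedMarking q (σ⁻¹ * γ, w)) + mink k ((q.1 : Γ → Mink) σ) := by
      have : liftedMarking q (γ, w) = ρ σ (liftedMarking q (σ⁻¹ * γ, w)) + (q.1 : Γ → Mink) σ := by
        have := liftedMarking_translate q σ (σ⁻¹ * γ, w)
        simpa [translate, affineAct] using this
      rw [this, mink_add_right, mink_rho_right hρ]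
    have a4 : ρ σ⁻¹ k 0 = -mink k (ρ σ origin) := by
      rw [mink_rho_right hρ, mink_origin_right, neg_neg]
    have a5 := hkx (σ, v)
    rw [liftedMarking, affineAct, mink_add_right] at a5
    have a6 := neg_le_of_abs_le (abs_mink_rho_le hρ σ hkc (q.2 v))
    rw [a2, a4] at a1
    rw [a3]
    simp only at a5
    linarith
  -- a linear inequality satisfied by all marked points, hence by `x`
  have hlin : ∀ s : ℝ, 0 < s → mink k x + c * s - s ^ 2 / 2 * (x 0 + C) ≤ mink k x := by
    intro s hs
    set H : Set Mink := {y | mink k y + c * s - s ^ 2 / 2 * (y 0 + C) ≤ mink k x} with hH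
    have hHc : IsClosed H := isClosed_le
      (((continuous_mink_comp continuous_const continuous_id).add continuous_const).sub
        (continuous_const.mul ((continuous_apply 0).add continuous_const))) continuous_const
    have hHconv : Convex ℝ H := by
      intro y hy z hz a b ha hb hab
      have e : mink k (a • y + b • z) + c * s - s ^ 2 / 2 * ((a • y + b • z) 0 + C)
          = a * (mink k y + c * s - s ^ 2 / 2 * (y 0 + C))
            + b * (mink k z + c * s - s ^ 2 / 2 * (z 0 + C)) := by
        rw [mink_add_right, mink_smul_right, mink_smul_right]
        simp only [Pi.add_apply, Pi.smul_apply, smul_eq_mul]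
        linear_combination (-c * s + s ^ 2 / 2 * C) * hab
      rw [hH, Set.mem_ofPred_eq, e]
      have h1 := mul_le_mul_of_nonneg_left hy ha
      have h2 := mul_le_mul_of_nonneg_left hz hb
      calc _ ≤ a * mink k x + b * mink k x := add_le_add h1 h2
        _ = mink k x := by rw [← add_mul, hab, one_mul]
    have hsub : convexHull ℝ (Set.range (liftedMarking q)) ⊆ H := by
      refine convexHull_min ?_ hHconv
      rintro _ ⟨⟨γ, w⟩, rfl⟩
      rw [hH, Set.mem_ofPred_eq]
      have h1 := claim γ w
      have h2 := hq γ w origin (mem_closedCone_of_plane origin_mem)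
      simp only [mink_origin_left, origin_zero, neg_neg] at h2
      -- tangent line inequality for the product with a null vector
      have h3 : s - s ^ 2 / 2 * ρ γ origin 0 ≤ -mink k (ρ γ origin) := by
        set y := ρ γ origin with hy
        have hyp : y ∈ hyperbolicPlane := origin_map_mem hρ γ
        have b1 : 1 ≤ 2 * y 0 * -mink k y := by
          have b2 := norm_sub_null_sq_le (mem_closedCone_of_plane hyp) hk hk0
          have hy1 := hyp.1
          have hk1 : k 1 ^ 2 + k 2 ^ 2 = 1 := by simp only [mink, hk0] at hk; nlinarith
          simp only [mink, hk0] at hy1 ⊢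
          have e1 : k 1 * y 1 + k 2 * y 2 ≤ Real.sqrt (y 1 ^ 2 + y 2 ^ 2) := by
            apply Real.le_sqrt_of_sq_le
            nlinarith [sq_nonneg (k 1 * y 2 - k 2 * y 1)]
          set r := Real.sqrt (y 1 ^ 2 + y 2 ^ 2) with hr
          have hr2 : r ^ 2 = y 1 ^ 2 + y 2 ^ 2 := Real.sq_sqrt (by positivity)
          have hr0 : 0 ≤ r := Real.sqrt_nonneg _
          have hy0 := hyp.2
          have hry : r ≤ y 0 := by nlinarith
          nlinarith
        have hy0 := hyp.2
        have b3 : 0 ≤ (1 - s * y 0) ^ 2 := sq_nonneg _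
        have b4 : 2 * y 0 * (s - s ^ 2 / 2 * y 0) ≤ 2 * y 0 * -mink k y := by nlinarith
        exact le_of_mul_le_mul_left b4 (by linarith)
      have h4 := mul_le_mul_of_nonneg_left h3 hc.le
      have h5 : s ^ 2 / 2 * (c * ρ γ origin 0) ≤ s ^ 2 / 2 * (liftedMarking q (γ, w) 0 + C) :=
        mul_le_mul_of_nonneg_left (by linarith) (by positivity)
      linarith
    exact closure_minimal hsub hHc hx
  -- For this `s` the loss `s ^ 2 / 2 * (|x 0| + C)` is only half of the gain `c * s`, which is
  -- absurd.
  have h1 := hlin (c / (|x 0| + C)) (by positivity)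
  have h2 : 0 < |x 0| + C := by positivity
  have h3 : c * (c / (|x 0| + C)) ≤ (c / (|x 0| + C)) ^ 2 / 2 * (x 0 + C) := by linarith
  have h4 : (c / (|x 0| + C)) ^ 2 / 2 * (x 0 + C) ≤ (c / (|x 0| + C)) ^ 2 / 2 * (|x 0| + C) :=
    mul_le_mul_of_nonneg_left (by linarith [le_abs_self (x 0)]) (by positivity)
  have h5 : (c / (|x 0| + C)) ^ 2 / 2 * (|x 0| + C) = c * (c / (|x 0| + C)) / 2 := by
    field_simp
  have h6 : 0 < c * (c / (|x 0| + C)) := by positivity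
  linarith

end

end HypRigidity

namespace HypRigidity

/-! ### Barycentric coordinates -/

section Barycentric

variable {ι E : Type*} [AddCommGroup E] [Module ℝ E]

/-- The closed simplex with vertex set `t`, in barycentric coordinates. -/
def stdSimp (t : Finset ι) : Set (ι → ℝ) :=
  {x | (∀ a, 0 ≤ x a) ∧ (∀ a, a ∉ t → x a = 0) ∧ ∑ a ∈ t, x a = 1}

/-- The point with barycentric coordinates `x` with respect to the points `Z`. -/
noncomputable def bary (Z : ι → E) (x : ι → ℝ) : E := ∑ᶠ a, x a • Z a

theorem bary_eq_sum (Z : ι → E) {x : ι → ℝ} {t : Finset ι} (h : ∀ a, a ∉ t → x a = 0) :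
    bary Z x = ∑ a ∈ t, x a • Z a := by
  refine finsum_eq_sum_of_support_subset _ fun a ha => ?_
  by_contra hat
  exact ha (by simp [h a hat])

theorem stdSimp_mono {t s : Finset ι} (h : t ⊆ s) : stdSimp t ⊆ stdSimp s := by
  rintro x ⟨h0, h1, h2⟩
  refine ⟨h0, fun a ha => h1 a fun hat => ha (h hat), ?_⟩
  rw [← h2]
  exact (Finset.sum_subset h fun a _ ha => h1 a ha).symm

theorem stdSimp_of_support {t s : Finset ι} {x : ι → ℝ} (hx : x ∈ stdSimp s)
    (h : ∀ a, x a ≠ 0 → a ∈ t) : x ∈ stdSimp t := by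
  classical
  obtain ⟨h0, h1, h2⟩ := hx
  have h3 : ∀ a, a ∉ t → x a = 0 := fun a ha => by
    by_contra hne
    exact ha (h a hne)
  refine ⟨h0, h3, ?_⟩
  rw [← h2, Finset.sum_subset (Finset.subset_union_left (s₂ := s)) fun a _ ha => h3 a ha,
    Finset.sum_subset (Finset.subset_union_right (s₁ := t)) fun a _ ha => h1 a ha]

theorem single_mem_stdSimp [DecidableEq ι] {t : Finset ι} {a : ι} (ha : a ∈ t) :
    (Pi.single a 1 : ι → ℝ) ∈ stdSimp t := by
  refine ⟨fun b => ?_, fun b hb => ?_, ?_⟩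
  · by_cases h : b = a
    · subst h; simp
    · simp [h]
  · have : b ≠ a := by rintro rfl; exact hb ha
    simp [this]
  · rw [Finset.sum_pi_single']; simp [ha]

theorem bary_single [DecidableEq ι] (Z : ι → E) (a : ι) : bary Z (Pi.single a 1) = Z a := by
  rw [bary_eq_sum Z (t := {a}) fun b hb => ?_]
  · simp
  · have : b ≠ a := by simpa using hb
    simp [this]

theorem convex_stdSimp (t : Finset ι) : Convex ℝ (stdSimp t) := by
  rintro x ⟨hx0, hx1, hx2⟩ y ⟨hy0, hy1, hy2⟩ a b ha hb hab
  refine ⟨fun i => ?_, fun i hi => ?_, ?_⟩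
  · exact add_nonneg (mul_nonneg ha (hx0 i)) (mul_nonneg hb (hy0 i))
  · simp [hx1 i hi, hy1 i hi]
  · simp only [Pi.add_apply, Pi.smul_apply, smul_eq_mul, Finset.sum_add_distrib, ← Finset.mul_sum,
      hx2, hy2]
    linarith

theorem isClosed_stdSimp (t : Finset ι) : IsClosed (stdSimp t) := by
  have e : stdSimp t = (⋂ a, {x : ι → ℝ | 0 ≤ x a}) ∩
      ((⋂ a, ⋂ (_ : a ∉ t), {x : ι → ℝ | x a = 0}) ∩ {x | ∑ a ∈ t, x a = 1}) := by
    ext x; simp [stdSimp]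
  rw [e]
  refine (isClosed_iInter fun a => isClosed_le continuous_const (continuous_apply a)).inter
    ((isClosed_iInter fun a => isClosed_iInter fun _ =>
      isClosed_eq (continuous_apply a) continuous_const).inter
      (isClosed_eq (by fun_prop) continuous_const))

theorem bary_add {t : Finset ι} (Z : ι → E) {x y : ι → ℝ} (hx : ∀ a, a ∉ t → x a = 0)
    (hy : ∀ a, a ∉ t → y a = 0) (c d : ℝ) : bary Z (c • x + d • y) = c • bary Z x + d • bary Z y := by
  rw [bary_eq_sum Z hx, bary_eq_sum Z hy, bary_eq_sum Z (t := t) fun a ha => by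
    simp [hx a ha, hy a ha]]
  simp only [Pi.add_apply, Pi.smul_apply, smul_eq_mul, add_smul, mul_smul, Finset.sum_add_distrib,
    Finset.smul_sum]

theorem mem_convexHull_image_iff {Z : ι → E} {t : Finset ι} {P : E} :
    P ∈ convexHull ℝ (Z '' (t : Set ι)) ↔ ∃ x ∈ stdSimp t, bary Z x = P := by
  classical
  constructor
  · intro hP
    have hsub : convexHull ℝ (Z '' (t : Set ι)) ⊆ {P | ∃ x ∈ stdSimp t, bary Z x = P} := by
      refine convexHull_min ?_ ?_
      · rintro _ ⟨a, ha, rfl⟩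
        exact ⟨Pi.single a 1, single_mem_stdSimp ha, bary_single Z a⟩
      · rintro _ ⟨x, hx, rfl⟩ _ ⟨y, hy, rfl⟩ a b ha hb hab
        exact ⟨a • x + b • y, convex_stdSimp t hx hy ha hb hab, bary_add Z hx.2.1 hy.2.1 a b⟩
    exact hsub hP
  · rintro ⟨x, hx, rfl⟩
    rw [bary_eq_sum Z hx.2.1]
    exact (convex_convexHull ℝ _).sum_mem (fun a _ => hx.1 a) hx.2.2
      fun a ha => subset_convexHull ℝ _ ⟨a, ha, rfl⟩

end Barycentric

theorem mink_bary {ι : Type*} {Z : ι → Mink} {x : ι → ℝ} {t : Finset ι} (hx : ∀ a, a ∉ t → x a = 0)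
    (n : Mink) : mink n (bary Z x) = ∑ a ∈ t, x a * mink n (Z a) := by
  rw [bary_eq_sum Z hx, mink_sum_right]
  simp only [mink_smul_right]

/-- If a linear functional attains its maximum over the points `Z` at a convex combination, then it
attains it at all points that occur. -/
theorem mink_eq_of_bary_max {ι : Type*} {Z : ι → Mink} {x : ι → ℝ} {t : Finset ι}
    (hx : x ∈ stdSimp t) {n : Mink} (hmax : ∀ b ∈ t, mink n (Z b) ≤ mink n (bary Z x)) {a : ι}
    (ha : x a ≠ 0) : mink n (Z a) = mink n (bary Z x) := by
  obtain ⟨h0, h1, h2⟩ := hx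
  have hat : a ∈ t := by
    by_contra h
    exact ha (h1 a h)
  have hsum : ∑ b ∈ t, x b * (mink n (bary Z x) - mink n (Z b)) = 0 := by
    have e : ∑ b ∈ t, x b * mink n (Z b) = mink n (bary Z x) := (mink_bary h1 n).symm
    simp only [mul_sub, Finset.sum_sub_distrib, ← Finset.sum_mul, h2, e]
    ring
  have := (Finset.sum_eq_zero_iff_of_nonneg fun b hb =>
    mul_nonneg (h0 b) (sub_nonneg.2 (hmax b hb))).1 hsum a hat
  rcases mul_eq_zero.1 this with h | h
  · exact absurd h ha
  · linarith

/-! ### Support planes of convex sets -/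

/-- A point of a convex set where a nonzero functional is maximal is not interior. -/
theorem notMem_interior_of_max {A : Set Mink} {n x : Mink} (hn : n ≠ 0)
    (h : ∀ a ∈ A, mink n a ≤ mink n x) : x ∉ interior A := by
  intro hx
  -- `m` is the Euclidean gradient of the functional `mink n`, so moving along it increases the
  -- functional.
  set m : Mink := ![-n 0, n 1, n 2] with hm
  have hnm : 0 < mink n m := by
    have e : mink n m = n 0 ^ 2 + n 1 ^ 2 + n 2 ^ 2 := by
      simp only [mink, hm, Matrix.cons_val]; ring
    rw [e]
    by_contra! hle
    apply hn
    ext i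
    fin_cases i <;> simp <;> nlinarith [sq_nonneg (n 0), sq_nonneg (n 1), sq_nonneg (n 2)]
  have hc : Filter.Tendsto (fun s : ℝ => x + s • m) (𝓝[>] 0) (𝓝 x) := by
    have : Filter.Tendsto (fun s : ℝ => x + s • m) (𝓝 0) (𝓝 (x + (0 : ℝ) • m)) :=
      (by fun_prop : Continuous fun s : ℝ => x + s • m).tendsto 0
    rw [zero_smul, add_zero] at this
    exact this.mono_left nhdsWithin_le_nhds
  obtain ⟨s, hs, hs0⟩ := ((hc.eventually (isOpen_interior.mem_nhds hx)).and
    self_mem_nhdsWithin).exists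
  have := h _ (interior_subset hs)
  rw [mink_add_right, mink_smul_right] at this
  nlinarith [mul_pos (show (0 : ℝ) < s from hs0) hnm]

/-- Supporting hyperplanes. -/
theorem exists_support {A : Set Mink} (hA : Convex ℝ A) (hne : A.Nonempty) {x : Mink}
    (hx : x ∉ A ∨ x ∉ interior A) : ∃ n : Mink, n ≠ 0 ∧ ∀ a ∈ A, mink n a ≤ mink n x := by
  have hx' : x ∉ interior A := hx.elim (fun h h' => h (interior_subset h')) id
  by_cases hcl : x ∈ closure A
  · by_cases hint : (interior A).Nonempty
    · obtain ⟨f, hf, hfx⟩ := geometric_hahn_banach_of_nonempty_interior_point hA hx' hint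
      obtain ⟨n, hn⟩ := exists_mink_eq f
      refine ⟨n, ?_, fun a ha => by rw [← hn, ← hn]; exact hfx a ha⟩
      rintro rfl
      exact hf (by ext y; simp [hn])
    · rw [hA.interior_nonempty_iff_affineSpan_eq_top] at hint
      obtain ⟨a₀, ha₀⟩ := hne
      -- With empty interior, the set lies in a proper affine subspace; a functional that vanishes
      -- on its direction is constant on the closure of the set and supports it trivially.
      have hdir : (affineSpan ℝ A).direction < ⊤ := by
        rw [lt_top_iff_ne_top]
        intro h
        exact hint ((AffineSubspace.direction_eq_top_iff_of_nonempty
          ⟨a₀, subset_affineSpan ℝ A ha₀⟩).1 h)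
      obtain ⟨f, hf, hfk⟩ := Submodule.exists_le_ker_of_lt_top _ hdir
      obtain ⟨n, hn⟩ := exists_mink_eq (LinearMap.toContinuousLinearMap f)
      have hn' : ∀ y, f y = mink n y := hn
      have hconst : ∀ a ∈ A, mink n a = mink n a₀ := by
        intro a ha
        have : a - a₀ ∈ (affineSpan ℝ A).direction :=
          AffineSubspace.vsub_mem_direction (subset_affineSpan ℝ A ha) (subset_affineSpan ℝ A ha₀)
        have h1 := hfk this
        rw [LinearMap.mem_ker, hn', mink_sub_right] at h1
        linarith
      have hx0 : mink n x = mink n a₀ :=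
        closure_minimal (s := A) (t := {y | mink n y = mink n a₀}) hconst
          (isClosed_eq (continuous_mink_comp continuous_const continuous_id) continuous_const) hcl
      refine ⟨n, ?_, fun a ha => by rw [hconst a ha, hx0]⟩
      rintro rfl
      exact hf (by ext y; simp [hn'])
  · obtain ⟨f, u, hf1, hf2⟩ := geometric_hahn_banach_closed_point hA.closure isClosed_closure hcl
    obtain ⟨n, hn⟩ := exists_mink_eq f
    obtain ⟨a₀, ha₀⟩ := hne
    refine ⟨n, ?_, fun a ha => by
      rw [← hn, ← hn]; exact ((hf1 a (subset_closure ha)).trans hf2).le⟩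
    rintro rfl
    have h1 := (hf1 a₀ (subset_closure ha₀)).trans hf2
    simp [hn] at h1

section

variable {Γ : Type*} [Group Γ] {ρ : Γ →* (Mink ≃ₗ[ℝ] Mink)} {V : Type*}

theorem mink_le_of_mem_convexHull_contact {q : MarkedData ρ V} {n x : Mink}
    (hx : x ∈ convexHull ℝ (liftedMarking q '' contact q n)) :
    ∀ b, mink n (liftedMarking q b) ≤ mink n x := by
  intro b
  have hconv : Convex ℝ {y | mink n (liftedMarking q b) ≤ mink n y} := by
    intro y hy z hz a c ha hc hac
    rw [Set.mem_ofPred_eq] at *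
    rw [mink_add_right, mink_smul_right, mink_smul_right]
    calc mink n (liftedMarking q b) = a * mink n (liftedMarking q b)
          + c * mink n (liftedMarking q b) := by rw [← add_mul, hac, one_mul]
      _ ≤ _ := add_le_add (mul_le_mul_of_nonneg_left hy ha) (mul_le_mul_of_nonneg_left hz hc)
  refine convexHull_min ?_ hconv hx
  rintro _ ⟨a, ha, rfl⟩
  exact ha b

theorem mink_le_of_mem_hull {q : MarkedData ρ V} {n x : Mink}
    (h : ∀ b, mink n (liftedMarking q b) ≤ mink n x) {y : Mink}
    (hy : y ∈ closure (convexHull ℝ (Set.range (liftedMarking q)))) : mink n y ≤ mink n x := by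
  have hH : Convex ℝ {y | mink n y ≤ mink n x} := by
    intro y hy z hz a c ha hc hac
    rw [Set.mem_ofPred_eq] at *
    rw [mink_add_right, mink_smul_right, mink_smul_right]
    calc _ ≤ a * mink n x + c * mink n x :=
        add_le_add (mul_le_mul_of_nonneg_left hy ha) (mul_le_mul_of_nonneg_left hz hc)
      _ = mink n x := by rw [← add_mul, hac, one_mul]
  have h1 : convexHull ℝ (Set.range (liftedMarking q)) ⊆ {y | mink n y ≤ mink n x} :=
    convexHull_min (by rintro _ ⟨b, rfl⟩; exact h b) hH
  exact closure_minimal h1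
    (isClosed_le (continuous_mink_comp continuous_const continuous_id) continuous_const) hy

variable (hρ : IsHyperbolicHolonomy ρ)
include hρ

theorem exists_support_of_mem_hullBoundary [Nonempty V] {q : MarkedData ρ V} {C c : ℝ} (hC : 0 < C)
    (hc : 0 < c) (hq : UniformGrowth q C c) {x : Mink} (hx : x ∈ hullBoundary q) :
    ∃ n ∈ futureCone, ∀ b, mink n (liftedMarking q b) ≤ mink n x := by
  set K := convexHull ℝ (Set.range (liftedMarking q)) with hK
  have hne : K.Nonempty := by
    obtain ⟨v⟩ := ‹Nonempty V›
    exact ⟨liftedMarking q (1, v), subset_convexHull ℝ _ ⟨_, rfl⟩⟩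
  obtain ⟨n, hn, hmax⟩ := exists_support (convex_convexHull ℝ _) hne (Or.inr hx.2)
  have hmax' : ∀ b, mink n (liftedMarking q b) ≤ mink n x :=
    fun b => hmax _ (subset_convexHull ℝ _ ⟨b, rfl⟩)
  exact ⟨n, support_mem_futureCone hρ hC hc hq hn hx.1 hmax', hmax'⟩

/-- Otherwise some `m` separates `x` from the convex hull of the contact points. Tilt the normal to
`n + ε • m`. By semicontinuity its maximum is attained at an old contact point, where `m` is smaller
than at `x`, although `x` lies in the closed hull. In particular the hull contains the part of its
closure on a timelike support plane. -/
theorem mem_convexHull_contact [Finite V] [Nonempty V] {q : MarkedData ρ V} {C c : ℝ} (hC : 0 < C)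
    (hc : 0 < c) (hq : UniformGrowth q C c) {n x : Mink} (hn : n ∈ futureCone)
    (hx : x ∈ closure (convexHull ℝ (Set.range (liftedMarking q))))
    (hmax : ∀ b, mink n (liftedMarking q b) ≤ mink n x) :
    x ∈ convexHull ℝ (liftedMarking q '' contact q n) := by
  by_contra hcon
  obtain ⟨hfin, hne⟩ := contact_finite_nonempty hρ hC.le hc hq hn
  obtain ⟨f, u, hf1, hf2⟩ := geometric_hahn_banach_closed_point (convex_convexHull ℝ _)
    ((hfin.image _).isClosed_convexHull ℝ) hcon
  obtain ⟨m, hm⟩ := exists_mink_eq f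
  have h1 : Filter.Tendsto (fun ε : ℝ => (q, n + ε • m)) (𝓝[>] 0) (𝓝 (q, n)) := by
    have : Filter.Tendsto (fun ε : ℝ => (q, n + ε • m)) (𝓝 0) (𝓝 (q, n + (0 : ℝ) • m)) :=
      (by fun_prop : Continuous fun ε : ℝ => (q, n + ε • m)).tendsto 0
    rw [zero_smul, add_zero] at this
    exact this.mono_left nhdsWithin_le_nhds
  have h2 : Filter.Tendsto (fun ε : ℝ => n + ε • m) (𝓝[>] 0) (𝓝 n) :=
    (continuous_snd.tendsto (q, n)).comp h1
  obtain ⟨ε, ⟨he1, he2⟩, hε0⟩ := ((h1.eventually (eventually_contact_subset hρ hC hc hq hn)).and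
    (h2.eventually (isOpen_futureCone.mem_nhds hn))).and self_mem_nhdsWithin |>.exists
  replace hε0 : 0 < ε := hε0
  obtain ⟨-, b, hb⟩ := contact_finite_nonempty hρ hC.le hc hq he2
  have hbn := he1 hb
  have h3 : f (liftedMarking q b) < f x :=
    (hf1 _ (subset_convexHull ℝ _ ⟨b, hbn, rfl⟩)).trans hf2
  rw [hm, hm] at h3
  have h4 : mink (n + ε • m) x ≤ mink (n + ε • m) (liftedMarking q b) := mink_le_of_mem_hull hb hx
  simp only [mink_add_left, mink_smul_left] at h4
  have h5 := hmax b
  nlinarith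

/-- The boundary of the hull consists of the faces cut out by the future timelike normals. -/
theorem mem_hullBoundary_iff [Finite V] [Nonempty V] {q : MarkedData ρ V} {C c : ℝ} (hC : 0 < C)
    (hc : 0 < c) (hq : UniformGrowth q C c) {x : Mink} : x ∈ hullBoundary q ↔
      ∃ n ∈ futureCone, x ∈ convexHull ℝ (liftedMarking q '' contact q n) := by
  constructor
  · intro hx
    obtain ⟨n, hn, hmax⟩ := exists_support_of_mem_hullBoundary hρ hC hc hq hx
    exact ⟨n, hn, mem_convexHull_contact hρ hC hc hq hn hx.1 hmax⟩
  · rintro ⟨n, hn, hx⟩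
    have hmax := mink_le_of_mem_convexHull_contact hx
    have hxK : x ∈ convexHull ℝ (Set.range (liftedMarking q)) :=
      convexHull_mono (Set.image_subset_range _ _) hx
    exact ⟨subset_closure hxK, notMem_interior_of_max (future_ne_zero hn)
      fun a ha => mink_le_of_mem_hull hmax (subset_closure ha)⟩

/-- In strictly convex position every marked point lies on a support plane. -/
theorem exists_mem_contact [Nonempty V] {p : MarkedData ρ V} (hp : p ∈ convexMarkedData ρ V)
    {C c : ℝ} (hC : 0 < C) (hc : 0 < c) (hpg : UniformGrowth p C c) (a : Γ × V) :
    ∃ n ∈ futureCone, a ∈ contact p n := by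
  have hne : (convexHull ℝ (liftedMarking p '' {a}ᶜ)).Nonempty := by
    obtain ⟨γ, hγ⟩ := exists_ne_one hρ
    refine ⟨_, subset_convexHull ℝ _ ⟨translate γ a, ?_, rfl⟩⟩
    intro h
    have : γ * a.1 = a.1 := congrArg Prod.fst (Set.mem_singleton_iff.1 h)
    exact hγ (by simpa using this)
  obtain ⟨n, hn, hmax⟩ := exists_support (convex_convexHull ℝ _) hne (Or.inl (hp.2 a))
  have hmax' : ∀ b, mink n (liftedMarking p b) ≤ mink n (liftedMarking p a) := by
    intro b
    by_cases hb : b = a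
    · rw [hb]
    · exact hmax _ (subset_convexHull ℝ _ ⟨b, hb, rfl⟩)
  exact ⟨n, support_mem_futureCone hρ hC hc hpg hn
    (subset_closure (subset_convexHull ℝ _ ⟨a, rfl⟩)) hmax', hmax'⟩

end

end HypRigidity

namespace HypRigidity

/-! ### Convex cellulations -/

section Cellulations

theorem lcross_lcross_left (a b c : Mink) :
    lcross (lcross a b) c = mink b c • a - mink a c • b := by
  ext i
  fin_cases i <;> simp [lcross, mink] <;> ring

theorem mink_lcross_left (a b : Mink) : mink (lcross a b) a = 0 := by
  simp [lcross, mink]; ring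

theorem mink_lcross_right (a b : Mink) : mink (lcross a b) b = 0 := by
  simp [lcross, mink]; ring

theorem mink_lcross_lcross (a b : Mink) :
    mink (lcross a b) (lcross a b) = mink a b ^ 2 - mink a a * mink b b := by
  simp [lcross, mink]; ring

theorem lcross_add_right (a b c : Mink) : lcross a (b + c) = lcross a b + lcross a c := by
  ext i
  fin_cases i <;> simp [lcross] <;> ring

theorem lcross_smul_right (a b : Mink) (r : ℝ) : lcross a (r • b) = r • lcross a b := by
  ext i
  fin_cases i <;> simp [lcross] <;> ring

theorem lcross_lcross_right (a b : Mink) :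
    lcross a (lcross a b) = mink a a • b - mink a b • a := by
  ext i
  fin_cases i <;> simp [lcross, mink] <;> ring

theorem eq_zero_of_orthonormal {x t e : Mink} (hx : mink x x = -1) (ht : mink t t = 1)
    (hxt : mink x t = 0) (h1 : mink e x = 0) (h2 : mink e t = 0)
    (h3 : mink e (lcross x t) = 0) : e = 0 := by
  have e1 : lcross (lcross x t) e = 0 := by
    rw [lcross_lcross_left, mink_comm t, mink_comm x, h1, h2]; simp
  have e2 := lcross_lcross_right (lcross x t) e
  rw [e1, mink_lcross_lcross, hx, ht, hxt, mink_comm _ e, h3] at e2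
  have e3 : lcross (lcross x t) (0 : Mink) = 0 := by
    ext i; fin_cases i <;> simp [lcross]
  rw [e3] at e2
  simpa using e2.symm

variable {Γ : Type*} [Group Γ] {ρ : Γ →* (Mink ≃ₗ[ℝ] Mink)} {W D : Type*} [MulAction Γ W]
  [MulAction Γ D]

namespace GeodesicGraph

variable (G : GeodesicGraph ρ W D)

theorem mink_pos (v : W) : mink (G.pos v) (G.pos v) = -1 := (G.pos_mem v).1

theorem mink_normal_normal (d : D) : mink (G.normal d) (G.normal d) = 1 := by
  rw [normal, mink_lcross_lcross, G.mink_pos, G.mink_dir, G.mink_pos_dir]; norm_num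

theorem mink_normal_dir (d : D) : mink (G.normal d) (G.dir d) = 0 := mink_lcross_right _ _

theorem normal_next (d : D) : G.normal (G.next d) =
    Real.cos (G.angle d) • G.normal d - Real.sin (G.angle d) • G.dir d := by
  rw [normal, G.src_next, G.dir_next, lcross_add_right, lcross_smul_right, lcross_smul_right,
    lcross_lcross_right, G.mink_pos, G.mink_pos_dir, normal]
  module

theorem normal_eq_next (d : D) : G.normal d =
    Real.sin (G.angle d) • G.dir (G.next d) + Real.cos (G.angle d) • G.normal (G.next d) := by
  rw [normal_next, G.dir_next, ← normal]
  have h := Real.sin_sq_add_cos_sq (G.angle d)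
  calc G.normal d = (Real.sin (G.angle d) ^ 2 + Real.cos (G.angle d) ^ 2) • G.normal d := by
        rw [h, one_smul]
    _ = _ := by module

theorem eq_zero_of_mink (d : D) {e : Mink} (h1 : mink e (G.pos (G.src d)) = 0)
    (h2 : mink e (G.dir d) = 0) (h3 : mink e (G.normal d) = 0) : e = 0 :=
  eq_zero_of_orthonormal (G.mink_pos _) (G.mink_dir d) (G.mink_pos_dir d) h1 h2 h3

namespace IsConvexCellulation

variable {G} (hG : G.IsConvexCellulation)
include hG

theorem sin_angle_pos (d : D) : 0 < Real.sin (G.angle d) :=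
  Real.sin_pos_of_pos_of_lt_pi (hG.angle_pos d) (hG.angle_lt_pi d)

/-- A corner angle in (0, π) is not a full turn, so every vertex has at least two darts. -/
theorem next_ne (d : D) : G.next d ≠ d := by
  intro h
  have h1 := G.mink_normal_dir d
  have h2 := G.dir_next d
  rw [h] at h2
  have h3 : mink (G.normal d) (G.dir d) = Real.sin (G.angle d) := by
    conv_lhs => rw [h2]
    rw [mink_add_right, mink_smul_right, mink_smul_right, ← normal, mink_normal_normal,
      mink_normal_dir]
    ring
  linarith [hG.sin_angle_pos d]

/-- A `finsum` over an infinite support is zero by convention, and so is an empty one; the angle sum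
2π excludes both. -/
theorem exists_darts (v : W) : ∃ F : Finset D, (∀ d, d ∈ F ↔ G.src d = v) ∧ F.Nonempty := by
  have hv := hG.sum_angle v
  have hfin : {d | G.src d = v}.Finite := by
    by_contra hinf
    have : ({d | G.src d = v} ∩ Function.support G.angle).Infinite := by
      rwa [Set.inter_eq_left.2 (show _ ⊆ Function.support G.angle from
        fun d _ => (hG.angle_pos d).ne')]
    have h0 := finsum_mem_eq_zero_of_infinite this
    have h1 : ∑ᶠ (d : D) (_ : G.src d = v), G.angle d = 0 := h0
    rw [h1] at hv
    linarith [Real.pi_pos]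
  refine ⟨hfin.toFinset, by simp, ?_⟩
  by_contra hne
  have h0 : ∀ d, G.src d ≠ v := by
    intro d hd
    exact hne ⟨d, by simpa using hd⟩
  have : ∑ᶠ (d : D) (_ : G.src d = v), G.angle d = 0 := by simp [h0]
  rw [this] at hv
  linarith [Real.pi_pos]

theorem tan_half_pos (d : D) : 0 < Real.tan (G.angle d / 2) :=
  Real.tan_pos_of_pos_of_lt_pi_div_two (by linarith [hG.angle_pos d])
    (by linarith [hG.angle_lt_pi d])

theorem coeff_pos (d : D) : 0 < G.coeff d :=
  add_pos (hG.tan_half_pos d) (hG.tan_half_pos _)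

omit hG in
theorem finsum_src {E : Type*} [AddCommMonoid E] {F : Finset D} {v : W}
    (hF : ∀ d, d ∈ F ↔ G.src d = v) (f : D → E) :
    ∑ᶠ (d : D) (_ : G.src d = v), f d = ∑ d ∈ F, f d := by
  rw [← finsum_mem_finset_eq_sum]
  simp only [hF]

theorem zeroGraph_adj {d : D} (hd : G.len d = 0) :
    G.zeroGraph.Adj (G.src d) (G.src (G.rev d)) := by
  rw [zeroGraph, SimpleGraph.fromRel_adj]
  exact ⟨(hG.zero_loopless d hd).symm, Or.inl ⟨d, rfl, rfl, hd⟩⟩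

omit hG in
theorem pos_rev_of_len_eq_zero {d : D} (hd : G.len d = 0) :
    G.pos (G.src (G.rev d)) = G.pos (G.src d) := by
  rw [G.pos_rev, hd]; simp

omit hG in
theorem len_rev_eq_zero {d : D} (hd : G.len d = 0) : G.len (G.rev d) = 0 := by
  have h := G.pos_rev (G.rev d)
  rw [G.rev_rev, pos_rev_of_len_eq_zero hd] at h
  have h1 := congrArg (mink (G.dir (G.rev d))) h
  have h2 := G.mink_pos_dir (G.rev d)
  rw [pos_rev_of_len_eq_zero hd, mink_comm] at h2
  rw [mink_add_right, mink_smul_right, mink_smul_right, h2, G.mink_dir] at h1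
  exact Real.sinh_eq_zero.1 (by simpa using h1.symm)

/-- There are only finitely many vertices at a given position. -/
theorem finite_pos_eq (hρ : IsHyperbolicHolonomy ρ) (x : Mink) : {v : W | G.pos v = x}.Finite := by
  classical
  obtain ⟨s, hs, hcov⟩ := G.finite_quotient
  have hex : ∀ v : W, ∃ d₀ ∈ s, ∃ γ : Γ, γ • G.src d₀ = v := by
    intro v
    obtain ⟨F, hF, d, hd⟩ := hG.exists_darts v
    obtain ⟨γ, d₀, hd₀, h⟩ := hcov d
    exact ⟨d₀, hd₀, γ, by rw [← G.src_smul, h]; exact (hF d).1 hd⟩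
  choose f hf γ hγ using hex
  refine Set.Finite.of_finite_image (f := f) (hs.subset (by rintro _ ⟨v, -, rfl⟩; exact hf v)) ?_
  intro v hv w hw hvw
  have h1 : ρ (γ v) (G.pos (G.src (f v))) = x := by rw [← G.pos_smul, hγ]; exact hv
  have h2 : ρ (γ w) (G.pos (G.src (f v))) = x := by rw [hvw, ← G.pos_smul, hγ]; exact hw
  have h3 : (γ w)⁻¹ * γ v = 1 := by
    by_contra hne
    refine hρ.free _ hne _ (G.pos_mem (G.src (f v))) ?_
    rw [rho_mul_apply, h1, ← h2, rho_inv_apply]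
  have h4 : γ v = γ w := (inv_mul_eq_one.1 h3).symm
  rw [← hγ v, ← hγ w, hvw, h4]

/-- The edges of zero length carry no infinite path without backtracking. -/
theorem no_zero_path (hρ : IsHyperbolicHolonomy ρ) {S : Set D} (h0 : ∀ d ∈ S, G.len d = 0)
    (hS : ∀ d ∈ S, ∃ d' ∈ S, G.src d' = G.src (G.rev d) ∧ d' ≠ G.rev d) : S = ∅ := by
  classical
  by_contra hne
  obtain ⟨d₀, hd₀⟩ := Set.nonempty_iff_ne_empty.2 hne
  -- The continuation property yields simple paths of every length in the forest. All their vertices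
  -- sit at one position, where there are only finitely many.
  have key : ∀ k : ℕ, ∃ d ∈ S, ∃ P : G.zeroGraph.Walk (G.src d₀) (G.src (G.rev d)), P.IsPath ∧
      P.length = k + 1 ∧ P.penultimate = G.src d ∧
      ∀ v ∈ P.support, G.pos v = G.pos (G.src d₀) := by
    intro k
    induction k with
    | zero =>
      refine ⟨d₀, hd₀, (hG.zeroGraph_adj (h0 _ hd₀)).toWalk, ?_, ?_, ?_, ?_⟩
      · simp [SimpleGraph.Adj.toWalk, (hG.zeroGraph_adj (h0 _ hd₀)).ne]
      · simp [SimpleGraph.Adj.toWalk]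
      · simp [SimpleGraph.Adj.toWalk]
      · intro v hv
        simp only [SimpleGraph.Adj.toWalk, SimpleGraph.Walk.support_cons,
          SimpleGraph.Walk.support_nil, List.mem_cons, List.not_mem_nil, or_false] at hv
        rcases hv with rfl | rfl
        · rfl
        · exact pos_rev_of_len_eq_zero (h0 _ hd₀)
    | succ k ih =>
      obtain ⟨d, hd, P, hP, hlen, hpen, hpos⟩ := ih
      obtain ⟨d', hd', hsrc, hne'⟩ := hS d hd
      have hadj := hG.zeroGraph_adj (h0 _ hd')
      have hnot : G.src (G.rev d') ∉ P.support := by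
        intro hmem
        -- In a forest, the end of a path is adjacent to no vertex of the path except the
        -- penultimate one, and that edge is the reverse of `d` because there are no multiple edges.
        have h1 := hG.zero_acyclic.eq_penultimate_of_adj_end hP (hsrc ▸ hadj) hmem
        rw [hpen] at h1
        apply hne'
        refine hG.zero_simple _ _ (h0 _ hd') (len_rev_eq_zero (h0 _ hd)) hsrc ?_
        rw [h1, G.rev_rev]
      refine ⟨d', hd', (P.copy rfl hsrc.symm).concat hadj, ?_, ?_, ?_, ?_⟩
      · exact SimpleGraph.Walk.IsPath.concat (by simpa using hP) (by simpa using hnot) hadj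
      · simp [hlen]
      · simp
      · intro v hv
        rw [SimpleGraph.Walk.support_concat] at hv
        simp only [SimpleGraph.Walk.support_copy, List.mem_append,
          List.mem_singleton] at hv
        rcases hv with h | rfl
        · exact hpos v h
        · rw [pos_rev_of_len_eq_zero (h0 _ hd'), hsrc]
          exact hpos _ P.end_mem_support
  set Fin := (hG.finite_pos_eq hρ (G.pos (G.src d₀))).toFinset with hFin
  obtain ⟨d, hd, P, hP, hlen, -, hpos⟩ := key Fin.card
  have h1 : P.support.toFinset ⊆ Fin := by
    intro v hv
    rw [hFin, Set.Finite.mem_toFinset]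
    exact hpos v (by simpa using hv)
  have h2 := Finset.card_le_card h1
  rw [List.toFinset_card_of_nodup hP.support_nodup, SimpleGraph.Walk.length_support] at h2
  omega

/-- The component of `e` along the edge is the same for all darts at a vertex. -/
theorem mink_dir_eq {e : D → Mink} (he : G.SolvesSystem e) {d d' : D} (h : G.src d = G.src d') :
    mink (e d) (G.dir d) = mink (e d') (G.dir d') := by
  -- The normal of `d` expressed in the frame of `next d`, and vice versa, turns the corner equation
  -- into sin(angle) times the difference of the two components.
  have step : ∀ d, mink (e (G.next d)) (G.dir (G.next d)) = mink (e d) (G.dir d) := by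
    intro d
    have h1 := he.corner d
    have h2 : mink (G.normal d) (e (G.next d)) =
        Real.sin (G.angle d) * mink (e (G.next d)) (G.dir (G.next d)) := by
      rw [mink_comm]
      conv_lhs => rw [G.normal_eq_next d]
      rw [mink_add_right, mink_smul_right, mink_smul_right, he.unit (G.next d)]; ring
    rw [h2, G.normal_next, mink_sub_right, mink_smul_right, mink_smul_right, he.unit d] at h1
    have h3 := (hG.sin_angle_pos d).ne'
    have h4 : Real.sin (G.angle d) *
        (mink (e (G.next d)) (G.dir (G.next d)) - mink (e d) (G.dir d)) = 0 := by linarith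
    have := (mul_eq_zero.1 h4).resolve_left h3
    linarith
  obtain ⟨n, hn⟩ := G.sameCycle_next d d' h
  have hinv : ∀ d, mink (e (G.next⁻¹ d)) (G.dir (G.next⁻¹ d)) = mink (e d) (G.dir d) := by
    intro d
    rw [← step (G.next⁻¹ d)]; simp
  have hall : ∀ n : ℤ, ∀ d, mink (e ((G.next ^ n) d)) (G.dir ((G.next ^ n) d)) =
      mink (e d) (G.dir d) := by
    intro n
    induction n using Int.induction_on with
    | zero => simp
    | succ k ih => intro d; rw [zpow_add_one, Equiv.Perm.mul_apply, ih, step]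
    | pred k ih => intro d; rw [zpow_sub_one, Equiv.Perm.mul_apply, ih, hinv]
  rw [← hn, hall]

omit hG in
-- The vector at the other end is the same up to sign; only the frame changes, by a hyperbolic
-- rotation through the length of the edge.
theorem mink_dir_rev {e : D → Mink} (hf : G.IsEdgeField e) (d : D) :
    mink (e (G.rev d)) (G.dir (G.rev d)) = Real.sinh (G.len d) * mink (e d) (G.pos (G.src d)) +
      Real.cosh (G.len d) * mink (e d) (G.dir d) := by
  rw [hf.rev, G.dir_rev, mink_neg_left, mink_neg_right, mink_add_right, mink_smul_right,
    mink_smul_right]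
  ring

omit hG in
theorem mink_pos_rev {e : D → Mink} (hf : G.IsEdgeField e) {d : D} (hd : G.len d = 0) :
    mink (e (G.rev d)) (G.pos (G.src (G.rev d))) = -mink (e d) (G.pos (G.src d)) := by
  rw [hf.rev, pos_rev_of_len_eq_zero hd, mink_neg_left]

omit hG in
theorem sum_coeff_eq_zero {e : D → Mink} (he : G.SolvesSystem e) {v : W} {F : Finset D}
    (hF : ∀ d, d ∈ F ↔ G.src d = v) :
    ∑ d ∈ F, G.coeff d * mink (e d) (G.pos (G.src d)) = 0 := by
  have h := he.vertex v
  rw [finsum_src hF, mink_sum_left] at h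
  rw [← h]
  refine Finset.sum_congr rfl fun d hd => ?_
  rw [mink_smul_left, (hF d).1 hd]

/-- At every vertex there is a dart with nonnegative `⟨e, v⟩`, and one can be chosen different from
any given dart with nonpositive `⟨e, v⟩`. -/
theorem exists_nonneg {e : D → Mink} (he : G.SolvesSystem e) (d : D)
    (hd : mink (e d) (G.pos (G.src d)) ≤ 0) :
    ∃ d', G.src d' = G.src d ∧ d' ≠ d ∧ 0 ≤ mink (e d') (G.pos (G.src d')) ∧
      (mink (e d) (G.pos (G.src d)) < 0 → 0 < mink (e d') (G.pos (G.src d'))) := by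
  obtain ⟨F, hF, -⟩ := hG.exists_darts (G.src d)
  have hsum := sum_coeff_eq_zero he hF
  by_cases h : ∃ d' ∈ F, 0 < mink (e d') (G.pos (G.src d'))
  · obtain ⟨d', hd', hpos⟩ := h
    exact ⟨d', (hF d').1 hd', by rintro rfl; linarith, hpos.le, fun _ => hpos⟩
  · push Not at h
    have h0 : ∀ d' ∈ F, mink (e d') (G.pos (G.src d')) = 0 := by
      intro d' hd'
      have := (Finset.sum_eq_zero_iff_of_nonpos fun d' hd' =>
        mul_nonpos_of_nonneg_of_nonpos (hG.coeff_pos d').le (h d' hd')).1 hsum d' hd'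
      exact (mul_eq_zero.1 this).resolve_left (hG.coeff_pos d').ne'
    refine ⟨G.next d, G.src_next d, hG.next_ne d, ?_, fun hlt => ?_⟩
    · exact (h0 _ ((hF _).2 (G.src_next d))).ge
    · exact absurd (h0 d ((hF d).2 rfl)) hlt.ne

/-- The maximum principle. The component along the edge attains a maximum `Q`, since there are
finitely many darts modulo `Γ`. If `Q > 0`, a dart with value `Q` and nonnegative product with its
vertex has length zero, because cosh > 1 would produce a larger value at the other end. The vertex
equation then supplies another such dart at the other end, different from the reverse, against
`no_zero_path`. -/
theorem mink_dir_nonpos (hρ : IsHyperbolicHolonomy ρ) {e : D → Mink} (hf : G.IsEdgeField e)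
    (he : G.SolvesSystem e) (d : D) : mink (e d) (G.dir d) ≤ 0 := by
  obtain ⟨s, hs, hcov⟩ := G.finite_quotient
  have hne : s.Nonempty := by
    obtain ⟨γ, d₀, hd₀, -⟩ := hcov d
    exact ⟨d₀, hd₀⟩
  obtain ⟨d₁, -, hmax⟩ := hs.exists_maximalFor (fun d => mink (e d) (G.dir d)) s hne
  have hmax' : ∀ d, mink (e d) (G.dir d) ≤ mink (e d₁) (G.dir d₁) := by
    intro d
    obtain ⟨γ, d₀, hd₀, rfl⟩ := hcov d
    rw [hf.smul, G.dir_smul, hρ.mink_map]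
    by_contra! hlt
    exact absurd (hmax hd₀ hlt.le) (not_le.2 hlt)
  by_contra! hpos
  set Q := mink (e d₁) (G.dir d₁) with hQ
  have hQ0 : 0 < Q := hpos.trans_le (hmax' d)
  have hlen : ∀ d, mink (e d) (G.dir d) = Q → 0 ≤ mink (e d) (G.pos (G.src d)) →
      G.len d = 0 := by
    intro d hd hp
    by_contra hne
    have hl : 0 < G.len d := lt_of_le_of_ne (G.len_nonneg d) (Ne.symm hne)
    have h1 := hmax' (G.rev d)
    rw [mink_dir_rev hf, hd] at h1
    have h2 : 1 < Real.cosh (G.len d) := Real.one_lt_cosh.2 hne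
    have h3 : 0 < Real.sinh (G.len d) := Real.sinh_pos_iff.2 hl
    nlinarith [mul_nonneg h3.le hp]
  have hempty := hG.no_zero_path hρ
    (S := {d | mink (e d) (G.dir d) = Q ∧ 0 ≤ mink (e d) (G.pos (G.src d))})
    (fun d hd => hlen d hd.1 hd.2) ?_
  · obtain ⟨d', hsrc, hpos'⟩ : ∃ d', G.src d' = G.src d₁ ∧
        0 ≤ mink (e d') (G.pos (G.src d')) := by
      by_cases h : 0 ≤ mink (e d₁) (G.pos (G.src d₁))
      · exact ⟨d₁, rfl, h⟩
      · obtain ⟨d', h1, -, h2, -⟩ := hG.exists_nonneg he d₁ (not_le.1 h).le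
        exact ⟨d', h1, h2⟩
    have : d' ∈ (∅ : Set D) := by
      rw [← hempty]
      exact ⟨hG.mink_dir_eq he hsrc, hpos'⟩
    exact this
  · rintro d ⟨hd, hp⟩
    have h0 := hlen d hd hp
    obtain ⟨d', h1, h2, h3, -⟩ := hG.exists_nonneg he (G.rev d) (by
      rw [mink_pos_rev hf h0]; linarith)
    refine ⟨d', ⟨?_, h3⟩, h1, h2⟩
    rw [hG.mink_dir_eq he h1, mink_dir_rev hf, h0, hd]
    simp

theorem mink_dir_eq_zero (hρ : IsHyperbolicHolonomy ρ) {e : D → Mink} (hf : G.IsEdgeField e)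
    (he : G.SolvesSystem e) (d : D) : mink (e d) (G.dir d) = 0 := by
  refine le_antisymm (hG.mink_dir_nonpos hρ hf he d) ?_
  have hf' : G.IsEdgeField fun d => -e d :=
    ⟨fun γ d => by rw [hf.smul, map_neg], fun d => by rw [hf.rev]⟩
  have he' : G.SolvesSystem fun d => -e d := by
    refine ⟨fun d => ?_, fun d => ?_, fun v => ?_⟩
    · rw [mink_neg_left, he.unit, neg_zero]
    · rw [mink_neg_left, mink_neg_right, ← neg_add, he.corner, neg_zero]
    · obtain ⟨F, hF, -⟩ := hG.exists_darts v
      have := he.vertex v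
      rw [finsum_src hF] at this ⊢
      simp only [smul_neg, Finset.sum_neg_distrib, mink_neg_left, this, neg_zero]
  have := hG.mink_dir_nonpos hρ hf' he' d
  rw [mink_neg_left] at this
  linarith

/-- Injectivity of the angle system. -/
theorem edgeField_eq_zero (hρ : IsHyperbolicHolonomy ρ) {e : D → Mink} (hf : G.IsEdgeField e)
    (he : G.SolvesSystem e) (d : D) : e d = 0 := by
  have hq := hG.mink_dir_eq_zero hρ hf he
  have hlen : ∀ d, mink (e d) (G.pos (G.src d)) ≠ 0 → G.len d = 0 := by
    intro d hp
    have h1 := mink_dir_rev hf d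
    rw [hq, hq, mul_zero, add_zero] at h1
    exact Real.sinh_eq_zero.1 ((mul_eq_zero.1 h1.symm).resolve_right hp)
  -- With vanishing edge components, a dart with nonzero product has length zero, and the products
  -- change sign under `rev`. The vertex equation continues a positive product to another dart,
  -- again without backtracking.
  have hempty := hG.no_zero_path hρ (S := {d | 0 < mink (e d) (G.pos (G.src d))})
    (fun d hd => hlen d (ne_of_gt hd)) ?_
  · have hle : ∀ d, mink (e d) (G.pos (G.src d)) ≤ 0 := by
      intro d
      by_contra! h
      have : d ∈ (∅ : Set D) := by
        rw [← hempty]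
        exact h
      exact this
    refine G.eq_zero_of_mink d (le_antisymm (hle d) ?_) (hq d) (he.unit d)
    by_contra! h
    have h1 := hle (G.rev d)
    rw [mink_pos_rev hf (hlen d h.ne)] at h1
    linarith
  · intro d hd
    replace hd : 0 < mink (e d) (G.pos (G.src d)) := hd
    have h0 : mink (e (G.rev d)) (G.pos (G.src (G.rev d))) < 0 := by
      rw [mink_pos_rev hf (hlen d hd.ne')]; linarith
    obtain ⟨d', h1, h2, -, h3⟩ := hG.exists_nonneg he (G.rev d) h0.le
    exact ⟨d', h3 h0, h1, h2⟩

/-- The sum of two unit normals turned by a quarter is parallel to the difference of the directions,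
with the half-angle tangent as ratio. Around a vertex these differences telescope, which is the
origin of the weights `coeff`. -/
theorem tan_half_smul (d : D) : Real.tan (G.angle d / 2) • (G.normal d + G.normal (G.next d)) =
    G.dir (G.next d) - G.dir d := by
  have h1 : Real.cos (G.angle d / 2) ≠ 0 := (Real.cos_pos_of_mem_Ioo
    ⟨by linarith [hG.angle_pos d, Real.pi_pos], by linarith [hG.angle_lt_pi d]⟩).ne'
  have hs : Real.sin (G.angle d) = 2 * Real.sin (G.angle d / 2) * Real.cos (G.angle d / 2) := by
    rw [← Real.sin_two_mul]; congr 1; ring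
  have hc : Real.cos (G.angle d) = 2 * Real.cos (G.angle d / 2) ^ 2 - 1 := by
    rw [← Real.cos_two_mul]; congr 1; ring
  have e1 : Real.tan (G.angle d / 2) * (1 + Real.cos (G.angle d)) = Real.sin (G.angle d) := by
    rw [hs, hc, Real.tan_eq_sin_div_cos]; field_simp; ring
  have e2 : Real.tan (G.angle d / 2) * Real.sin (G.angle d) = 1 - Real.cos (G.angle d) := by
    have := Real.sin_sq_add_cos_sq (G.angle d / 2)
    rw [hs, hc, Real.tan_eq_sin_div_cos]; field_simp; linarith
  rw [G.normal_next, G.dir_next, ← normal]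
  calc _ = (Real.tan (G.angle d / 2) * (1 + Real.cos (G.angle d))) • G.normal d -
        (Real.tan (G.angle d / 2) * Real.sin (G.angle d)) • G.dir d := by module
    _ = _ := by rw [e1, e2]; module

/-- The linear relation between the normals of the edges at a vertex. -/
theorem sum_coeff_normal {v : W} {F : Finset D} (hF : ∀ d, d ∈ F ↔ G.src d = v) :
    ∑ d ∈ F, G.coeff d • G.normal d = 0 := by
  have hre : ∀ f : D → Mink, ∑ d ∈ F, f (G.next d) = ∑ d ∈ F, f d := fun f =>
    Finset.sum_bijective G.next G.next.bijective
      (fun d => by rw [hF, hF, G.src_next]) fun _ _ => rfl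
  have h1 : ∑ d ∈ F, Real.tan (G.angle (G.next.symm d) / 2) • G.normal d =
      ∑ d ∈ F, Real.tan (G.angle d / 2) • G.normal (G.next d) := by
    rw [← hre fun d => Real.tan (G.angle (G.next.symm d) / 2) • G.normal d]
    simp
  simp only [coeff, add_smul, Finset.sum_add_distrib]
  rw [h1, ← Finset.sum_add_distrib]
  simp only [← smul_add, hG.tan_half_smul, Finset.sum_sub_distrib]
  rw [hre fun d => G.dir d, sub_self]

/-- A deformation that preserves the angles solves the angle system. -/
theorem solvesSystem {u : W → Mink} {e : D → Mink} (h : G.IsInfinitesimalDeformation u e)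
    (ha : G.PreservesAngles e) : G.SolvesSystem e := by
  refine ⟨h.unit, ha, fun v => ?_⟩
  obtain ⟨F, hF, -⟩ := hG.exists_darts v
  rw [finsum_src hF, mink_sum_left]
  have h1 : ∀ d ∈ F, mink (G.coeff d • e d) (G.pos v) =
      -mink (u v) (G.coeff d • G.normal d) := by
    intro d hd
    have := h.incident d
    rw [(hF d).1 hd] at this
    rw [mink_smul_left, mink_smul_right, mink_comm (e d)]
    linear_combination G.coeff d * this
  rw [Finset.sum_congr rfl h1, Finset.sum_neg_distrib, ← mink_sum_right, hG.sum_coeff_normal hF]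
  simp

theorem deformation_eq_zero (hρ : IsHyperbolicHolonomy ρ) {u : W → Mink} {e : D → Mink}
    (h : G.IsInfinitesimalDeformation u e) (ha : G.PreservesAngles e) :
    (∀ v, u v = 0) ∧ ∀ d, e d = 0 := by
  have he := hG.edgeField_eq_zero hρ h.edgeField (hG.solvesSystem h ha)
  refine ⟨fun v => ?_, he⟩
  obtain ⟨F, hF, d, hd⟩ := hG.exists_darts v
  have hv : G.src d = v := (hF d).1 hd
  have hn : ∀ d, G.src d = v → mink (u v) (G.normal d) = 0 := by
    intro d hv
    have := h.incident d
    rw [he d, hv] at this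
    simpa using this
  have h1 := hn d hv
  have h2 := hn (G.next d) ((G.src_next d).trans hv)
  rw [G.normal_next, mink_sub_right, mink_smul_right, mink_smul_right, h1] at h2
  refine G.eq_zero_of_mink d (hv ▸ h.tangent v) ?_ h1
  have h3 : Real.sin (G.angle d) * mink (u v) (G.dir d) = 0 := by linarith
  exact (mul_eq_zero.1 h3).resolve_left (hG.sin_angle_pos d).ne'

end IsConvexCellulation

end GeodesicGraph
end Cellulations

end HypRigidity

namespace HypRigidity

/-! ### Planar triangulations of convex polygons -/

section Planar

/-- Twice the oriented area of a triangle. -/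
def area2 (a b c : ℝ × ℝ) : ℝ := (b.1 - a.1) * (c.2 - a.2) - (b.2 - a.2) * (c.1 - a.1)

theorem area2_rotate (a b c : ℝ × ℝ) : area2 b c a = area2 a b c := by
  simp only [area2]; ring

theorem area2_swap (a b c : ℝ × ℝ) : area2 b a c = -area2 a b c := by
  simp only [area2]; ring

@[simp] theorem area2_left (a b : ℝ × ℝ) : area2 a b a = 0 := by
  simp only [area2]; ring

@[simp] theorem area2_right (a b : ℝ × ℝ) : area2 a b b = 0 := by
  simp only [area2]; ring

@[simp] theorem area2_same (a b : ℝ × ℝ) : area2 a a b = 0 := by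
  simp only [area2]; ring

variable {ι : Type*}

theorem sum_area2 {y : ι → ℝ × ℝ} {t : Finset ι} {x : ι → ℝ} (a b : ℝ × ℝ) :
    ∑ c ∈ t, x c * area2 a b (y c) = (b.1 - a.1) * (∑ c ∈ t, x c • y c).2
      - (b.2 - a.2) * (∑ c ∈ t, x c • y c).1
      - (∑ c ∈ t, x c) * ((b.1 - a.1) * a.2 - (b.2 - a.2) * a.1) := by
  rw [Prod.fst_sum, Prod.snd_sum, Finset.mul_sum, Finset.mul_sum, Finset.sum_mul,
    ← Finset.sum_sub_distrib, ← Finset.sum_sub_distrib]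
  refine Finset.sum_congr rfl fun c _ => ?_
  simp only [area2, Prod.smul_fst, Prod.smul_snd, smul_eq_mul]
  ring

theorem area2_bary {y : ι → ℝ × ℝ} {t : Finset ι} {x : ι → ℝ} (hx : x ∈ stdSimp t)
    (a b : ℝ × ℝ) : area2 a b (bary y x) = ∑ c ∈ t, x c * area2 a b (y c) := by
  rw [sum_area2, hx.2.2, bary_eq_sum y hx.2.1]
  simp only [area2]
  ring

/-- A convex combination where a functional that is nonnegative on all points vanishes is a
combination of the zeros of the functional. -/
theorem eq_zero_of_sum_eq_zero {t : Finset ι} {x f : ι → ℝ} (hx : x ∈ stdSimp t)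
    (hf : ∀ c ∈ t, 0 ≤ f c) (h : ∑ c ∈ t, x c * f c = 0) {c : ι} (hc : x c ≠ 0) :
    c ∈ t ∧ f c = 0 := by
  have hct : c ∈ t := by
    by_contra hn
    exact hc (hx.2.1 c hn)
  refine ⟨hct, ?_⟩
  have := (Finset.sum_eq_zero_iff_of_nonneg fun b hb => mul_nonneg (hx.1 b) (hf b hb)).1 h c hct
  exact (mul_eq_zero.1 this).resolve_left hc

variable [DecidableEq ι]

theorem bary_injOn_pair {y : ι → ℝ × ℝ} {a b : ι} (hab : y a ≠ y b) :
    Set.InjOn (bary y) (stdSimp {a, b}) := by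
  have hne : a ≠ b := by rintro rfl; exact hab rfl
  intro x hx x' hx' h
  have key : ∀ x ∈ stdSimp {a, b}, bary y x = y b + x a • (y a - y b) ∧ x b = 1 - x a := by
    intro x hx
    have h2 := hx.2.2
    rw [Finset.sum_pair hne] at h2
    have hb : x b = 1 - x a := by linarith
    refine ⟨?_, hb⟩
    rw [bary_eq_sum y hx.2.1, Finset.sum_pair hne, hb]
    module
  rw [(key x hx).1, (key x' hx').1, add_right_inj] at h
  have ha : x a = x' a := smul_left_injective ℝ (sub_ne_zero.2 hab) h
  funext c
  by_cases hca : c = a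
  · rw [hca, ha]
  by_cases hcb : c = b
  · rw [hcb, (key x hx).2, (key x' hx').2, ha]
  · rw [hx.2.1 c (by simp [hca, hcb]), hx'.2.1 c (by simp [hca, hcb])]

theorem bary_injOn_triangle {y : ι → ℝ × ℝ} {a b c : ι} (h : 0 < area2 (y a) (y b) (y c)) :
    Set.InjOn (bary y) (stdSimp {a, b, c}) := by
  have hab : a ≠ b := by rintro rfl; simp at h
  have hac : a ≠ c := by rintro rfl; simp at h
  have hbc : b ≠ c := by rintro rfl; simp at h
  have key : ∀ x ∈ stdSimp {a, b, c},
      area2 (y b) (y c) (bary y x) = x a * area2 (y a) (y b) (y c) ∧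
      area2 (y c) (y a) (bary y x) = x b * area2 (y a) (y b) (y c) ∧
      area2 (y a) (y b) (bary y x) = x c * area2 (y a) (y b) (y c) := by
    intro x hx
    simp only [area2_bary hx]
    rw [Finset.sum_insert (by simp [hab, hac]), Finset.sum_insert (by simp [hbc]),
      Finset.sum_singleton, Finset.sum_insert (by simp [hab, hac]),
      Finset.sum_insert (by simp [hbc]), Finset.sum_singleton,
      Finset.sum_insert (by simp [hab, hac]), Finset.sum_insert (by simp [hbc]),
      Finset.sum_singleton]
    simp only [area2_left, area2_right, area2_rotate (y a) (y b) (y c),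
      ← area2_rotate (y c) (y a) (y b)]
    refine ⟨by ring, by ring, by ring⟩
  intro x hx x' hx' hxx
  obtain ⟨h1, h2, h3⟩ := key x hx
  obtain ⟨h1', h2', h3'⟩ := key x' hx'
  rw [hxx] at h1 h2 h3
  funext d
  by_cases hda : d = a
  · rw [hda]; exact mul_right_cancel₀ h.ne' (h1.symm.trans h1')
  by_cases hdb : d = b
  · rw [hdb]; exact mul_right_cancel₀ h.ne' (h2.symm.trans h2')
  by_cases hdc : d = c
  · rw [hdc]; exact mul_right_cancel₀ h.ne' (h3.symm.trans h3')
  · rw [hx.2.1 d (by simp [hda, hdb, hdc]), hx'.2.1 d (by simp [hda, hdb, hdc])]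

theorem mem_triangle {y : ι → ℝ × ℝ} {a b c : ι} (h : 0 < area2 (y a) (y b) (y c)) {P : ℝ × ℝ}
    (h1 : 0 ≤ area2 (y a) (y b) P) (h2 : 0 ≤ area2 (y b) (y c) P)
    (h3 : 0 ≤ area2 (y c) (y a) P) : ∃ x ∈ stdSimp {a, b, c}, bary y x = P := by
  rw [← mem_convexHull_image_iff]
  set D := area2 (y a) (y b) (y c) with hD
  have hP : P = (area2 (y b) (y c) P / D) • y a + (area2 (y c) (y a) P / D) • y b +
      (area2 (y a) (y b) P / D) • y c := by
    ext
    · simp only [Prod.fst_add, Prod.smul_fst, smul_eq_mul]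
      field_simp
      simp only [hD, area2]; ring
    · simp only [Prod.snd_add, Prod.smul_snd, smul_eq_mul]
      field_simp
      simp only [hD, area2]; ring
  have hs : area2 (y b) (y c) P / D + area2 (y c) (y a) P / D + area2 (y a) (y b) P / D = 1 := by
    field_simp
    simp only [hD, area2]; ring
  have hmem : ∀ d ∈ ({a, b, c} : Finset ι),
      y d ∈ convexHull ℝ (y '' (({a, b, c} : Finset ι) : Set ι)) :=
    fun d hd => subset_convexHull ℝ _ ⟨d, hd, rfl⟩
  rw [hP]
  have := (convex_convexHull ℝ (y '' (({a, b, c} : Finset ι) : Set ι))).sum_mem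
    (t := Finset.univ) (w := ![area2 (y b) (y c) P / D, area2 (y c) (y a) P / D,
      area2 (y a) (y b) P / D]) (z := ![y a, y b, y c]) ?_ ?_ ?_
  · simpa [Fin.sum_univ_three] using this
  · intro i _
    fin_cases i
    · exact div_nonneg h2 h.le
    · exact div_nonneg h3 h.le
    · exact div_nonneg h1 h.le
  · simpa [Fin.sum_univ_three] using hs
  · intro i _
    fin_cases i
    · exact hmem a (by simp)
    · exact hmem b (by simp)
    · exact hmem c (by simp)

/-- A nonnegative combination on the line through `a` and `b` which lies on the correct side of
two further lines is a nonnegative combination of `a` and `b`. -/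
theorem exists_segment {a b c d Q : ℝ × ℝ} {ε ω : ℝ} (hc : 0 < ε * area2 a b c)
    (hd : 0 < ε * area2 b d a)
    (h0 : (b.1 - a.1) * Q.2 - (b.2 - a.2) * Q.1 = ω * ((b.1 - a.1) * a.2 - (b.2 - a.2) * a.1))
    (h1 : 0 ≤ ε * ((a.1 - c.1) * Q.2 - (a.2 - c.2) * Q.1
      - ω * ((a.1 - c.1) * c.2 - (a.2 - c.2) * c.1)))
    (h2 : 0 ≤ ε * ((d.1 - b.1) * Q.2 - (d.2 - b.2) * Q.1
      - ω * ((d.1 - b.1) * b.2 - (d.2 - b.2) * b.1))) :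
    ∃ s t : ℝ, 0 ≤ s ∧ 0 ≤ t ∧ s + t = ω ∧ Q = s • a + t • b := by
  set D := ε * area2 a b c with hD
  set N := ε * ((a.1 - c.1) * Q.2 - (a.2 - c.2) * Q.1
      - ω * ((a.1 - c.1) * c.2 - (a.2 - c.2) * c.1)) with hN
  have hQ : Q = (ω - N / D) • a + (N / D) • b := by
    have e1 : D * Q.1 = D * ω * a.1 + N * (b.1 - a.1) := by
      simp only [hD, hN, area2]
      linear_combination ε * (c.1 - a.1) * h0
    have e2 : D * Q.2 = D * ω * a.2 + N * (b.2 - a.2) := by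
      simp only [hD, hN, area2]
      linear_combination ε * (c.2 - a.2) * h0
    ext
    · simp only [Prod.fst_add, Prod.smul_fst, smul_eq_mul]
      field_simp; linarith
    · simp only [Prod.snd_add, Prod.smul_snd, smul_eq_mul]
      field_simp; linarith
  refine ⟨ω - N / D, N / D, ?_, div_nonneg h1 hc.le, by ring, hQ⟩
  have e3 : ε * ((d.1 - b.1) * Q.2 - (d.2 - b.2) * Q.1
      - ω * ((d.1 - b.1) * b.2 - (d.2 - b.2) * b.1)) = (ω - N / D) * (ε * area2 b d a) := by
    set r := N / D
    rw [hQ]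
    simp only [area2, Prod.fst_add, Prod.snd_add, Prod.smul_fst, Prod.smul_snd, smul_eq_mul]
    ring
  rw [e3] at h2
  by_contra! hlt
  nlinarith

/-- A convex combination that lies on the side of `s₁` of the line through `a, b ∈ s₁` is a convex
combination of points of `s₁`. -/
theorem mem_of_cut {y : ι → ℝ × ℝ} {s₁ s₂ : Finset ι} {a b : ι} {c d : ℝ × ℝ} {ε : ℝ}
    (hdisj : Disjoint s₁ s₂) (ha : a ∈ s₁) (hb : b ∈ s₁)
    (hc : 0 < ε * area2 (y a) (y b) c) (hd : 0 < ε * area2 (y b) d (y a))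
    (hpos : ∀ k ∈ s₂, 0 ≤ ε * area2 (y a) (y b) (y k))
    (hca : ∀ k ∈ s₁ ∪ s₂, 0 ≤ ε * area2 c (y a) (y k))
    (hbd : ∀ k ∈ s₁ ∪ s₂, 0 ≤ ε * area2 (y b) d (y k)) {x : ι → ℝ} (hx : x ∈ stdSimp (s₁ ∪ s₂))
    (hP : ε * area2 (y a) (y b) (bary y x) < 0) : ∃ x' ∈ stdSimp s₁, bary y x' = bary y x := by
  obtain ⟨hx0, hx1, hx2⟩ := hx
  set f : ι → ℝ := fun k => ε * area2 (y a) (y b) (y k) with hf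
  have hsum : ∑ k ∈ s₁, x k * f k + ∑ k ∈ s₂, x k * f k < 0 := by
    rw [← Finset.sum_union hdisj]
    rw [area2_bary ⟨hx0, hx1, hx2⟩, Finset.mul_sum] at hP
    refine lt_of_eq_of_lt (Finset.sum_congr rfl fun k _ => ?_) hP
    simp only [hf]; ring
  have h2 : 0 ≤ ∑ k ∈ s₂, x k * f k := Finset.sum_nonneg fun k hk => mul_nonneg (hx0 k) (hpos k hk)
  set f1 := ∑ k ∈ s₁, x k * f k
  set f2 := ∑ k ∈ s₂, x k * f k
  have h1 : f1 < 0 := by linarith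
  -- The fraction `θ` of the mass on `s₁` balances the mass on `s₂`, so the combination `z` lies on
  -- the cutting line. The two further lines place it between `a` and `b`; replacing it by a
  -- combination of these leaves weights on `s₁` only.
  set θ := f2 / (-f1) with hθ
  have hθ0 : 0 ≤ θ := div_nonneg h2 (by linarith)
  have hθ1 : θ ≤ 1 := by rw [hθ, div_le_one (by linarith)]; linarith
  have hθf : θ * f1 + f2 = 0 := by
    have := h1.ne
    rw [hθ]; field_simp; ring
  set z : ι → ℝ := fun k => if k ∈ s₁ then θ * x k else x k with hz
  have hz1 : ∀ k ∈ s₁, z k = θ * x k := fun k hk => by simp [hz, hk]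
  have hz2 : ∀ k ∈ s₂, z k = x k := fun k hk => by simp [hz, Finset.disjoint_right.1 hdisj hk]
  have hz0 : ∀ k, 0 ≤ z k := by
    intro k
    by_cases hk : k ∈ s₁
    · rw [hz1 k hk]; exact mul_nonneg hθ0 (hx0 k)
    · simp only [hz, hk, if_false]; exact hx0 k
  set Q := ∑ k ∈ s₁ ∪ s₂, z k • y k with hQ
  set ω := ∑ k ∈ s₁ ∪ s₂, z k with hω
  have hlin : ∀ p r : ℝ × ℝ, ε * ((r.1 - p.1) * Q.2 - (r.2 - p.2) * Q.1
      - ω * ((r.1 - p.1) * p.2 - (r.2 - p.2) * p.1)) =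
      ∑ k ∈ s₁ ∪ s₂, z k * (ε * area2 p r (y k)) := by
    intro p r
    rw [← sum_area2, Finset.mul_sum]
    exact Finset.sum_congr rfl fun k _ => by ring
  have hnn : ∀ p r : ℝ × ℝ, (∀ k ∈ s₁ ∪ s₂, 0 ≤ ε * area2 p r (y k)) →
      0 ≤ ε * ((r.1 - p.1) * Q.2 - (r.2 - p.2) * Q.1
      - ω * ((r.1 - p.1) * p.2 - (r.2 - p.2) * p.1)) := fun p r h => by
    rw [hlin]
    exact Finset.sum_nonneg fun k hk => mul_nonneg (hz0 k) (h k hk)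
  have hzero : ε * (((y b).1 - (y a).1) * Q.2 - ((y b).2 - (y a).2) * Q.1
      - ω * (((y b).1 - (y a).1) * (y a).2 - ((y b).2 - (y a).2) * (y a).1)) = 0 := by
    rw [hlin, Finset.sum_union hdisj, ← hθf]
    congr 1
    · simp only [f1, Finset.mul_sum]
      exact Finset.sum_congr rfl fun k hk => by rw [hz1 k hk]; simp only [hf]; ring
    · exact Finset.sum_congr rfl fun k hk => by rw [hz2 k hk]
  have hε : ε ≠ 0 := by rintro rfl; simp at hc
  obtain ⟨s, t, hs, ht, hst, hQst⟩ := exists_segment hc hd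
    (by linarith [(mul_eq_zero.1 hzero).resolve_left hε]) (hnn c (y a) hca) (hnn (y b) d hbd)
  set x' : ι → ℝ := fun k => (if k ∈ s₁ then (1 - θ) * x k else 0) +
    ((if k = a then s else 0) + (if k = b then t else 0)) with hx'
  have hxsum : ∑ k ∈ s₁, x k + ∑ k ∈ s₂, x k = 1 := by rw [← Finset.sum_union hdisj, hx2]
  have hωsum : ω = θ * ∑ k ∈ s₁, x k + ∑ k ∈ s₂, x k := by
    rw [hω, Finset.sum_union hdisj, Finset.mul_sum]
    congr 1
    · exact Finset.sum_congr rfl fun k hk => hz1 k hk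
    · exact Finset.sum_congr rfl fun k hk => hz2 k hk
  have hQsum : Q = θ • ∑ k ∈ s₁, x k • y k + ∑ k ∈ s₂, x k • y k := by
    rw [hQ, Finset.sum_union hdisj, Finset.smul_sum]
    congr 1
    · exact Finset.sum_congr rfl fun k hk => by rw [hz1 k hk, mul_smul]
    · exact Finset.sum_congr rfl fun k hk => by rw [hz2 k hk]
  have hmem : x' ∈ stdSimp s₁ := by
    refine ⟨fun k => ?_, fun k hk => ?_, ?_⟩
    · simp only [hx']
      have := mul_nonneg (sub_nonneg.2 hθ1) (hx0 k)
      positivity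
    · have hka : k ≠ a := by rintro rfl; exact hk ha
      have hkb : k ≠ b := by rintro rfl; exact hk hb
      simp [hx', hk, hka, hkb]
    · simp only [hx', Finset.sum_add_distrib, Finset.sum_ite_eq', ha, hb, if_true,
        Finset.sum_ite_mem, Finset.inter_self, ← Finset.mul_sum]
      linarith
  refine ⟨x', hmem, ?_⟩
  rw [bary_eq_sum y hmem.2.1, bary_eq_sum y hx1, Finset.sum_union hdisj]
  have e : ∑ k ∈ s₁, x' k • y k = (1 - θ) • ∑ k ∈ s₁, x k • y k + (s • y a + t • y b) := by
    simp only [hx', add_smul, Finset.sum_add_distrib, ite_smul, zero_smul, Finset.sum_ite_eq', ha,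
      hb, if_true, Finset.sum_ite_mem, Finset.inter_self, mul_smul, ← Finset.smul_sum]
  rw [e, ← hQst, hQsum]
  module

end Planar

end HypRigidity

/-! ### Combinatorial triangulations and their bijection with a convex polygon -/

namespace HypRigidity

section Planar

variable {ι : Type*} {σ : ℕ → ι} {n : ℕ} {y : ι → ℝ × ℝ}

/-- The points `y (σ 0), …, y (σ n)` are the vertices of a strictly convex polygon, in
counterclockwise order. -/
def ConvexlyOrdered (σ : ℕ → ι) (n : ℕ) (y : ι → ℝ × ℝ) : Prop :=
  ∀ i j k, i < j → j < k → k ≤ n → 0 < area2 (y (σ i)) (y (σ j)) (y (σ k))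

theorem ConvexlyOrdered.ne (h : ConvexlyOrdered σ n y) (hn : 2 ≤ n) {i j : ℕ} (hij : i < j)
    (hj : j ≤ n) : y (σ i) ≠ y (σ j) := by
  intro e
  by_cases h1 : i + 1 < j
  · have := h i (i + 1) j (by omega) h1 hj
    rw [e, area2_left] at this
    exact lt_irrefl _ this
  · by_cases h2 : j < n
    · have := h i j n hij h2 le_rfl
      rw [e, area2_same] at this
      exact lt_irrefl _ this
    · have := h (i - 1) i j (by omega) hij hj
      rw [e, area2_right] at this
      exact lt_irrefl _ this

theorem ConvexlyOrdered.injOn (h : ConvexlyOrdered σ n y) (hn : 2 ≤ n) :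
    Set.InjOn σ (Set.Iic n) := by
  intro i hi j hj hij
  rcases lt_trichotomy i j with hlt | rfl | hlt
  · exact absurd (congrArg y hij) (h.ne hn hlt hj)
  · rfl
  · exact absurd (congrArg y hij.symm) (h.ne hn hlt hi)

theorem ConvexlyOrdered.pos_outside (h : ConvexlyOrdered σ n y) {i j k : ℕ} (hij : i < j)
    (hj : j ≤ n) (hk : k ≤ n) (hkij : k < i ∨ j < k) :
    0 < area2 (y (σ i)) (y (σ j)) (y (σ k)) := by
  rcases hkij with hlt | hlt
  · rw [area2_rotate]
    exact h k i j hlt hij hj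
  · exact h i j k hij hlt hk

theorem ConvexlyOrdered.nonneg_outside (h : ConvexlyOrdered σ n y) {i j k : ℕ} (hij : i < j)
    (hj : j ≤ n) (hk : k ≤ n) (hkij : k ≤ i ∨ j ≤ k) :
    0 ≤ area2 (y (σ i)) (y (σ j)) (y (σ k)) := by
  rcases eq_or_ne k i with rfl | h1
  · simp
  rcases eq_or_ne k j with rfl | h2
  · simp
  exact (h.pos_outside hij hj hk (by omega)).le

theorem ConvexlyOrdered.neg_inside (h : ConvexlyOrdered σ n y) {i j k : ℕ} (hik : i < k)
    (hkj : k < j) (hj : j ≤ n) : area2 (y (σ i)) (y (σ j)) (y (σ k)) < 0 := by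
  have e : area2 (y (σ i)) (y (σ j)) (y (σ k)) = -area2 (y (σ i)) (y (σ k)) (y (σ j)) := by
    simp only [area2]; ring
  rw [e]
  linarith [h i k j hik hkj hj]

theorem ConvexlyOrdered.nonpos_inside (h : ConvexlyOrdered σ n y) {i j k : ℕ} (hik : i ≤ k)
    (hkj : k ≤ j) (hj : j ≤ n) : area2 (y (σ i)) (y (σ j)) (y (σ k)) ≤ 0 := by
  rcases eq_or_ne k i with rfl | h1
  · simp
  rcases eq_or_ne k j with rfl | h2
  · simp
  exact (h.neg_inside (by omega) (by omega) hj).le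

variable [DecidableEq ι]

/-- `T` is the set of triangles of a triangulation of the polygon `σ i, …, σ j` (a segment if
`j = i + 1`). -/
inductive IsTri (σ : ℕ → ι) : ℕ → ℕ → Set (Finset ι) → Prop
  | leaf (i : ℕ) : IsTri σ i (i + 1) ∅
  | node {i m j : ℕ} {T₁ T₂ : Set (Finset ι)} (h₁ : IsTri σ i m T₁) (h₂ : IsTri σ m j T₂) :
      IsTri σ i j (insert {σ i, σ m, σ j} (T₁ ∪ T₂))

/-- The union of the closed simplices of `T` and of a base simplex. -/
def triReal (t : Finset ι) (T : Set (Finset ι)) : Set (ι → ℝ) := stdSimp t ∪ ⋃ s ∈ T, stdSimp s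

/-- The vertices `σ i, …, σ j`. -/
def seg (σ : ℕ → ι) (i j : ℕ) : Finset ι := (Finset.Icc i j).image σ

theorem mem_seg {i j : ℕ} {a : ι} : a ∈ seg σ i j ↔ ∃ k, i ≤ k ∧ k ≤ j ∧ σ k = a := by
  simp [seg, and_assoc]

theorem IsTri.lt {i j : ℕ} {T : Set (Finset ι)} (h : IsTri σ i j T) : i < j := by
  induction h with
  | leaf i => omega
  | node _ _ h1 h2 => omega

theorem IsTri.finite {i j : ℕ} {T : Set (Finset ι)} (h : IsTri σ i j T) : T.Finite := by
  induction h with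
  | leaf i => simp
  | node _ _ h1 h2 => exact (h1.union h2).insert _

theorem IsTri.exists_eq {i j : ℕ} {T : Set (Finset ι)} (h : IsTri σ i j T) {t : Finset ι}
    (ht : t ∈ T) : ∃ a b c, i ≤ a ∧ a < b ∧ b < c ∧ c ≤ j ∧ t = {σ a, σ b, σ c} := by
  induction h with
  | leaf i => exact absurd ht (Set.notMem_empty _)
  | node h1 h2 ih1 ih2 =>
    have := h1.lt
    have := h2.lt
    rcases ht with rfl | ht | ht
    · exact ⟨_, _, _, le_rfl, h1.lt, h2.lt, le_rfl, rfl⟩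
    · obtain ⟨a, b, c, h⟩ := ih1 ht
      exact ⟨a, b, c, by omega, by omega, by omega, by omega, h.2.2.2.2⟩
    · obtain ⟨a, b, c, h⟩ := ih2 ht
      exact ⟨a, b, c, by omega, by omega, by omega, by omega, h.2.2.2.2⟩

theorem IsTri.subset_seg {i j : ℕ} {T : Set (Finset ι)} (h : IsTri σ i j T) {t : Finset ι}
    (ht : t ∈ T) : t ⊆ seg σ i j := by
  obtain ⟨a, b, c, h1, h2, h3, h4, rfl⟩ := h.exists_eq ht
  intro d hd
  simp only [Finset.mem_insert, Finset.mem_singleton] at hd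
  rcases hd with rfl | rfl | rfl
  · exact mem_seg.2 ⟨a, by omega, by omega, rfl⟩
  · exact mem_seg.2 ⟨b, by omega, by omega, rfl⟩
  · exact mem_seg.2 ⟨c, by omega, by omega, rfl⟩

theorem pair_subset_seg {i j : ℕ} (h : i ≤ j) : {σ i, σ j} ⊆ seg σ i j := by
  intro d hd
  simp only [Finset.mem_insert, Finset.mem_singleton] at hd
  rcases hd with rfl | rfl
  · exact mem_seg.2 ⟨i, le_rfl, h, rfl⟩
  · exact mem_seg.2 ⟨j, h, le_rfl, rfl⟩

theorem IsTri.triReal_subset {i j : ℕ} {T : Set (Finset ι)} (h : IsTri σ i j T) :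
    triReal {σ i, σ j} T ⊆ stdSimp (seg σ i j) := by
  rintro x (hx | hx)
  · exact stdSimp_mono (pair_subset_seg h.lt.le) hx
  · obtain ⟨t, ht, hx⟩ := Set.mem_iUnion₂.1 hx
    exact stdSimp_mono (h.subset_seg ht) hx

theorem triReal_node {i m j : ℕ} {T₁ T₂ : Set (Finset ι)} :
    triReal {σ i, σ j} (insert {σ i, σ m, σ j} (T₁ ∪ T₂)) =
      triReal {σ i, σ m} T₁ ∪ stdSimp {σ i, σ m, σ j} ∪ triReal {σ m, σ j} T₂ := by
  have h1 : stdSimp {σ i, σ j} ⊆ stdSimp {σ i, σ m, σ j} := stdSimp_mono (by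
    intro a; simp only [Finset.mem_insert, Finset.mem_singleton]; tauto)
  have h2 : stdSimp {σ i, σ m} ⊆ stdSimp {σ i, σ m, σ j} := stdSimp_mono (by
    intro a; simp only [Finset.mem_insert, Finset.mem_singleton]; tauto)
  have h3 : stdSimp {σ m, σ j} ⊆ stdSimp {σ i, σ m, σ j} := stdSimp_mono (by
    intro a; simp only [Finset.mem_insert, Finset.mem_singleton]; tauto)
  simp only [triReal, Set.biUnion_insert, Set.biUnion_union]
  ext x
  simp only [Set.mem_union]
  have h1x := @h1 x
  have h2x := @h2 x
  have h3x := @h3 x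
  tauto

/-- All sides of the polygon belong to a triangulation. -/
theorem IsTri.side_subset {i j : ℕ} {T : Set (Finset ι)} (h : IsTri σ i j T) {k : ℕ} (hik : i ≤ k)
    (hkj : k < j) : stdSimp {σ k, σ (k + 1)} ⊆ triReal {σ i, σ j} T := by
  induction h with
  | leaf i =>
    obtain rfl : k = i := by omega
    exact Set.subset_union_left
  | @node i m j T₁ T₂ h1 h2 ih1 ih2 =>
    rw [triReal_node]
    by_cases hkm : k < m
    · exact (ih1 hik hkm).trans (Set.subset_union_left.trans Set.subset_union_left)
    · exact (ih2 (by omega) hkj).trans Set.subset_union_right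

/-- A point of a polygon that is cut off by a diagonal `σ i, σ m`. -/
theorem ConvexlyOrdered.cut_left (h : ConvexlyOrdered σ n y) (hn : 2 ≤ n) {i m j : ℕ}
    (him : i < m) (hmj : m < j) (hj : j ≤ n) {x : ι → ℝ} (hx : x ∈ stdSimp (seg σ i j))
    (hP : area2 (y (σ i)) (y (σ m)) (bary y x) < 0) :
    ∃ x' ∈ stdSimp (seg σ i m), bary y x' = bary y x := by
  have hinj := h.injOn hn
  have hunion : seg σ i j = seg σ i m ∪ seg σ (m + 1) j := by
    ext a
    simp only [Finset.mem_union, mem_seg]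
    constructor
    · rintro ⟨k, h1, h2, rfl⟩
      by_cases hk : k ≤ m
      · exact Or.inl ⟨k, h1, hk, rfl⟩
      · exact Or.inr ⟨k, by omega, h2, rfl⟩
    · rintro (⟨k, h1, h2, rfl⟩ | ⟨k, h1, h2, rfl⟩)
      · exact ⟨k, h1, by omega, rfl⟩
      · exact ⟨k, by omega, h2, rfl⟩
  refine mem_of_cut (s₂ := seg σ (m + 1) j) (a := σ i) (b := σ m) (c := y (σ j))
    (d := y (σ (m + 1))) (ε := 1) ?_ ?_ ?_ ?_ ?_ ?_ ?_ ?_ (hunion ▸ hx) (by linarith)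
  · rw [Finset.disjoint_left]
    intro a ha hb
    obtain ⟨k, h1, h2, rfl⟩ := mem_seg.1 ha
    obtain ⟨k', h1', h2', he⟩ := mem_seg.1 hb
    have := hinj (show k' ∈ Set.Iic n by simp; omega) (show k ∈ Set.Iic n by simp; omega) he
    omega
  · exact mem_seg.2 ⟨i, le_rfl, him.le, rfl⟩
  · exact mem_seg.2 ⟨m, him.le, le_rfl, rfl⟩
  · rw [one_mul]; exact h i m j him hmj hj
  · rw [one_mul]; exact h.pos_outside (by omega) (by omega) (by omega) (by omega)
  · intro k hk
    obtain ⟨k, h1, h2, rfl⟩ := mem_seg.1 hk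
    rw [one_mul]
    exact h.nonneg_outside him (by omega) (by omega) (by omega)
  · intro k hk
    rw [← hunion] at hk
    obtain ⟨k, h1, h2, rfl⟩ := mem_seg.1 hk
    rw [one_mul, area2_swap]
    linarith [h.nonpos_inside h1 h2 hj]
  · intro k hk
    rw [← hunion] at hk
    obtain ⟨k, h1, h2, rfl⟩ := mem_seg.1 hk
    rw [one_mul]
    exact h.nonneg_outside (by omega) (by omega) (by omega) (by omega)

/-- A point of a polygon that is cut off by a diagonal `σ m, σ j`. -/
theorem ConvexlyOrdered.cut_right (h : ConvexlyOrdered σ n y) (hn : 2 ≤ n) {i m j : ℕ}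
    (him : i < m) (hmj : m < j) (hj : j ≤ n) {x : ι → ℝ} (hx : x ∈ stdSimp (seg σ i j))
    (hP : area2 (y (σ m)) (y (σ j)) (bary y x) < 0) :
    ∃ x' ∈ stdSimp (seg σ m j), bary y x' = bary y x := by
  have hinj := h.injOn hn
  have hunion : seg σ i j = seg σ m j ∪ seg σ i (m - 1) := by
    ext a
    simp only [Finset.mem_union, mem_seg]
    constructor
    · rintro ⟨k, h1, h2, rfl⟩
      by_cases hk : m ≤ k
      · exact Or.inl ⟨k, hk, h2, rfl⟩
      · exact Or.inr ⟨k, h1, by omega, rfl⟩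
    · rintro (⟨k, h1, h2, rfl⟩ | ⟨k, h1, h2, rfl⟩)
      · exact ⟨k, by omega, h2, rfl⟩
      · exact ⟨k, h1, by omega, rfl⟩
  refine mem_of_cut (s₂ := seg σ i (m - 1)) (a := σ j) (b := σ m) (c := y (σ i))
    (d := y (σ (m - 1))) (ε := -1) ?_ ?_ ?_ ?_ ?_ ?_ ?_ ?_ (hunion ▸ hx) ?_
  · rw [Finset.disjoint_left]
    intro a ha hb
    obtain ⟨k, h1, h2, rfl⟩ := mem_seg.1 ha
    obtain ⟨k', h1', h2', he⟩ := mem_seg.1 hb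
    have := hinj (show k' ∈ Set.Iic n by simp; omega) (show k ∈ Set.Iic n by simp; omega) he
    omega
  · exact mem_seg.2 ⟨j, by omega, le_rfl, rfl⟩
  · exact mem_seg.2 ⟨m, le_rfl, by omega, rfl⟩
  · rw [area2_swap, neg_one_mul, neg_neg]
    exact h.pos_outside hmj hj (by omega) (Or.inl him)
  · rw [area2_swap, neg_one_mul, neg_neg]
    have hm : m - 1 + 1 = m := by omega
    exact h.pos_outside (by omega) (by omega) hj (by omega)
  · intro k hk
    obtain ⟨k, h1, h2, rfl⟩ := mem_seg.1 hk
    rw [area2_swap, neg_one_mul, neg_neg]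
    exact h.nonneg_outside hmj (by omega) (by omega) (by omega)
  · intro k hk
    rw [← hunion] at hk
    obtain ⟨k, h1, h2, rfl⟩ := mem_seg.1 hk
    rw [neg_one_mul]
    linarith [h.nonpos_inside h1 h2 hj]
  · intro k hk
    rw [← hunion] at hk
    obtain ⟨k, h1, h2, rfl⟩ := mem_seg.1 hk
    rw [area2_swap, neg_one_mul, neg_neg]
    exact h.nonneg_outside (by omega) (by omega) (by omega) (by omega)
  · rw [area2_swap, neg_one_mul, neg_neg]; exact hP

/-- A triangulation maps bijectively to the polygon. -/
theorem IsTri.bijOn (h : ConvexlyOrdered σ n y) (hn : 2 ≤ n) {i j : ℕ} {T : Set (Finset ι)}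
    (hT : IsTri σ i j T) (hj : j ≤ n) : Set.InjOn (bary y) (triReal {σ i, σ j} T) ∧
      ∀ x ∈ stdSimp (seg σ i j), ∃ x' ∈ triReal {σ i, σ j} T, bary y x' = bary y x := by
  induction hT with
  | leaf i =>
    have e : triReal {σ i, σ (i + 1)} (∅ : Set (Finset ι)) = stdSimp {σ i, σ (i + 1)} := by
      simp [triReal]
    rw [e]
    refine ⟨bary_injOn_pair (h.ne hn (Nat.lt_succ_self i) hj), fun x hx => ⟨x, ?_, rfl⟩⟩
    refine stdSimp_mono (fun a ha => ?_) hx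
    obtain ⟨k, h1, h2, rfl⟩ := mem_seg.1 ha
    obtain rfl | rfl : k = i ∨ k = i + 1 := by omega
    · simp
    · simp
  | @node i m j T₁ T₂ h1 h2 ih1 ih2 =>
    have him := h1.lt
    have hmj := h2.lt
    obtain ⟨inj1, sur1⟩ := ih1 (by omega)
    obtain ⟨inj2, sur2⟩ := ih2 hj
    rw [triReal_node]
    have htri := h i m j him hmj hj
    have injt := bary_injOn_triangle htri
    -- points on both sides of the diagonal `σ i, σ m`
    have left : ∀ x ∈ triReal {σ i, σ m} T₁, ∀ x' ∈ stdSimp (insert (σ i) (seg σ m j)),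
        bary y x = bary y x' → x = x' := by
      intro x hx x' hx' e
      have hxs := h1.triReal_subset hx
      have a1 := area2_bary (y := y) hxs (y (σ i)) (y (σ m))
      have a2 := area2_bary (y := y) hx' (y (σ i)) (y (σ m))
      have n1 : ∀ c ∈ seg σ i m, area2 (y (σ i)) (y (σ m)) (y c) ≤ 0 := by
        intro c hc
        obtain ⟨k, k1, k2, rfl⟩ := mem_seg.1 hc
        exact h.nonpos_inside k1 k2 (by omega)
      have n2 : ∀ c ∈ insert (σ i) (seg σ m j), 0 ≤ area2 (y (σ i)) (y (σ m)) (y c) := by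
        intro c hc
        rcases Finset.mem_insert.1 hc with rfl | hc
        · simp
        · obtain ⟨k, k1, k2, rfl⟩ := mem_seg.1 hc
          exact h.nonneg_outside him (by omega) (by omega) (by omega)
      have s1 : ∑ c ∈ seg σ i m, x c * area2 (y (σ i)) (y (σ m)) (y c) ≤ 0 :=
        Finset.sum_nonpos fun c hc => mul_nonpos_of_nonneg_of_nonpos (hxs.1 c) (n1 c hc)
      have s2 := Finset.sum_nonneg fun c hc => mul_nonneg (hx'.1 c) (n2 c hc)
      rw [← a1, e, a2] at s1
      have z2 := le_antisymm s1 s2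
      have z1 := (a1.symm.trans (e ▸ a2)).trans z2
      -- The affine function of the diagonal has opposite signs on the two vertex sets, so it
      -- vanishes at the common point. Each combination then involves only vertices where the
      -- function vanishes, and the question is reduced to one triangle.
      have m1 : x ∈ stdSimp {σ i, σ m, σ j} := by
        refine stdSimp_of_support hxs fun c hc => ?_
        obtain ⟨hc1, hc2⟩ := eq_zero_of_sum_eq_zero (f := fun c =>
          -area2 (y (σ i)) (y (σ m)) (y c)) hxs (fun c hc => by linarith [n1 c hc])
          (by simp only [mul_neg, Finset.sum_neg_distrib, z1, neg_zero]) hc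
        obtain ⟨k, k1, k2, rfl⟩ := mem_seg.1 hc1
        by_cases e1 : k = i
        · simp [e1]
        by_cases e2 : k = m
        · simp [e2]
        have := h.neg_inside (i := i) (j := m) (k := k) (by omega) (by omega) (by omega)
        linarith
      have m2 : x' ∈ stdSimp {σ i, σ m, σ j} := by
        refine stdSimp_of_support hx' fun c hc => ?_
        obtain ⟨hc1, hc2⟩ := eq_zero_of_sum_eq_zero hx' n2 z2 hc
        rcases Finset.mem_insert.1 hc1 with rfl | hc1
        · simp
        obtain ⟨k, k1, k2, rfl⟩ := mem_seg.1 hc1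
        by_cases e2 : k = m
        · simp [e2]
        have := h.pos_outside (i := i) (j := m) (k := k) him (by omega) (by omega) (by omega)
        linarith
      exact injt m1 m2 e
    have right : ∀ x ∈ triReal {σ m, σ j} T₂, ∀ x' ∈ stdSimp {σ i, σ m, σ j},
        bary y x = bary y x' → x = x' := by
      intro x hx x' hx' e
      have hxs := h2.triReal_subset hx
      have a1 := area2_bary (y := y) hxs (y (σ m)) (y (σ j))
      have a2 := area2_bary (y := y) hx' (y (σ m)) (y (σ j))
      have n1 : ∀ c ∈ seg σ m j, area2 (y (σ m)) (y (σ j)) (y c) ≤ 0 := by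
        intro c hc
        obtain ⟨k, k1, k2, rfl⟩ := mem_seg.1 hc
        exact h.nonpos_inside k1 k2 (by omega)
      have n2 : ∀ c ∈ ({σ i, σ m, σ j} : Finset ι), 0 ≤ area2 (y (σ m)) (y (σ j)) (y c) := by
        intro c hc
        simp only [Finset.mem_insert, Finset.mem_singleton] at hc
        rcases hc with rfl | rfl | rfl
        · exact h.nonneg_outside hmj hj (by omega) (by omega)
        · simp
        · simp
      have s1 : ∑ c ∈ seg σ m j, x c * area2 (y (σ m)) (y (σ j)) (y c) ≤ 0 :=
        Finset.sum_nonpos fun c hc => mul_nonpos_of_nonneg_of_nonpos (hxs.1 c) (n1 c hc)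
      have s2 := Finset.sum_nonneg fun c hc => mul_nonneg (hx'.1 c) (n2 c hc)
      rw [← a1, e, a2] at s1
      have z2 := le_antisymm s1 s2
      have z1 := (a1.symm.trans (e ▸ a2)).trans z2
      have m1 : x ∈ stdSimp {σ i, σ m, σ j} := by
        refine stdSimp_of_support hxs fun c hc => ?_
        obtain ⟨hc1, hc2⟩ := eq_zero_of_sum_eq_zero (f := fun c =>
          -area2 (y (σ m)) (y (σ j)) (y c)) hxs (fun c hc => by linarith [n1 c hc])
          (by simp only [mul_neg, Finset.sum_neg_distrib, z1, neg_zero]) hc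
        obtain ⟨k, k1, k2, rfl⟩ := mem_seg.1 hc1
        by_cases e1 : k = m
        · simp [e1]
        by_cases e2 : k = j
        · simp [e2]
        have := h.neg_inside (i := m) (j := j) (k := k) (by omega) (by omega) (by omega)
        linarith
      exact injt m1 hx' e
    have sub2 : triReal {σ m, σ j} T₂ ⊆ stdSimp (insert (σ i) (seg σ m j)) :=
      h2.triReal_subset.trans (stdSimp_mono (Finset.subset_insert _ _))
    have subt : stdSimp {σ i, σ m, σ j} ⊆ stdSimp (insert (σ i) (seg σ m j)) :=
      stdSimp_mono (Finset.insert_subset_insert _ (pair_subset_seg hmj.le))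
    constructor
    · rintro x ((hx | hx) | hx) x' ((hx' | hx') | hx') e
      · exact inj1 hx hx' e
      · exact left x hx x' (subt hx') e
      · exact left x hx x' (sub2 hx') e
      · exact (left x' hx' x (subt hx) e.symm).symm
      · exact injt hx hx' e
      · exact (right x' hx' x hx e.symm).symm
      · exact (left x' hx' x (sub2 hx) e.symm).symm
      · exact right x hx x' hx' e
      · exact inj2 hx hx' e
    · intro x hx
      by_cases c1 : area2 (y (σ i)) (y (σ m)) (bary y x) < 0
      · obtain ⟨x', hx', e⟩ := h.cut_left hn him hmj hj hx c1
        obtain ⟨x'', hx'', e'⟩ := sur1 x' hx'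
        exact ⟨x'', Or.inl (Or.inl hx''), e'.trans e⟩
      by_cases c2 : area2 (y (σ m)) (y (σ j)) (bary y x) < 0
      · obtain ⟨x', hx', e⟩ := h.cut_right hn him hmj hj hx c2
        obtain ⟨x'', hx'', e'⟩ := sur2 x' hx'
        exact ⟨x'', Or.inr hx'', e'.trans e⟩
      · have c3 : 0 ≤ area2 (y (σ j)) (y (σ i)) (bary y x) := by
          rw [area2_bary hx]
          refine Finset.sum_nonneg fun c hc => mul_nonneg (hx.1 c) ?_
          obtain ⟨k, k1, k2, rfl⟩ := mem_seg.1 hc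
          rw [area2_swap]
          linarith [h.nonpos_inside k1 k2 hj]
        obtain ⟨x', hx', e⟩ := mem_triangle htri (not_lt.1 c1) (not_lt.1 c2) c3
        exact ⟨x', Or.inl (Or.inr hx'), e⟩

end Planar

end HypRigidity

/-! ### Cyclic order of points in convex position, lower hulls, and the recursive form of
triangulations -/

namespace HypRigidity

section Planar

variable {ι : Type*} {σ : ℕ → ι} {n : ℕ} {w : ι → ℝ × ℝ}

/-- The area in the rotated coordinates along and across the functional `(f1, f2)`, in which slopes
from `a` can be compared. -/
theorem area2_cut {f1 f2 : ℝ} (a b c : ℝ × ℝ) :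
    (f1 ^ 2 + f2 ^ 2) * area2 a b c =
      (f1 * (b.1 - a.1) + f2 * (b.2 - a.2)) * (f1 * (c.2 - a.2) - f2 * (c.1 - a.1)) -
      (f1 * (c.1 - a.1) + f2 * (c.2 - a.2)) * (f1 * (b.2 - a.2) - f2 * (b.1 - a.1)) := by
  simp only [area2]; ring

variable [DecidableEq ι]

/-- Points in strictly convex position in the plane are the vertices of a convex polygon. -/
theorem exists_convexlyOrdered {A : Finset ι} (hA : 3 ≤ A.card)
    (hw : ∀ a ∈ A, w a ∉ convexHull ℝ (w '' ((A.erase a : Finset ι) : Set ι))) :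
    ∃ (σ : ℕ → ι) (n : ℕ), 2 ≤ n ∧ seg σ 0 n = A ∧ ConvexlyOrdered σ n w := by
  obtain ⟨a₀, ha₀⟩ : A.Nonempty := Finset.card_pos.1 (by omega)
  obtain ⟨f, u, hfa, hfb⟩ := geometric_hahn_banach_point_closed (convex_convexHull ℝ _)
    ((((A.erase a₀).finite_toSet).image w).isClosed_convexHull ℝ) (hw a₀ ha₀)
  set f1 := f (1, 0) with hf1
  set f2 := f (0, 1) with hf2
  have hf : ∀ P : ℝ × ℝ, f P = f1 * P.1 + f2 * P.2 := by
    intro P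
    have : P = P.1 • ((1, 0) : ℝ × ℝ) + P.2 • ((0, 1) : ℝ × ℝ) := by ext <;> simp
    conv_lhs => rw [this]
    rw [map_add, map_smul, map_smul, smul_eq_mul, smul_eq_mul]; ring
  set B := A.erase a₀ with hB
  set F : ι → ℝ := fun b => f1 * ((w b).1 - (w a₀).1) + f2 * ((w b).2 - (w a₀).2) with hF
  have hFpos : ∀ b ∈ B, 0 < F b := by
    intro b hb
    have := hfa.trans (hfb (w b) (subset_convexHull ℝ _ ⟨b, hb, rfl⟩))
    rw [hf, hf] at this
    simp only [hF]; linarith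
  -- The functional `F` is positive on all other points, so the slope seen from `a₀` is defined, and
  -- increasing slope is the counterclockwise order.
  set s : ι → ℝ := fun b => (f1 * ((w b).2 - (w a₀).2) - f2 * ((w b).1 - (w a₀).1)) / F b with hs
  have hN : 0 < f1 ^ 2 + f2 ^ 2 := by
    obtain ⟨b, hb⟩ : B.Nonempty := Finset.card_pos.1 (by
      rw [hB, Finset.card_erase_of_mem ha₀]; omega)
    by_contra! hle
    have h1 : f1 = 0 := by nlinarith [sq_nonneg f1, sq_nonneg f2]
    have h2 : f2 = 0 := by nlinarith [sq_nonneg f1, sq_nonneg f2]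
    have := hFpos b hb
    simp [hF, h1, h2] at this
  have harea : ∀ b ∈ B, ∀ c ∈ B, (f1 ^ 2 + f2 ^ 2) * area2 (w a₀) (w b) (w c) =
      F b * F c * (s c - s b) := by
    intro b hb c hc
    have h1 := (hFpos b hb).ne'
    have h2 := (hFpos c hc).ne'
    rw [area2_cut]
    simp only [hs]
    field_simp
    simp only [hF]
    ring
  have hpos : ∀ b ∈ B, ∀ c ∈ B, s b < s c → 0 < area2 (w a₀) (w b) (w c) := by
    intro b hb c hc h
    have := mul_pos (mul_pos (hFpos b hb) (hFpos c hc)) (sub_pos.2 h)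
    rw [← harea b hb c hc] at this
    exact (mul_pos_iff_of_pos_left hN).1 this
  have hmemE : ∀ {a b : ι}, a ∈ A → b ∈ A → b ≠ a →
      w b ∈ convexHull ℝ (w '' ((A.erase a : Finset ι) : Set ι)) := fun {a b} _ hb hne =>
    subset_convexHull ℝ _ ⟨b, Finset.mem_coe.2 (Finset.mem_erase.2 ⟨hne, hb⟩), rfl⟩
  have hinj : Set.InjOn s B := by
    -- Points of equal slope are collinear with `a₀`, and the nearer one would be a convex
    -- combination of `a₀` and the farther one.
    have key : ∀ b ∈ B, ∀ c ∈ B, s b = s c → F b ≤ F c → b = c := by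
      intro b hb c hc h hle
      by_contra hne
      have hbA := Finset.mem_of_mem_erase hb
      refine hw b hbA ?_
      have hr : w b = (1 - F b / F c) • w a₀ + (F b / F c) • w c := by
        have h1 := harea b hb c hc
        rw [h, sub_self, mul_zero] at h1
        have h2 := (mul_eq_zero.1 h1).resolve_left hN.ne'
        have h3 := hFpos c hc
        have e1 : F c * (w b).1 = F c * (w a₀).1 + F b * ((w c).1 - (w a₀).1) := by
          simp only [hF]; simp only [area2] at h2
          linear_combination f2 * h2
        have e2 : F c * (w b).2 = F c * (w a₀).2 + F b * ((w c).2 - (w a₀).2) := by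
          simp only [hF]; simp only [area2] at h2
          linear_combination (-f1) * h2
        ext
        · simp only [Prod.fst_add, Prod.smul_fst, smul_eq_mul]; field_simp; linarith
        · simp only [Prod.snd_add, Prod.smul_snd, smul_eq_mul]; field_simp; linarith
      rw [hr]
      refine convex_convexHull ℝ _ (hmemE hbA ha₀ (Finset.ne_of_mem_erase hb).symm)
        (hmemE hbA (Finset.mem_of_mem_erase hc) (Ne.symm hne)) ?_
        (div_nonneg (hFpos b hb).le (hFpos c hc).le) (by ring)
      rw [sub_nonneg, div_le_one (hFpos c hc)]
      exact hle
    intro b hb c hc h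
    rcases le_total (F b) (F c) with hle | hle
    · exact key b hb c hc h hle
    · exact (key c hc b hb h.symm hle).symm
  set k := (B.image s).card with hk
  have hkc : k = A.card - 1 := by
    rw [hk, Finset.card_image_of_injOn hinj, hB, Finset.card_erase_of_mem ha₀]
  have hex : ∀ j : Fin k, ∃ b ∈ B, s b = (B.image s).orderEmbOfFin rfl j := fun j =>
    Finset.mem_image.1 (Finset.orderEmbOfFin_mem _ rfl j)
  choose g hgB hgs using hex
  set σ : ℕ → ι := fun j => if h : j - 1 < k then (if j = 0 then a₀ else g ⟨j - 1, h⟩) else a₀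
    with hσ
  have hσ0 : σ 0 = a₀ := by simp [hσ]
  have hσg : ∀ j, 0 < j → ∀ h : j ≤ k, σ j = g ⟨j - 1, by omega⟩ := by
    intro j h0 h
    have : j - 1 < k := by omega
    simp [hσ, this, h0.ne']
  have hσB : ∀ j, 0 < j → j ≤ k → σ j ∈ B := fun j h0 h => by rw [hσg j h0 h]; exact hgB _
  have hσs : ∀ i j, 0 < i → i < j → j ≤ k → s (σ i) < s (σ j) := by
    intro i j h0 hij hj
    rw [hσg i h0 (by omega), hσg j (by omega) hj, hgs, hgs, OrderEmbedding.lt_iff_lt, Fin.lt_def]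
    simp only
    omega
  refine ⟨σ, k, by omega, ?_, ?_⟩
  · ext a
    rw [mem_seg]
    constructor
    · rintro ⟨j, -, hj, rfl⟩
      rcases Nat.eq_zero_or_pos j with rfl | h0
      · rwa [hσ0]
      · exact Finset.mem_of_mem_erase (hσB j h0 hj)
    · intro ha
      by_cases haa : a = a₀
      · exact ⟨0, le_rfl, Nat.zero_le _, hσ0.trans haa.symm⟩
      · have haB : a ∈ B := Finset.mem_erase.2 ⟨haa, ha⟩
        have h1 : s a ∈ Set.range ((B.image s).orderEmbOfFin rfl) := by
          rw [Finset.range_orderEmbOfFin]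
          exact Finset.mem_coe.2 (Finset.mem_image_of_mem s haB)
        obtain ⟨j, hj⟩ := h1
        refine ⟨j + 1, Nat.zero_le _, j.2, ?_⟩
        rw [hσg (j + 1) (Nat.succ_pos _) j.2]
        exact hinj (hgB _) haB ((hgs _).trans hj)
  · intro i j l hij hjl hl
    rcases Nat.eq_zero_or_pos i with rfl | h0
    · rw [hσ0]
      exact hpos _ (hσB j hij (by omega)) _ (hσB l (by omega) hl) (hσs j l hij hjl hl)
    -- If the turn at the middle vertex is not to the left, this vertex lies in the triangle of `a₀`
    -- and the other two.
    · by_contra! hle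
      have hiB := hσB i h0 (by omega)
      have hjB := hσB j (by omega) (by omega)
      have hlB := hσB l (by omega) hl
      have hij' := hσs i j h0 hij (by omega)
      have hjl' := hσs j l (by omega) hjl hl
      obtain ⟨x, hx, hxj⟩ := mem_triangle (y := w) (P := w (σ j))
        (hpos _ hiB _ hlB (hij'.trans hjl')) (hpos _ hiB _ hjB hij').le (by
          have e : area2 (w (σ i)) (w (σ l)) (w (σ j)) = -area2 (w (σ i)) (w (σ j)) (w (σ l)) := by
            simp only [area2]; ring
          rw [e]; linarith) (by
          rw [← area2_rotate]
          exact (hpos _ hjB _ hlB hjl').le)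
      refine hw (σ j) (Finset.mem_of_mem_erase hjB) ?_
      rw [← hxj]
      refine convexHull_mono (Set.image_mono ?_) (mem_convexHull_image_iff.2 ⟨x, hx, rfl⟩)
      intro c hc
      simp only [Finset.coe_insert, Finset.coe_singleton, Set.mem_insert_iff,
        Set.mem_singleton_iff] at hc
      rw [Finset.mem_coe, Finset.mem_erase]
      rcases hc with rfl | rfl | rfl
      · exact ⟨(Finset.ne_of_mem_erase hjB).symm, ha₀⟩
      · exact ⟨fun h => by rw [h] at hij'; exact lt_irrefl _ hij', Finset.mem_of_mem_erase hiB⟩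
      · exact ⟨fun h => by rw [h] at hjl'; exact lt_irrefl _ hjl', Finset.mem_of_mem_erase hlB⟩

/-- Affine functions on the plane. -/
def IsAff (l : ℝ × ℝ → ℝ) : Prop := ∃ α β γ : ℝ, ∀ P, l P = α + β * P.1 + γ * P.2

omit [DecidableEq ι] in
theorem isAff_area2 (a b : ℝ × ℝ) : IsAff (area2 a b) :=
  ⟨-((b.1 - a.1) * a.2 - (b.2 - a.2) * a.1), -(b.2 - a.2), b.1 - a.1, fun P => by
    simp only [area2]; ring⟩

omit [DecidableEq ι] in
theorem IsAff.add_mul {l l' : ℝ × ℝ → ℝ} (h : IsAff l) (h' : IsAff l') (r : ℝ) :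
    IsAff fun P => l P + r * l' P := by
  obtain ⟨α, β, γ, h⟩ := h
  obtain ⟨α', β', γ', h'⟩ := h'
  exact ⟨α + r * α', β + r * β', γ + r * γ', fun P => by simp only [h, h']; ring⟩

omit [DecidableEq ι] in
/-- An affine function vanishing at `a` and `b` is a multiple of the area. -/
theorem IsAff.mul_area2 {l : ℝ × ℝ → ℝ} (h : IsAff l) {a b : ℝ × ℝ} (ha : l a = 0) (hb : l b = 0)
    (c P : ℝ × ℝ) : l P * area2 a b c = l c * area2 a b P := by
  obtain ⟨α, β, γ, h⟩ := h
  rw [h] at ha hb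
  rw [h, h]
  simp only [area2]
  linear_combination ((P.1 - c.1) * b.2 - (P.2 - c.2) * b.1 + (P.2 * c.1 - P.1 * c.2)) * ha -
    ((P.1 - c.1) * a.2 - (P.2 - c.2) * a.1 + (P.2 * c.1 - P.1 * c.2)) * hb

/-- The triangulation of a convex polygon given by the lower hull of the heights `u`. -/
theorem exists_lowerHull (h : ConvexlyOrdered σ n w) (hn : 2 ≤ n) (u : ι → ℝ) :
    ∃ T, IsTri σ 0 n T ∧ ∀ t ∈ T, ∃ l, IsAff l ∧ (∀ a ∈ t, l (w a) = u a) ∧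
      ∀ k ≤ n, l (w (σ k)) ≤ u (σ k) := by
  have key : ∀ d i j, j - i = d → i < j → j ≤ n → ∀ l₀, IsAff l₀ → l₀ (w (σ i)) = u (σ i) →
      l₀ (w (σ j)) = u (σ j) → (∀ k ≤ n, l₀ (w (σ k)) ≤ u (σ k)) →
      ∃ T, IsTri σ i j T ∧ ∀ t ∈ T, ∃ l, IsAff l ∧ (∀ a ∈ t, l (w a) = u a) ∧
        ∀ k ≤ n, l (w (σ k)) ≤ u (σ k) := by
    intro d
    induction d using Nat.strong_induction_on with
    | _ d ih =>
      intro i j hd hij hj l₀ hl₀ hi₀ hj₀ hle₀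
      by_cases hleaf : j = i + 1
      · exact ⟨∅, hleaf ▸ IsTri.leaf i, by simp⟩
      -- Tilt `l₀` about the line through `σ i` and `σ j`, upwards on the vertices between them,
      -- until the first of these is touched. On the remaining vertices the tilt only lowers the
      -- function, so it stays below the heights.
      set r : ℕ → ℝ := fun c => (u (σ c) - l₀ (w (σ c))) /
        (-area2 (w (σ i)) (w (σ j)) (w (σ c))) with hr
      obtain ⟨m, hm, hmin⟩ := (Finset.Ioo i j).exists_min_image r
        ⟨i + 1, by rw [Finset.mem_Ioo]; omega⟩
      rw [Finset.mem_Ioo] at hm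
      have hneg : ∀ c, i < c → c < j → 0 < -area2 (w (σ i)) (w (σ j)) (w (σ c)) :=
        fun c h1 h2 => by linarith [h.neg_inside h1 h2 hj]
      have hrm : 0 ≤ r m := div_nonneg (by linarith [hle₀ m (by omega)]) (hneg m hm.1 hm.2).le
      set l : ℝ × ℝ → ℝ := fun P => l₀ P + (-r m) * area2 (w (σ i)) (w (σ j)) P with hl
      have hlA : IsAff l := hl₀.add_mul (isAff_area2 _ _) _
      have hli : l (w (σ i)) = u (σ i) := by simp [hl, hi₀]
      have hlj : l (w (σ j)) = u (σ j) := by simp [hl, hj₀]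
      have hlm : l (w (σ m)) = u (σ m) := by
        have := (h.neg_inside hm.1 hm.2 hj).ne
        simp only [hl, hr]
        field_simp
        ring
      have hle : ∀ k ≤ n, l (w (σ k)) ≤ u (σ k) := by
        intro k hk
        by_cases hin : i < k ∧ k < j
        · have h1 := hmin k (Finset.mem_Ioo.2 hin)
          have h2 := hneg k hin.1 hin.2
          have h3 : r k * (-area2 (w (σ i)) (w (σ j)) (w (σ k))) =
              u (σ k) - l₀ (w (σ k)) := by
            simp only [hr]
            exact div_mul_cancel₀ _ h2.ne'
          simp only [hl]
          nlinarith
        · have h1 := h.nonneg_outside hij hj hk (by omega)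
          have h2 := hle₀ k hk
          simp only [hl]
          nlinarith [mul_nonneg hrm h1]
      obtain ⟨T₁, hT₁, h₁⟩ := ih (m - i) (by omega) i m rfl hm.1 (by omega) l hlA hli hlm hle
      obtain ⟨T₂, hT₂, h₂⟩ := ih (j - m) (by omega) m j rfl hm.2 hj l hlA hlm hlj hle
      refine ⟨_, IsTri.node hT₁ hT₂, ?_⟩
      rintro t (rfl | ht | ht)
      · refine ⟨l, hlA, fun a ha => ?_, hle⟩
        simp only [Finset.mem_insert, Finset.mem_singleton] at ha
        rcases ha with rfl | rfl | rfl
        · exact hli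
        · exact hlm
        · exact hlj
      · exact h₁ t ht
      · exact h₂ t ht
  set a := w (σ 0)
  set b := w (σ n)
  have hab : a ≠ b := h.ne hn (by omega) le_rfl
  set N := (b.1 - a.1) ^ 2 + (b.2 - a.2) ^ 2 with hN
  have hN0 : 0 < N := by
    by_contra! hle
    apply hab
    ext <;> nlinarith [sq_nonneg (b.1 - a.1), sq_nonneg (b.2 - a.2)]
  set l₁ : ℝ × ℝ → ℝ := fun P => u (σ 0) + ((u (σ n) - u (σ 0)) / N) *
    ((b.1 - a.1) * (P.1 - a.1) + (b.2 - a.2) * (P.2 - a.2)) with hl₁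
  have hl₁A : IsAff l₁ := ⟨u (σ 0) - ((u (σ n) - u (σ 0)) / N) *
    ((b.1 - a.1) * a.1 + (b.2 - a.2) * a.2), ((u (σ n) - u (σ 0)) / N) * (b.1 - a.1),
    ((u (σ n) - u (σ 0)) / N) * (b.2 - a.2), fun P => by simp only [hl₁]; ring⟩
  -- `l₁` interpolates the two ends of the base side. The area is negative at all other vertices, so
  -- a large multiple of it pushes the function below the heights there.
  obtain ⟨M, hM⟩ := ((Finset.range (n + 1)).image fun k => (l₁ (w (σ k)) - u (σ k)) /
    (-area2 a b (w (σ k)))).bddAbove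
  refine key n 0 n (by omega) (by omega) le_rfl (fun P => l₁ P + M * area2 a b P)
    (hl₁A.add_mul (isAff_area2 _ _) _) (by simp [hl₁, a]) ?_ ?_
  · simp only [hl₁]
    change u (σ 0) + (u (σ n) - u (σ 0)) / N * ((b.1 - a.1) * (b.1 - a.1) +
      (b.2 - a.2) * (b.2 - a.2)) + M * area2 a b b = _
    rw [area2_right, ← sq, ← sq, ← hN]
    field_simp
    ring
  · intro k hk
    rcases Nat.eq_zero_or_pos k with rfl | h0
    · simp [hl₁, a]
    rcases Nat.eq_or_lt_of_le hk with rfl | hlt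
    · simp only [hl₁]
      change u (σ 0) + (u (σ k) - u (σ 0)) / N * ((b.1 - a.1) * (b.1 - a.1) +
        (b.2 - a.2) * (b.2 - a.2)) + M * area2 a b b ≤ _
      rw [area2_right, ← sq, ← sq, ← hN]
      field_simp
      linarith
    · have h1 : 0 < -area2 a b (w (σ k)) := by linarith [h.neg_inside h0 hlt le_rfl]
      have h2 := hM (Finset.mem_coe.2 (Finset.mem_image_of_mem _ (Finset.mem_range.2
        (Nat.lt_succ_of_le hk))))
      rw [div_le_iff₀ h1] at h2
      linarith

/-- The sides of the polygon. -/
def IsSide (σ : ℕ → ι) (n : ℕ) (a b : ι) : Prop :=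
  (∃ k < n, a = σ k ∧ b = σ (k + 1)) ∨ (a = σ 0 ∧ b = σ n)

theorem IsTri.isSide_subset {T : Set (Finset ι)} (hT : IsTri σ 0 n T) {a b : ι}
    (h : IsSide σ n a b) : stdSimp {a, b} ⊆ triReal {σ 0, σ n} T := by
  rcases h with ⟨k, hk, rfl, rfl⟩ | ⟨rfl, rfl⟩
  · exact hT.side_subset (Nat.zero_le _) hk
  · exact Set.subset_union_left

theorem IsTri.triReal_eq {T : Set (Finset ι)} (hn : 2 ≤ n) (hT : IsTri σ 0 n T) :
    triReal {σ 0, σ n} T = ⋃ t ∈ T, stdSimp t := by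
  refine Set.union_eq_right.2 ?_
  cases hT with
  | leaf => omega
  | @node _ m _ T₁ T₂ h1 h2 =>
    intro x hx
    refine Set.mem_iUnion₂.2 ⟨{σ 0, σ m, σ n}, Set.mem_insert _ _, stdSimp_mono ?_ hx⟩
    intro a; simp only [Finset.mem_insert, Finset.mem_singleton]; tauto

omit [DecidableEq ι] in
/-- A nonconstant affine function attains its maximum over the vertices only on a side. -/
theorem ConvexlyOrdered.exists_side (h : ConvexlyOrdered σ n w) (hn : 2 ≤ n) {l : ℝ × ℝ → ℝ}
    (hl : IsAff l) {M : ℝ} (hle : ∀ k ≤ n, l (w (σ k)) ≤ M) (hne : ∃ k ≤ n, l (w (σ k)) ≠ M) :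
    ∃ a b, IsSide σ n a b ∧ ∀ k ≤ n, l (w (σ k)) = M → σ k = a ∨ σ k = b := by
  obtain ⟨k₀, hk₀, hk₀M⟩ := hne
  obtain ⟨α, β, γ, hαβ⟩ := id hl
  set g : ℝ × ℝ → ℝ := fun P => l P - M with hg
  have hgA : IsAff g := ⟨α - M, β, γ, fun P => by simp only [hg, hαβ]; ring⟩
  have hgle : ∀ k ≤ n, g (w (σ k)) ≤ 0 := fun k hk => by simp only [hg]; linarith [hle k hk]
  have area_ne : ∀ i j k, i < j → j ≤ n → k ≤ n → k ≠ i → k ≠ j →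
      area2 (w (σ i)) (w (σ j)) (w (σ k)) ≠ 0 := by
    intro i j k hij hj hk h1 h2
    by_cases hin : i < k ∧ k < j
    · exact (h.neg_inside hin.1 hin.2 hj).ne
    · exact (h.pos_outside hij hj hk (by omega)).ne'
  -- a third maximum would make the function constant
  have third : ∀ i j k, i < j → j ≤ n → k ≤ n → l (w (σ i)) = M → l (w (σ j)) = M →
      l (w (σ k)) = M → k ≠ i → k ≠ j → False := by
    intro i j k hij hj hk hi hj' hk' h1 h2
    have e := hgA.mul_area2 (a := w (σ i)) (b := w (σ j)) (by simp [hg, hi]) (by simp [hg, hj'])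
      (w (σ k)) (w (σ k₀))
    have : g (w (σ k)) = 0 := by simp [hg, hk']
    rw [this, zero_mul] at e
    have := (mul_eq_zero.1 e).resolve_right (area_ne i j k hij hj hk h1 h2)
    simp only [hg] at this
    exact hk₀M (by linarith)
  by_cases htwo : ∃ i j, i < j ∧ j ≤ n ∧ l (w (σ i)) = M ∧ l (w (σ j)) = M
  · obtain ⟨i, j, hij, hj, hi', hj'⟩ := htwo
    refine ⟨σ i, σ j, ?_, fun k hk hk' => ?_⟩
    · by_contra hns
      have h1 : i + 1 < j := by
        by_contra hcon
        exact hns (Or.inl ⟨i, by omega, rfl, by congr 1; omega⟩)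
      obtain ⟨k, hk, hkout⟩ : ∃ k ≤ n, k < i ∨ j < k := by
        by_cases hi0 : i = 0
        · refine ⟨n, le_rfl, Or.inr ?_⟩
          by_contra hcon
          exact hns (Or.inr ⟨by rw [hi0], by congr 1; omega⟩)
        · exact ⟨0, by omega, Or.inl (by omega)⟩
      have e := hgA.mul_area2 (a := w (σ i)) (b := w (σ j)) (by simp [hg, hi'])
        (by simp [hg, hj']) (w (σ (i + 1))) (w (σ k))
      have a1 := h.neg_inside (Nat.lt_succ_self i) h1 hj
      have a2 := h.pos_outside hij hj hk hkout
      have b1 := hgle (i + 1) (by omega)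
      have b2 := hgle k hk
      have h0 : g (w (σ k)) = 0 := by
        by_contra hne
        have : g (w (σ k)) < 0 := lt_of_le_of_ne b2 hne
        nlinarith [mul_pos_of_neg_of_neg this a1]
      refine third i j k hij hj hk hi' hj' ?_ (by omega) (by omega)
      simp only [hg] at h0
      linarith
    · by_contra! hcon
      exact third i j k hij hj hk hi' hj' hk' (fun e => hcon.1 (by rw [e]))
        (fun e => hcon.2 (by rw [e]))
  · push Not at htwo
    by_cases hone : ∃ i ≤ n, l (w (σ i)) = M
    · obtain ⟨i, hi, hi'⟩ := hone
      have uniq : ∀ k ≤ n, l (w (σ k)) = M → k = i := by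
        intro k hk hk'
        rcases lt_trichotomy k i with hlt | rfl | hlt
        · exact absurd hi' (htwo k i hlt hi hk')
        · rfl
        · exact absurd hk' (htwo i k hlt hk hi')
      by_cases hin : i = n
      · exact ⟨σ 0, σ n, Or.inr ⟨rfl, rfl⟩, fun k hk hk' => Or.inr (by rw [uniq k hk hk', hin])⟩
      · exact ⟨σ i, σ (i + 1), Or.inl ⟨i, by omega, rfl, rfl⟩,
          fun k hk hk' => Or.inl (by rw [uniq k hk hk'])⟩
    · push Not at hone
      exact ⟨σ 0, σ n, Or.inr ⟨rfl, rfl⟩, fun k hk hk' => absurd hk' (hone k hk)⟩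

/-- The midpoint of two vertices, in barycentric coordinates. -/
noncomputable def midpt (a b : ι) : ι → ℝ := fun c => if c = a ∨ c = b then 1 / 2 else 0

theorem midpt_mem {a b : ι} (h : a ≠ b) : midpt a b ∈ stdSimp {a, b} := by
  refine ⟨fun c => ?_, fun c hc => ?_, ?_⟩
  · simp only [midpt]; split_ifs <;> norm_num
  · simp only [Finset.mem_insert, Finset.mem_singleton] at hc
    simp [midpt, hc]
  · rw [Finset.sum_pair h]; simp [midpt]; norm_num

/-- A geometric triangulation of a convex polygon arises by recursion. -/
theorem exists_isTri (h : ConvexlyOrdered σ n w) (hn : 2 ≤ n) {TF : Set (Finset ι)}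
    (hcard : ∀ t ∈ TF, t.card = 3) (hsub : ∀ t ∈ TF, t ⊆ seg σ 0 n)
    (hcov : ∀ x ∈ stdSimp (seg σ 0 n), ∃ t ∈ TF, ∃ x' ∈ stdSimp t, bary w x' = bary w x)
    (hinj : Set.InjOn (bary w) (⋃ t ∈ TF, stdSimp t)) : IsTri σ 0 n TF := by
  have hσ := h.injOn hn
  have hfin : TF.Finite := (Finset.finite_toSet (seg σ 0 n).powerset).subset
    fun t ht => Finset.mem_coe.2 (Finset.mem_powerset.2 (hsub t ht))
  have hσne : ∀ {i j}, i < j → j ≤ n → σ i ≠ σ j := fun {i j} hij hj e =>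
    h.ne hn hij hj (congrArg w e)
  have hpairseg : ∀ {i j}, i ≤ n → j ≤ n → ({σ i, σ j} : Finset ι) ⊆ seg σ 0 n := by
    intro i j hi hj a ha
    simp only [Finset.mem_insert, Finset.mem_singleton] at ha
    rcases ha with rfl | rfl
    · exact mem_seg.2 ⟨i, Nat.zero_le _, hi, rfl⟩
    · exact mem_seg.2 ⟨j, Nat.zero_le _, hj, rfl⟩
  have key : ∀ d i j, j - i = d → i < j → j ≤ n → (∃ t ∈ TF, σ i ∈ t ∧ σ j ∈ t) →
      ∃ T, IsTri σ i j T ∧ T ⊆ TF := by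
    intro d
    induction d using Nat.strong_induction_on with
    | _ d ih =>
      rintro i j hd hij hj ⟨t₀, ht₀, hi₀, hj₀⟩
      by_cases hleaf : j = i + 1
      · exact ⟨∅, hleaf ▸ IsTri.leaf i, by simp⟩
      have hμ := midpt_mem (hσne hij hj)
      have hμ₀ : midpt (σ i) (σ j) ∈ stdSimp t₀ := stdSimp_mono (by
        intro a ha
        simp only [Finset.mem_insert, Finset.mem_singleton] at ha
        rcases ha with rfl | rfl
        · exact hi₀
        · exact hj₀) hμ
      have hμs := stdSimp_mono (hpairseg (by omega) hj) hμ
      set μ := midpt (σ i) (σ j) with hμdef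
      set ν : ι → ℝ := Pi.single (σ (i + 1)) 1 with hν
      have hνs : ν ∈ stdSimp (seg σ 0 n) :=
        single_mem_stdSimp (mem_seg.2 ⟨i + 1, Nat.zero_le _, by omega, rfl⟩)
      -- Move slightly from the midpoint of the diagonal towards a vertex beyond it. Triangles that
      -- miss the midpoint are closed and are avoided, so the triangle reached contains the
      -- midpoint, hence by injectivity both ends of the diagonal, and it has a vertex strictly
      -- beyond. That vertex is the apex of the recursion.
      set U : Set (ℝ × ℝ) := ⋃ t ∈ {t ∈ TF | bary w μ ∉ convexHull ℝ (w '' (t : Set ι))},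
        convexHull ℝ (w '' (t : Set ι)) with hU
      have hUc : IsClosed U := (hfin.subset (Set.sep_subset _ _)).isClosed_biUnion
        fun t _ => ((t.finite_toSet).image w).isClosed_convexHull ℝ
      have hμU : bary w μ ∉ U := by
        intro hmem
        obtain ⟨t, ht, hmem⟩ := Set.mem_iUnion₂.1 hmem
        exact ht.2 hmem
      have htend : Filter.Tendsto (fun ε : ℝ => (1 - ε) • bary w μ + ε • bary w ν) (𝓝[>] 0)
          (𝓝 (bary w μ)) := by
        have h1 : Filter.Tendsto (fun ε : ℝ => (1 - ε) • bary w μ + ε • bary w ν) (𝓝 0)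
            (𝓝 ((1 - (0 : ℝ)) • bary w μ + (0 : ℝ) • bary w ν)) :=
          (by fun_prop : Continuous fun ε : ℝ =>
            (1 - ε) • bary w μ + ε • bary w ν).tendsto 0
        simp only [sub_zero, one_smul, zero_smul, add_zero] at h1
        exact h1.mono_left nhdsWithin_le_nhds
      obtain ⟨ε, ⟨hεU, hε1⟩, hε0⟩ := ((htend.eventually (hUc.isOpen_compl.mem_nhds hμU)).and
        (nhdsWithin_le_nhds (Iio_mem_nhds (zero_lt_one' ℝ)))).and self_mem_nhdsWithin |>.exists
      replace hε0 : 0 < ε := hε0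
      replace hε1 : ε < 1 := hε1
      set ξ := (1 - ε) • μ + ε • ν with hξ
      have hξs : ξ ∈ stdSimp (seg σ 0 n) :=
        convex_stdSimp _ hμs hνs (by linarith) hε0.le (by ring)
      have hξb : bary w ξ = (1 - ε) • bary w μ + ε • bary w ν :=
        bary_add w hμs.2.1 hνs.2.1 _ _
      obtain ⟨t, ht, x, hx, hxξ⟩ := hcov ξ hξs
      have hμt : bary w μ ∈ convexHull ℝ (w '' (t : Set ι)) := by
        by_contra hcon
        refine hεU (Set.mem_iUnion₂.2 ⟨t, ⟨ht, hcon⟩, ?_⟩)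
        rw [← hξb, ← hxξ]
        exact mem_convexHull_image_iff.2 ⟨x, hx, rfl⟩
      obtain ⟨x', hx', hx'μ⟩ := mem_convexHull_image_iff.1 hμt
      have hx'eq : x' = μ := hinj (Set.mem_iUnion₂.2 ⟨t, ht, hx'⟩)
        (Set.mem_iUnion₂.2 ⟨t₀, ht₀, hμ₀⟩) hx'μ
      have hit : σ i ∈ t := by
        by_contra hcon
        have := hx'.2.1 _ hcon
        rw [hx'eq] at this
        norm_num [hμdef, midpt] at this
      have hjt : σ j ∈ t := by
        by_contra hcon
        have := hx'.2.1 _ hcon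
        rw [hx'eq] at this
        norm_num [hμdef, midpt] at this
      have hneg : area2 (w (σ i)) (w (σ j)) (bary w x) < 0 := by
        obtain ⟨α, β, γ, hl⟩ := isAff_area2 (w (σ i)) (w (σ j))
        have h1 : area2 (w (σ i)) (w (σ j)) (bary w μ) = 0 := by
          rw [area2_bary hμ, Finset.sum_pair (hσne hij hj)]; simp
        have h2 : area2 (w (σ i)) (w (σ j)) (bary w ν) < 0 := by
          rw [hν, bary_single]
          exact h.neg_inside (by omega) (by omega) hj
        rw [hxξ, hξb]
        have h3 : area2 (w (σ i)) (w (σ j)) ((1 - ε) • bary w μ + ε • bary w ν) =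
            (1 - ε) * area2 (w (σ i)) (w (σ j)) (bary w μ) +
            ε * area2 (w (σ i)) (w (σ j)) (bary w ν) := by
          rw [hl, hl, hl]
          simp only [Prod.fst_add, Prod.snd_add, Prod.smul_fst, Prod.smul_snd, smul_eq_mul]
          ring
        rw [h3, h1]
        nlinarith
      obtain ⟨c, hct, hc⟩ : ∃ c ∈ t, area2 (w (σ i)) (w (σ j)) (w c) < 0 := by
        by_contra! hcon
        rw [area2_bary hx] at hneg
        exact absurd hneg (not_lt.2 (Finset.sum_nonneg fun c hc => mul_nonneg (hx.1 c) (hcon c hc)))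
      obtain ⟨m, -, hmn, rfl⟩ := mem_seg.1 (hsub t ht hct)
      have him : i < m ∧ m < j := by
        by_contra hcon
        exact absurd hc (not_lt.2 (h.nonneg_outside hij hj hmn (by omega)))
      have hteq : t = {σ i, σ m, σ j} := by
        symm
        refine Finset.eq_of_subset_of_card_le ?_ ?_
        · intro a ha
          simp only [Finset.mem_insert, Finset.mem_singleton] at ha
          rcases ha with rfl | rfl | rfl
          · exact hit
          · exact hct
          · exact hjt
        · rw [hcard t ht, Finset.card_insert_of_notMem, Finset.card_insert_of_notMem,
            Finset.card_singleton]
          · simpa using hσne him.2 hj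
          · simp only [Finset.mem_insert, Finset.mem_singleton, not_or]
            exact ⟨hσne him.1 hmn, hσne hij hj⟩
      obtain ⟨T₁, hT₁, h₁⟩ := ih (m - i) (by omega) i m rfl him.1 hmn ⟨t, ht, hit, hct⟩
      obtain ⟨T₂, hT₂, h₂⟩ := ih (j - m) (by omega) m j rfl him.2 hj ⟨t, ht, hct, hjt⟩
      refine ⟨_, IsTri.node hT₁ hT₂, ?_⟩
      rw [← hteq]
      exact Set.insert_subset ht (Set.union_subset h₁ h₂)
  have h0n : 0 < n := by omega
  have hμ := midpt_mem (hσne h0n le_rfl)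
  obtain ⟨t, ht, x, hx, hxμ⟩ := hcov _ (stdSimp_mono (hpairseg (Nat.zero_le _) le_rfl) hμ)
  have hxp : x ∈ stdSimp {σ 0, σ n} := by
    have hz : ∑ c ∈ t, x c * -area2 (w (σ 0)) (w (σ n)) (w c) = 0 := by
      simp only [mul_neg, Finset.sum_neg_distrib]
      rw [← area2_bary hx, hxμ, area2_bary hμ, Finset.sum_pair (hσne h0n le_rfl)]; simp
    refine stdSimp_of_support hx fun c hc => ?_
    obtain ⟨hct, hc0⟩ := eq_zero_of_sum_eq_zero
      (f := fun c => -area2 (w (σ 0)) (w (σ n)) (w c)) hx (fun c hc => by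
      obtain ⟨k, -, hk, rfl⟩ := mem_seg.1 (hsub t ht hc)
      linarith [h.nonpos_inside (Nat.zero_le k) hk le_rfl]) hz hc
    obtain ⟨k, -, hk, rfl⟩ := mem_seg.1 (hsub t ht hct)
    by_cases h1 : k = 0
    · simp [h1]
    by_cases h2 : k = n
    · simp [h2]
    have := h.neg_inside (i := 0) (j := n) (k := k) (by omega) (by omega) le_rfl
    linarith
  have hxeq := bary_injOn_pair (h.ne hn h0n le_rfl) hxp hμ hxμ
  have hmem : ∀ k, k = 0 ∨ k = n → σ k ∈ t := by
    intro k hk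
    by_contra hcon
    have := hx.2.1 _ hcon
    rw [hxeq] at this
    rcases hk with rfl | rfl <;> norm_num [midpt] at this
  obtain ⟨T, hT, hTsub⟩ := key n 0 n (by omega) h0n le_rfl
    ⟨t, ht, hmem 0 (Or.inl rfl), hmem n (Or.inr rfl)⟩
  have hTeq : T = TF := by
    refine hTsub.antisymm fun s hs => ?_
    -- The barycenter of a triangle has all coordinates positive; injectivity therefore identifies
    -- this triangle with the triangle of `T` that covers the same planar point.
    set β : ι → ℝ := fun c => if c ∈ s then 1 / 3 else 0 with hβ
    have hβs : β ∈ stdSimp s := by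
      refine ⟨fun c => ?_, fun c hc => by simp [hβ, hc], ?_⟩
      · simp only [hβ]; split_ifs <;> norm_num
      · simp only [hβ, Finset.sum_ite_mem, Finset.inter_self, Finset.sum_const, hcard s hs]
        norm_num
    obtain ⟨x', hx', hx'β⟩ := (hT.bijOn h hn le_rfl).2 β (stdSimp_mono (hsub s hs) hβs)
    rw [hT.triReal_eq hn] at hx'
    obtain ⟨s', hs', hx's⟩ := Set.mem_iUnion₂.1 hx'
    have e := hinj (Set.mem_iUnion₂.2 ⟨s', hTsub hs', hx's⟩) (Set.mem_iUnion₂.2 ⟨s, hs, hβs⟩) hx'β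
    have hss : s ⊆ s' := by
      intro c hc
      by_contra hcon
      have := hx's.2.1 c hcon
      rw [e] at this
      norm_num [hβ, hc] at this
    rw [Finset.eq_of_subset_of_card_le hss (by rw [hcard s hs, hcard s' (hTsub hs')])]
    exact hs'
  exact hTeq ▸ hT

end Planar

end HypRigidity

/-! ### Developing triangles with prescribed edge lengths into the plane -/

namespace HypRigidity

section Planar

/-- The square of the Euclidean distance. -/
def sqD (a b : ℝ × ℝ) : ℝ := (a.1 - b.1) ^ 2 + (a.2 - b.2) ^ 2

theorem sqD_comm (a b : ℝ × ℝ) : sqD a b = sqD b a := by simp only [sqD]; ring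

@[simp] theorem sqD_self (a : ℝ × ℝ) : sqD a a = 0 := by simp [sqD]

theorem sqD_pos {a b : ℝ × ℝ} (h : a ≠ b) : 0 < sqD a b := by
  by_contra! hle
  apply h
  simp only [sqD] at hle
  ext <;> nlinarith [sq_nonneg (a.1 - b.1), sq_nonneg (a.2 - b.2)]

@[fun_prop] theorem continuous_sqD {X : Type*} [TopologicalSpace X] {f g : X → ℝ × ℝ}
    (hf : Continuous f) (hg : Continuous g) : Continuous fun x => sqD (f x) (g x) := by
  simp only [sqD]; fun_prop

@[fun_prop] theorem continuous_area2 {X : Type*} [TopologicalSpace X] {f g h : X → ℝ × ℝ}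
    (hf : Continuous f) (hg : Continuous g) (hh : Continuous h) :
    Continuous fun x => area2 (f x) (g x) (h x) := by
  simp only [area2]; fun_prop

/-- The relative position of the third vertex of a triangle with given edge lengths. -/
noncomputable def apexRatio (a b : ℝ × ℝ) (d₁ d₂ : ℝ) : ℝ := (d₁ - d₂ + sqD a b) / (2 * sqD a b)

/-- The squared relative height of a triangle with given edge lengths. -/
noncomputable def apexSq (a b : ℝ × ℝ) (d₁ d₂ : ℝ) : ℝ :=
  d₁ / sqD a b - apexRatio a b d₁ d₂ ^ 2

/-- The third vertex of a triangle with given edge lengths, to the right of the base. -/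
noncomputable def apex (a b : ℝ × ℝ) (d₁ d₂ : ℝ) : ℝ × ℝ :=
  (a.1 + apexRatio a b d₁ d₂ * (b.1 - a.1) + √(apexSq a b d₁ d₂) * (b.2 - a.2),
    a.2 + apexRatio a b d₁ d₂ * (b.2 - a.2) - √(apexSq a b d₁ d₂) * (b.1 - a.1))

theorem sqD_apex {a b : ℝ × ℝ} {d₁ d₂ : ℝ} (hab : 0 < sqD a b) (h : 0 ≤ apexSq a b d₁ d₂) :
    sqD a (apex a b d₁ d₂) = d₁ ∧ sqD b (apex a b d₁ d₂) = d₂ := by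
  have hr := Real.sq_sqrt h
  have hs : apexRatio a b d₁ d₂ * (2 * sqD a b) = d₁ - d₂ + sqD a b := by
    rw [apexRatio]; field_simp
  have hq : (apexRatio a b d₁ d₂ ^ 2 + √(apexSq a b d₁ d₂) ^ 2) * sqD a b = d₁ := by
    rw [hr, apexSq]; field_simp; ring
  have hL : sqD a b = (a.1 - b.1) ^ 2 + (a.2 - b.2) ^ 2 := rfl
  set L := sqD a b
  set s := apexRatio a b d₁ d₂
  set r := √(apexSq a b d₁ d₂)
  have e1 : sqD a (apex a b d₁ d₂) = (s ^ 2 + r ^ 2) * L := by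
    rw [hL]; simp only [sqD, apex, s, r]; ring
  have e2 : sqD b (apex a b d₁ d₂) = (s ^ 2 + r ^ 2) * L - s * (2 * L) + L := by
    rw [hL]; simp only [sqD, apex, s, r]; ring
  exact ⟨by rw [e1, hq], by rw [e2, hq, hs]; ring⟩

/-- Heron's formula; it keeps the radicand of `apex` away from zero near a nondegenerate triangle,
where the apex is then a smooth function of the lengths. -/
theorem apexSq_eq {a b c : ℝ × ℝ} (hab : 0 < sqD a b) :
    apexSq a b (sqD a c) (sqD b c) = (area2 a b c / sqD a b) ^ 2 := by
  rw [apexSq, apexRatio]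
  field_simp
  simp only [area2, sqD]
  ring

theorem apex_eq {a b c : ℝ × ℝ} (hab : 0 < sqD a b) (hc : area2 a b c < 0) :
    apex a b (sqD a c) (sqD b c) = c := by
  have hr : √(apexSq a b (sqD a c) (sqD b c)) = -area2 a b c / sqD a b := by
    rw [apexSq_eq hab, Real.sqrt_sq_eq_abs, abs_div, abs_of_neg hc, abs_of_pos hab]
  rw [apex, hr, apexRatio]
  ext
  · simp only
    field_simp
    simp only [area2, sqD]
    ring
  · simp only
    field_simp
    simp only [area2, sqD]
    ring

/-- The third vertex depends locally Lipschitz continuously on the edge lengths. -/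
theorem exists_apex_lipschitz {a b c : ℝ × ℝ} (hab : 0 < sqD a b) (hc : area2 a b c < 0) :
    ∃ K : ℝ, 1 ≤ K ∧ ∃ δ : ℝ, 0 < δ ∧ ∀ a₁ b₁ c₁ : ℝ × ℝ, dist a₁ a < δ → dist b₁ b < δ →
      dist c₁ c < δ → ∀ a₂ b₂ : ℝ × ℝ, ∀ d₁ d₂ r : ℝ, r < δ → dist a₂ a₁ ≤ r → dist b₂ b₁ ≤ r →
      |d₁ - sqD a₁ c₁| ≤ r → |d₂ - sqD b₁ c₁| ≤ r →
      ∃ c₂, sqD a₂ c₂ = d₁ ∧ sqD b₂ c₂ = d₂ ∧ dist c₂ c₁ ≤ K * r := by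
  set F : (ℝ × ℝ) × (ℝ × ℝ) × ℝ × ℝ → ℝ × ℝ := fun x => apex x.1 x.2.1 x.2.2.1 x.2.2.2 with hF
  set x₀ : (ℝ × ℝ) × (ℝ × ℝ) × ℝ × ℝ := (a, b, sqD a c, sqD b c) with hx₀
  have hL : ContDiff ℝ 1 fun x : (ℝ × ℝ) × (ℝ × ℝ) × ℝ × ℝ => sqD x.1 x.2.1 := by
    simp only [sqD]; fun_prop
  have hR : ContDiffAt ℝ 1 (fun x : (ℝ × ℝ) × (ℝ × ℝ) × ℝ × ℝ =>
      apexRatio x.1 x.2.1 x.2.2.1 x.2.2.2) x₀ := by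
    simp only [apexRatio]
    refine ContDiffAt.div ?_ ?_ ?_
    · exact ContDiffAt.add (by fun_prop) hL.contDiffAt
    · exact contDiffAt_const.mul hL.contDiffAt
    · simp only [hx₀]; positivity
  have hS : ContDiffAt ℝ 1 (fun x : (ℝ × ℝ) × (ℝ × ℝ) × ℝ × ℝ =>
      apexSq x.1 x.2.1 x.2.2.1 x.2.2.2) x₀ := by
    simp only [apexSq]
    refine ContDiffAt.sub ?_ (hR.pow 2)
    exact ContDiffAt.div (by fun_prop) hL.contDiffAt (by simp only [hx₀]; exact hab.ne')
  have hS0 : 0 < apexSq x₀.1 x₀.2.1 x₀.2.2.1 x₀.2.2.2 := by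
    simp only [hx₀]
    rw [apexSq_eq hab]
    exact sq_pos_of_neg (div_neg_of_neg_of_pos hc hab)
  have hQ := hS.sqrt hS0.ne'
  have hFd : ContDiffAt ℝ 1 F x₀ := by
    simp only [hF, apex]
    refine ContDiffAt.prodMk ?_ ?_
    · refine ContDiffAt.add (ContDiffAt.add (by fun_prop) (hR.mul (by fun_prop)))
        (hQ.mul (by fun_prop))
    · refine ContDiffAt.sub (ContDiffAt.add (by fun_prop) (hR.mul (by fun_prop)))
        (hQ.mul (by fun_prop))
  obtain ⟨K, s, hs, hLip⟩ := hFd.exists_lipschitzOnWith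
  have hev : ∀ᶠ x in 𝓝 x₀, x ∈ s ∧ 0 < apexSq x.1 x.2.1 x.2.2.1 x.2.2.2 ∧ 0 < sqD x.1 x.2.1 :=
    (Filter.eventually_mem_set.2 hs).and ((hS.continuousAt.eventually (lt_mem_nhds hS0)).and
      (hL.continuous.continuousAt.eventually (lt_mem_nhds (by simpa [hx₀] using hab))))
  obtain ⟨δ₁, hδ₁, hball⟩ := Metric.eventually_nhds_iff.1 hev
  have hcont : ContinuousAt (fun z : (ℝ × ℝ) × (ℝ × ℝ) × (ℝ × ℝ) =>
      ((z.1, z.2.1, sqD z.1 z.2.2, sqD z.2.1 z.2.2) : (ℝ × ℝ) × (ℝ × ℝ) × ℝ × ℝ))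
      (a, b, c) := by
    apply Continuous.continuousAt; fun_prop
  have hev2 : ∀ᶠ z : (ℝ × ℝ) × (ℝ × ℝ) × (ℝ × ℝ) in 𝓝 (a, b, c),
      dist ((z.1, z.2.1, sqD z.1 z.2.2, sqD z.2.1 z.2.2) : (ℝ × ℝ) × (ℝ × ℝ) × ℝ × ℝ) x₀ < δ₁ / 2 ∧
      area2 z.1 z.2.1 z.2.2 < 0 := by
    refine (hcont.eventually (Metric.ball_mem_nhds _ (half_pos hδ₁))).and ?_
    have hc3 : Continuous fun z : (ℝ × ℝ) × (ℝ × ℝ) × (ℝ × ℝ) => area2 z.1 z.2.1 z.2.2 := by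
      fun_prop
    exact (hc3.tendsto (a, b, c)).eventually (gt_mem_nhds hc)
  obtain ⟨δ₂, hδ₂, hball2⟩ := Metric.eventually_nhds_iff.1 hev2
  refine ⟨max 1 K, le_max_left _ _, min (δ₁ / 2) δ₂, lt_min (half_pos hδ₁) hδ₂, ?_⟩
  intro a₁ b₁ c₁ ha₁ hb₁ hc₁ a₂ b₂ d₁ d₂ r hr ha₂ hb₂ hd₁ hd₂
  obtain ⟨h1, h2⟩ := hball2 (y := (a₁, b₁, c₁)) (by
    rw [Prod.dist_eq, Prod.dist_eq]
    exact max_lt (ha₁.trans_le (min_le_right _ _)) (max_lt (hb₁.trans_le (min_le_right _ _))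
      (hc₁.trans_le (min_le_right _ _))))
  simp only at h1 h2
  obtain ⟨m1, -, p1⟩ := hball (h1.trans (half_lt_self hδ₁))
  simp only at p1
  have hdist : dist ((a₂, b₂, d₁, d₂) : (ℝ × ℝ) × (ℝ × ℝ) × ℝ × ℝ)
      (a₁, b₁, sqD a₁ c₁, sqD b₁ c₁) ≤ r := by
    rw [Prod.dist_eq, Prod.dist_eq, Prod.dist_eq]
    exact max_le ha₂ (max_le hb₂ (max_le hd₁ hd₂))
  obtain ⟨m2, q2, p2⟩ := hball (y := (a₂, b₂, d₁, d₂)) (by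
    refine (dist_triangle _ _ _).trans_lt (lt_of_lt_of_eq
      (add_lt_add_of_le_of_lt (hdist.trans (hr.le.trans (min_le_left _ _))) h1) (by ring)))
  obtain ⟨e1, e2⟩ := sqD_apex p2 q2.le
  refine ⟨apex a₂ b₂ d₁ d₂, e1, e2, ?_⟩
  have h3 := hLip.dist_le_mul _ m2 _ m1
  simp only [hF] at h3
  rw [apex_eq p1 h2] at h3
  refine h3.trans ?_
  calc (K : ℝ) * _ ≤ K * r := mul_le_mul_of_nonneg_left hdist K.2
    _ ≤ max 1 K * r := mul_le_mul_of_nonneg_right (le_max_right _ _) (dist_nonneg.trans ha₂)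

variable {ι : Type*} {σ : ℕ → ι} {n : ℕ}

/-- Convexity of a polygon is stable. -/
theorem ConvexlyOrdered.stable {w : ι → ℝ × ℝ} (h : ConvexlyOrdered σ n w) :
    ∃ ε > 0, ∀ y : ι → ℝ × ℝ, (∀ k ≤ n, dist (y (σ k)) (w (σ k)) < ε) →
      ConvexlyOrdered σ n y := by
  have key : ∀ z ∈ (Finset.range (n + 1) ×ˢ Finset.range (n + 1) ×ˢ Finset.range (n + 1)),
      ∀ᶠ ε : ℝ in 𝓝[>] 0, z.1 < z.2.1 → z.2.1 < z.2.2 → ∀ y : ι → ℝ × ℝ,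
      (∀ k ≤ n, dist (y (σ k)) (w (σ k)) < ε) →
      0 < area2 (y (σ z.1)) (y (σ z.2.1)) (y (σ z.2.2)) := by
    rintro ⟨i, j, k⟩ hz
    simp only [Finset.mem_product, Finset.mem_range] at hz
    by_cases hijk : i < j ∧ j < k
    · have hc : Continuous fun z : (ℝ × ℝ) × (ℝ × ℝ) × (ℝ × ℝ) => area2 z.1 z.2.1 z.2.2 := by
        fun_prop
      obtain ⟨δ, hδ, hb⟩ := Metric.eventually_nhds_iff.1 (hc.continuousAt.eventually
        (lt_mem_nhds (h i j k hijk.1 hijk.2 (by omega)) :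
          {x | 0 < x} ∈ 𝓝 (area2 ((w (σ i), w (σ j), w (σ k)) : (ℝ × ℝ) × (ℝ × ℝ) × (ℝ × ℝ)).1
            (w (σ j)) (w (σ k)))))
      filter_upwards [Ioo_mem_nhdsGT hδ] with ε hε _ _ y hy
      refine hb (y := (y (σ i), y (σ j), y (σ k))) ?_
      rw [Prod.dist_eq, Prod.dist_eq]
      exact max_lt ((hy i (by omega)).trans hε.2) (max_lt ((hy j (by omega)).trans hε.2)
        ((hy k (by omega)).trans hε.2))
    · exact Filter.Eventually.of_forall fun ε h1 h2 => absurd ⟨h1, h2⟩ hijk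
  have := ((Filter.eventually_all_finset _).2 key).and self_mem_nhdsWithin
  obtain ⟨ε, h1, h2⟩ := this.exists
  refine ⟨ε, h2, fun y hy i j k hij hjk hk => ?_⟩
  exact h1 (i, j, k) (by simp only [Finset.mem_product, Finset.mem_range]; omega) hij hjk y hy

variable [DecidableEq ι]

/-- The triangles of a triangulated polygon with prescribed edge lengths can be developed into the
plane, close to a given polygon whose edge lengths are close to the prescribed ones. -/
theorem exists_development {w₀ : ι → ℝ × ℝ} (h : ConvexlyOrdered σ n w₀) (hn : 2 ≤ n) :
    ∃ C : ℝ, 0 < C ∧ ∃ δ : ℝ, 0 < δ ∧ ∀ w : ι → ℝ × ℝ,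
      (∀ k ≤ n, dist (w (σ k)) (w₀ (σ k)) < δ) → ∀ T, IsTri σ 0 n T → ∀ (M : ι → ι → ℝ) (r : ℝ),
      r < δ → (∀ a, M a a = 0) → (∀ a b, M a b = M b a) →
      (∀ a ∈ seg σ 0 n, ∀ b ∈ seg σ 0 n, |M a b - sqD (w a) (w b)| ≤ r) →
      ∃ y : ι → ℝ × ℝ, (∀ k ≤ n, dist (y (σ k)) (w (σ k)) ≤ C * r) ∧
        ∀ t ∈ T, ∀ a ∈ t, ∀ b ∈ t, sqD (y a) (y b) = M a b := by
  have hinj := h.injOn hn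
  -- uniform constants for the apexes
  have hK : ∃ K : ℝ, 1 ≤ K ∧ ∃ δ : ℝ, 0 < δ ∧ ∀ i m j, i < m → m < j → j ≤ n →
      ∀ a₁ b₁ c₁ : ℝ × ℝ, dist a₁ (w₀ (σ i)) < δ → dist b₁ (w₀ (σ j)) < δ →
      dist c₁ (w₀ (σ m)) < δ → ∀ a₂ b₂ : ℝ × ℝ, ∀ d₁ d₂ r : ℝ, r < δ → dist a₂ a₁ ≤ r →
      dist b₂ b₁ ≤ r → |d₁ - sqD a₁ c₁| ≤ r → |d₂ - sqD b₁ c₁| ≤ r →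
      ∃ c₂, sqD a₂ c₂ = d₁ ∧ sqD b₂ c₂ = d₂ ∧ dist c₂ c₁ ≤ K * r := by
    have : ∀ z : ℕ × ℕ × ℕ, ∃ K : ℝ, 1 ≤ K ∧ ∃ δ : ℝ, 0 < δ ∧ (z.1 < z.2.1 → z.2.1 < z.2.2 →
        z.2.2 ≤ n → ∀ a₁ b₁ c₁ : ℝ × ℝ, dist a₁ (w₀ (σ z.1)) < δ → dist b₁ (w₀ (σ z.2.2)) < δ →
        dist c₁ (w₀ (σ z.2.1)) < δ → ∀ a₂ b₂ : ℝ × ℝ, ∀ d₁ d₂ r : ℝ, r < δ → dist a₂ a₁ ≤ r →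
        dist b₂ b₁ ≤ r → |d₁ - sqD a₁ c₁| ≤ r → |d₂ - sqD b₁ c₁| ≤ r →
        ∃ c₂, sqD a₂ c₂ = d₁ ∧ sqD b₂ c₂ = d₂ ∧ dist c₂ c₁ ≤ K * r) := by
      rintro ⟨i, m, j⟩
      by_cases hz : i < m ∧ m < j ∧ j ≤ n
      · obtain ⟨K, hK, δ, hδ, hh⟩ := exists_apex_lipschitz
          (sqD_pos (h.ne hn (hz.1.trans hz.2.1) hz.2.2)) (h.neg_inside hz.1 hz.2.1 hz.2.2)
        exact ⟨K, hK, δ, hδ, fun _ _ _ => hh⟩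
      · exact ⟨1, le_rfl, 1, one_pos, fun h1 h2 h3 => absurd ⟨h1, h2, h3⟩ hz⟩
    choose K hK1 δ hδ hh using this
    set Z := Finset.range (n + 1) ×ˢ Finset.range (n + 1) ×ˢ Finset.range (n + 1) with hZ
    have hZne : Z.Nonempty := ⟨(0, 0, 0), by simp [hZ]⟩
    obtain ⟨z₁, -, hmax⟩ := Z.exists_max_image K hZne
    obtain ⟨z₂, -, hmin⟩ := Z.exists_min_image δ hZne
    refine ⟨K z₁, hK1 _, δ z₂, hδ _, ?_⟩
    intro i m j him hmj hj a₁ b₁ c₁ ha hb hc a₂ b₂ d₁ d₂ r hr ha₂ hb₂ h1 h2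
    have hz : (i, m, j) ∈ Z := by
      simp only [hZ, Finset.mem_product, Finset.mem_range]; omega
    have hle := hmin _ hz
    obtain ⟨c₂, e1, e2, e3⟩ := hh (i, m, j) him hmj hj a₁ b₁ c₁ (ha.trans_le hle)
      (hb.trans_le hle) (hc.trans_le hle) a₂ b₂ d₁ d₂ r (hr.trans_le hle) ha₂ hb₂ h1 h2
    exact ⟨c₂, e1, e2, e3.trans
      (mul_le_mul_of_nonneg_right (hmax _ hz) (dist_nonneg.trans ha₂))⟩
  obtain ⟨K, hK1, δ, hδ, hh⟩ := hK
  -- development of a part of the polygon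
  have key : ∀ w : ι → ℝ × ℝ, (∀ k ≤ n, dist (w (σ k)) (w₀ (σ k)) < δ) → ∀ (M : ι → ι → ℝ)
      (r : ℝ), (∀ a, M a a = 0) → (∀ a b, M a b = M b a) →
      (∀ a ∈ seg σ 0 n, ∀ b ∈ seg σ 0 n, |M a b - sqD (w a) (w b)| ≤ r) → ∀ i j T,
      IsTri σ i j T → j ≤ n → ∀ r', r ≤ r' → K ^ (j - i) * r' < δ → ∀ p q : ℝ × ℝ,
      dist p (w (σ i)) ≤ r' → dist q (w (σ j)) ≤ r' → sqD p q = M (σ i) (σ j) →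
      ∃ y : ι → ℝ × ℝ, y (σ i) = p ∧ y (σ j) = q ∧
        (∀ k, i ≤ k → k ≤ j → dist (y (σ k)) (w (σ k)) ≤ K ^ (j - i) * r') ∧
        ∀ t ∈ T, ∀ a ∈ t, ∀ b ∈ t, sqD (y a) (y b) = M a b := by
    intro w hw M r hM0 hMs hM i j T hT
    induction hT with
    | leaf i =>
      intro hj r' hr hr' p q hp hq hpq
      have hne : σ (i + 1) ≠ σ i := fun e =>
        h.ne hn (Nat.lt_succ_self i) hj (congrArg w₀ e).symm
      have hr0 : 0 ≤ r' := dist_nonneg.trans hp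
      have hle : r' ≤ K ^ (i + 1 - i) * r' := by
        rw [Nat.add_sub_cancel_left, pow_one]; nlinarith
      refine ⟨fun a => if a = σ i then p else q, by simp, by simp [hne], fun k h1 h2 => ?_,
        by simp⟩
      obtain rfl | rfl : k = i ∨ k = i + 1 := by omega
      · simpa using hp.trans hle
      · simpa [hne] using hq.trans hle
    | @node i m j T₁ T₂ h1 h2 ih1 ih2 =>
      intro hj r' hr hr' p q hp hq hpq
      have him := h1.lt
      have hmj := h2.lt
      have hr0 : 0 ≤ r' := dist_nonneg.trans hp
      have hmem : ∀ k, k ≤ n → σ k ∈ seg σ 0 n := fun k hk => mem_seg.2 ⟨k, Nat.zero_le _, hk, rfl⟩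
      have hpow : ∀ e e' : ℕ, e ≤ e' → K ^ e * r' ≤ K ^ e' * r' := fun e e' he =>
        mul_le_mul_of_nonneg_right (pow_le_pow_right₀ hK1 he) hr0
      have hr'δ : r' < δ := lt_of_le_of_lt (by simpa using hpow 0 (j - i) (Nat.zero_le _)) hr'
      obtain ⟨c, hc1, hc2, hc3⟩ := hh i m j him hmj hj (w (σ i)) (w (σ j)) (w (σ m))
        (hw i (by omega)) (hw j hj) (hw m (by omega)) p q (M (σ i) (σ m)) (M (σ j) (σ m)) r' hr'δ
        hp hq ((hM _ (hmem i (by omega)) _ (hmem m (by omega))).trans hr)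
        ((hM _ (hmem j hj) _ (hmem m (by omega))).trans hr)
      -- Each apex multiplies the error by at most `K`. Both parts of the recursion are shorter by
      -- at least one index, so the exponent `j - i` bounds the depth.
      have hrK : r' ≤ K * r' := by nlinarith
      have step : ∀ e, e + 1 ≤ j - i → K ^ e * (K * r') ≤ K ^ (j - i) * r' := by
        intro e he
        rw [← mul_assoc, ← pow_succ]
        exact hpow _ _ he
      obtain ⟨y₁, a1, a2, a3, a4⟩ := ih1 (by omega) (K * r') (hr.trans hrK)
        ((step _ (by omega)).trans_lt hr') p c (hp.trans hrK) hc3 hc1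
      obtain ⟨y₂, b1, b2, b3, b4⟩ := ih2 hj (K * r') (hr.trans hrK)
        ((step _ (by omega)).trans_lt hr') c q hc3 (hq.trans hrK)
        (by rw [sqD_comm, hc2, hMs])
      set y : ι → ℝ × ℝ := fun a => if a ∈ seg σ i m then y₁ a else y₂ a with hy
      have hy1 : ∀ a ∈ seg σ i m, y a = y₁ a := fun a ha => by simp [hy, ha]
      have hy2 : ∀ a ∈ seg σ m j, y a = y₂ a := by
        intro a ha
        by_cases ha1 : a ∈ seg σ i m
        · obtain ⟨k, k1, k2, rfl⟩ := mem_seg.1 ha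
          obtain ⟨k', k1', k2', e⟩ := mem_seg.1 ha1
          have := hinj (show k' ∈ Set.Iic n by simp; omega) (show k ∈ Set.Iic n by simp; omega) e
          obtain rfl : k = m := by omega
          rw [hy1 _ ha1, a2, b1]
        · simp [hy, ha1]
      have yi : y (σ i) = p := by
        rw [hy1 _ (mem_seg.2 ⟨i, le_rfl, him.le, rfl⟩), a1]
      have ym : y (σ m) = c := by
        rw [hy1 _ (mem_seg.2 ⟨m, him.le, le_rfl, rfl⟩), a2]
      have yj : y (σ j) = q := by
        rw [hy2 _ (mem_seg.2 ⟨j, hmj.le, le_rfl, rfl⟩), b2]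
      refine ⟨y, yi, yj, fun k h1 h2 => ?_, ?_⟩
      · by_cases hkm : k ≤ m
        · rw [hy1 _ (mem_seg.2 ⟨k, h1, hkm, rfl⟩)]
          exact (a3 k h1 hkm).trans (step _ (by omega))
        · rw [hy2 _ (mem_seg.2 ⟨k, by omega, h2, rfl⟩)]
          exact (b3 k (by omega) h2).trans (step _ (by omega))
      · rintro t (rfl | ht | ht) a ha b hb
        · simp only [Finset.mem_insert, Finset.mem_singleton] at ha hb
          rcases ha with rfl | rfl | rfl <;> rcases hb with rfl | rfl | rfl
          · rw [sqD_self, hM0]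
          · rw [yi, ym, hc1]
          · rw [yi, yj, hpq]
          · rw [yi, ym, sqD_comm, hc1, hMs]
          · rw [sqD_self, hM0]
          · rw [ym, yj, sqD_comm, hc2, hMs]
          · rw [yi, yj, sqD_comm, hpq, hMs]
          · rw [ym, yj, hc2]
          · rw [sqD_self, hM0]
        · rw [hy1 a (h1.subset_seg ht ha), hy1 b (h1.subset_seg ht hb)]
          exact a4 t ht a ha b hb
        · rw [hy2 a (h2.subset_seg ht ha), hy2 b (h2.subset_seg ht hb)]
          exact b4 t ht a ha b hb
  -- the base edge
  have hL₀ := sqD_pos (h.ne hn (show 0 < n by omega) le_rfl)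
  set L₀ := sqD (w₀ (σ 0)) (w₀ (σ n)) with hL₀def
  have hcont : Continuous fun z : (ℝ × ℝ) × (ℝ × ℝ) => sqD z.1 z.2 := by fun_prop
  obtain ⟨δ₂, hδ₂, hball⟩ := Metric.eventually_nhds_iff.1 (hcont.continuousAt.eventually
    (lt_mem_nhds (half_lt_self hL₀) : {x | L₀ / 2 < x} ∈
      𝓝 (sqD ((w₀ (σ 0), w₀ (σ n)) : (ℝ × ℝ) × (ℝ × ℝ)).1 (w₀ (σ n)))))
  set B := dist (w₀ (σ 0)) (w₀ (σ n)) + 2 * δ with hB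
  have hB0 : 0 ≤ B := by positivity
  set C₁ := max 1 (2 * B / L₀) with hC₁
  have hC₁1 : 1 ≤ C₁ := le_max_left _ _
  have hKn : 1 ≤ K ^ n := one_le_pow₀ hK1
  refine ⟨K ^ n * C₁, by positivity, min (min δ δ₂) (min (L₀ / 2) (δ / (K ^ n * C₁))), ?_, ?_⟩
  · refine lt_min (lt_min hδ hδ₂) (lt_min (half_pos hL₀) (by positivity))
  intro w hw T hT M r hr hM0 hMs hM
  have hwδ : ∀ k ≤ n, dist (w (σ k)) (w₀ (σ k)) < δ := fun k hk =>
    (hw k hk).trans_le ((min_le_left _ _).trans (min_le_left _ _))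
  have hmem : ∀ k, k ≤ n → σ k ∈ seg σ 0 n := fun k hk => mem_seg.2 ⟨k, Nat.zero_le _, hk, rfl⟩
  have hM0n := hM _ (hmem 0 (Nat.zero_le _)) _ (hmem n le_rfl)
  have hr0 : 0 ≤ r := (abs_nonneg _).trans hM0n
  set L := sqD (w (σ 0)) (w (σ n)) with hL
  have hLlow : L₀ / 2 < L := by
    refine hball (y := (w (σ 0), w (σ n))) ?_
    rw [Prod.dist_eq]
    exact max_lt ((hw 0 (Nat.zero_le _)).trans_le ((min_le_left _ _).trans (min_le_right _ _)))
      ((hw n le_rfl).trans_le ((min_le_left _ _).trans (min_le_right _ _)))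
  have hLpos : 0 < L := (half_pos hL₀).trans hLlow
  set m := M (σ 0) (σ n) with hm
  have hrL : r < L₀ / 2 := hr.trans_le ((min_le_right _ _).trans (min_le_left _ _))
  have hmpos : 0 < m := by
    have := (abs_le.1 hM0n).1
    linarith
  -- The base side is rescaled about its first end to the prescribed length. The factor differs from
  -- one by at most `2 * r / L₀`, so the second end moves by a multiple of `r`.
  set lam := √(m / L) with hlam
  have hlam2 : lam ^ 2 = m / L := Real.sq_sqrt (by positivity)
  have hlam0 : 0 ≤ lam := Real.sqrt_nonneg _
  have hlam1 : |lam - 1| ≤ 2 * r / L₀ := by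
    have h1 : |lam - 1| * (lam + 1) = |m - L| / L := by
      have e : (lam - 1) * (lam + 1) = (m - L) / L := by
        field_simp
        have : lam ^ 2 * L = m := by rw [hlam2]; field_simp
        linear_combination this
      rw [← abs_of_pos hLpos, ← abs_div, abs_of_pos hLpos, ← e, abs_mul,
        abs_of_pos (by linarith : 0 < lam + 1)]
    have h2 : |m - L| / L ≤ 2 * r / L₀ := by
      rw [div_le_div_iff₀ hLpos hL₀]
      nlinarith [abs_nonneg (m - L)]
    nlinarith [abs_nonneg (lam - 1)]
  set q : ℝ × ℝ := w (σ 0) + lam • (w (σ n) - w (σ 0)) with hq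
  have hqd : dist q (w (σ n)) ≤ C₁ * r := by
    have e : q - w (σ n) = (lam - 1) • (w (σ n) - w (σ 0)) := by rw [hq]; module
    rw [dist_eq_norm, e, norm_smul, Real.norm_eq_abs, ← dist_eq_norm]
    have h1 : dist (w (σ n)) (w (σ 0)) ≤ B := by
      rw [dist_comm]
      have := dist_triangle4 (w (σ 0)) (w₀ (σ 0)) (w₀ (σ n)) (w (σ n))
      have h2 := hwδ 0 (Nat.zero_le _)
      have h3 := hwδ n le_rfl
      rw [dist_comm] at h3
      linarith
    calc |lam - 1| * dist (w (σ n)) (w (σ 0)) ≤ (2 * r / L₀) * B :=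
          mul_le_mul hlam1 h1 dist_nonneg (by positivity)
      _ = (2 * B / L₀) * r := by ring
      _ ≤ C₁ * r := mul_le_mul_of_nonneg_right (le_max_right _ _) hr0
  have hqs : sqD (w (σ 0)) q = m := by
    have e : sqD (w (σ 0)) q = lam ^ 2 * L := by
      simp only [hq, hL, sqD, Prod.fst_add, Prod.snd_add, Prod.smul_fst, Prod.smul_snd,
        Prod.fst_sub, Prod.snd_sub, smul_eq_mul]
      ring
    rw [e, hlam2]; field_simp
  have hrδ : r < δ / (K ^ n * C₁) := hr.trans_le ((min_le_right _ _).trans (min_le_right _ _))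
  rw [lt_div_iff₀ (by positivity)] at hrδ
  obtain ⟨y, -, -, y3, y4⟩ := key w hwδ M r hM0 hMs hM 0 n T hT le_rfl (C₁ * r) (by nlinarith)
    (by rw [Nat.sub_zero]; linarith) (w (σ 0)) q (by rw [dist_self]; positivity) hqd hqs
  refine ⟨y, fun k hk => ?_, y4⟩
  have := y3 k (Nat.zero_le _) hk
  rwa [Nat.sub_zero, ← mul_assoc] at this

end Planar

end HypRigidity

namespace HypRigidity

/-! ### Orthonormal frames and planar coordinates -/

section Frame

/-- The first vector of an orthonormal frame of the tangent plane of the hyperbolic plane. -/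
noncomputable def frame1 (ν : Mink) : Mink :=
  ![ν 1, 1 + (1 / (1 + ν 0)) * ν 1 ^ 2, (1 / (1 + ν 0)) * (ν 1 * ν 2)]

/-- The second vector of an orthonormal frame of the tangent plane of the hyperbolic plane. -/
noncomputable def frame2 (ν : Mink) : Mink :=
  ![ν 2, (1 / (1 + ν 0)) * (ν 1 * ν 2), 1 + (1 / (1 + ν 0)) * ν 2 ^ 2]

/-- Coordinates of the orthogonal projection to the tangent plane at `ν`. -/
noncomputable def pc (ν Z : Mink) : ℝ × ℝ := (mink (frame1 ν) Z, mink (frame2 ν) Z)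

theorem pc_sub (ν Z Z' : Mink) : pc ν (Z - Z') = pc ν Z - pc ν Z' := by
  simp only [pc, mink_sub_right, Prod.mk_sub_mk]

theorem continuous_pc (ν : Mink) : Continuous (pc ν) :=
  (continuous_mink_comp continuous_const continuous_id).prodMk
    (continuous_mink_comp continuous_const continuous_id)

theorem pc_bary {ι : Type*} {Z : ι → Mink} {x : ι → ℝ} {t : Finset ι} (ν : Mink)
    (hx : ∀ a, a ∉ t → x a = 0) : pc ν (bary Z x) = bary (fun a => pc ν (Z a)) x := by
  rw [bary_eq_sum (fun a => pc ν (Z a)) hx]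
  ext
  · rw [Prod.fst_sum]; exact mink_bary hx _
  · rw [Prod.snd_sum]; exact mink_bary hx _

theorem frame_aux {ν : Mink} (hν : ν ∈ hyperbolicPlane) :
    1 / (1 + ν 0) * (1 + ν 0) = 1 ∧ 1 / (1 + ν 0) * (ν 1 ^ 2 + ν 2 ^ 2) = ν 0 - 1 := by
  obtain ⟨h1, h2⟩ := hν
  have h3 : 1 + ν 0 ≠ 0 := by positivity
  refine ⟨by field_simp, ?_⟩
  simp only [mink] at h1
  field_simp
  linear_combination h1

/-- Expansion in the orthonormal frame `ν`, `frame1 ν`, `frame2 ν`, the image of the standard frame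
under the boost that takes the base point to `ν`. -/
theorem mink_eq_pc {ν : Mink} (hν : ν ∈ hyperbolicPlane) (Z Z' : Mink) :
    mink Z Z' = (pc ν Z).1 * (pc ν Z').1 + (pc ν Z).2 * (pc ν Z').2 - mink ν Z * mink ν Z' := by
  obtain ⟨hk, h1⟩ := frame_aux hν
  have h2 := hν.1
  simp only [mink, pc, frame1, frame2, Matrix.cons_val] at *
  set k := 1 / (1 + ν 0)
  linear_combination (-Z 0 * Z' 0) * h2 + ((Z 0 * (ν 1 * Z' 1 + ν 2 * Z' 2) +
    Z' 0 * (ν 1 * Z 1 + ν 2 * Z 2)) - k * (ν 1 * Z 1 + ν 2 * Z 2) * (ν 1 * Z' 1 + ν 2 * Z' 2)) * h1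
    - (ν 1 * Z 1 + ν 2 * Z 2) * (ν 1 * Z' 1 + ν 2 * Z' 2) * hk

theorem eq_of_pc {ν : Mink} (hν : ν ∈ hyperbolicPlane) {Z Z' : Mink} (h : pc ν Z = pc ν Z')
    (h' : mink ν Z = mink ν Z') : Z = Z' := by
  rw [← sub_eq_zero]
  have e : pc ν (Z - Z') = 0 := by rw [pc_sub, h, sub_self]
  have hY : ∀ Y, mink (Z - Z') Y = 0 := fun Y => by
    rw [mink_eq_pc hν, mink_sub_right, h', e]
    simp
  ext i
  fin_cases i
  · have := hY ![1, 0, 0]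
    simp [mink] at this ⊢
    linarith
  · simpa [mink] using hY ![0, 1, 0]
  · simpa [mink] using hY ![0, 0, 1]

theorem pc_lcross {ν : Mink} (hν : ν ∈ hyperbolicPlane) (Z : Mink) :
    pc ν (lcross ν Z) = (-(pc ν Z).2, (pc ν Z).1) := by
  obtain ⟨hk, h1⟩ := frame_aux hν
  simp only [mink, pc, frame1, frame2, lcross, Matrix.cons_val] at *
  set k := 1 / (1 + ν 0)
  ext
  · simp only
    linear_combination (ν 1 * ν 2 * Z 1 - ν 1 ^ 2 * Z 2) * hk + Z 2 * h1
  · simp only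
    linear_combination (-(ν 1 * ν 2 * Z 2) + ν 2 ^ 2 * Z 1) * hk - Z 1 * h1

/-- The orthogonal projection is recovered from the planar coordinates. -/
theorem mink_self_eq_sqD {ν : Mink} (hν : ν ∈ hyperbolicPlane) (Z Z' : Mink) :
    mink (Z - Z') (Z - Z') = sqD (pc ν Z) (pc ν Z') - (mink ν Z - mink ν Z') ^ 2 := by
  rw [mink_eq_pc hν, pc_sub, mink_sub_right]
  simp only [sqD, Prod.fst_sub, Prod.snd_sub]
  ring

end Frame
end HypRigidity

namespace HypRigidity

/-! ### Facets of the hull boundary -/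

theorem exists_triple {ι : Type*} [DecidableEq ι] {σ : ℕ → ι} {n : ℕ} {t : Finset ι}
    (ht : t.card = 3) (hts : t ⊆ seg σ 0 n) :
    ∃ i j k, i < j ∧ j < k ∧ k ≤ n ∧ σ i ∈ t ∧ σ j ∈ t ∧ σ k ∈ t := by
  have hex : ∀ a ∈ t, ∃ k, k ≤ n ∧ σ k = a := fun a ha => by
    obtain ⟨k, -, hk, e⟩ := mem_seg.1 (hts ha)
    exact ⟨k, hk, e⟩
  choose! f hf hfσ using hex
  have hinj : Set.InjOn f t := fun a ha b hb h => by rw [← hfσ a ha, ← hfσ b hb, h]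
  have hcard : (t.image f).card = 3 := by rw [Finset.card_image_of_injOn hinj, ht]
  set g := (t.image f).orderEmbOfFin hcard
  have hg : ∀ j, g j ≤ n ∧ σ (g j) ∈ t := by
    intro j
    obtain ⟨a, ha, e⟩ := Finset.mem_image.1 ((t.image f).orderEmbOfFin_mem hcard j)
    rw [show g j = f a from e.symm]
    exact ⟨hf a ha, by rw [hfσ a ha]; exact ha⟩
  exact ⟨g 0, g 1, g 2, g.strictMono (by decide), g.strictMono (by decide), (hg 2).1, (hg 0).2,
    (hg 1).2, (hg 2).2⟩

/-- The barycenter of a simplex. -/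
theorem exists_barycenter {ι : Type*} {t : Finset ι} (ht : t.Nonempty) :
    ∃ x ∈ stdSimp t, ∀ a ∈ t, 0 < x a := by
  classical
  have hc : (0 : ℝ) < t.card := by exact_mod_cast Finset.card_pos.2 ht
  refine ⟨fun a => if a ∈ t then (t.card : ℝ)⁻¹ else 0, ⟨fun a => ?_, fun a ha => by simp [ha], ?_⟩,
    fun a ha => by simp only [ha, if_true]; positivity⟩
  · simp only; split_ifs <;> positivity
  · simp only [Finset.sum_ite_mem, Finset.inter_self, Finset.sum_const, nsmul_eq_mul]
    field_simp

section Facets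

variable {Γ : Type*} [Group Γ] {ρ : Γ →* (Mink ≃ₗ[ℝ] Mink)} {V : Type*}

/-- `ν` is the unit normal of a two-dimensional face of the hull boundary. -/
def IsFacet (p : MarkedData ρ V) (ν : Mink) : Prop :=
  ν ∈ hyperbolicPlane ∧ ∃ t : Finset (Γ × V), t.card = 3 ∧ (t : Set (Γ × V)) ⊆ contact p ν

theorem contact_normalize {p : MarkedData ρ V} {n : Mink} (hn : n ∈ futureCone) :
    ∃ ν ∈ hyperbolicPlane, contact p ν = contact p n := by
  obtain ⟨c, hc, h⟩ := exists_normalize hn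
  exact ⟨c • n, h, contact_smul hc p n⟩

theorem injective_liftedMarking {p : MarkedData ρ V} (hp : p ∈ convexMarkedData ρ V) :
    Function.Injective (liftedMarking p) := by
  intro a b h
  by_contra hne
  exact hp.2 a (h ▸ subset_convexHull ℝ _ ⟨b, Ne.symm hne, rfl⟩)

/-- Marked points on a support plane are in strictly convex position in this plane. -/
theorem pc_notMem_convexHull {p : MarkedData ρ V} (hp : p ∈ convexMarkedData ρ V) {ν : Mink}
    (hν : ν ∈ hyperbolicPlane) {s : Finset (Γ × V)} (hs : (s : Set (Γ × V)) ⊆ contact p ν)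
    {a : Γ × V} (ha : a ∈ contact p ν) (has : a ∉ s) :
    pc ν (liftedMarking p a) ∉
      convexHull ℝ ((fun b => pc ν (liftedMarking p b)) '' (s : Set (Γ × V))) := by
  intro hmem
  obtain ⟨x, hx, hxa⟩ := mem_convexHull_image_iff.1 hmem
  have e : liftedMarking p a = bary (liftedMarking p) x := by
    refine eq_of_pc hν ?_ ?_
    · rw [pc_bary ν hx.2.1, hxa]
    · rw [mink_bary hx.2.1]
      rw [Finset.sum_congr rfl fun c hc => by
        rw [← mink_eq_of_contact ha (hs hc)], ← Finset.sum_mul, hx.2.2, one_mul]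
  refine hp.2 a ?_
  rw [e]
  refine convexHull_mono (Set.image_mono ?_) (mem_convexHull_image_iff.2 ⟨x, hx, rfl⟩)
  rintro b hb rfl
  exact has hb

variable [DecidableEq (Γ × V)]

/-- A polygon structure on the face with normal `ν`. -/
structure IsPolygon (p : MarkedData ρ V) (ν : Mink) (σ : ℕ → Γ × V) (n : ℕ) : Prop where
  two_le : 2 ≤ n
  contact_eq : contact p ν = (seg σ 0 n : Finset (Γ × V))
  ordered : ConvexlyOrdered σ n fun a => pc ν (liftedMarking p a)

theorem IsPolygon.mem_iff {p : MarkedData ρ V} {ν : Mink} {σ : ℕ → Γ × V} {n : ℕ}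
    (h : IsPolygon p ν σ n) {a : Γ × V} : a ∈ contact p ν ↔ a ∈ seg σ 0 n := by
  rw [h.contact_eq, Finset.mem_coe]

theorem IsPolygon.mem {p : MarkedData ρ V} {ν : Mink} {σ : ℕ → Γ × V} {n : ℕ}
    (h : IsPolygon p ν σ n) {k : ℕ} (hk : k ≤ n) : σ k ∈ contact p ν :=
  h.mem_iff.2 (mem_seg.2 ⟨k, Nat.zero_le _, hk, rfl⟩)

variable (hρ : IsHyperbolicHolonomy ρ) [Finite V] [Nonempty V] {p : MarkedData ρ V}
  (hp : p ∈ convexMarkedData ρ V)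
include hρ hp

omit [DecidableEq (Γ × V)] in
theorem contact_finite {n : Mink} (hn : n ∈ futureCone) : (contact p n).Finite := by
  obtain ⟨C, c, hC, hc, hpg⟩ := exists_uniformGrowth hρ hp
  exact (contact_finite_nonempty hρ hC.le hc hpg hn).1

omit [DecidableEq (Γ × V)] in
theorem contact_nonempty {n : Mink} (hn : n ∈ futureCone) : (contact p n).Nonempty := by
  obtain ⟨C, c, hC, hc, hpg⟩ := exists_uniformGrowth hρ hp
  exact (contact_finite_nonempty hρ hC.le hc hpg hn).2

theorem IsFacet.exists_polygon {ν : Mink} (hν : IsFacet p ν) : ∃ σ n, IsPolygon p ν σ n := by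
  have hfin := contact_finite hρ hp (mem_futureCone_of_plane hν.1)
  obtain ⟨t, ht, hts⟩ := hν.2
  obtain ⟨σ, n, hn, hseg, hord⟩ := exists_convexlyOrdered (A := hfin.toFinset)
    (w := fun a => pc ν (liftedMarking p a))
    (by rw [← ht]; exact Finset.card_le_card fun a ha => hfin.mem_toFinset.2 (hts ha))
    (fun a ha => pc_notMem_convexHull hp hν.1
      (fun b hb => hfin.mem_toFinset.1 (Finset.mem_of_mem_erase hb)) (hfin.mem_toFinset.1 ha)
      (Finset.notMem_erase _ _))
  exact ⟨σ, n, hn, by rw [hseg, hfin.coe_toFinset], hord⟩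

omit hρ hp [Finite V] [Nonempty V] in
/-- The normal of a face is determined by three of its points. -/
theorem eq_of_triple {ν : Mink} (hν : ν ∈ hyperbolicPlane) {σ : ℕ → Γ × V} {n : ℕ}
    (hpoly : IsPolygon p ν σ n) {m : Mink} (hm : m ∈ hyperbolicPlane) {i j k : ℕ} (hij : i < j)
    (hjk : j < k) (hk : k ≤ n) (hi' : σ i ∈ contact p m) (hj' : σ j ∈ contact p m)
    (hk' : σ k ∈ contact p m) : m = ν := by
  have harea := hpoly.ordered i j k hij hjk hk
  set Z := liftedMarking p
  have e1 : mink m (Z (σ j) - Z (σ i)) = 0 := by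
    rw [mink_sub_right, mink_eq_of_contact hj' hi', sub_self]
  have e2 : mink m (Z (σ k) - Z (σ i)) = 0 := by
    rw [mink_sub_right, mink_eq_of_contact hk' hi', sub_self]
  have f1 : mink ν (Z (σ j) - Z (σ i)) = 0 := by
    rw [mink_sub_right, mink_eq_of_contact (hpoly.mem (k := j) (by omega))
      (hpoly.mem (k := i) (by omega)), sub_self]
  have f2 : mink ν (Z (σ k) - Z (σ i)) = 0 := by
    rw [mink_sub_right, mink_eq_of_contact (hpoly.mem hk) (hpoly.mem (k := i) (by omega)),
      sub_self]
  rw [mink_eq_pc hν, f1, pc_sub] at e1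
  rw [mink_eq_pc hν, f2, pc_sub] at e2
  simp only [area2] at harea
  simp only [Prod.fst_sub, Prod.snd_sub, mul_zero, sub_zero] at e1 e2
  have hpc1 : (pc ν m).1 = 0 := by
    refine (mul_eq_zero.1 (?_ : (pc ν m).1 * _ = 0)).resolve_right harea.ne'
    linear_combination ((pc ν (Z (σ k))).2 - (pc ν (Z (σ i))).2) * e1 -
      ((pc ν (Z (σ j))).2 - (pc ν (Z (σ i))).2) * e2
  have hpc2 : (pc ν m).2 = 0 := by
    refine (mul_eq_zero.1 (?_ : (pc ν m).2 * _ = 0)).resolve_right harea.ne'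
    linear_combination ((pc ν (Z (σ j))).1 - (pc ν (Z (σ i))).1) * e2 -
      ((pc ν (Z (σ k))).1 - (pc ν (Z (σ i))).1) * e1
  have h1 : mink ν m ^ 2 = 1 := by
    have := mink_eq_pc hν m m
    rw [hpc1, hpc2, hm.1] at this
    linarith
  have h2 : mink ν m < 0 := mink_neg_of_future (mem_closedCone_of_plane hν)
    (future_ne_zero (mem_futureCone_of_plane hν)) (mem_futureCone_of_plane hm)
  have h3 : mink ν m = -1 := by nlinarith
  have hνν : pc ν ν = 0 := by
    have := mink_eq_pc hν ν ν
    rw [hν.1] at this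
    ext
    · simp only [Prod.fst_zero]; nlinarith [sq_nonneg (pc ν ν).1, sq_nonneg (pc ν ν).2]
    · simp only [Prod.snd_zero]; nlinarith [sq_nonneg (pc ν ν).1, sq_nonneg (pc ν ν).2]
  exact eq_of_pc hν (by rw [hνν]; exact Prod.ext hpc1 hpc2) (by rw [h3, hν.1])

theorem IsFacet.eq_of_subset {ν m : Mink} (hν : IsFacet p ν) (hm : m ∈ hyperbolicPlane)
    {t : Finset (Γ × V)} (ht : t.card = 3) (h1 : (t : Set (Γ × V)) ⊆ contact p ν)
    (h2 : (t : Set (Γ × V)) ⊆ contact p m) : m = ν := by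
  obtain ⟨σ, n, hpoly⟩ := hν.exists_polygon hρ hp
  obtain ⟨i, j, k, hij, hjk, hk, hi, hj, hk'⟩ := exists_triple ht
    (fun a ha => hpoly.mem_iff.1 (h1 ha))
  exact eq_of_triple hν.1 hpoly hm hij hjk hk (h2 hi) (h2 hj) (h2 hk')

variable {T : Set (Finset (Γ × V))} (hT : IsFaceTriangulation p T)

include hT

omit [DecidableEq (Γ × V)] in
/-- Every triangle lies in a facet. -/
theorem exists_facet_of_triangle {t : Finset (Γ × V)} (ht : t ∈ T) :
    ∃ ν, IsFacet p ν ∧ (t : Set (Γ × V)) ⊆ contact p ν := by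
  obtain ⟨C, c, hC, hc, hpg⟩ := exists_uniformGrowth hρ hp
  have hcard := hT.card_eq t ht
  -- A support plane at the barycenter of a triangle contains all of its vertices, since every
  -- weight is positive.
  obtain ⟨x, hx, hpos⟩ := exists_barycenter (t := t) (Finset.card_pos.1 (by omega))
  have hmem := hT.subset_boundary t ht (mem_convexHull_image_iff.2 ⟨x, hx, rfl⟩)
  obtain ⟨n, hn, hn'⟩ := (mem_hullBoundary_iff hρ hC hc hpg).1 hmem
  have hmax := mink_le_of_mem_convexHull_contact hn'
  obtain ⟨ν, hν, hνn⟩ := contact_normalize (p := p) hn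
  have hsub : (t : Set (Γ × V)) ⊆ contact p ν := by
    intro a ha
    rw [hνn]
    intro b
    rw [mink_eq_of_bary_max hx (fun b _ => hmax b) (hpos a ha).ne']
    exact hmax b
  exact ⟨ν, ⟨hν, t, hcard, hsub⟩, hsub⟩

omit [DecidableEq (Γ × V)] in
/-- The intersection of the hull boundary with a support plane lies in a facet. -/
theorem exists_facet_of_contact {n : Mink} (hn : n ∈ futureCone) {s : Finset (Γ × V)}
    (hs : (s : Set (Γ × V)) ⊆ contact p n) {x : Γ × V → ℝ} (hx : x ∈ stdSimp s)
    (hpos : ∀ a ∈ s, 0 < x a) : ∃ ν, IsFacet p ν ∧ (s : Set (Γ × V)) ⊆ contact p ν ∧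
      ∃ t ∈ T, (t : Set (Γ × V)) ⊆ contact p ν ∧
        bary (liftedMarking p) x ∈ convexHull ℝ (liftedMarking p '' (t : Set (Γ × V))) := by
  obtain ⟨C, c, hC, hc, hpg⟩ := exists_uniformGrowth hρ hp
  have hmem : bary (liftedMarking p) x ∈ hullBoundary p := (mem_hullBoundary_iff hρ hC hc hpg).2
    ⟨n, hn, convexHull_mono (Set.image_mono hs) (mem_convexHull_image_iff.2 ⟨x, hx, rfl⟩)⟩
  obtain ⟨t, ht, hxt⟩ := hT.cover _ hmem
  obtain ⟨ν, hν, htν⟩ := exists_facet_of_triangle hρ hp hT ht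
  have hmax := mink_le_of_mem_convexHull_contact (convexHull_mono (Set.image_mono htν) hxt)
  refine ⟨ν, hν, ?_, t, ht, htν, hxt⟩
  intro a ha b
  rw [mink_eq_of_bary_max hx (fun b _ => hmax b) (hpos a ha).ne']
  exact hmax b

omit [DecidableEq (Γ × V)] in
-- The triangulation covers the boundary by genuine triangles, so vertices and edges never occur
-- outside a two-dimensional face. The barycenter of the contact set detects such a face.
theorem exists_facet {n : Mink} (hn : n ∈ futureCone) :
    ∃ ν, IsFacet p ν ∧ contact p n ⊆ contact p ν := by
  have hfin := contact_finite hρ hp hn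
  obtain ⟨x, hx, hpos⟩ := exists_barycenter (t := hfin.toFinset)
    (by simpa using contact_nonempty hρ hp hn)
  obtain ⟨ν, hν, h, -⟩ := exists_facet_of_contact hρ hp hT hn (by simp) hx hpos
  exact ⟨ν, hν, by simpa using h⟩

/-- The triangles in a facet triangulate the corresponding polygon. -/
theorem IsFacet.isTri {ν : Mink} (hν : IsFacet p ν) {σ : ℕ → Γ × V} {n : ℕ}
    (hpoly : IsPolygon p ν σ n) : IsTri σ 0 n {t | t ∈ T ∧ (t : Set (Γ × V)) ⊆ contact p ν} := by
  set TF := {t | t ∈ T ∧ (t : Set (Γ × V)) ⊆ contact p ν} with hTF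
  set Z := liftedMarking p with hZ
  set w := fun a => pc ν (Z a) with hw
  have hsub : ∀ t ∈ TF, t ⊆ seg σ 0 n := fun t ht a ha => hpoly.mem_iff.1 (ht.2 ha)
  have hfin : TF.Finite := (Finset.finite_toSet (seg σ 0 n).powerset).subset
    fun t ht => Finset.mem_coe.2 (Finset.mem_powerset.2 (hsub t ht))
  have hZeq : ∀ {s s' : Finset (Γ × V)} {x x' : Γ × V → ℝ}, x ∈ stdSimp s → x' ∈ stdSimp s' →
      (s : Set (Γ × V)) ⊆ contact p ν → (s' : Set (Γ × V)) ⊆ contact p ν →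
      bary w x = bary w x' → bary Z x = bary Z x' := by
    intro s s' x x' hx hx' hs hs' h
    have hconst : ∀ {s : Finset (Γ × V)} {x : Γ × V → ℝ}, x ∈ stdSimp s →
        (s : Set (Γ × V)) ⊆ contact p ν → mink ν (bary Z x) = mink ν (Z (σ 0)) := by
      intro s x hx hs
      rw [mink_bary hx.2.1, Finset.sum_congr rfl fun c hc => by
        rw [mink_eq_of_contact (hs hc) (hpoly.mem (Nat.zero_le n))], ← Finset.sum_mul, hx.2.2,
        one_mul]
    refine eq_of_pc hν.1 ?_ ?_
    · rw [pc_bary ν hx.2.1, pc_bary ν hx'.2.1]; exact h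
    · rw [hconst hx hs, hconst hx' hs']
  have hsegc : ((seg σ 0 n : Finset (Γ × V)) : Set (Γ × V)) ⊆ contact p ν := hpoly.contact_eq.ge
  refine exists_isTri hpoly.ordered hpoly.two_le (fun t ht => hT.card_eq t ht.1) hsub ?_ ?_
  · -- covering: first the relative interior, then its closure
    -- At a point with all weights positive, the facet of the covering triangle contains every
    -- vertex of the polygon, so it is the facet `ν` itself.
    have hint : ∀ x ∈ stdSimp (seg σ 0 n), (∀ a ∈ seg σ 0 n, 0 < x a) →
        bary w x ∈ ⋃ t ∈ TF, convexHull ℝ (w '' (t : Set (Γ × V))) := by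
      intro x hx hpos
      obtain ⟨ν', hν', hsν', t, ht, htν', hxt⟩ := exists_facet_of_contact hρ hp hT
        (mem_futureCone_of_plane hν.1) hsegc hx hpos
      obtain ⟨s, hs3, hs⟩ := hν.2
      have heq : ν' = ν := hν.eq_of_subset hρ hp hν'.1 hs3 hs
        (hs.trans (hpoly.contact_eq.le.trans hsν'))
      rw [heq] at htν'
      refine Set.mem_iUnion₂.2 ⟨t, ⟨ht, htν'⟩, ?_⟩
      obtain ⟨x', hx', e⟩ := mem_convexHull_image_iff.1 hxt
      refine mem_convexHull_image_iff.2 ⟨x', hx', ?_⟩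
      rw [hw, ← pc_bary ν hx'.2.1, e, pc_bary ν hx.2.1]
    intro x hx
    have hclosed : IsClosed (⋃ t ∈ TF, convexHull ℝ (w '' (t : Set (Γ × V)))) :=
      hfin.isClosed_biUnion fun t _ => ((t.finite_toSet).image w).isClosed_convexHull ℝ
    obtain ⟨b, hb, hbpos⟩ := exists_barycenter (t := seg σ 0 n)
      ⟨σ 0, mem_seg.2 ⟨0, le_rfl, Nat.zero_le _, rfl⟩⟩
    have htend : Filter.Tendsto (fun ε : ℝ => (1 - ε) • bary w x + ε • bary w b) (𝓝[>] 0)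
        (𝓝 (bary w x)) := by
      have h1 : Filter.Tendsto (fun ε : ℝ => (1 - ε) • bary w x + ε • bary w b) (𝓝 0)
          (𝓝 ((1 - (0 : ℝ)) • bary w x + (0 : ℝ) • bary w b)) :=
        (by fun_prop : Continuous fun ε : ℝ =>
          (1 - ε) • bary w x + ε • bary w b).tendsto 0
      simp only [sub_zero, one_smul, zero_smul, add_zero] at h1
      exact h1.mono_left nhdsWithin_le_nhds
    have hmem : bary w x ∈ ⋃ t ∈ TF, convexHull ℝ (w '' (t : Set (Γ × V))) := by
      refine hclosed.mem_of_tendsto htend ?_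
      filter_upwards [Ioo_mem_nhdsGT (zero_lt_one' ℝ)] with ε hε
      rw [← bary_add w hx.2.1 hb.2.1]
      refine hint _ (convex_stdSimp _ hx hb (by linarith [hε.2]) hε.1.le (by ring)) fun a ha => ?_
      have h1 := mul_nonneg (by linarith [hε.2] : 0 ≤ 1 - ε) (hx.1 a)
      have h2 := mul_pos hε.1 (hbpos a ha)
      simp only [Pi.add_apply, Pi.smul_apply, smul_eq_mul]
      linarith
    obtain ⟨t, ht, hmem⟩ := Set.mem_iUnion₂.1 hmem
    obtain ⟨x', hx', e⟩ := mem_convexHull_image_iff.1 hmem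
    exact ⟨t, ht, x', hx', e⟩
  · intro x hx x' hx' e
    obtain ⟨t, ht, hxt⟩ := Set.mem_iUnion₂.1 hx
    obtain ⟨s, hs, hxs⟩ := Set.mem_iUnion₂.1 hx'
    have eZ := hZeq hxt hxs ht.2 hs.2 e
    have hinter := hT.inter t ht.1 s hs.1 ⟨mem_convexHull_image_iff.2 ⟨x, hxt, rfl⟩,
      mem_convexHull_image_iff.2 ⟨x', hxs, eZ.symm⟩⟩
    rw [← Finset.coe_inter] at hinter
    obtain ⟨x₀, hx₀, e₀⟩ := mem_convexHull_image_iff.1 hinter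
    have hinj : ∀ t ∈ TF, Set.InjOn (bary w) (stdSimp t) := by
      intro t ht
      obtain ⟨i, j, k, hij, hjk, hk, hi, hj, hk'⟩ := exists_triple (hT.card_eq t ht.1) (hsub t ht)
      have hσ := hpoly.ordered.injOn hpoly.two_le
      have hne : ∀ {i j}, i < j → j ≤ n → σ i ≠ σ j := fun {i j} hij hj e =>
        hpoly.ordered.ne hpoly.two_le hij hj (by simp only [e])
      have hteq : t = {σ i, σ j, σ k} := by
        symm
        refine Finset.eq_of_subset_of_card_le ?_ ?_
        · intro a ha
          simp only [Finset.mem_insert, Finset.mem_singleton] at ha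
          rcases ha with rfl | rfl | rfl <;> assumption
        · rw [hT.card_eq t ht.1, Finset.card_insert_of_notMem, Finset.card_insert_of_notMem,
            Finset.card_singleton]
          · simpa using hne hjk hk
          · simp only [Finset.mem_insert, Finset.mem_singleton, not_or]
            exact ⟨hne hij (by omega), hne (hij.trans hjk) hk⟩
      rw [hteq]
      exact bary_injOn_triangle (hpoly.ordered i j k hij hjk hk)
    have ew : bary w x₀ = bary w x := by
      rw [hw, ← pc_bary ν hx₀.2.1, e₀, pc_bary ν hxt.2.1]
    have h1 := hinj t ht (stdSimp_mono Finset.inter_subset_left hx₀) hxt ew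
    have h2 := hinj s hs (stdSimp_mono Finset.inter_subset_right hx₀) hxs (ew.trans e)
    exact h1.symm.trans h2

end Facets

end HypRigidity

/-! ### Finiteness of the facets modulo the group, stability of faces, adjacent facets -/

namespace HypRigidity

section Facets

variable {Γ : Type*} [Group Γ] {ρ : Γ →* (Mink ≃ₗ[ℝ] Mink)} {V : Type*}

theorem exists_facet_map (hρ : IsHyperbolicHolonomy ρ) {p : MarkedData ρ V} {ν : Mink}
    (hν : IsFacet p ν) (γ : Γ) : IsFacet p (ρ γ ν) := by
  obtain ⟨h1, t, ht, hts⟩ := hν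
  refine ⟨hρ.map_plane γ ν h1, t.map (translate γ).toEmbedding, by rw [Finset.card_map, ht], ?_⟩
  rw [contact_map hρ, Finset.coe_map]
  exact Set.image_mono hts

theorem exists_map_height_le (hρ : IsHyperbolicHolonomy ρ) :
    ∃ M : ℝ, ∀ w ∈ hyperbolicPlane, ∃ γ : Γ, ρ γ w ∈ hyperbolicPlane ∧ (ρ γ w) 0 ≤ M := by
  obtain ⟨M, -, h⟩ := exists_orbit_near hρ
  refine ⟨M, fun w hw => ?_⟩
  obtain ⟨γ, -, h2⟩ := h w hw
  refine ⟨γ⁻¹, hρ.map_plane _ _ hw, ?_⟩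
  have h3 := (map_closedCone hρ γ⁻¹ h2).2
  rw [map_sub, map_smul, rho_inv_apply] at h3
  simp only [Pi.sub_apply, Pi.smul_apply, origin_zero, smul_eq_mul, mul_one] at h3
  linarith

variable (hρ : IsHyperbolicHolonomy ρ) [Finite V] [Nonempty V] {p : MarkedData ρ V}
  (hp : p ∈ convexMarkedData ρ V) {T : Set (Finset (Γ × V))} (hT : IsFaceTriangulation p T)
include hρ hp hT

/-- There are finitely many facets up to the action of the group. -/
theorem finite_facets : ∃ S : Set Mink, S.Finite ∧ (∀ ν ∈ S, IsFacet p ν) ∧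
    ∀ ν, IsFacet p ν → ∃ γ : Γ, ∃ ν₀ ∈ S, ν = ρ γ ν₀ := by
  classical
  obtain ⟨C, c, hC, hc, hpg⟩ := exists_uniformGrowth hρ hp
  obtain ⟨M, hM⟩ := exists_map_height_le hρ
  have hfin : {ν | IsFacet p ν ∧ ν 0 ≤ M}.Finite := by
    -- Near `n₀` every contact set is contained in that of one facet, and three of its points
    -- determine the normal. So there is at most one facet normal nearby.
    have hloc : ∀ n₀ ∈ {x | x ∈ hyperbolicPlane ∧ x 0 ≤ M}, ∃ U ∈ 𝓝[{x | x ∈ hyperbolicPlane ∧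
        x 0 ≤ M}] n₀, ({ν | IsFacet p ν} ∩ U).Finite := by
      intro n₀ hn₀
      have hn₀' := mem_futureCone_of_plane hn₀.1
      obtain ⟨ν, hν, hsub⟩ := exists_facet hρ hp hT hn₀'
      have hev : ∀ᶠ n in 𝓝 n₀, contact p n ⊆ contact p n₀ :=
        (Continuous.tendsto (by fun_prop : Continuous fun n : Mink => (p, n)) n₀).eventually
          (eventually_contact_subset hρ hC hc hpg hn₀')
      refine ⟨{n | contact p n ⊆ contact p n₀}, nhdsWithin_le_nhds hev,
        (Set.finite_singleton ν).subset ?_⟩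
      rintro m ⟨hm, hm'⟩
      obtain ⟨t, ht, hts⟩ := hm.2
      exact hν.eq_of_subset hρ hp hm.1 ht (hts.trans (hm'.trans hsub)) hts
    obtain ⟨U, hU⟩ : ∃ U : Mink → Set Mink, ∀ n₀ ∈ {x | x ∈ hyperbolicPlane ∧ x 0 ≤ M},
        U n₀ ∈ 𝓝[{x | x ∈ hyperbolicPlane ∧ x 0 ≤ M}] n₀ ∧ ({ν | IsFacet p ν} ∩ U n₀).Finite := by
      choose! U h1 h2 using hloc
      exact ⟨U, fun n hn => ⟨h1 n hn, h2 n hn⟩⟩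
    obtain ⟨t, ht, htc⟩ := (isCompact_plane_le M).elim_nhdsWithin_subcover U fun n hn => (hU n hn).1
    refine (t.finite_toSet.biUnion fun n hn => (hU n (ht n hn)).2).subset ?_
    rintro ν ⟨hν, hνM⟩
    obtain ⟨n, hn, hνn⟩ := Set.mem_iUnion₂.1 (htc ⟨hν.1, hνM⟩)
    exact Set.mem_iUnion₂.2 ⟨n, hn, hν, hνn⟩
  refine ⟨_, hfin, fun ν hν => hν.1, fun ν hν => ?_⟩
  obtain ⟨γ, h1, h2⟩ := hM ν hν.1
  exact ⟨γ⁻¹, ρ γ ν, ⟨exists_facet_map hρ hν γ, h2⟩, (rho_inv_apply γ ν).symm⟩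

/-- Near `p`, the faces of the hull boundary are contained in the facets at `p`. -/
theorem eventually_contact_subset_facet : ∀ᶠ q in 𝓝 p, ∀ n ∈ futureCone,
    ∃ ν, IsFacet p ν ∧ contact q n ⊆ contact p ν := by
  obtain ⟨C, c, hC, hc, hpg⟩ := exists_uniformGrowth hρ hp
  obtain ⟨M, hM⟩ := exists_map_height_le hρ
  have key : ∀ᶠ q in 𝓝 p, ∀ n ∈ {x | x ∈ hyperbolicPlane ∧ x 0 ≤ M},
      ∃ ν, IsFacet p ν ∧ contact q n ⊆ contact p ν := by
    -- Semicontinuity holds jointly in the data and the normal; compactness of the normals modulo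
    -- `Γ` makes the neighbourhood of `p` independent of the normal.
    refine (isCompact_plane_le M).eventually_forall_of_forall_eventually fun n₀ hn₀ => ?_
    have hn₀' := mem_futureCone_of_plane hn₀.1
    obtain ⟨ν, hν, hsub⟩ := exists_facet hρ hp hT hn₀'
    filter_upwards [eventually_contact_subset hρ hC hc hpg hn₀'] with x hx
    exact ⟨ν, hν, hx.trans hsub⟩
  filter_upwards [key] with q hq n hn
  obtain ⟨m, hm, hmn⟩ := contact_normalize (p := q) hn
  obtain ⟨γ, h1, h2⟩ := hM m hm
  obtain ⟨ν, hν, hsub⟩ := hq _ ⟨h1, h2⟩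
  refine ⟨ρ γ⁻¹ ν, exists_facet_map hρ hν _, ?_⟩
  rw [← hmn]
  intro a ha
  have h3 := hsub ((mem_contact_translate hρ (γ := γ)).2 ha)
  rw [← mem_contact_translate hρ (γ := γ), rho_apply_inv]
  exact h3

omit hT in
/-- Two different facets meet in a side. -/
theorem IsFacet.exists_side [DecidableEq (Γ × V)] {ν ν' : Mink} (hν : IsFacet p ν)
    (hν' : IsFacet p ν') (hne : ν ≠ ν') {σ : ℕ → Γ × V} {n : ℕ} (hpoly : IsPolygon p ν σ n) :
    ∃ a b, IsSide σ n a b ∧ ∀ c ∈ contact p ν ∩ contact p ν', c = a ∨ c = b := by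
  obtain ⟨a₀, ha₀⟩ := contact_nonempty hρ hp (mem_futureCone_of_plane hν'.1)
  set Z := liftedMarking p
  set M := mink ν' (Z a₀) with hM
  -- On the plane of the facet, `mink ν'` is this affine function of the planar coordinates. The
  -- common points are those where it attains the level `M`; were it equal to `M` at three vertices,
  -- the normals would coincide.
  set l : ℝ × ℝ → ℝ := fun P => -mink ν (Z (σ 0)) * mink ν ν' + (pc ν ν').1 * P.1 +
    (pc ν ν').2 * P.2 with hl
  have hlA : IsAff l := ⟨_, _, _, fun P => rfl⟩
  have hlk : ∀ k ≤ n, l (pc ν (Z (σ k))) = mink ν' (Z (σ k)) := by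
    intro k hk
    rw [mink_eq_pc hν.1 ν' (Z (σ k)), mink_eq_of_contact (hpoly.mem hk) (hpoly.mem (Nat.zero_le n))]
    simp only [hl]; ring
  have hcon : ∀ k ≤ n, l (pc ν (Z (σ k))) = M → σ k ∈ contact p ν' := by
    intro k hk h
    exact mem_contact_of_eq ha₀ (by rw [hlk k hk] at h; exact h.symm)
  obtain ⟨a, b, hab, h⟩ := hpoly.ordered.exists_side hpoly.two_le hlA (M := M)
    (fun k hk => (hlk k hk).trans_le (ha₀ _)) (by
      by_contra! hall
      have h2 := hpoly.two_le
      refine hne (eq_of_triple hν.1 hpoly hν'.1 (show 0 < 1 by omega) (show 1 < 2 by omega) h2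
        (hcon 0 (by omega) (hall 0 (by omega))) (hcon 1 (by omega) (hall 1 (by omega)))
        (hcon 2 h2 (hall 2 h2))).symm)
  refine ⟨a, b, hab, ?_⟩
  rintro c ⟨hc, hc'⟩
  obtain ⟨k, -, hk, rfl⟩ := mem_seg.1 (hpoly.mem_iff.1 hc)
  exact h k hk ((hlk k hk).trans (mink_eq_of_contact hc' ha₀))

end Facets

end HypRigidity

/-! ### Barycentric formulas for flat distances -/

namespace HypRigidity

section General

/-- A right inverse of an injective continuous map on a compact set is continuous. -/
theorem continuousOn_of_rightInverse {X Y : Type*} [TopologicalSpace X] [TopologicalSpace Y]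
    [T2Space Y] {f : X → Y} {g : Y → X} {K : Set X} {S : Set Y} (hK : IsCompact K)
    (hf : ContinuousOn f K) (hinj : Set.InjOn f K) (hg : ∀ y ∈ S, g y ∈ K ∧ f (g y) = y) :
    ContinuousOn g S := by
  rw [continuousOn_iff_isClosed]
  intro t ht
  refine ⟨f '' (K ∩ t), ((hK.inter_right ht).image_of_continuousOn
    (hf.mono Set.inter_subset_left)).isClosed, ?_⟩
  ext y
  constructor
  · rintro ⟨h1, h2⟩
    exact ⟨⟨g y, ⟨(hg y h2).1, h1⟩, (hg y h2).2⟩, h2⟩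
  · rintro ⟨⟨x, ⟨hx, hxt⟩, rfl⟩, h2⟩
    have : g (f x) = x := hinj (hg _ h2).1 hx (hg _ h2).2
    exact ⟨by rw [Set.mem_preimage, this]; exact hxt, h2⟩

variable {ι E : Type*} [AddCommGroup E] [Module ℝ E]

theorem continuousOn_bary [TopologicalSpace E] [ContinuousAdd E] [ContinuousSMul ℝ E]
    (Z : ι → E) (t : Finset ι) : ContinuousOn (bary Z) (stdSimp t) := by
  have h : Continuous fun x : ι → ℝ => ∑ a ∈ t, x a • Z a :=
    continuous_finsetSum _ fun a _ => (continuous_apply a).smul continuous_const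
  exact h.continuousOn.congr fun x hx => bary_eq_sum Z hx.2.1

theorem isCompact_stdSimp (t : Finset ι) : IsCompact (stdSimp t) := by
  refine (isCompact_univ_pi fun _ : ι => isCompact_Icc (a := (0 : ℝ)) (b := 1)).of_isClosed_subset
    (isClosed_stdSimp t) fun x hx a _ => ⟨hx.1 a, ?_⟩
  by_cases ha : a ∈ t
  · rw [← hx.2.2]
    exact Finset.single_le_sum (fun b _ => hx.1 b) ha
  · rw [hx.2.1 a ha]; exact zero_le_one

/-- The differences of barycentric coordinates sum to zero, so in the polarized form only the
squared lengths of edges survive. This is why `flatSq` computes distances from edge lengths alone.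
-/
theorem bilin_bary_sub {B : LinearMap.BilinForm ℝ E} (hB : ∀ x y, B x y = B y x) (Z : ι → E)
    {t : Finset ι} {x y : ι → ℝ} (hx : x ∈ stdSimp t) (hy : y ∈ stdSimp t) :
    B (bary Z x - bary Z y) (bary Z x - bary Z y) =
      -(1 / 2) * ∑ a ∈ t, ∑ b ∈ t, B (Z a - Z b) (Z a - Z b) * (x a - y a) * (x b - y b) := by
  set d : ι → ℝ := fun a => x a - y a with hd
  have hd0 : ∑ a ∈ t, d a = 0 := by
    simp only [hd, Finset.sum_sub_distrib, hx.2.2, hy.2.2, sub_self]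
  have e : bary Z x - bary Z y = ∑ a ∈ t, d a • Z a := by
    rw [bary_eq_sum Z hx.2.1, bary_eq_sum Z hy.2.1, ← Finset.sum_sub_distrib]
    exact Finset.sum_congr rfl fun a _ => (sub_smul _ _ _).symm
  rw [e]
  have e1 : B (∑ a ∈ t, d a • Z a) (∑ a ∈ t, d a • Z a) =
      ∑ a ∈ t, ∑ b ∈ t, d a * d b * B (Z a) (Z b) := by
    simp only [map_sum, LinearMap.sum_apply, map_smul, LinearMap.smul_apply, smul_eq_mul,
      Finset.mul_sum]
    refine (Finset.sum_comm).trans ?_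
    exact Finset.sum_congr rfl fun a _ => Finset.sum_congr rfl fun b _ => by ring
  have e2 : ∑ a ∈ t, ∑ b ∈ t, B (Z a - Z b) (Z a - Z b) * (x a - y a) * (x b - y b) =
      (∑ a ∈ t, d a * B (Z a) (Z a)) * (∑ b ∈ t, d b) +
      (∑ a ∈ t, d a) * (∑ b ∈ t, d b * B (Z b) (Z b)) -
      2 * ∑ a ∈ t, ∑ b ∈ t, d a * d b * B (Z a) (Z b) := by
    rw [Finset.sum_mul_sum, Finset.sum_mul_sum, Finset.mul_sum, ← Finset.sum_add_distrib,
      ← Finset.sum_sub_distrib]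
    refine Finset.sum_congr rfl fun a _ => ?_
    rw [Finset.mul_sum, ← Finset.sum_add_distrib, ← Finset.sum_sub_distrib]
    refine Finset.sum_congr rfl fun b _ => ?_
    simp only [map_sub, LinearMap.sub_apply, hd]
    rw [hB (Z b) (Z a)]
    ring
  rw [e1, e2, hd0]
  ring

/-- The Minkowski form as a bilinear form. -/
noncomputable def minkForm : LinearMap.BilinForm ℝ Mink :=
  LinearMap.mk₂ ℝ mink mink_add_left mink_smul_left mink_add_right mink_smul_right

/-- The Euclidean form as a bilinear form. -/
noncomputable def dotForm : LinearMap.BilinForm ℝ (ℝ × ℝ) :=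
  LinearMap.mk₂ ℝ (fun a b => a.1 * b.1 + a.2 * b.2)
    (fun a b c => by simp only [Prod.fst_add, Prod.snd_add]; ring)
    (fun r a b => by simp only [Prod.smul_fst, Prod.smul_snd, smul_eq_mul]; ring)
    (fun a b c => by simp only [Prod.fst_add, Prod.snd_add]; ring)
    (fun r a b => by simp only [Prod.smul_fst, Prod.smul_snd, smul_eq_mul]; ring)

theorem dotForm_sub (a b : ℝ × ℝ) : dotForm (a - b) (a - b) = sqD a b := by
  simp only [dotForm, LinearMap.mk₂_apply, sqD, Prod.fst_sub, Prod.snd_sub]; ring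

theorem mink_bary_sub (Z : ι → Mink) {t : Finset ι} {x y : ι → ℝ} (hx : x ∈ stdSimp t)
    (hy : y ∈ stdSimp t) : mink (bary Z x - bary Z y) (bary Z x - bary Z y) =
      -(1 / 2) * ∑ a ∈ t, ∑ b ∈ t, mink (Z a - Z b) (Z a - Z b) * (x a - y a) * (x b - y b) :=
  bilin_bary_sub (B := minkForm) mink_comm Z hx hy

theorem sqD_bary (Z : ι → ℝ × ℝ) {t : Finset ι} {x y : ι → ℝ} (hx : x ∈ stdSimp t)
    (hy : y ∈ stdSimp t) : sqD (bary Z x) (bary Z y) =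
      -(1 / 2) * ∑ a ∈ t, ∑ b ∈ t, sqD (Z a) (Z b) * (x a - y a) * (x b - y b) := by
  simp only [← dotForm_sub]
  exact bilin_bary_sub (B := dotForm) (fun a b => by
    simp only [dotForm, LinearMap.mk₂_apply]; ring) Z hx hy

end General

/-! ### The hull boundary of nearby data over one facet -/

section FaceMap

variable {Γ : Type*} [Group Γ] {ρ : Γ →* (Mink ≃ₗ[ℝ] Mink)} {V : Type*}

/-- The union of the simplices of `T` in the facet `ν`. -/
def facetReal (p : MarkedData ρ V) (T : Set (Finset (Γ × V))) (ν : Mink) : Set (Γ × V → ℝ) :=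
  ⋃ t ∈ {t | t ∈ T ∧ (t : Set (Γ × V)) ⊆ contact p ν}, stdSimp t

/-- The part over the facet `ν` of an isometry from the flat surface with edge lengths `l` to the
hull boundary of `q`. -/
structure FaceMap (p q : MarkedData ρ V) (T : Set (Finset (Γ × V))) (ν : Mink)
    (h : (Γ × V → ℝ) → Mink) (l : (Γ × V) × (Γ × V) → ℝ) : Prop where
  continuousOn : ContinuousOn h (facetReal p T ν)
  pieces : ∀ t ∈ T, (t : Set (Γ × V)) ⊆ contact p ν → ∃ 𝒦 : Set (Set (Γ × V → ℝ)), 𝒦.Finite ∧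
    ⋃₀ 𝒦 = simplex t ∧ ∀ K ∈ 𝒦, IsClosed K ∧ Convex ℝ K ∧
      ∀ x ∈ K, ∀ y ∈ K, mink (h x - h y) (h x - h y) = flatSq l t x y
  injOn : Set.InjOn h (facetReal p T ν)
  surj : ∀ n ∈ futureCone, contact q n ⊆ contact p ν → ∀ s : Finset (Γ × V),
    (s : Set (Γ × V)) ⊆ contact q n → ∀ x' ∈ stdSimp s,
      ∃ x ∈ facetReal p T ν, h x = bary (liftedMarking q) x'
  maps : ∀ x ∈ facetReal p T ν, ∃ n ∈ futureCone, contact q n ⊆ contact p ν ∧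
    ∃ s : Finset (Γ × V), (s : Set (Γ × V)) ⊆ contact q n ∧
      ∃ x' ∈ stdSimp s, h x = bary (liftedMarking q) x'
  side : ∀ ν', IsFacet p ν' → ν' ≠ ν → ∀ s : Finset (Γ × V),
    (s : Set (Γ × V)) ⊆ contact p ν ∩ contact p ν' → ∀ x ∈ stdSimp s,
      x ∈ facetReal p T ν ∧ h x = bary (liftedMarking q) x
  single : ∀ a ∈ contact p ν, ∃ x ∈ facetReal p T ν, (x a = 1 ∧ ∀ b, b ≠ a → x b = 0) ∧
    h x = liftedMarking q a
  len_self : ∀ a, l (a, a) = 0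
  len_comm : ∀ a b, l (a, b) = l (b, a)
  len_pos : ∀ a ∈ contact p ν, ∀ b ∈ contact p ν, a ≠ b → 0 < l (a, b)
  len_side : ∀ ν', IsFacet p ν' → ν' ≠ ν → ∀ a ∈ contact p ν ∩ contact p ν',
    ∀ b ∈ contact p ν ∩ contact p ν', l (a, b) =
      √(mink (liftedMarking q a - liftedMarking q b) (liftedMarking q a - liftedMarking q b))

variable [DecidableEq (Γ × V)] (hρ : IsHyperbolicHolonomy ρ) [Finite V] [Nonempty V]
  {p : MarkedData ρ V} (hp : p ∈ convexMarkedData ρ V) {T : Set (Finset (Γ × V))}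
  (hT : IsFaceTriangulation p T)
include hρ hp

/-- Near `p`, the hull boundary over a facet is triangulated by the lower hull. -/
theorem IsFacet.eventually_lowerHull {ν : Mink} (hν : IsFacet p ν) {σ : ℕ → Γ × V} {n : ℕ}
    (hpoly : IsPolygon p ν σ n) : ∀ᶠ q in 𝓝 p,
      ConvexlyOrdered σ n (fun a => pc ν (liftedMarking q a)) →
      ∃ T', IsTri σ 0 n T' ∧ ∀ t ∈ T', ∃ m ∈ futureCone, (t : Set (Γ × V)) ⊆ contact q m ∧
        contact q m ⊆ contact p ν := by
  obtain ⟨C, c, hC, hc, hpg⟩ := exists_uniformGrowth hρ hp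
  have hνf := mem_futureCone_of_plane hν.1
  set w : MarkedData ρ V → ℕ → ℝ × ℝ := fun q k => pc ν (liftedMarking q (σ k)) with hw
  set u : MarkedData ρ V → ℕ → ℝ := fun q k => -mink ν (liftedMarking q (σ k)) with hu
  have hwc : ∀ k, Continuous fun q => w q k := fun k =>
    (continuous_pc ν).comp (continuous_liftedMarking (σ k))
  have huc : ∀ k, Continuous fun q => u q k := fun k =>
    (continuous_mink_comp continuous_const (continuous_liftedMarking (σ k))).neg
  have hup : ∀ k, k ≤ n → u p k = u p 0 := fun k hk => by
    simp only [hu, mink_eq_of_contact (hpoly.mem hk) (hpoly.mem (Nat.zero_le n))]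
  -- the normal of a triangle
  set β : MarkedData ρ V → ℕ × ℕ × ℕ → ℝ := fun q z =>
    ((u q z.2.1 - u q z.1) * ((w q z.2.2).2 - (w q z.1).2) -
      (u q z.2.2 - u q z.1) * ((w q z.2.1).2 - (w q z.1).2)) /
      area2 (w q z.1) (w q z.2.1) (w q z.2.2) with hβ
  set δ : MarkedData ρ V → ℕ × ℕ × ℕ → ℝ := fun q z =>
    ((u q z.2.2 - u q z.1) * ((w q z.2.1).1 - (w q z.1).1) -
      (u q z.2.1 - u q z.1) * ((w q z.2.2).1 - (w q z.1).1)) /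
      area2 (w q z.1) (w q z.2.1) (w q z.2.2) with hδ
  set N : MarkedData ρ V → ℕ × ℕ × ℕ → Mink := fun q z =>
    ν + β q z • frame1 ν + δ q z • frame2 ν with hN
  -- The slopes `β` and `δ` come from Cramer's rule. At `p` all heights agree, so both vanish there
  -- and the normal `N q z` tends to `ν`; upper semicontinuity then confines its contact set to the
  -- facet.
  have hev : ∀ z ∈ Finset.range (n + 1) ×ˢ Finset.range (n + 1) ×ˢ Finset.range (n + 1),
      ∀ᶠ q in 𝓝 p, z.1 < z.2.1 → z.2.1 < z.2.2 → N q z ∈ futureCone ∧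
        contact q (N q z) ⊆ contact p ν := by
    rintro ⟨i, j, k⟩ hz
    simp only [Finset.mem_product, Finset.mem_range] at hz
    by_cases hijk : i < j ∧ j < k
    · have harea : area2 (w p i) (w p j) (w p k) ≠ 0 :=
        (hpoly.ordered i j k hijk.1 hijk.2 (by omega)).ne'
      have e1 : u p i = u p 0 := hup i (by omega)
      have e2 : u p j = u p 0 := hup j (by omega)
      have e3 : u p k = u p 0 := hup k (by omega)
      have hac : ContinuousAt (fun q => area2 (w q i) (w q j) (w q k)) p :=
        (continuous_area2 (hwc i) (hwc j) (hwc k)).continuousAt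
      have hβc : ContinuousAt (fun q => β q (i, j, k)) p := by
        refine ContinuousAt.div (Continuous.continuousAt ?_) hac harea
        exact (((huc j).sub (huc i)).mul ((hwc k).snd.sub (hwc i).snd)).sub
          (((huc k).sub (huc i)).mul ((hwc j).snd.sub (hwc i).snd))
      have hδc : ContinuousAt (fun q => δ q (i, j, k)) p := by
        refine ContinuousAt.div (Continuous.continuousAt ?_) hac harea
        exact (((huc k).sub (huc i)).mul ((hwc j).fst.sub (hwc i).fst)).sub
          (((huc j).sub (huc i)).mul ((hwc k).fst.sub (hwc i).fst))
      have hβ0 : β p (i, j, k) = 0 := by simp only [hβ, e1, e2, e3]; simp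
      have hδ0 : δ p (i, j, k) = 0 := by simp only [hδ, e1, e2, e3]; simp
      have hNc : ContinuousAt (fun q => N q (i, j, k)) p :=
        (continuousAt_const.add (hβc.smul continuousAt_const)).add (hδc.smul continuousAt_const)
      have hN0 : N p (i, j, k) = ν := by simp only [hN, hβ0, hδ0]; simp
      have h1 : Filter.Tendsto (fun q => (q, N q (i, j, k))) (𝓝 p) (𝓝 (p, ν)) := by
        have h2 : Filter.Tendsto (fun q => N q (i, j, k)) (𝓝 p) (𝓝 ν) := hN0 ▸ hNc
        exact Filter.tendsto_id.prodMk_nhds h2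
      filter_upwards [h1.eventually (eventually_contact_subset hρ hC hc hpg hνf),
        ((continuous_snd.tendsto (p, ν)).comp h1).eventually (isOpen_futureCone.mem_nhds hνf)]
        with q hq1 hq2 _ _
      exact ⟨hq2, hq1⟩
    · exact Filter.Eventually.of_forall fun q h1 h2 => absurd ⟨h1, h2⟩ hijk
  filter_upwards [(Filter.eventually_all_finset _).2 hev,
    eventually_uniformGrowth hρ hc hpg] with q hq hqg hconv
  obtain ⟨T', hT', hhull⟩ := exists_lowerHull hconv hpoly.two_le
    (fun a => -mink ν (liftedMarking q a))
  refine ⟨T', hT', fun t ht => ?_⟩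
  obtain ⟨i, j, k, -, hij, hjk, hk, hteq⟩ := hT'.exists_eq ht
  obtain ⟨l, ⟨α, b, d, hl⟩, heq, hle⟩ := hhull t ht
  obtain ⟨hNf, hNc⟩ := hq (i, j, k)
    (by simp only [Finset.mem_product, Finset.mem_range]; omega) hij hjk
  have harea := hconv i j k hij hjk hk
  have hmem : ∀ m, m = i ∨ m = j ∨ m = k → l (w q m) = u q m := by
    intro m hm
    refine heq (σ m) ?_
    rw [hteq]
    simp only [Finset.mem_insert, Finset.mem_singleton]
    rcases hm with rfl | rfl | rfl <;> simp
  have hi' := hmem i (Or.inl rfl)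
  have hj' := hmem j (Or.inr (Or.inl rfl))
  have hk' := hmem k (Or.inr (Or.inr rfl))
  rw [hl] at hi' hj' hk'
  have hb : β q (i, j, k) = b := by
    change _ / area2 (w q i) (w q j) (w q k) = b
    rw [div_eq_iff harea.ne']
    simp only [area2]
    rw [← hi', ← hj', ← hk']
    ring
  have hd : δ q (i, j, k) = d := by
    change _ / area2 (w q i) (w q j) (w q k) = d
    rw [div_eq_iff harea.ne']
    simp only [area2]
    rw [← hi', ← hj', ← hk']
    ring
  have hNl : ∀ m, mink (N q (i, j, k)) (liftedMarking q (σ m)) = l (w q m) - u q m - α := by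
    intro m
    simp only [hN, hb, hd, mink_add_left, mink_smul_left, hl, hw, hu, pc]
    ring
  refine ⟨N q (i, j, k), hNf, ?_, hNc⟩
  obtain ⟨a₀, ha₀⟩ := (contact_finite_nonempty hρ (by positivity) (by positivity) hqg hNf).2
  obtain ⟨m₀, -, hm₀, rfl⟩ := mem_seg.1 (hpoly.mem_iff.1 (hNc ha₀))
  intro a ha
  have ha' : a ∈ t := ha
  obtain ⟨m, -, hm, rfl⟩ := mem_seg.1 (hT'.subset_seg ht ha')
  have h1 := heq _ ha'
  have h2 := hle m₀ hm₀
  -- The maximum over all marked points is attained at a vertex of the polygon. There the lower hull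
  -- inequality shows that it does not exceed the value at the vertices of the triangle.
  refine mem_contact_of_eq ha₀ (le_antisymm ?_ (ha₀ (σ m)))
  rw [hNl, hNl]
  have h1' : l (w q m) = u q m := h1
  have h2' : l (w q m₀) ≤ u q m₀ := h2
  linarith

end FaceMap

end HypRigidity

/-! ### The isometry over a facet obtained from a development -/

namespace HypRigidity

section

variable {Γ : Type*} [Group Γ] {ρ : Γ →* (Mink ≃ₗ[ℝ] Mink)} {V : Type*}
  [DecidableEq (Γ × V)] (hρ : IsHyperbolicHolonomy ρ) [Finite V] [Nonempty V]
  {p : MarkedData ρ V} (hp : p ∈ convexMarkedData ρ V) {T : Set (Finset (Γ × V))}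
  (hT : IsFaceTriangulation p T)

omit [Finite V] [Nonempty V] in
theorem IsPolygon.mem_triReal {ν : Mink} {σ : ℕ → Γ × V} {n : ℕ} (hpoly : IsPolygon p ν σ n)
    {T' : Set (Finset (Γ × V))} (hT' : IsTri σ 0 n T') {a : Γ × V} (ha : a ∈ contact p ν) :
    (Pi.single a 1 : Γ × V → ℝ) ∈ triReal {σ 0, σ n} T' := by
  obtain ⟨k, -, hk, rfl⟩ := mem_seg.1 (hpoly.mem_iff.1 ha)
  have hn := hpoly.two_le
  rcases Nat.lt_or_ge k n with h | h
  · exact hT'.side_subset (Nat.zero_le k) h (single_mem_stdSimp (by simp))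
  · obtain rfl : k = n := le_antisymm hk h
    obtain ⟨m, rfl⟩ : ∃ m, k = m + 1 := ⟨k - 1, by omega⟩
    exact hT'.side_subset (Nat.zero_le m) (Nat.lt_succ_self m) (single_mem_stdSimp (by simp))

include hρ hp hT

/-- A development `y` of a triangulation of the hull boundary of `q` over the facet `ν` of `p`
defines an isometry. -/
theorem exists_faceMap {ν : Mink} (hν : IsFacet p ν) {σ : ℕ → Γ × V} {n : ℕ}
    (hpoly : IsPolygon p ν σ n) {q : MarkedData ρ V}
    (hw : ConvexlyOrdered σ n fun a => pc ν (liftedMarking q a)) {y : Γ × V → ℝ × ℝ}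
    (hy : ConvexlyOrdered σ n y) {T' : Set (Finset (Γ × V))} (hT' : IsTri σ 0 n T')
    (hsup : ∀ t ∈ T', ∃ m ∈ futureCone, (t : Set (Γ × V)) ⊆ contact q m ∧
      contact q m ⊆ contact p ν)
    (hM : ∀ t ∈ T', ∀ a ∈ t, ∀ b ∈ t, sqD (y a) (y b) =
      mink (liftedMarking q a - liftedMarking q b) (liftedMarking q a - liftedMarking q b)) :
    ∃ h, FaceMap p q T ν h fun e => √(sqD (y e.1) (y e.2)) := by
  have hn := hpoly.two_le
  set Z := liftedMarking q with hZ
  set w : Γ × V → ℝ × ℝ := fun a => pc ν (Z a) with hwdef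
  have hTF := hν.isTri hρ hp hT hpoly
  set S := seg σ 0 n with hS
  set R := facetReal p T ν with hRdef
  set R' : Set (Γ × V → ℝ) := ⋃ t ∈ T', stdSimp t with hR'def
  have hR : triReal {σ 0, σ n} {t | t ∈ T ∧ (t : Set (Γ × V)) ⊆ contact p ν} = R :=
    hTF.triReal_eq hn
  have hR' : triReal {σ 0, σ n} T' = R' := hT'.triReal_eq hn
  have hRS : R ⊆ stdSimp S := hR ▸ hTF.triReal_subset
  have hRS' : R' ⊆ stdSimp S := hR' ▸ hT'.triReal_subset
  obtain ⟨hyi, hys⟩ := IsTri.bijOn hy hn hTF le_rfl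
  obtain ⟨hyi', hys'⟩ := IsTri.bijOn hy hn hT' le_rfl
  obtain ⟨hwi', hws'⟩ := IsTri.bijOn hw hn hT' le_rfl
  rw [hR] at hyi hys
  rw [hR'] at hyi' hys' hwi' hws'
  -- `T` and `T'` triangulate the same polygon `y`. The map goes from a simplex of `T` to the point
  -- of `y`, then by `G` to the coordinates with respect to `T'`, and from there affinely to the
  -- hull boundary.
  set G : ℝ × ℝ → Γ × V → ℝ := Function.invFunOn (bary y) R' with hG
  have hGspec : ∀ x ∈ stdSimp S, G (bary y x) ∈ R' ∧ bary y (G (bary y x)) = bary y x := by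
    intro x hx
    obtain ⟨x', hx', he⟩ := hys' x hx
    have hex : ∃ a ∈ R', bary y a = bary y x := ⟨x', hx', he⟩
    exact ⟨Function.invFunOn_mem hex, Function.invFunOn_eq hex⟩
  have hGeq : ∀ x x', x ∈ stdSimp S → x' ∈ R' → bary y x' = bary y x → G (bary y x) = x' :=
    fun x x' hx hx' he => hyi' (hGspec x hx).1 hx' ((hGspec x hx).2.trans he.symm)
  have hR'c : IsCompact R' := hT'.finite.isCompact_biUnion fun t _ => isCompact_stdSimp t
  have hGc : ContinuousOn G (bary y '' stdSimp S) := by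
    refine continuousOn_of_rightInverse hR'c ((continuousOn_bary y S).mono hRS') hyi' ?_
    rintro _ ⟨x, hx, rfl⟩
    exact hGspec x hx
  have hpcb : ∀ {x}, x ∈ stdSimp S → pc ν (bary Z x) = bary w x := fun hx => pc_bary ν hx.2.1
  have hside : ∀ ν', IsFacet p ν' → ν' ≠ ν → ∀ s : Finset (Γ × V),
    (s : Set (Γ × V)) ⊆ contact p ν ∩ contact p ν' → stdSimp s ⊆ R ∩ R' := by
    intro ν' hν' hne s hs
    obtain ⟨a, b, hab, hc⟩ := hν.exists_side hρ hp hν' hne.symm hpoly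
    have hsub : s ⊆ {a, b} := fun c hc' => by
      simpa only [Finset.mem_insert, Finset.mem_singleton] using hc c (hs hc')
    intro x hx
    have := stdSimp_mono hsub hx
    exact ⟨hR ▸ hTF.isSide_subset hab this, hR' ▸ hT'.isSide_subset hab this⟩
  refine ⟨fun x => bary Z (G (bary y x)), ?_, ?_, ?_, ?_, ?_, ?_, ?_, ?_, ?_, ?_, ?_⟩
  · have h1 : ContinuousOn (fun x => G (bary y x)) R :=
      hGc.comp ((continuousOn_bary y S).mono hRS) fun x hx => ⟨x, hRS hx, rfl⟩
    exact ContinuousOn.comp (g := bary Z) (continuousOn_bary Z S) h1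
      fun x hx => hRS' (hGspec x (hRS hx)).1
  · intro t ht htν
    have htR : stdSimp t ⊆ R := fun x hx => Set.mem_biUnion (x := t) ⟨ht, htν⟩ hx
    -- The pieces of a triangle of `T` are its intersections with the triangles of `T'`, taken in
    -- the polygon `y`; on each of them the map is affine and isometric.
    refine ⟨(fun s => {x | x ∈ stdSimp t ∧ bary y x ∈ bary y '' stdSimp s}) '' T',
      hT'.finite.image _, ?_, ?_⟩
    · ext x
      constructor
      · rintro ⟨_, ⟨s, -, rfl⟩, hx⟩
        exact hx.1
      · intro hx
        obtain ⟨s, hs, hxs⟩ := Set.mem_iUnion₂.1 (hGspec x (hRS (htR hx))).1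
        exact ⟨_, ⟨s, hs, rfl⟩, hx, _, hxs, (hGspec x (hRS (htR hx))).2⟩
    · rintro _ ⟨s, hs, rfl⟩
      refine ⟨?_, ?_, ?_⟩
      · exact (continuousOn_bary y t).preimage_isClosed_of_isClosed (isClosed_stdSimp t)
          ((isCompact_stdSimp s).image_of_continuousOn (continuousOn_bary y s)).isClosed
      · rintro x₁ ⟨h1, x₁', h1', e1⟩ x₂ ⟨h2, x₂', h2', e2⟩ a b ha hb hab
        refine ⟨convex_stdSimp t h1 h2 ha hb hab, a • x₁' + b • x₂',
          convex_stdSimp s h1' h2' ha hb hab, ?_⟩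
        rw [bary_add y h1'.2.1 h2'.2.1, bary_add y h1.2.1 h2.2.1, e1, e2]
      · rintro x₁ ⟨h1, x₁', h1', e1⟩ x₂ ⟨h2, x₂', h2', e2⟩
        have hsR' : stdSimp s ⊆ R' := fun x hx => Set.mem_biUnion (x := s) hs hx
        rw [hGeq x₁ x₁' (hRS (htR h1)) (hsR' h1') e1, hGeq x₂ x₂' (hRS (htR h2)) (hsR' h2') e2,
          mink_bary_sub Z h1' h2']
        have e3 := sqD_bary y h1' h2'
        have e4 := sqD_bary y h1 h2
        rw [e1, e2] at e3
        calc _ = sqD (bary y x₁) (bary y x₂) := by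
              rw [e3]
              congr 1
              exact Finset.sum_congr rfl fun a ha => Finset.sum_congr rfl fun b hb => by
                rw [hM s hs a ha b hb]
          _ = _ := by
              rw [e4, flatSq]
              congr 1
              exact Finset.sum_congr rfl fun a ha => Finset.sum_congr rfl fun b hb => by
                rw [Real.sq_sqrt]
                simp only [sqD]; positivity
  · intro x₁ h1 x₂ h2 he
    have e1 := hGspec x₁ (hRS h1)
    have e2 := hGspec x₂ (hRS h2)
    have he' := congrArg (pc ν) he
    simp only at he'
    rw [hpcb (hRS' e1.1), hpcb (hRS' e2.1)] at he'
    have := hwi' e1.1 e2.1 he'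
    exact hyi h1 h2 (by rw [← e1.2, ← e2.2, this])
  · intro m hm hmc c hc x₀ hx₀
    have hcS : c ⊆ S := fun a ha => hpoly.mem_iff.1 (hmc (hc ha))
    have hX' : bary Z x₀ ∈ convexHull ℝ (Z '' contact q m) :=
      convexHull_mono (Set.image_mono hc) (mem_convexHull_image_iff.2 ⟨x₀, hx₀, rfl⟩)
    obtain ⟨x', hx', he⟩ := hws' x₀ (stdSimp_mono hcS hx₀)
    obtain ⟨s, hs, hxs⟩ := Set.mem_iUnion₂.1 hx'
    obtain ⟨m', hm', hsm', hmc'⟩ := hsup s hs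
    have hX2 : bary Z x' ∈ convexHull ℝ (Z '' contact q m') :=
      convexHull_mono (Set.image_mono hsm') (mem_convexHull_image_iff.2 ⟨x', hxs, rfl⟩)
    have hle : ∀ (k : Mink) (u : Γ × V → ℝ) (P : Mink), u ∈ stdSimp S →
        (∀ b, mink k (Z b) ≤ mink k P) → mink k (bary Z u) ≤ mink k P := by
      intro k u P hu hb
      rw [mink_bary hu.2.1]
      calc ∑ a ∈ S, u a * mink k (Z a) ≤ ∑ a ∈ S, u a * mink k P :=
            Finset.sum_le_sum fun a _ => mul_le_mul_of_nonneg_left (hb a) (hu.1 a)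
        _ = mink k P := by rw [← Finset.sum_mul, hu.2.2, one_mul]
    have i1 := hle m x' _ (hRS' hx') (mink_le_of_mem_convexHull_contact hX')
    have i2 := hle m' x₀ _ (stdSimp_mono hcS hx₀) (mink_le_of_mem_convexHull_contact hX2)
    have hpc : pc ν (bary Z x') = pc ν (bary Z x₀) := by
      rw [hpcb (hRS' hx'), hpcb (stdSimp_mono hcS hx₀), he]
    have key : ∀ k ∈ futureCone, 0 < -mink ν k := fun k hk => by
      rw [Left.neg_pos_iff]
      have h3 := mem_futureCone_of_plane hν.1
      exact mink_neg_of_future (mem_closedCone_of_plane hν.1) (future_ne_zero h3) hk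
    rw [mink_eq_pc hν.1 m, mink_eq_pc hν.1 m, hpc] at i1
    rw [mink_eq_pc hν.1 m', mink_eq_pc hν.1 m', hpc] at i2
    -- Two boundary points over the same point of the face plane coincide: the support plane at each
    -- of them bounds the height of the other.
    have heq : bary Z x' = bary Z x₀ := by
      refine eq_of_pc hν.1 hpc (le_antisymm ?_ ?_)
      · nlinarith [key m hm]
      · nlinarith [key m' hm']
    obtain ⟨x, hx, hxe⟩ := hys x' (hRS' hx')
    exact ⟨x, hx, by rw [hGeq x x' (hRS hx) hx' hxe.symm, heq]⟩
  · intro x hx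
    obtain ⟨s, hs, hxs⟩ := Set.mem_iUnion₂.1 (hGspec x (hRS hx)).1
    obtain ⟨m, hm, hsm, hmc⟩ := hsup s hs
    exact ⟨m, hm, hmc, s, hsm, _, hxs, rfl⟩
  · intro ν' hν' hne s hs x hx
    obtain ⟨h1, h2⟩ := hside ν' hν' hne s hs hx
    exact ⟨h1, by rw [hGeq x x (hRS h1) h2 rfl]⟩
  · intro a ha
    have h1 : (Pi.single a 1 : Γ × V → ℝ) ∈ R := hR ▸ hpoly.mem_triReal hTF ha
    have h2 : (Pi.single a 1 : Γ × V → ℝ) ∈ R' := hR' ▸ hpoly.mem_triReal hT' ha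
    refine ⟨_, h1, ⟨Pi.single_eq_same _ _, fun b hb => Pi.single_eq_of_ne hb _⟩, ?_⟩
    rw [hGeq _ _ (hRS h1) h2 rfl, bary_single]
  · intro a; simp
  · intro a b; simp only [sqD_comm (y a)]
  · intro a ha b hb hab
    obtain ⟨i, -, hi, rfl⟩ := mem_seg.1 (hpoly.mem_iff.1 ha)
    obtain ⟨j, -, hj, rfl⟩ := mem_seg.1 (hpoly.mem_iff.1 hb)
    refine Real.sqrt_pos.2 (sqD_pos ?_)
    rcases lt_trichotomy i j with h | rfl | h
    · exact hy.ne hn h hj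
    · exact absurd rfl hab
    · exact (hy.ne hn h hi).symm
  · intro ν' hν' hne a ha b hb
    by_cases hab : a = b
    · subst hab; simp [mink]
    have h1 : (({a, b} : Finset (Γ × V)) : Set (Γ × V)) ⊆ contact p ν ∩ contact p ν' := by
      intro c hc
      simp only [Finset.coe_insert, Finset.coe_singleton, Set.mem_insert_iff,
        Set.mem_singleton_iff] at hc
      rcases hc with rfl | rfl <;> assumption
    obtain ⟨s, hs, hxs⟩ := Set.mem_iUnion₂.1 (hside ν' hν' hne _ h1 (midpt_mem hab)).2
    have has : ∀ c, midpt a b c ≠ 0 → c ∈ s := fun c hc => by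
      by_contra h; exact hc (hxs.2.1 c h)
    rw [hM s hs a (has a (by simp [midpt])) b (has b (by simp [midpt]))]

end

end HypRigidity

/-! ### Edge lengths over a facet up to second order -/

namespace HypRigidity

theorem abs_sqD_sub_le {a b a' b' : ℝ × ℝ} {r B : ℝ} (ha : dist a a' ≤ r) (hb : dist b b' ≤ r)
    (h1 : ‖a‖ ≤ B) (h2 : ‖b‖ ≤ B) (h3 : ‖a'‖ ≤ B) (h4 : ‖b'‖ ≤ B) :
    |sqD a b - sqD a' b'| ≤ 16 * B * r := by
  rw [Prod.dist_eq, max_le_iff, Real.dist_eq, Real.dist_eq] at ha hb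
  simp only [Prod.norm_def, Real.norm_eq_abs, max_le_iff] at h1 h2 h3 h4
  have hr : 0 ≤ r := (abs_nonneg _).trans ha.1
  have key : ∀ s t s' t' : ℝ, |s - s'| ≤ r → |t - t'| ≤ r → |s| ≤ B → |t| ≤ B → |s'| ≤ B →
      |t'| ≤ B → |(s - t) ^ 2 - (s' - t') ^ 2| ≤ 8 * B * r := by
    intro s t s' t' h1 h2 h3 h4 h5 h6
    have e : (s - t) ^ 2 - (s' - t') ^ 2 = ((s - s') - (t - t')) * ((s - t) + (s' - t')) := by ring
    have b1 : |(s - s') - (t - t')| ≤ 2 * r := (abs_sub _ _).trans (by linarith)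
    have b2 : |(s - t) + (s' - t')| ≤ 4 * B := by
      have := abs_add_le (s - t) (s' - t')
      have := abs_sub s t
      have := abs_sub s' t'
      linarith
    rw [e, abs_mul]
    calc _ ≤ 2 * r * (4 * B) := mul_le_mul b1 b2 (abs_nonneg _) (by linarith)
      _ = _ := by ring
  have k1 := key _ _ _ _ ha.1 hb.1 h1.1 h2.1 h3.1 h4.1
  have k2 := key _ _ _ _ ha.2 hb.2 h1.2 h2.2 h3.2 h4.2
  have e : sqD a b - sqD a' b' = ((a.1 - b.1) ^ 2 - (a'.1 - b'.1) ^ 2) +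
      ((a.2 - b.2) ^ 2 - (a'.2 - b'.2) ^ 2) := by simp only [sqD]; ring
  rw [e]
  exact (abs_add_le _ _).trans (by linarith)

section

variable {Γ : Type*} [Group Γ] {ρ : Γ →* (Mink ≃ₗ[ℝ] Mink)} {V : Type*}

/-- The squared length of the difference of two lifted marked points. -/
def edgeSq (q : MarkedData ρ V) (a b : Γ × V) : ℝ :=
  mink (liftedMarking q a - liftedMarking q b) (liftedMarking q a - liftedMarking q b)

/-- The total displacement of the lifted marked points in `S`. -/
noncomputable def displacement (p q : MarkedData ρ V) (S : Finset (Γ × V)) : ℝ :=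
  ∑ c ∈ S, ‖liftedMarking q c - liftedMarking p c‖

theorem continuous_displacement (p : MarkedData ρ V) (S : Finset (Γ × V)) :
    Continuous fun q => displacement p q S :=
  continuous_finsetSum _ fun c _ => ((continuous_liftedMarking c).sub continuous_const).norm

theorem displacement_self (p : MarkedData ρ V) (S : Finset (Γ × V)) : displacement p p S = 0 := by
  simp [displacement]

theorem norm_le_displacement (p q : MarkedData ρ V) {S : Finset (Γ × V)} {a : Γ × V} (ha : a ∈ S) :
    ‖liftedMarking q a - liftedMarking p a‖ ≤ displacement p q S :=
  Finset.single_le_sum (f := fun c => ‖liftedMarking q c - liftedMarking p c‖)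
    (fun _ _ => norm_nonneg _) ha

theorem displacement_nonneg (p q : MarkedData ρ V) (S : Finset (Γ × V)) :
    0 ≤ displacement p q S := Finset.sum_nonneg fun _ _ => norm_nonneg _

variable (hρ : IsHyperbolicHolonomy ρ) [Finite V] [Nonempty V]
  {p : MarkedData ρ V} (hp : p ∈ convexMarkedData ρ V) {T : Set (Finset (Γ × V))}
  (hT : IsFaceTriangulation p T)
include hρ hp hT

/-- At `p` all vertices of the facet have the same height above its plane. For nearby data the
height differences are of first order and enter `edgeSq` by their squares. The projected polygon
thus has the prescribed squared lengths up to `r q`, which is of second order, and by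
`exists_development` the developed polygon differs from it by a multiple of `r q`. This holds for
all pairs of vertices, not only for edges of the lower hull. -/
theorem IsFacet.eventually_faceMap {ν : Mink} (hν : IsFacet p ν) :
    ∃ (C : ℝ) (S : Finset (Γ × V)), ∀ᶠ q in 𝓝 p, ∃ h l, FaceMap p q T ν h l ∧
      ∀ a ∈ contact p ν, ∀ b ∈ contact p ν,
        |l (a, b) ^ 2 - edgeSq q a b| ≤ C * displacement p q S ^ 2 := by
  classical
  obtain ⟨σ, n, hpoly⟩ := hν.exists_polygon hρ hp
  have hn := hpoly.two_le
  obtain ⟨C₀, hC₀, δ, hδ, hdev⟩ := exists_development hpoly.ordered hn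
  obtain ⟨ε, hε, hstab⟩ := hpoly.ordered.stable
  set S := seg σ 0 n with hS
  set w : MarkedData ρ V → Γ × V → ℝ × ℝ := fun q a => pc ν (liftedMarking q a) with hw
  have hwc : ∀ a, Continuous fun q => w q a := fun a =>
    (continuous_pc ν).comp (continuous_liftedMarking a)
  obtain ⟨B, hB⟩ : ∃ B, ∀ a ∈ S, ‖w p a‖ ≤ B := ⟨∑ a ∈ S, ‖w p a‖, fun a ha =>
    Finset.single_le_sum (f := fun a => ‖w p a‖) (fun _ _ => norm_nonneg _) ha⟩
  set r : MarkedData ρ V → ℝ := fun q => (6 * ‖ν‖ * displacement p q S) ^ 2 with hr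
  have hrc : Continuous r := (continuous_const.mul (continuous_displacement p S)).pow 2
  have hr0 : r p = 0 := by simp only [hr, displacement_self]; ring
  have ev1 : ∀ᶠ q in 𝓝 p, ∀ a ∈ S, dist (w q a) (w p a) < min δ (ε / 2) := by
    refine (Filter.eventually_all_finset _).2 fun a _ => ?_
    exact (hwc a).continuousAt.eventually (Metric.ball_mem_nhds _ (lt_min hδ (half_pos hε)))
  have ev2 : ∀ᶠ q in 𝓝 p, r q < δ :=
    hrc.continuousAt.eventually (gt_mem_nhds (by rw [hr0]; exact hδ))
  have ev3 : ∀ᶠ q in 𝓝 p, C₀ * r q < ε / 2 :=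
    (continuous_const.mul hrc).continuousAt.eventually
      (gt_mem_nhds (by rw [Pi.mul_apply, hr0, mul_zero]; exact half_pos hε))
  refine ⟨(16 * (B + ε) * C₀ + 1) * (6 * ‖ν‖) ^ 2, S, ?_⟩
  filter_upwards [ev1, ev2, ev3, hν.eventually_lowerHull hρ hp hpoly] with q h1 h2 h3 h4
  have hmemS : ∀ k ≤ n, σ k ∈ S := fun k hk => mem_seg.2 ⟨k, Nat.zero_le k, hk, rfl⟩
  have hqw : ConvexlyOrdered σ n (w q) := hstab _ fun k hk =>
    ((h1 _ (hmemS k hk)).trans_le (min_le_right _ _)).trans (by linarith)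
  obtain ⟨T', hT', hsup⟩ := h4 hqw
  have hMw : ∀ a ∈ S, ∀ b ∈ S, |edgeSq q a b - sqD (w q a) (w q b)| ≤ r q := by
    intro a ha b hb
    have e0 : mink ν (liftedMarking p a) = mink ν (liftedMarking p b) :=
      mink_eq_of_contact (hpoly.mem_iff.2 ha) (hpoly.mem_iff.2 hb)
    have e1 : mink ν (liftedMarking q a) - mink ν (liftedMarking q b) =
        mink ν (liftedMarking q a - liftedMarking p a) -
          mink ν (liftedMarking q b - liftedMarking p b) := by
      rw [mink_sub_right, mink_sub_right, e0]; ring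
    have e2 : |mink ν (liftedMarking q a) - mink ν (liftedMarking q b)| ≤
        6 * ‖ν‖ * displacement p q S := by
      rw [e1]
      have i1 := abs_mink_le ν (liftedMarking q a - liftedMarking p a)
      have i2 := abs_mink_le ν (liftedMarking q b - liftedMarking p b)
      have i3 := mul_le_mul_of_nonneg_left (norm_le_displacement p q ha) (norm_nonneg ν)
      have i4 := mul_le_mul_of_nonneg_left (norm_le_displacement p q hb) (norm_nonneg ν)
      refine (abs_sub _ _).trans ?_
      linarith
    rw [edgeSq, mink_self_eq_sqD hν.1, sub_sub_cancel_left, abs_neg, abs_of_nonneg (sq_nonneg _),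
      ← sq_abs]
    exact pow_le_pow_left₀ (abs_nonneg _) e2 2
  obtain ⟨y, hy1, hy2⟩ := hdev (w q)
    (fun k hk => (h1 _ (hmemS k hk)).trans_le (min_le_left _ _)) T' hT' (edgeSq q) (r q) h2
    (fun a => by simp [edgeSq, mink])
    (fun a b => by simp only [edgeSq, mink, Pi.sub_apply]; ring) hMw
  have hyd : ∀ a ∈ S, dist (y a) (w q a) ≤ C₀ * r q := by
    intro a ha
    obtain ⟨k, -, hk, rfl⟩ := mem_seg.1 ha
    exact hy1 k hk
  have hyp : ∀ a ∈ S, dist (y a) (w p a) < ε := fun a ha =>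
    calc dist (y a) (w p a) ≤ dist (y a) (w q a) + dist (w q a) (w p a) := dist_triangle _ _ _
      _ < ε / 2 + ε / 2 := add_lt_add ((hyd a ha).trans_lt h3)
          ((h1 a ha).trans_le (min_le_right _ _))
      _ = ε := by ring
  have hyo : ConvexlyOrdered σ n y := hstab _ fun k hk => hyp _ (hmemS k hk)
  obtain ⟨h, hh⟩ := exists_faceMap hρ hp hT hν hpoly hqw hyo hT' hsup hy2
  refine ⟨h, _, hh, fun a ha b hb => ?_⟩
  rw [hpoly.mem_iff] at ha hb
  have hnorm : ∀ u a, a ∈ S → dist u (w p a) < ε → ‖u‖ ≤ B + ε := fun u a ha hu => by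
    have := norm_le_norm_add_norm_sub' u (w p a)
    rw [← dist_eq_norm] at this
    linarith [hB a ha]
  have hwp : ∀ a ∈ S, dist (w q a) (w p a) < ε := fun a ha =>
    ((h1 a ha).trans_le (min_le_right _ _)).trans (by linarith)
  have i1 := abs_sqD_sub_le (hyd a ha) (hyd b hb) (hnorm _ a ha (hyp a ha)) (hnorm _ b hb (hyp b hb))
    (hnorm _ a ha (hwp a ha)) (hnorm _ b hb (hwp b hb))
  have i2 := hMw a ha b hb
  have hsq : √(sqD (y a) (y b)) ^ 2 = sqD (y a) (y b) :=
    Real.sq_sqrt (by simp only [sqD]; positivity)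
  rw [abs_sub_comm] at i2
  calc |√(sqD (y a) (y b)) ^ 2 - edgeSq q a b| =
        |(sqD (y a) (y b) - sqD (w q a) (w q b)) + (sqD (w q a) (w q b) - edgeSq q a b)| := by
          rw [hsq]; congr 1; ring
    _ ≤ 16 * (B + ε) * (C₀ * r q) + r q := (abs_add_le _ _).trans (add_le_add i1 i2)
    _ = _ := by simp only [hr]; ring

end

end HypRigidity

/-! ### Transport of face maps by the group -/

namespace HypRigidity

section

variable {Γ : Type*} [Group Γ] {ρ : Γ →* (Mink ≃ₗ[ℝ] Mink)} {V : Type*}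

theorem translate_mul (γ μ : Γ) (a : Γ × V) :
    translate (γ * μ) a = translate γ (translate μ a) :=
  Prod.ext (mul_assoc γ μ a.1) rfl

theorem stdSimp_map_iff {ι : Type*} (e : ι ≃ ι) {t : Finset ι} {x : ι → ℝ} :
    x ∈ stdSimp (t.map e.toEmbedding) ↔ (fun a => x (e a)) ∈ stdSimp t := by
  simp only [stdSimp, Set.mem_ofPred_eq, Finset.mem_map_equiv, Finset.sum_map,
    Equiv.coe_toEmbedding]
  rw [← e.forall_congr_right (q := fun a => 0 ≤ x a),
    ← e.forall_congr_right (q := fun a => e.symm a ∉ t → x a = 0)]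
  simp only [Equiv.symm_apply_apply]

theorem affineAct_bary (q : MarkedData ρ V) (γ : Γ) {s : Finset (Γ × V)} {x : Γ × V → ℝ}
    (hx : (fun a => x (translate γ a)) ∈ stdSimp s) :
    affineAct q.1 γ (bary (liftedMarking q) fun a => x (translate γ a)) =
      bary (liftedMarking q) x := by
  rw [bary_eq_sum _ hx.2.1,
    bary_eq_sum _ ((stdSimp_map_iff (translate γ)).2 hx).2.1, Finset.sum_map]
  simp only [Equiv.coe_toEmbedding, liftedMarking_translate, affineAct, smul_add,
    Finset.sum_add_distrib, map_sum, map_smul]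
  rw [← Finset.sum_smul, hx.2.2, one_smul]

variable {p : MarkedData ρ V} {T : Set (Finset (Γ × V))}

theorem translate_inv (γ : Γ) : (translate γ⁻¹ : Γ × V ≃ Γ × V) = (translate γ).symm := by
  ext a <;> simp [translate]

theorem map_symm_map (γ : Γ) (t : Finset (Γ × V)) :
    (t.map (translate γ⁻¹).toEmbedding).map (translate γ).toEmbedding = t := by
  rw [translate_inv, Finset.map_map]
  convert Finset.map_refl
  ext a <;> simp

variable (hρ : IsHyperbolicHolonomy ρ)
include hρ

theorem map_subset_contact_iff (q : MarkedData ρ V) {n : Mink} {γ : Γ} {t : Finset (Γ × V)} :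
    ((t.map (translate γ).toEmbedding : Finset (Γ × V)) : Set (Γ × V)) ⊆ contact q (ρ γ n) ↔
      (t : Set (Γ × V)) ⊆ contact q n := by
  rw [Finset.coe_map, Equiv.coe_toEmbedding, contact_map hρ q n γ,
    Set.image_subset_image_iff (translate γ).injective]

theorem mem_facetReal_map (hT : IsFaceTriangulation p T) {ν : Mink} (γ : Γ) {x : Γ × V → ℝ} :
    x ∈ facetReal p T (ρ γ ν) ↔ (fun a => x (translate γ a)) ∈ facetReal p T ν := by
  simp only [facetReal, Set.mem_iUnion₂]
  constructor
  · rintro ⟨t, ⟨ht, htc⟩, hx⟩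
    refine ⟨t.map (translate γ⁻¹).toEmbedding, ⟨hT.invariant _ t ht, ?_⟩, ?_⟩
    · rw [← map_subset_contact_iff hρ p (γ := γ), map_symm_map]; exact htc
    · rw [← stdSimp_map_iff, map_symm_map]; exact hx
  · rintro ⟨t, ⟨ht, htc⟩, hx⟩
    exact ⟨_, ⟨hT.invariant γ t ht, (map_subset_contact_iff hρ p).2 htc⟩, (stdSimp_map_iff _).2 hx⟩

/-- The isometries over facets can be moved by the group. -/
theorem FaceMap.map (hT : IsFaceTriangulation p T) {q : MarkedData ρ V} {ν : Mink}
    {h : (Γ × V → ℝ) → Mink} {l : (Γ × V) × (Γ × V) → ℝ} (hF : FaceMap p q T ν h l) (γ : Γ) :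
    FaceMap p q T (ρ γ ν) (fun x => affineAct q.1 γ (h fun a => x (translate γ a)))
      fun e => l ((translate γ).symm e.1, (translate γ).symm e.2) := by
  have hc : Continuous fun (x : Γ × V → ℝ) a => x (translate γ a) :=
    continuous_pi fun a => continuous_apply _
  have hρc : Continuous (ρ γ : Mink → Mink) :=
    (ρ γ : Mink →ₗ[ℝ] Mink).continuous_of_finiteDimensional
  have hinj : Function.Injective fun (x : Γ × V → ℝ) a => x (translate γ a) := fun x y hxy => by
    funext a
    have := congrFun hxy ((translate γ).symm a)
    simpa using this
  have hmem : ∀ {q' : MarkedData ρ V} {n : Mink} {a : Γ × V}, a ∈ contact q' (ρ γ n) →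
      (translate γ).symm a ∈ contact q' n := fun {q' n a} ha => by
    rw [← mem_contact_translate hρ (γ := γ), Equiv.apply_symm_apply]; exact ha
  have hcc : ∀ {n : Mink}, contact q n ⊆ contact p (ρ γ ν) →
      contact q (ρ γ⁻¹ n) ⊆ contact p ν := by
    intro n hn a ha
    rw [← mem_contact_translate hρ (γ := γ), rho_apply_inv] at ha
    exact (mem_contact_translate hρ).1 (hn ha)
  have hsub : ∀ {q' : MarkedData ρ V} {n : Mink} {s : Finset (Γ × V)},
      (s : Set (Γ × V)) ⊆ contact q' n →
      ((s.map (translate γ⁻¹).toEmbedding : Finset (Γ × V)) : Set (Γ × V)) ⊆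
        contact q' (ρ γ⁻¹ n) := fun hs => (map_subset_contact_iff hρ _).2 hs
  have hstd : ∀ {s : Finset (Γ × V)} {x : Γ × V → ℝ}, x ∈ stdSimp s →
      (fun a => x (translate γ a)) ∈ stdSimp (s.map (translate γ⁻¹).toEmbedding) := by
    intro s x hx
    rw [← stdSimp_map_iff, map_symm_map]; exact hx
  refine ⟨?_, ?_, ?_, ?_, ?_, ?_, ?_, fun a => hF.len_self _, fun a b => hF.len_comm _ _, ?_, ?_⟩
  · have h1 : ContinuousOn (fun x : Γ × V → ℝ => h fun a => x (translate γ a))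
        (facetReal p T (ρ γ ν)) :=
      hF.continuousOn.comp hc.continuousOn fun x hx => (mem_facetReal_map hρ hT γ).1 hx
    exact (hρc.comp_continuousOn h1).add continuousOn_const
  · intro t ht htc
    obtain ⟨𝒦, hfin, hU, h𝒦⟩ := hF.pieces _ (hT.invariant γ⁻¹ t ht)
      (by rw [← map_subset_contact_iff hρ p (γ := γ), map_symm_map]; exact htc)
    refine ⟨(fun K => (fun (x : Γ × V → ℝ) a => x (translate γ a)) ⁻¹' K) '' 𝒦, hfin.image _, ?_, ?_⟩
    · rw [Set.sUnion_image]
      ext x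
      have e1 : x ∈ simplex t ↔ (fun a => x (translate γ a)) ∈ ⋃₀ 𝒦 := by
        rw [hU]
        change x ∈ stdSimp t ↔ _ ∈ stdSimp (t.map (translate γ⁻¹).toEmbedding)
        rw [← stdSimp_map_iff, map_symm_map]
      rw [e1]
      simp only [Set.mem_iUnion₂, Set.mem_preimage, Set.mem_sUnion, exists_prop]
    · rintro _ ⟨K, hK, rfl⟩
      obtain ⟨h1, h2, h3⟩ := h𝒦 K hK
      refine ⟨h1.preimage hc, fun x hx y hy a b ha hb hab => h2 hx hy ha hb hab, ?_⟩
      intro x hx y hy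
      rw [affineAct_sub, hρ.mink_map, h3 _ hx _ hy]
      simp only [flatSq, Finset.sum_map, translate_inv, Equiv.coe_toEmbedding,
        Equiv.apply_symm_apply]
  · intro x hx y hy he
    refine hinj (hF.injOn ((mem_facetReal_map hρ hT γ).1 hx) ((mem_facetReal_map hρ hT γ).1 hy) ?_)
    simp only [affineAct, add_left_inj] at he
    exact (ρ γ).injective he
  · intro n hn hnc s hs x' hx'
    obtain ⟨x, hx, he⟩ := hF.surj (ρ γ⁻¹ n) (map_futureCone hρ _ hn) (hcc hnc) _ (hsub hs) _
      (hstd hx')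
    refine ⟨fun a => x ((translate γ).symm a), (mem_facetReal_map hρ hT γ).2 ?_, ?_⟩
    · simpa only [Equiv.symm_apply_apply] using hx
    · simp only [Equiv.symm_apply_apply]
      rw [he, affineAct_bary q γ (hstd hx')]
  · intro x hx
    obtain ⟨n, hn, hnc, s, hs, x', hx', he⟩ := hF.maps _ ((mem_facetReal_map hρ hT γ).1 hx)
    refine ⟨ρ γ n, map_futureCone hρ _ hn, ?_, _, (map_subset_contact_iff hρ q).2 hs,
      fun a => x' ((translate γ).symm a), ?_, ?_⟩
    · rw [contact_map hρ, contact_map hρ]; exact Set.image_mono hnc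
    · rw [stdSimp_map_iff]; simpa only [Equiv.symm_apply_apply] using hx'
    · rw [he, ← affineAct_bary q γ (s := s) (x := fun a => x' ((translate γ).symm a))]
      · simp only [Equiv.symm_apply_apply]
      · simpa only [Equiv.symm_apply_apply] using hx'
  · intro ν' hν' hne s hs x hx
    have h1 : ρ γ⁻¹ ν' ≠ ν := fun h => hne (by rw [← h, rho_apply_inv])
    obtain ⟨h2, h3⟩ := hF.side _ (exists_facet_map hρ hν' γ⁻¹) h1
      (s.map (translate γ⁻¹).toEmbedding) (Set.subset_inter
        (by rw [← map_subset_contact_iff hρ p (γ := γ), map_symm_map]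
            exact hs.trans Set.inter_subset_left)
        (hsub (hs.trans Set.inter_subset_right))) _ (hstd hx)
    refine ⟨(mem_facetReal_map hρ hT γ).2 h2, ?_⟩
    rw [h3, affineAct_bary q γ (hstd hx)]
  · intro a ha
    obtain ⟨x, hx, ⟨h1, h2⟩, h3⟩ := hF.single _ (hmem ha)
    refine ⟨fun b => x ((translate γ).symm b), (mem_facetReal_map hρ hT γ).2 ?_,
      ⟨h1, fun b hb => h2 _ fun h => hb ((translate γ).symm.injective h)⟩, ?_⟩
    · simpa only [Equiv.symm_apply_apply] using hx
    · simp only [Equiv.symm_apply_apply]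
      rw [h3, ← liftedMarking_translate, Equiv.apply_symm_apply]
  · exact fun a ha b hb hab => hF.len_pos _ (hmem ha) _ (hmem hb)
      fun h => hab ((translate γ).symm.injective h)
  · intro ν' hν' hne a ha b hb
    have h1 : ρ γ⁻¹ ν' ≠ ν := fun h => hne (by rw [← h, rho_apply_inv])
    have hm : ∀ {c}, c ∈ contact p ν' → (translate γ).symm c ∈ contact p (ρ γ⁻¹ ν') :=
      fun hc => by rw [← translate_inv]; exact (mem_contact_translate hρ).2 hc
    rw [hF.len_side _ (exists_facet_map hρ hν' γ⁻¹) h1 _ ⟨hmem ha.1, hm ha.2⟩ _ ⟨hmem hb.1, hm hb.2⟩,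
      ← hρ.mink_map γ, ← liftedMarking_translate_sub, Equiv.apply_symm_apply,
      Equiv.apply_symm_apply]

end

end HypRigidity

/-! ### Gluing the face maps equivariantly -/

namespace HypRigidity

section

variable {Γ : Type*} [Group Γ] {ρ : Γ →* (Mink ≃ₗ[ℝ] Mink)} {V : Type*}

open Classical in
/-- Edge lengths chosen facet by facet. -/
noncomputable def gluedLen (p : MarkedData ρ V) (l : Mink → (Γ × V) × (Γ × V) → ℝ)
    (e : (Γ × V) × (Γ × V)) : ℝ :=
  if h : ∃ ν, IsFacet p ν ∧ e.1 ∈ contact p ν ∧ e.2 ∈ contact p ν then l h.choose e else 0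

open Classical in
/-- A map chosen facet by facet. -/
noncomputable def gluedMap (p : MarkedData ρ V) (T : Set (Finset (Γ × V)))
    (H : Mink → (Γ × V → ℝ) → Mink) (x : Γ × V → ℝ) : Mink :=
  if h : ∃ ν, IsFacet p ν ∧ x ∈ facetReal p T ν then H h.choose x else 0

variable {p q : MarkedData ρ V} {T : Set (Finset (Γ × V))} {H : Mink → (Γ × V → ℝ) → Mink}
  {l : Mink → (Γ × V) × (Γ × V) → ℝ}
  (hF : ∀ ν, IsFacet p ν → FaceMap p q T ν (H ν) (l ν))
include hF

theorem gluedLen_eq {ν : Mink} (hν : IsFacet p ν) {a b : Γ × V} (ha : a ∈ contact p ν)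
    (hb : b ∈ contact p ν) : gluedLen p l (a, b) = l ν (a, b) := by
  have h : ∃ ν, IsFacet p ν ∧ (a, b).1 ∈ contact p ν ∧ (a, b).2 ∈ contact p ν := ⟨ν, hν, ha, hb⟩
  rw [gluedLen, dif_pos h]
  obtain ⟨h1, h2, h3⟩ := h.choose_spec
  by_cases hne : h.choose = ν
  · rw [hne]
  · rw [(hF _ h1).len_side ν hν (Ne.symm hne) a ⟨h2, ha⟩ b ⟨h3, hb⟩,
      (hF ν hν).len_side _ h1 hne a ⟨ha, h2⟩ b ⟨hb, h3⟩]

theorem gluedMap_eq {ν : Mink} (hν : IsFacet p ν) {x : Γ × V → ℝ} (hx : x ∈ facetReal p T ν) :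
    gluedMap p T H x = H ν x := by
  classical
  have h : ∃ ν, IsFacet p ν ∧ x ∈ facetReal p T ν := ⟨ν, hν, hx⟩
  rw [gluedMap, dif_pos h]
  obtain ⟨h1, h2⟩ := h.choose_spec
  by_cases hne : h.choose = ν
  · rw [hne]
  · obtain ⟨t, ⟨-, ht⟩, hxt⟩ := Set.mem_iUnion₂.1 hx
    obtain ⟨t', ⟨-, ht'⟩, hxt'⟩ := Set.mem_iUnion₂.1 h2
    have hx' : x ∈ stdSimp (t ∩ t') := by
      refine stdSimp_of_support hxt fun a ha => Finset.mem_inter.2 ⟨?_, ?_⟩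
      · by_contra hc; exact ha (hxt.2.1 a hc)
      · by_contra hc; exact ha (hxt'.2.1 a hc)
    have e1 : ((t ∩ t' : Finset _) : Set (Γ × V)) ⊆ contact p ν ∩ contact p h.choose := by
      rw [Finset.coe_inter]; exact Set.inter_subset_inter ht ht'
    rw [((hF ν hν).side _ h1 hne _ e1 x hx').2,
      ((hF _ h1).side _ hν (Ne.symm hne) _ (Set.inter_comm _ _ ▸ e1) x hx').2]

variable (hρ : IsHyperbolicHolonomy ρ) [Finite V] [Nonempty V]
  (hp : p ∈ convexMarkedData ρ V) (hT : IsFaceTriangulation p T)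
include hρ hp hT

/-- An equivariant family of isometries over the facets defines an isometry of the flat surface
onto the hull boundary. -/
theorem inducedMetricHasLengths_gluedLen {C c : ℝ} (hC : 0 < C) (hc : 0 < c)
    (hg : UniformGrowth q C c)
    (hsub : ∀ n ∈ futureCone, ∃ ν, IsFacet p ν ∧ contact q n ⊆ contact p ν)
    (hH : ∀ ν, IsFacet p ν → ∀ γ x,
      H (ρ γ ν) (fun a => x ((translate γ).symm a)) = affineAct q.1 γ (H ν x))
    (hl : ∀ ν, IsFacet p ν → ∀ γ a b, l (ρ γ ν) (translate γ a, translate γ b) = l ν (a, b)) :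
    InducedMetricHasLengths q T (gluedLen p l) := by
  have hex : ∀ {x}, x ∈ realization T → ∃ ν, IsFacet p ν ∧ x ∈ facetReal p T ν := by
    intro x hx
    obtain ⟨t, ht, hxt⟩ := Set.mem_iUnion₂.1 hx
    classical
    obtain ⟨ν, hν, htν⟩ := exists_facet_of_triangle hρ hp hT ht
    exact ⟨ν, hν, Set.mem_biUnion (x := t) ⟨ht, htν⟩ hxt⟩
  have hreal : ∀ {ν x}, x ∈ facetReal p T ν → x ∈ realization T := by
    intro ν x hx
    obtain ⟨t, ⟨ht, -⟩, hxt⟩ := Set.mem_iUnion₂.1 hx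
    exact Set.mem_biUnion ht hxt
  have hzero : ∀ {a b : Γ × V}, (¬ ∃ ν, IsFacet p ν ∧ a ∈ contact p ν ∧ b ∈ contact p ν) →
      gluedLen p l (a, b) = 0 := fun h => dif_neg h
  obtain ⟨C₁, c₁, hC₁, hc₁, hpg⟩ := exists_uniformGrowth hρ hp
  refine ⟨?_, ?_, ?_, ?_, gluedMap p T H, ⟨?_, ?_, ?_⟩, ?_, ?_, ?_⟩
  · intro a
    by_cases h : ∃ ν, IsFacet p ν ∧ a ∈ contact p ν ∧ a ∈ contact p ν
    · obtain ⟨ν, hν, ha, -⟩ := h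
      rw [gluedLen_eq hF hν ha ha, (hF ν hν).len_self]
    · exact hzero h
  · intro a b
    by_cases h : ∃ ν, IsFacet p ν ∧ a ∈ contact p ν ∧ b ∈ contact p ν
    · obtain ⟨ν, hν, ha, hb⟩ := h
      rw [gluedLen_eq hF hν ha hb, gluedLen_eq hF hν hb ha, (hF ν hν).len_comm]
    · rw [hzero h, hzero fun ⟨ν, hν, hb, ha⟩ => h ⟨ν, hν, ha, hb⟩]
  · rintro ⟨a, b⟩ ⟨hab, t, ht, ha, hb⟩
    classical
    obtain ⟨ν, hν, htν⟩ := exists_facet_of_triangle hρ hp hT ht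
    rw [gluedLen_eq hF hν (htν ha) (htν hb)]
    exact (hF ν hν).len_pos a (htν ha) b (htν hb) hab
  · intro γ a b
    by_cases h : ∃ ν, IsFacet p ν ∧ a ∈ contact p ν ∧ b ∈ contact p ν
    · obtain ⟨ν, hν, ha, hb⟩ := h
      rw [gluedLen_eq hF hν ha hb, gluedLen_eq hF (exists_facet_map hρ hν γ)
        ((mem_contact_translate hρ).2 ha) ((mem_contact_translate hρ).2 hb), hl ν hν]
    · rw [hzero h, hzero]
      rintro ⟨ν, hν, ha, hb⟩
      refine h ⟨_, exists_facet_map hρ hν γ⁻¹, ?_, ?_⟩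
      · rw [← mem_contact_translate hρ (γ := γ), rho_apply_inv]; exact ha
      · rw [← mem_contact_translate hρ (γ := γ), rho_apply_inv]; exact hb
  · intro x hx
    obtain ⟨ν, hν, hxν⟩ := hex hx
    obtain ⟨n, hn, -, s, hs, x', hx', he⟩ := (hF ν hν).maps x hxν
    rw [gluedMap_eq hF hν hxν, he]
    exact (mem_hullBoundary_iff hρ hC hc hg).2 ⟨n, hn, convexHull_mono (Set.image_mono hs)
      (mem_convexHull_image_iff.2 ⟨x', hx', rfl⟩)⟩
  · intro x₁ h1 x₂ h2 he
    obtain ⟨ν₁, hν₁, hx₁⟩ := hex h1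
    obtain ⟨ν₂, hν₂, hx₂⟩ := hex h2
    rw [gluedMap_eq hF hν₁ hx₁, gluedMap_eq hF hν₂ hx₂] at he
    by_cases hne : ν₁ = ν₂
    · subst hne; exact (hF ν₁ hν₁).injOn hx₁ hx₂ he
    obtain ⟨n₁, hn₁, hc₁, s₁, hs₁, x₁', hx₁', e₁⟩ := (hF ν₁ hν₁).maps x₁ hx₁
    obtain ⟨n₂, hn₂, hc₂, s₂, hs₂, x₂', hx₂', e₂⟩ := (hF ν₂ hν₂).maps x₂ hx₂
    have hmax : ∀ b, mink n₁ (liftedMarking q b) ≤ mink n₁ (bary (liftedMarking q) x₂') := by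
      rw [← e₂, ← he, e₁]
      exact mink_le_of_mem_convexHull_contact (convexHull_mono (Set.image_mono hs₁)
        (mem_convexHull_image_iff.2 ⟨x₁', hx₁', rfl⟩))
    classical
    -- If points over two facets have the same image, the marked points that occur in the image with
    -- positive weight lie on both facets. The side condition then makes both preimages equal to the
    -- coordinates `x₂'`.
    set s := s₂.filter fun a => x₂' a ≠ 0 with hs
    have hxs : x₂' ∈ stdSimp s := stdSimp_of_support hx₂' fun a ha => by
      refine Finset.mem_filter.2 ⟨?_, ha⟩
      by_contra hc; exact ha (hx₂'.2.1 a hc)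
    have hsub1 : (s : Set (Γ × V)) ⊆ contact p ν₁ := by
      intro a ha
      refine hc₁ fun b => ?_
      have ha' : a ∈ s := ha
      rw [mink_eq_of_bary_max hx₂' (fun b _ => hmax b) (Finset.mem_filter.1 ha').2]
      exact hmax b
    have hsub2 : (s : Set (Γ × V)) ⊆ contact p ν₂ := fun a ha =>
      hc₂ (hs₂ (Finset.mem_filter.1 (show a ∈ s from ha)).1)
    obtain ⟨k1, k2⟩ := (hF ν₁ hν₁).side ν₂ hν₂ (Ne.symm hne) s (Set.subset_inter hsub1 hsub2) _ hxs
    obtain ⟨k3, k4⟩ := (hF ν₂ hν₂).side ν₁ hν₁ hne s (Set.subset_inter hsub2 hsub1) _ hxs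
    rw [(hF ν₁ hν₁).injOn hx₁ k1 (by rw [he, e₂, k2]), (hF ν₂ hν₂).injOn hx₂ k3 (by rw [e₂, k4])]
  · intro X hX
    obtain ⟨n, hn, hXn⟩ := (mem_hullBoundary_iff hρ hC hc hg).1 hX
    obtain ⟨ν, hν, hnν⟩ := hsub n hn
    classical
    obtain ⟨s, hs⟩ := (contact_finite hρ hp (mem_futureCone_of_plane hν.1)).subset hnν
      |>.exists_finset_coe
    rw [← hs] at hXn
    obtain ⟨x', hx', rfl⟩ := mem_convexHull_image_iff.1 hXn
    obtain ⟨x, hx, he⟩ := (hF ν hν).surj n hn hnν s hs.le x' hx'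
    exact ⟨x, hreal hx, by rw [gluedMap_eq hF hν hx, he]⟩
  · intro γ x hx
    obtain ⟨ν, hν, hxν⟩ := hex hx
    rw [gluedMap_eq hF hν hxν, ← hH ν hν, gluedMap_eq hF (exists_facet_map hρ hν γ)]
    refine (mem_facetReal_map hρ hT γ).2 ?_
    simpa only [Equiv.symm_apply_apply] using hxν
  · intro a
    obtain ⟨n, hn, ha⟩ := exists_mem_contact hρ hp hC₁ hc₁ hpg a
    classical
    obtain ⟨ν, hν, hnν⟩ := exists_facet hρ hp hT hn
    obtain ⟨x, hx, ⟨h1, h2⟩, he⟩ := (hF ν hν).single a (hnν ha)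
    have hxe : x = Pi.single a 1 := by
      funext b
      by_cases hb : b = a
      · subst hb; rw [h1, Pi.single_eq_same]
      · rw [h2 b hb, Pi.single_eq_of_ne hb]
    have := gluedMap_eq hF hν hx
    rw [he, hxe] at this
    convert this
  · intro t ht
    classical
    obtain ⟨ν, hν, htν⟩ := exists_facet_of_triangle hρ hp hT ht
    have htR : simplex t ⊆ facetReal p T ν := fun x hx => Set.mem_biUnion (x := t) ⟨ht, htν⟩ hx
    have heq : ∀ x ∈ simplex t, gluedMap p T H x = H ν x := fun x hx => gluedMap_eq hF hν (htR hx)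
    refine ⟨((hF ν hν).continuousOn.mono htR).congr heq, ?_⟩
    obtain ⟨𝒦, h1, h2, h3⟩ := (hF ν hν).pieces t ht htν
    refine ⟨𝒦, h1, h2, fun K hK => ⟨(h3 K hK).1, (h3 K hK).2.1, fun x hx y hy => ?_⟩⟩
    have hKt : K ⊆ simplex t := h2 ▸ Set.subset_sUnion_of_mem hK
    rw [heq x (hKt hx), heq y (hKt hy), (h3 K hK).2.2 x hx y hy]
    simp only [flatSq]
    congr 1
    exact Finset.sum_congr rfl fun a ha => Finset.sum_congr rfl fun b hb => by
      rw [gluedLen_eq hF hν (htν ha) (htν hb)]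

end

section

variable {Γ : Type*} [Group Γ] {ρ : Γ →* (Mink ≃ₗ[ℝ] Mink)} {V : Type*}
  (hρ : IsHyperbolicHolonomy ρ) [Finite V] [Nonempty V]
  {p : MarkedData ρ V} (hp : p ∈ convexMarkedData ρ V) {T : Set (Finset (Γ × V))}
  (hT : IsFaceTriangulation p T)
include hρ hp hT

/-- Equivariant representatives of the facets. -/
theorem exists_facet_representatives : ∃ (S : Set Mink) (rep : Mink → Mink) (g : Mink → Γ),
    S.Finite ∧ (∀ ν ∈ S, IsFacet p ν) ∧
    (∀ ν, IsFacet p ν → rep ν ∈ S ∧ ν = ρ (g ν) (rep ν)) ∧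
    ∀ ν, IsFacet p ν → ∀ γ, rep (ρ γ ν) = rep ν ∧ g (ρ γ ν) = γ * g ν := by
  obtain ⟨S, hS, hSf, hcov⟩ := finite_facets hρ hp hT
  -- The predicate depends only on the orbit of `ν`, so the choice of `rep` is constant on orbits.
  -- Freeness of the action on the plane makes `g` unique, hence equivariant.
  set rep : Mink → Mink := fun ν => Classical.epsilon fun ν₀ => ν₀ ∈ S ∧ ∃ γ, ν = ρ γ ν₀ with hrep
  set g : Mink → Γ := fun ν => Classical.epsilon fun γ => ν = ρ γ (rep ν) with hg
  have h1 : ∀ ν, IsFacet p ν → rep ν ∈ S ∧ ∃ γ, ν = ρ γ (rep ν) := fun ν hν => by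
    obtain ⟨γ, ν₀, hν₀, he⟩ := hcov ν hν
    exact Classical.epsilon_spec (p := fun ν₀ => ν₀ ∈ S ∧ ∃ γ, ν = ρ γ ν₀) ⟨ν₀, hν₀, γ, he⟩
  have h2 : ∀ ν, IsFacet p ν → ν = ρ (g ν) (rep ν) := fun ν hν =>
    Classical.epsilon_spec (p := fun γ => ν = ρ γ (rep ν)) (h1 ν hν).2
  have h3 : ∀ ν γ, rep (ρ γ ν) = rep ν := by
    intro ν γ
    simp only [hrep]
    congr 1
    funext ν₀
    refine propext (and_congr_right fun _ => ⟨?_, ?_⟩)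
    · rintro ⟨μ, hμ⟩
      exact ⟨γ⁻¹ * μ, by rw [rho_mul_apply, ← hμ, rho_inv_apply]⟩
    · rintro ⟨μ, hμ⟩
      exact ⟨γ * μ, by rw [rho_mul_apply, ← hμ]⟩
  refine ⟨S, rep, g, hS, hSf, fun ν hν => ⟨(h1 ν hν).1, h2 ν hν⟩, fun ν hν γ => ⟨h3 ν γ, ?_⟩⟩
  have e1 := h2 _ (exists_facet_map hρ hν γ)
  rw [h3] at e1
  by_contra hne
  refine hρ.free ((g (ρ γ ν))⁻¹ * (γ * g ν)) (fun h => hne (inv_mul_eq_one.1 h)) (rep ν)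
    (hSf _ (h1 ν hν).1).1 ?_
  rw [rho_mul_apply, rho_mul_apply, ← h2 ν hν]
  exact (congrArg _ e1).trans (rho_inv_apply _ _)

/-- Near `p`, the induced metrics have edge lengths whose squares agree with those of the lifted
marked points up to second order. -/
theorem exists_eventually_lengths : ∃ Φ : (Γ × V) × (Γ × V) → MarkedData ρ V → ℝ,
    (∀ᶠ q in 𝓝 p, InducedMetricHasLengths q T fun e => Φ e q) ∧
    ∀ ν, IsFacet p ν → ∀ a ∈ contact p ν, ∀ b ∈ contact p ν,
      ∃ (C : ℝ) (S : Finset (Γ × V)), ∀ᶠ q in 𝓝 p, 0 ≤ Φ (a, b) q ∧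
        |Φ (a, b) q ^ 2 - edgeSq q a b| ≤ C * displacement p q S ^ 2 := by
  obtain ⟨S, rep, g, hS, hSf, hrep, hequiv⟩ := exists_facet_representatives hρ hp hT
  have hloc : ∀ ν : S, ∃ (C : ℝ) (F : Finset (Γ × V)), ∀ᶠ q in 𝓝 p, ∃ h l, FaceMap p q T ν h l ∧
      ∀ a ∈ contact p ν, ∀ b ∈ contact p ν,
        |l (a, b) ^ 2 - edgeSq q a b| ≤ C * displacement p q F ^ 2 :=
    fun ν => (hSf ν ν.2).eventually_faceMap hρ hp hT
  choose C F hCF using hloc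
  obtain ⟨C₁, c₁, hC₁, hc₁, hpg⟩ := exists_uniformGrowth hρ hp
  have hall : ∀ᶠ q in 𝓝 p, ∀ ν : S, ∃ h l, FaceMap p q T ν h l ∧
      ∀ a ∈ contact p ν, ∀ b ∈ contact p ν,
        |l (a, b) ^ 2 - edgeSq q a b| ≤ C ν * displacement p q (F ν) ^ 2 := by
    have := hS.to_subtype
    exact Filter.eventually_all.2 hCF
  classical
  -- The choice is made for all data, with the default zero where no face maps exist; near `p` the
  -- default is never used.
  have hchoice : ∀ q : MarkedData ρ V, ∃ (h : Mink → (Γ × V → ℝ) → Mink)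
      (l : Mink → (Γ × V) × (Γ × V) → ℝ), (∀ ν : S, ∃ h l, FaceMap p q T ν h l ∧
        ∀ a ∈ contact p ν, ∀ b ∈ contact p ν,
          |l (a, b) ^ 2 - edgeSq q a b| ≤ C ν * displacement p q (F ν) ^ 2) →
      ∀ ν : S, FaceMap p q T ν (h ν) (l ν) ∧ ∀ a ∈ contact p ν, ∀ b ∈ contact p ν,
          |l ν (a, b) ^ 2 - edgeSq q a b| ≤ C ν * displacement p q (F ν) ^ 2 := by
    intro q
    by_cases hq : ∀ ν : S, ∃ h l, FaceMap p q T ν h l ∧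
        ∀ a ∈ contact p ν, ∀ b ∈ contact p ν,
          |l (a, b) ^ 2 - edgeSq q a b| ≤ C ν * displacement p q (F ν) ^ 2
    · choose h l hh using hq
      refine ⟨fun ν => if hν : ν ∈ S then h ⟨ν, hν⟩ else 0,
        fun ν => if hν : ν ∈ S then l ⟨ν, hν⟩ else 0, fun _ ν => ?_⟩
      simp only [Subtype.coe_prop, dif_pos, Subtype.coe_eta]
      exact hh ν
    · exact ⟨0, 0, fun h => absurd h hq⟩
  choose h l hhl using hchoice
  set L : MarkedData ρ V → Mink → (Γ × V) × (Γ × V) → ℝ := fun q ν e =>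
    l q (rep ν) ((translate (g ν)).symm e.1, (translate (g ν)).symm e.2) with hL
  set H : MarkedData ρ V → Mink → (Γ × V → ℝ) → Mink := fun q ν x =>
    affineAct q.1 (g ν) (h q (rep ν) fun a => x (translate (g ν) a)) with hH
  have hfam : ∀ q, (∀ ν : S, ∃ h l, FaceMap p q T ν h l ∧
      ∀ a ∈ contact p ν, ∀ b ∈ contact p ν,
        |l (a, b) ^ 2 - edgeSq q a b| ≤ C ν * displacement p q (F ν) ^ 2) →
      ∀ ν, IsFacet p ν → FaceMap p q T ν (H q ν) (L q ν) := by
    intro q hq ν hν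
    have := (hhl q hq ⟨rep ν, (hrep ν hν).1⟩).1.map hρ hT (g ν)
    exact (congrArg (fun μ => FaceMap p q T μ (H q ν) (L q ν)) (hrep ν hν).2).mpr this
  refine ⟨fun e q => gluedLen p (L q) e, ?_, ?_⟩
  · filter_upwards [hall, eventually_uniformGrowth hρ hc₁ hpg,
      eventually_contact_subset_facet hρ hp hT] with q hq1 hq2 hq3
    refine inducedMetricHasLengths_gluedLen (H := H q) (hfam q hq1) hρ hp hT (by positivity)
      (by positivity) hq2 hq3 ?_ ?_
    · intro ν hν γ x
      obtain ⟨e1, e2⟩ := hequiv ν hν γ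
      simp only [hH, e1, e2, affineAct_mul, translate_mul, Equiv.symm_apply_apply]
    · intro ν hν γ a b
      obtain ⟨e1, e2⟩ := hequiv ν hν γ
      have e3 : ∀ a : Γ × V, (translate (γ * g ν)).symm (translate γ a) = (translate (g ν)).symm a := by
        intro a
        rw [Equiv.symm_apply_eq, translate_mul, Equiv.apply_symm_apply]
      simp only [hL, e1, e2, e3]
  · intro ν hν a ha b hb
    refine ⟨C ⟨rep ν, (hrep ν hν).1⟩, F ⟨rep ν, (hrep ν hν).1⟩, ?_⟩
    have hm : ∀ {c}, c ∈ contact p ν → (translate (g ν)).symm c ∈ contact p (rep ν) := by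
      intro c hc
      rw [(hrep ν hν).2] at hc
      rw [← mem_contact_translate hρ (γ := g ν), Equiv.apply_symm_apply]
      exact hc
    filter_upwards [hall] with q hq
    rw [gluedLen_eq (hfam q hq) hν ha hb]
    constructor
    · by_cases hab : a = b
      · rw [hab, (hfam q hq ν hν).len_self]
      · exact ((hfam q hq ν hν).len_pos a ha b hb hab).le
    · have := (hhl q hq ⟨rep ν, (hrep ν hν).1⟩).2 _ (hm ha) _ (hm hb)
      have e : edgeSq q ((translate (g ν)).symm a) ((translate (g ν)).symm b) = edgeSq q a b := by
        rw [edgeSq, ← hρ.mink_map (g ν), ← liftedMarking_translate_sub, Equiv.apply_symm_apply,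
          Equiv.apply_symm_apply, edgeSq]
      rw [e] at this
      exact this

end

end HypRigidity

/-! ### Differentiability of the edge lengths -/

namespace HypRigidity

/-- Factor the difference of the squares of `f` and `L + d`, and divide by `f + L + d`, which is at
least `L / 2`. -/
theorem abs_sub_sub_le_of_sq {f L d E C K : ℝ} (hL : 0 < L) (hf : 0 ≤ f)
    (hX : |f ^ 2 - L ^ 2 - 2 * L * d| ≤ C * E ^ 2) (hd : |d| ≤ K * E) (hKE : K * E ≤ L / 2) :
    |f - L - d| ≤ 2 / L * (C + K ^ 2) * E ^ 2 := by
  have h1 : (f - L - d) * (f + L + d) = (f ^ 2 - L ^ 2 - 2 * L * d) - d ^ 2 := by ring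
  have h2 : L / 2 ≤ f + L + d := by linarith [neg_abs_le d]
  have h3 : d ^ 2 ≤ K ^ 2 * E ^ 2 := by
    rw [← sq_abs, ← mul_pow]; exact pow_le_pow_left₀ (abs_nonneg _) hd 2
  have h4 : |f - L - d| * (L / 2) ≤ (C + K ^ 2) * E ^ 2 := by
    calc |f - L - d| * (L / 2) ≤ |f - L - d| * |f + L + d| :=
          mul_le_mul_of_nonneg_left (h2.trans (le_abs_self _)) (abs_nonneg _)
      _ = |(f ^ 2 - L ^ 2 - 2 * L * d) - d ^ 2| := by rw [← abs_mul, h1]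
      _ ≤ |f ^ 2 - L ^ 2 - 2 * L * d| + |d ^ 2| := abs_sub _ _
      _ ≤ (C + K ^ 2) * E ^ 2 := by rw [abs_of_nonneg (sq_nonneg d)]; linarith
  calc |f - L - d| = 2 / L * (|f - L - d| * (L / 2)) := by field_simp
    _ ≤ 2 / L * ((C + K ^ 2) * E ^ 2) := mul_le_mul_of_nonneg_left h4 (by positivity)
    _ = _ := by ring

section

variable {Γ : Type*} [Group Γ] {ρ : Γ →* (Mink ≃ₗ[ℝ] Mink)} {V : Type*}

/-- The derivative of half the squared length of an edge. -/
noncomputable def edgeDeriv (p : MarkedData ρ V) (a b : Γ × V) : MarkedData ρ V →L[ℝ] ℝ :=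
  (LinearMap.toContinuousLinearMap (minkForm (liftedMarking p a - liftedMarking p b))).comp
    (markingCLM ρ a - markingCLM ρ b)

theorem edgeDeriv_apply (p q : MarkedData ρ V) (a b : Γ × V) : edgeDeriv p a b q =
    mink (liftedMarking p a - liftedMarking p b) (liftedMarking q a - liftedMarking q b) := rfl

/-- A length whose square agrees with the squared length of an edge up to second order has the
same derivative. -/
theorem hasFDerivAt_of_sq_sub_edgeSq {p : MarkedData ρ V} {a b : Γ × V} (hab : 0 < edgeSq p a b)
    {f : MarkedData ρ V → ℝ} {C : ℝ} {S : Finset (Γ × V)}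
    (hf : ∀ᶠ q in 𝓝 p, 0 ≤ f q ∧ |f q ^ 2 - edgeSq q a b| ≤ C * displacement p q S ^ 2) :
    HasFDerivAt f ((√(edgeSq p a b))⁻¹ • edgeDeriv p a b) p := by
  classical
  set L := √(edgeSq p a b) with hLdef
  have hL : 0 < L := Real.sqrt_pos.2 hab
  have hL2 : L ^ 2 = edgeSq p a b := Real.sq_sqrt hab.le
  have hfp : f p = L := by
    obtain ⟨h1, h2⟩ := hf.self_of_nhds
    rw [displacement_self, zero_pow two_ne_zero, mul_zero] at h2
    rw [hLdef, ← sub_eq_zero.1 (abs_eq_zero.1 (le_antisymm h2 (abs_nonneg _))), Real.sqrt_sq h1]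
  set F : Finset (Γ × V) := insert a (insert b S) with hF
  -- The data space has only the topology of pointwise convergence. Only the finitely many points of
  -- `F` enter the estimate, so the error is measured through the normed space of their positions.
  set G : MarkedData ρ V →L[ℝ] (F → Mink) := ContinuousLinearMap.pi fun c => markingCLM ρ c with hG
  have hGn : ∀ q, ∀ c ∈ F, ‖liftedMarking q c - liftedMarking p c‖ ≤ ‖G (q - p)‖ := by
    intro q c hc
    rw [← liftedMarking_sub]
    exact norm_le_pi_norm (G (q - p)) ⟨c, hc⟩
  have hdisp : ∀ q, displacement p q S ≤ S.card * ‖G (q - p)‖ := fun q => by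
    rw [← nsmul_eq_mul]
    exact Finset.sum_le_card_nsmul _ _ _ fun c hc =>
      hGn q c (Finset.mem_insert_of_mem (Finset.mem_insert_of_mem hc))
  set Δ := liftedMarking p a - liftedMarking p b with hΔ
  have hC0 : ∀ᶠ q in 𝓝 p, 0 ≤ f q ∧
      |f q ^ 2 - edgeSq q a b| ≤ |C| * S.card ^ 2 * ‖G (q - p)‖ ^ 2 := by
    filter_upwards [hf] with q hq
    refine ⟨hq.1, hq.2.trans ?_⟩
    calc C * displacement p q S ^ 2 ≤ |C| * displacement p q S ^ 2 :=
          mul_le_mul_of_nonneg_right (le_abs_self C) (sq_nonneg _)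
      _ ≤ |C| * (S.card * ‖G (q - p)‖) ^ 2 := mul_le_mul_of_nonneg_left
          (pow_le_pow_left₀ (displacement_nonneg p q S) (hdisp q) 2) (abs_nonneg C)
      _ = _ := by ring
  set K := L⁻¹ * (6 * ‖Δ‖) with hK
  have hGc : Continuous fun q => ‖G (q - p)‖ := (G.continuous.comp (continuous_sub_right p)).norm
  have hG0 : ‖G (p - p)‖ = 0 := by simp
  have hsmall : ∀ᶠ q in 𝓝 p, K * ‖G (q - p)‖ < L / 2 :=
    (continuous_const.mul hGc).continuousAt.eventually
      (gt_mem_nhds (by rw [Pi.mul_apply, hG0, mul_zero]; exact half_pos hL))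
  have hbound : ∀ᶠ q in 𝓝 p, |f q - f p - (L⁻¹ • edgeDeriv p a b) (q - p)| ≤
      2 / L * (|C| * S.card ^ 2 + 12 + K ^ 2) * ‖G (q - p)‖ ^ 2 := by
    filter_upwards [hC0, hsmall] with q hq1 hq2
    rw [hfp]
    set δ := liftedMarking (q - p) a - liftedMarking (q - p) b with hδ
    have hδn : ‖δ‖ ≤ 2 * ‖G (q - p)‖ := by
      have h1 := hGn q a (Finset.mem_insert_self _ _)
      have h2 := hGn q b (Finset.mem_insert_of_mem (Finset.mem_insert_self _ _))
      rw [← liftedMarking_sub] at h1 h2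
      exact (norm_sub_le _ _).trans (by linarith)
    have hd : (L⁻¹ • edgeDeriv p a b) (q - p) = L⁻¹ * mink Δ δ := rfl
    rw [hd]
    refine abs_sub_sub_le_of_sq hL hq1.1 ?_ ?_ hq2.le
    · have e1 : edgeSq q a b = L ^ 2 + 2 * L * (L⁻¹ * mink Δ δ) + mink δ δ := by
        have e2 : liftedMarking q a - liftedMarking q b = Δ + δ := by
          rw [hΔ, hδ, liftedMarking_sub, liftedMarking_sub]; abel
        rw [hL2, edgeSq, edgeSq, e2, mink_add_left, mink_add_right, mink_add_right, mink_comm δ Δ]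
        field_simp
        ring
      have e3 : |mink δ δ| ≤ 12 * ‖G (q - p)‖ ^ 2 := by
        refine (abs_mink_le δ δ).trans ?_
        nlinarith [norm_nonneg δ]
      calc |f q ^ 2 - L ^ 2 - 2 * L * (L⁻¹ * mink Δ δ)| = |(f q ^ 2 - edgeSq q a b) + mink δ δ| := by
            rw [e1]; congr 1; ring
        _ ≤ _ := (abs_add_le _ _).trans (by linarith [hq1.2])
    · rw [abs_mul, abs_of_pos (inv_pos.2 hL), hK, mul_assoc]
      refine mul_le_mul_of_nonneg_left ?_ (inv_pos.2 hL).le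
      refine (abs_mink_le Δ δ).trans ?_
      nlinarith [norm_nonneg Δ]
  rw [hasFDerivAt_iff_isLittleOTVS]
  refine Asymptotics.IsLittleOTVS.trans_isBigOTVS (g := fun q => G (q - p)) ?_
    (G.isBigOTVS_fun_comp)
  rw [Asymptotics.isLittleOTVS_iff_isLittleO]
  have hO : (fun q => f q - f p - (L⁻¹ • edgeDeriv p a b) (q - p)) =O[𝓝 p]
      fun q => ‖G (q - p)‖ ^ 2 := by
    refine Asymptotics.IsBigO.of_bound (2 / L * (|C| * S.card ^ 2 + 12 + K ^ 2)) ?_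
    filter_upwards [hbound] with q hq
    rw [Real.norm_eq_abs, norm_pow, norm_norm]
    exact hq
  refine hO.trans_isLittleO ?_
  have h0 : Filter.Tendsto (fun q => ‖G (q - p)‖) (𝓝 p) (𝓝 0) := hG0 ▸ hGc.tendsto p
  have h1 : (fun q => ‖G (q - p)‖ * ‖G (q - p)‖) =o[𝓝 p] fun q => 1 * ‖G (q - p)‖ :=
    ((Asymptotics.isLittleO_one_iff ℝ).2 h0).mul_isBigO (Asymptotics.isBigO_refl _ _)
  simp only [one_mul, ← sq] at h1
  exact h1.of_norm_right

end

end HypRigidity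

/-! ### Infinitesimal rigidity of polygons and the twists of the facets -/

namespace HypRigidity

section

variable {ι : Type*} [DecidableEq ι] {σ : ℕ → ι} {n : ℕ} {w u : ι → ℝ × ℝ}

/-- An infinitesimal deformation of a triangulated convex polygon which preserves the lengths of
the edges is a rotation. -/
theorem IsTri.exists_rotation (hw : ConvexlyOrdered σ n w) (hn : 2 ≤ n) {i j : ℕ}
    {T : Set (Finset ι)} (hT : IsTri σ i j T) (hj : j ≤ n)
    (hd : ∀ t ∈ T, ∀ a ∈ t, ∀ b ∈ t, dotForm (w a - w b) (u a - u b) = 0)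
    (hij : dotForm (w (σ i) - w (σ j)) (u (σ i) - u (σ j)) = 0) :
    ∃ κ : ℝ, ∀ a ∈ seg σ i j, ∀ b ∈ seg σ i j,
      u a - u b = κ • (-(w a - w b).2, (w a - w b).1) := by
  have key : ∀ {s : Finset ι} {κ : ℝ} (c : ι),
      (∀ a ∈ s, u a - u c = κ • (-(w a - w c).2, (w a - w c).1)) →
      ∀ a ∈ s, ∀ b ∈ s, u a - u b = κ • (-(w a - w b).2, (w a - w b).1) := by
    intro s κ c h a ha b hb
    have e : u a - u b = (u a - u c) - (u b - u c) := by abel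
    rw [e, h a ha, h b hb, ← smul_sub]
    congr 1
    ext <;> simp only [Prod.fst_sub, Prod.snd_sub] <;> ring
  induction hT with
  | leaf i =>
    have hne := hw.ne hn (Nat.lt_succ_self i) hj
    have hpos := sqD_pos hne
    set x := w (σ i) - w (σ (i + 1)) with hx
    set y := u (σ i) - u (σ (i + 1)) with hy
    have hx2 : x.1 ^ 2 + x.2 ^ 2 = sqD (w (σ i)) (w (σ (i + 1))) := by
      simp only [hx, sqD, Prod.fst_sub, Prod.snd_sub]
    have hd0 : x.1 * y.1 + x.2 * y.2 = 0 := hij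
    have hxpos : 0 < x.1 ^ 2 + x.2 ^ 2 := hx2 ▸ hpos
    refine ⟨(x.1 * y.2 - x.2 * y.1) / (x.1 ^ 2 + x.2 ^ 2), key (σ (i + 1)) ?_⟩
    intro a ha
    obtain ⟨k, hk1, hk2, rfl⟩ := mem_seg.1 ha
    obtain rfl | rfl : k = i ∨ k = i + 1 := by omega
    · change y = _ • (-x.2, x.1)
      ext
      · simp only [Prod.smul_fst, smul_eq_mul]
        rw [div_mul_eq_mul_div, eq_div_iff hxpos.ne']
        linear_combination x.1 * hd0
      · simp only [Prod.smul_snd, smul_eq_mul]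
        rw [div_mul_eq_mul_div, eq_div_iff hxpos.ne']
        linear_combination x.2 * hd0
    · ext <;> simp
  | @node i m j T₁ T₂ h₁ h₂ ih₁ ih₂ =>
    have him := h₁.lt
    have hmj := h₂.lt
    have ht := hd _ (Set.mem_insert _ _)
    obtain ⟨κ₁, k1⟩ := ih₁ (by omega)
      (fun t ht => hd t (Set.mem_insert_of_mem _ (Or.inl ht))) (ht _ (by simp) _ (by simp))
    obtain ⟨κ₂, k2⟩ := ih₂ hj
      (fun t ht => hd t (Set.mem_insert_of_mem _ (Or.inr ht))) (ht _ (by simp) _ (by simp))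
    have harea := hw i m j him hmj hj
    have e1 := k1 (σ i) (mem_seg.2 ⟨i, le_rfl, him.le, rfl⟩) (σ m) (mem_seg.2 ⟨m, him.le, le_rfl, rfl⟩)
    have e2 := k2 (σ j) (mem_seg.2 ⟨j, hmj.le, le_rfl, rfl⟩) (σ m) (mem_seg.2 ⟨m, le_rfl, hmj.le, rfl⟩)
    have e3 : u (σ i) - u (σ j) = (u (σ i) - u (σ m)) - (u (σ j) - u (σ m)) := by abel
    rw [e3, e1, e2] at hij
    -- The two parts rotate about `σ m` with velocities `κ₁` and `κ₂`. The length of the third side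
    -- is preserved to first order, so their difference times the area of the triangle is zero.
    have hκ : κ₂ = κ₁ := by
      have : (κ₁ - κ₂) * area2 (w (σ i)) (w (σ m)) (w (σ j)) = 0 := by
        rw [← hij]
        simp only [dotForm, LinearMap.mk₂_apply, area2, Prod.fst_sub, Prod.snd_sub, Prod.smul_fst,
          Prod.smul_snd, smul_eq_mul]
        ring
      rcases mul_eq_zero.1 this with h | h
      · linarith
      · exact absurd h harea.ne'
    rw [hκ] at k2
    refine ⟨κ₁, key (σ m) fun a ha => ?_⟩
    obtain ⟨k, hk1, hk2, rfl⟩ := mem_seg.1 ha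
    rcases le_total k m with h | h
    · exact k1 _ (mem_seg.2 ⟨k, hk1, h, rfl⟩) _ (mem_seg.2 ⟨m, him.le, le_rfl, rfl⟩)
    · exact k2 _ (mem_seg.2 ⟨k, h, hk2, rfl⟩) _ (mem_seg.2 ⟨m, le_rfl, hmj.le, rfl⟩)

end

section

variable {Γ : Type*} [Group Γ] {ρ : Γ →* (Mink ≃ₗ[ℝ] Mink)} {V : Type*}

/-- The variation `q` of the marked points turns the facet `ν` with angular velocity `κ` in its
plane. -/
def HasTwist (p q : MarkedData ρ V) (ν : Mink) (κ : ℝ) : Prop :=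
  ∀ a ∈ contact p ν, ∀ b ∈ contact p ν,
    liftedMarking q a - liftedMarking q b +
      mink ν (liftedMarking q a - liftedMarking q b) • ν =
    κ • lcross ν (liftedMarking p a - liftedMarking p b)

theorem HasTwist.neg {p q : MarkedData ρ V} {ν : Mink} {κ : ℝ} (h : HasTwist p q ν κ) :
    HasTwist p (-q) ν (-κ) := by
  intro a ha b hb
  have e : ∀ a, liftedMarking (-q) a = -liftedMarking q a := fun a => (markingCLM ρ a).map_neg q
  rw [neg_smul, ← h a ha b hb, e, e, neg_sub_neg, ← neg_sub (liftedMarking q a), mink_neg_right,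
    neg_smul, neg_add]

theorem HasTwist.mink_lcross {p q : MarkedData ρ V} {ν : Mink} (hν : ν ∈ hyperbolicPlane) {κ : ℝ}
    (h : HasTwist p q ν κ) {a b : Γ × V} (ha : a ∈ contact p ν) (hb : b ∈ contact p ν) :
    mink (liftedMarking q a - liftedMarking q b)
      (lcross ν (liftedMarking p a - liftedMarking p b)) = κ * edgeSq p a b := by
  have h1 := congrArg (fun x => mink x (lcross ν (liftedMarking p a - liftedMarking p b)))
    (h a ha b hb)
  have h0 : mink ν (liftedMarking p a - liftedMarking p b) = 0 := by
    rw [mink_sub_right, mink_eq_of_contact ha hb, sub_self]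
  simp only [mink_add_left, mink_smul_left, mink_lcross_lcross] at h1
  rw [mink_comm ν (lcross _ _), mink_lcross_left, h0, hν.1] at h1
  rw [edgeSq]
  linear_combination h1

theorem HasTwist.sq {p q : MarkedData ρ V} {ν : Mink} (hν : ν ∈ hyperbolicPlane) {κ : ℝ}
    (h : HasTwist p q ν κ) {a b : Γ × V} (ha : a ∈ contact p ν) (hb : b ∈ contact p ν) :
    κ ^ 2 * edgeSq p a b =
      edgeSq q a b + mink ν (liftedMarking q a - liftedMarking q b) ^ 2 := by
  have h1 := congrArg (fun x => mink x x) (h a ha b hb)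
  have h0 : mink ν (liftedMarking p a - liftedMarking p b) = 0 := by
    rw [mink_sub_right, mink_eq_of_contact ha hb, sub_self]
  simp only [mink_add_left, mink_add_right, mink_smul_left, mink_smul_right,
    mink_lcross_lcross] at h1
  rw [mink_comm _ ν, h0, hν.1] at h1
  rw [edgeSq, edgeSq]
  linear_combination -h1

theorem pc_add_smul (ν Z Z' : Mink) (r : ℝ) : pc ν (Z + r • Z') = pc ν Z + r • pc ν Z' := by
  ext <;> simp only [pc, mink_add_right, mink_smul_right, Prod.fst_add, Prod.snd_add,
    Prod.smul_fst, Prod.smul_snd, smul_eq_mul]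

theorem pc_smul (ν Z : Mink) (r : ℝ) : pc ν (r • Z) = r • pc ν Z := by
  ext <;> simp only [pc, mink_smul_right, Prod.smul_fst, Prod.smul_snd, smul_eq_mul]

theorem pc_self {ν : Mink} (hν : ν ∈ hyperbolicPlane) : pc ν ν = 0 := by
  have h := mink_eq_pc hν ν ν
  rw [hν.1] at h
  ext
  · change (pc ν ν).1 = 0
    nlinarith [sq_nonneg (pc ν ν).1, sq_nonneg (pc ν ν).2]
  · change (pc ν ν).2 = 0
    nlinarith [sq_nonneg (pc ν ν).1, sq_nonneg (pc ν ν).2]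

variable (hρ : IsHyperbolicHolonomy ρ) {p : MarkedData ρ V}
include hρ

theorem edgeSq_translate (q : MarkedData ρ V) (γ : Γ) (a b : Γ × V) :
    edgeSq q (translate γ a) (translate γ b) = edgeSq q a b := by
  rw [edgeSq, liftedMarking_translate_sub, hρ.mink_map, edgeSq]

variable (hp : p ∈ convexMarkedData ρ V)
include hp

omit hρ in
theorem edgeSq_pos {ν : Mink} (hν : ν ∈ hyperbolicPlane) {a b : Γ × V} (ha : a ∈ contact p ν)
    (hb : b ∈ contact p ν) (hab : a ≠ b) : 0 < edgeSq p a b := by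
  have h0 := mink_eq_of_contact ha hb
  rw [edgeSq, mink_self_eq_sqD hν, h0, sub_self, zero_pow two_ne_zero, sub_zero]
  exact sqD_pos fun h => hab (injective_liftedMarking hp (eq_of_pc hν h h0))

/-- `HasTwist.sq` expresses the square of the twist by quantities that the group preserves. The sign
is not needed, as the maximum principle is applied to absolute values. -/
theorem HasTwist.sq_map {q : MarkedData ρ V} {ν : Mink} (hν : IsFacet p ν) {κ κ' : ℝ} {γ : Γ}
    (h : HasTwist p q ν κ) (h' : HasTwist p q (ρ γ ν) κ') : κ' ^ 2 = κ ^ 2 := by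
  obtain ⟨t, ht, htν⟩ := hν.2
  obtain ⟨a, ha, b, hb, hab⟩ := Finset.one_lt_card.1 (by omega : 1 < t.card)
  have e := h.sq hν.1 (htν ha) (htν hb)
  have e' := h'.sq (exists_facet_map hρ hν γ).1 ((mem_contact_translate hρ).2 (htν ha))
    ((mem_contact_translate hρ).2 (htν hb))
  rw [edgeSq_translate hρ, edgeSq_translate hρ, liftedMarking_translate_sub, hρ.mink_map, ← e] at e'
  exact mul_right_cancel₀ (edgeSq_pos hp hν.1 (htν ha) (htν hb) hab).ne' e'

variable [Finite V] [Nonempty V] {T : Set (Finset (Γ × V))} (hT : IsFaceTriangulation p T)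
include hT

/-- A variation which preserves the lengths of all edges twists every facet. -/
theorem IsFacet.exists_twist {ν : Mink} (hν : IsFacet p ν) {q : MarkedData ρ V}
    (hq : ∀ e ∈ edges T, edgeDeriv p e.1 e.2 q = 0) : ∃ κ, HasTwist p q ν κ := by
  classical
  obtain ⟨σ, n, hpoly⟩ := hν.exists_polygon hρ hp
  have hn := hpoly.two_le
  have hTF := hν.isTri hρ hp hT hpoly
  have h0 : ∀ {a b}, a ∈ contact p ν → b ∈ contact p ν →
      mink ν (liftedMarking p a - liftedMarking p b) = 0 := fun ha hb => by
    rw [mink_sub_right, mink_eq_of_contact ha hb, sub_self]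
  have hd : ∀ t ∈ {t | t ∈ T ∧ (t : Set (Γ × V)) ⊆ contact p ν}, ∀ a ∈ t, ∀ b ∈ t,
      dotForm (pc ν (liftedMarking p a) - pc ν (liftedMarking p b))
        (pc ν (liftedMarking q a) - pc ν (liftedMarking q b)) = 0 := by
    rintro t ⟨ht, htν⟩ a ha b hb
    by_cases hab : a = b
    · rw [hab, sub_self, map_zero, LinearMap.zero_apply]
    · have h1 := hq (a, b) ⟨hab, t, ht, ha, hb⟩
      rw [edgeDeriv_apply, mink_eq_pc hν.1, h0 (htν ha) (htν hb), zero_mul, sub_zero, pc_sub,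
        pc_sub] at h1
      exact h1
  have hside : IsSide σ n (σ 0) (σ n) := Or.inr ⟨rfl, rfl⟩
  have hne : σ 0 ≠ σ n := fun h =>
    hpoly.ordered.ne hn (show 0 < n by omega) le_rfl (by simp only [h])
  have hmid := hTF.isSide_subset hside (midpt_mem hne)
  rw [hTF.triReal_eq hn] at hmid
  -- The triangle that contains the midpoint of the base side has both its ends as vertices, so the
  -- base side is an edge of `T`.
  obtain ⟨t, ht, hxt⟩ := Set.mem_iUnion₂.1 hmid
  have hmem : ∀ c, midpt (σ 0) (σ n) c ≠ 0 → c ∈ t := fun c hc => by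
    by_contra h; exact hc (hxt.2.1 c h)
  obtain ⟨κ, hκ⟩ := hTF.exists_rotation (u := fun a => pc ν (liftedMarking q a)) hpoly.ordered hn
    le_rfl hd (hd t ht _ (hmem _ (by simp [midpt])) _ (hmem _ (by simp [midpt])))
  refine ⟨κ, fun a ha b hb => eq_of_pc hν.1 ?_ ?_⟩
  · rw [pc_add_smul, pc_self hν.1, smul_zero, add_zero, pc_smul, pc_lcross hν.1, pc_sub, pc_sub]
    exact hκ a (hpoly.mem_iff.1 ha) b (hpoly.mem_iff.1 hb)
  · rw [mink_add_right, mink_smul_right, hν.1.1, mink_smul_right, mink_comm ν (lcross _ _),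
      mink_lcross_left]
    ring

end

end HypRigidity

/-! ### The maximum principle for twists and the injectivity of the differential -/

namespace HypRigidity

theorem lcross_smul_sub_left (a b c : Mink) (r s : ℝ) :
    lcross (r • (a - s • b)) c = r • (lcross a c - s • lcross b c) := by
  ext i
  fin_cases i <;> simp [lcross] <;> ring

section

variable {Γ : Type*} [Group Γ] {ρ : Γ →* (Mink ≃ₗ[ℝ] Mink)} {V : Type*}

/-- The twists of two facets with a common side. -/
theorem HasTwist.adjacent {p q : MarkedData ρ V} {ν ν' : Mink} (hν : ν ∈ hyperbolicPlane)
    (hν' : ν' ∈ hyperbolicPlane) {κ κ' r s : ℝ} (h : HasTwist p q ν κ) (h' : HasTwist p q ν' κ')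
    {a b : Γ × V} (ha : a ∈ contact p ν) (hb : b ∈ contact p ν) (ha' : a ∈ contact p ν')
    (hb' : b ∈ contact p ν') (hpos : 0 < edgeSq p b a)
    (he : ν' = r • (ν - s • lcross ν (liftedMarking p b - liftedMarking p a))) :
    κ' = r * (κ - s * mink ν (liftedMarking q b - liftedMarking q a)) := by
  have e := h.mink_lcross hν hb ha
  have e' := h'.mink_lcross hν' hb' ha'
  have h0 : mink ν (liftedMarking p b - liftedMarking p a) = 0 := by
    rw [mink_sub_right, mink_eq_of_contact hb ha, sub_self]
  set Δ := liftedMarking p b - liftedMarking p a with hΔ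
  have hc : lcross ν' Δ = r • (lcross ν Δ - s • lcross (lcross ν Δ) Δ) := by
    rw [he, lcross_smul_sub_left]
  rw [hc, lcross_lcross_left, h0, zero_smul, sub_zero, mink_smul_right, mink_sub_right, e,
    mink_smul_right, mink_smul_right, mink_comm _ ν] at e'
  refine mul_right_cancel₀ hpos.ne' ?_
  rw [← e']
  simp only [edgeSq, ← hΔ]
  ring

variable (hρ : IsHyperbolicHolonomy ρ) [Finite V] [Nonempty V] {p : MarkedData ρ V}
  (hp : p ∈ convexMarkedData ρ V)
include hρ hp

/-- The facet on the other side of a side of a facet. -/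
theorem IsFacet.exists_adjacent {ν : Mink} (hν : IsFacet p ν) {a b : Γ × V}
    (ha : a ∈ contact p ν) (hb : b ∈ contact p ν) (hab : a ≠ b)
    (hside : ∀ c ∈ contact p ν, c ≠ a → c ≠ b → 0 < area2 (pc ν (liftedMarking p a))
      (pc ν (liftedMarking p b)) (pc ν (liftedMarking p c))) :
    ∃ r s : ℝ, 1 < r ∧ 0 < s ∧ ∃ ν', IsFacet p ν' ∧
      ν' = r • (ν - s • lcross ν (liftedMarking p b - liftedMarking p a)) ∧
      a ∈ contact p ν' ∧ b ∈ contact p ν' := by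
  classical
  obtain ⟨C, c₀, hC, hc₀, hpg⟩ := exists_uniformGrowth hρ hp
  have hνf := mem_futureCone_of_plane hν.1
  have h0 : ∀ {x y}, x ∈ contact p ν → y ∈ contact p ν →
      mink ν (liftedMarking p x - liftedMarking p y) = 0 := fun hx hy => by
    rw [mink_sub_right, mink_eq_of_contact hx hy, sub_self]
  set Δ := liftedMarking p b - liftedMarking p a with hΔ
  set k := lcross ν Δ with hk
  have hkν : mink ν k = 0 := by rw [mink_comm]; exact mink_lcross_left _ _
  have hkΔ : mink k Δ = 0 := mink_lcross_right _ _
  have hL : 0 < mink Δ Δ := edgeSq_pos hp hν.1 hb ha hab.symm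
  have hkk : mink k k = mink Δ Δ := by
    rw [hk, mink_lcross_lcross, h0 hb ha, hν.1.1]; ring
  -- Rotate the support plane about the side from `a` to `b`. The vector `k` points into the facet,
  -- so for `s > 0` the rest of the facet drops below the plane. The neighbouring facet is found at
  -- the last `s` for which `a` is still a contact point.
  set N : ℝ → Mink := fun s => ν - s • k with hN
  have hNm : ∀ s x, mink (N s) x = mink ν x - s * mink k x := fun s x => by
    simp only [hN, mink_sub_left, mink_smul_left]
  have hNN : ∀ s, mink (N s) (N s) = -1 + s ^ 2 * mink Δ Δ := fun s => by
    simp only [hN, mink_sub_left, mink_sub_right, mink_smul_left, mink_smul_right, hkk, hν.1.1,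
      hkν, mink_comm k ν]
    ring
  have hNc : Continuous N := continuous_const.sub (continuous_id.smul continuous_const)
  have hNab : ∀ s, mink (N s) (liftedMarking p b) = mink (N s) (liftedMarking p a) := fun s => by
    have e1 := h0 hb ha
    have e2 := hkΔ
    rw [hΔ, mink_sub_right] at e2
    rw [mink_sub_right] at e1
    rw [hNm, hNm]
    linear_combination e1 - s * e2
  have hsidek : ∀ c ∈ contact p ν, c ≠ a → c ≠ b →
      mink k (liftedMarking p a) < mink k (liftedMarking p c) := by
    intro c hc hca hcb
    have h1 := hside c hc hca hcb
    have h2 : mink k (liftedMarking p c - liftedMarking p a) =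
        area2 (pc ν (liftedMarking p a)) (pc ν (liftedMarking p b)) (pc ν (liftedMarking p c)) := by
      rw [mink_eq_pc hν.1, hkν, zero_mul, sub_zero, hk, pc_lcross hν.1, pc_sub, pc_sub]
      simp only [area2, Prod.fst_sub, Prod.snd_sub]
      ring
    rw [mink_sub_right] at h2
    linarith
  set P : Set ℝ := {s | 0 ≤ s ∧ a ∈ contact p (N s)} with hP
  have hfut : ∀ s, a ∈ contact p (N s) → N s ∈ futureCone := by
    intro s hs
    refine support_mem_futureCone hρ hC hc₀ hpg (fun h => ?_)
      (subset_closure (subset_convexHull ℝ _ ⟨a, rfl⟩)) hs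
    have h1 := hNm s ν
    rw [h, hν.1.1, mink_comm k, hkν] at h1
    simp [mink] at h1
  have hPclosed : IsClosed P := by
    have : P = Set.Ici 0 ∩ ⋂ c, {s | mink (N s) (liftedMarking p c) ≤
        mink (N s) (liftedMarking p a)} := by
      ext s
      simp only [hP, contact, Set.mem_ofPred_eq, Set.mem_inter_iff, Set.mem_Ici, Set.mem_iInter]
    rw [this]
    exact isClosed_Ici.inter (isClosed_iInter fun c => isClosed_le
      (continuous_mink_comp hNc continuous_const) (continuous_mink_comp hNc continuous_const))
  -- The rotation stops because normals of support planes are timelike, and `N s` is so only while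
  -- `s ^ 2 * mink Δ Δ < 1`.
  have hPbdd : BddAbove P := by
    refine ⟨1 + 1 / mink Δ Δ, fun s hs => ?_⟩
    have h1 := (hfut s hs.2).1
    rw [hNN] at h1
    have h2 : s ^ 2 < 1 / mink Δ Δ := by rw [lt_div_iff₀ hL]; linarith
    nlinarith [sq_nonneg (s - 1)]
  have hN0 : N 0 = ν := by simp only [hN, zero_smul, sub_zero]
  have hP0 : (0 : ℝ) ∈ P := ⟨le_rfl, by rw [hN0]; exact ha⟩
  set s := sSup P with hs
  have hsP : s ∈ P := hPclosed.csSup_mem ⟨0, hP0⟩ hPbdd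
  have hsemi : ∀ t, N t ∈ futureCone →
      ∃ t' > t, contact p (N t') ⊆ contact p (N t) ∧ (contact p (N t')).Nonempty := by
    intro t ht
    have h1 : Filter.Tendsto (fun t' => (p, N t')) (𝓝 t) (𝓝 (p, N t)) :=
      tendsto_const_nhds.prodMk_nhds (hNc.tendsto t)
    have h2 := (h1.eventually (eventually_contact_subset hρ hC hc₀ hpg ht)).and
      ((hNc.tendsto t).eventually (isOpen_futureCone.mem_nhds ht))
    obtain ⟨t', ⟨h3, h4⟩, h5⟩ := ((h2.filter_mono nhdsWithin_le_nhds).and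
      (self_mem_nhdsWithin : Set.Ioi t ∈ 𝓝[>] t)).exists
    exact ⟨t', h5, h3, contact_nonempty hρ hp h4⟩
  have hspos : 0 < s := by
    obtain ⟨t, ht, h1, c, hc⟩ := hsemi 0 (hN0.symm ▸ hνf)
    rw [hN0] at h1
    have ht0 : (0 : ℝ) < t := ht
    refine ht0.trans_le (le_csSup hPbdd ⟨ht0.le, fun d => (hc d).trans ?_⟩)
    by_cases hca : c = a
    · rw [hca]
    by_cases hcb : c = b
    · rw [hcb, hNab]
    · have e1 := mink_eq_of_contact (h1 hc) ha
      have e2 := hsidek c (h1 hc) hca hcb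
      rw [hNm, hNm, e1]
      nlinarith
  have hsf := hfut s hsP.2
  -- Just beyond the last position some other marked point `c` is touched. By semicontinuity it
  -- already touches the last plane, so it is the third vertex of the neighbour.
  obtain ⟨t, ht, h1, c, hc⟩ := hsemi s hsf
  have hat : a ∉ contact p (N t) := fun h =>
    absurd (le_csSup hPbdd (show t ∈ P from ⟨hspos.le.trans (le_of_lt ht), h⟩)) (not_le.2 ht)
  have hbs : b ∈ contact p (N s) := mem_contact_of_eq hsP.2 (hNab s).symm
  have hca : c ≠ a := fun h => hat (h ▸ hc)
  have hcb : c ≠ b := fun h => hat (mem_contact_of_eq (h ▸ hc) (hNab t))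
  obtain ⟨r, hr, hrν⟩ := exists_normalize hsf
  have hcon := contact_smul hr p (N s)
  refine ⟨r, s, ?_, hspos, r • N s, ⟨hrν, {a, b, c}, ?_, ?_⟩, rfl, hcon ▸ hsP.2, hcon ▸ hbs⟩
  -- The form of `N s` is -1 + s² ⟨Δ, Δ⟩, greater than -1, so normalizing multiplies by `r > 1`.
  · have h2 := hrν.1
    rw [mink_smul_left, mink_smul_right, hNN] at h2
    have h3 : 0 < s ^ 2 * mink Δ Δ := by positivity
    by_contra hle
    nlinarith [mul_pos (mul_pos hr hr) h3]
  · rw [Finset.card_eq_three]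
    exact ⟨a, b, c, hab, hca.symm, hcb.symm, rfl⟩
  · intro d hd
    simp only [Finset.coe_insert, Finset.coe_singleton, Set.mem_insert_iff,
      Set.mem_singleton_iff] at hd
    rw [hcon]
    rcases hd with rfl | rfl | rfl
    · exact hsP.2
    · exact hbs
    · exact h1 hc

/-- The sides of a facet bound facets with a relation between the twists. -/
theorem IsPolygon.exists_adjacent_twist [DecidableEq (Γ × V)] {ν : Mink} (hν : IsFacet p ν)
    {σ : ℕ → Γ × V} {n : ℕ} (hpoly : IsPolygon p ν σ n) {q : MarkedData ρ V} {κ : Mink → ℝ}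
    (hκ : ∀ ν, IsFacet p ν → HasTwist p q ν (κ ν)) {i j : ℕ}
    (hij : (i < n ∧ j = i + 1) ∨ (i = n ∧ j = 0)) :
    ∃ r s : ℝ, 1 < r ∧ 0 < s ∧ ∃ ν', IsFacet p ν' ∧
      κ ν' = r * (κ ν - s * mink ν (liftedMarking q (σ j) - liftedMarking q (σ i))) := by
  have hn := hpoly.two_le
  have hi : i ≤ n := by omega
  have hj : j ≤ n := by omega
  have ha := hpoly.mem hi
  have hb := hpoly.mem hj
  have hab : σ i ≠ σ j := fun h => by
    rcases hij with ⟨h1, h2⟩ | ⟨h1, h2⟩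
    · exact hpoly.ordered.ne hn (show i < j by omega) hj (by simp only [h])
    · exact hpoly.ordered.ne hn (show j < i by omega) hi (by simp only [h])
  obtain ⟨r, s, hr, hs, ν', hν', he, ha', hb'⟩ := hν.exists_adjacent hρ hp ha hb hab (by
    intro c hc hca hcb
    obtain ⟨k, -, hk, rfl⟩ := mem_seg.1 (hpoly.mem_iff.1 hc)
    have hki : k ≠ i := fun h => hca (by rw [h])
    have hkj : k ≠ j := fun h => hcb (by rw [h])
    rcases hij with ⟨h1, h2⟩ | ⟨h1, h2⟩
    · exact hpoly.ordered.pos_outside (by omega) hj hk (by omega)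
    · rw [← area2_rotate]
      exact hpoly.ordered j k i (by omega) (by omega) hi)
  exact ⟨r, s, hr, hs, ν', hν', (hκ ν hν).adjacent hν.1 hν'.1 (hκ ν' hν') ha hb ha' hb'
    (edgeSq_pos hp hν.1 hb ha hab.symm) he⟩

/-- The angular velocity of the facets has no positive maximum. -/
theorem not_exists_max_twist {q : MarkedData ρ V} {κ : Mink → ℝ}
    (hκ : ∀ ν, IsFacet p ν → HasTwist p q ν (κ ν)) {ν : Mink} (hν : IsFacet p ν)
    (hmax : ∀ ν', IsFacet p ν' → κ ν' ≤ κ ν) : κ ν ≤ 0 := by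
  classical
  by_contra! hpos
  obtain ⟨σ, n, hpoly⟩ := hν.exists_polygon hρ hp
  -- If the neighbour's twist is no larger than the positive `κ ν`, the factor `r > 1` forces the
  -- height difference along the side to be positive. This holds for every side, including the
  -- closing one from `σ n` to `σ 0`.
  have key : ∀ i j, ((i < n ∧ j = i + 1) ∨ (i = n ∧ j = 0)) →
      mink ν (liftedMarking q (σ i)) < mink ν (liftedMarking q (σ j)) := by
    intro i j hij
    obtain ⟨r, s, hr, hs, ν', hν', he⟩ := hpoly.exists_adjacent_twist hρ hp hν hκ hij
    have h1 := hmax ν' hν'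
    rw [he] at h1
    have h2 : 0 < s * mink ν (liftedMarking q (σ j) - liftedMarking q (σ i)) := by
      by_contra! h
      nlinarith
    have h3 := pos_of_mul_pos_right h2 hs.le
    rw [mink_sub_right] at h3
    linarith
  have hmono : ∀ k ≤ n, mink ν (liftedMarking q (σ 0)) ≤ mink ν (liftedMarking q (σ k)) := by
    intro k
    induction k with
    | zero => intro _; exact le_rfl
    | succ k ih => intro hk; exact (ih (by omega)).trans (key k (k + 1) (Or.inl ⟨hk, rfl⟩)).le
  exact absurd (key n 0 (Or.inr ⟨rfl, rfl⟩)) (not_lt.2 (hmono n le_rfl))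

/-- If no facet is twisted, each facet is only translated. -/
theorem IsFacet.eq_of_twist_eq_zero {q : MarkedData ρ V}
    (hκ : ∀ ν, IsFacet p ν → HasTwist p q ν 0) {ν : Mink} (hν : IsFacet p ν) {a b : Γ × V}
    (ha : a ∈ contact p ν) (hb : b ∈ contact p ν) : liftedMarking q a = liftedMarking q b := by
  classical
  obtain ⟨σ, n, hpoly⟩ := hν.exists_polygon hρ hp
  have key : ∀ i < n, liftedMarking q (σ (i + 1)) = liftedMarking q (σ i) := by
    intro i hi
    obtain ⟨r, s, hr, hs, ν', hν', he⟩ := hpoly.exists_adjacent_twist hρ hp hν (κ := fun _ => 0) hκ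
      (Or.inl ⟨hi, rfl⟩)
    -- With all twists zero, the relation across a side leaves only the height difference, which
    -- must vanish; the twist equation in the plane then removes the tangential part.
    have h1 : mink ν (liftedMarking q (σ (i + 1)) - liftedMarking q (σ i)) = 0 := by
      have : r * s ≠ 0 := by positivity
      refine (mul_eq_zero.1 (?_ : (r * s) * _ = 0)).resolve_left this
      linear_combination he
    have h2 := hκ ν hν _ (hpoly.mem (k := i + 1) hi) _ (hpoly.mem (k := i) hi.le)
    rw [h1, zero_smul, zero_smul, add_zero] at h2
    exact sub_eq_zero.1 h2
  have hall : ∀ k ≤ n, liftedMarking q (σ k) = liftedMarking q (σ 0) := by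
    intro k
    induction k with
    | zero => intro _; rfl
    | succ k ih => intro hk; rw [key k hk, ih (by omega)]
  obtain ⟨i, -, hi, rfl⟩ := mem_seg.1 (hpoly.mem_iff.1 ha)
  obtain ⟨j, -, hj, rfl⟩ := mem_seg.1 (hpoly.mem_iff.1 hb)
  rw [hall i hi, hall j hj]

variable {T : Set (Finset (Γ × V))} (hT : IsFaceTriangulation p T)
include hT

/-- The absolute value of the twist is invariant under the group and so attains its maximum among
finitely many facets. The maximum principle applies there to `q` or to `-q`, depending on the sign.
-/
theorem hasTwist_zero {q : MarkedData ρ V} (hq : ∀ e ∈ edges T, edgeDeriv p e.1 e.2 q = 0)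
    {ν : Mink} (hν : IsFacet p ν) : HasTwist p q ν 0 := by
  classical
  have hex : ∀ ν, ∃ κ, IsFacet p ν → HasTwist p q ν κ := fun ν => by
    by_cases h : IsFacet p ν
    · obtain ⟨κ, hκ⟩ := h.exists_twist hρ hp hT hq
      exact ⟨κ, fun _ => hκ⟩
    · exact ⟨0, fun h' => absurd h' h⟩
  choose κ hκ using hex
  obtain ⟨S, hS, hSf, hcov⟩ := finite_facets hρ hp hT
  have hSne : S.Nonempty := by
    obtain ⟨-, ν₀, h, -⟩ := hcov ν hν
    exact ⟨ν₀, h⟩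
  obtain ⟨μ, hμS, hμ⟩ := hS.exists_maximalFor (fun ν => |κ ν|) S hSne
  have hμf := hSf μ hμS
  have hmax : ∀ ν, IsFacet p ν → |κ ν| ≤ |κ μ| := by
    intro ν hν
    obtain ⟨γ, ν₀, hν₀, rfl⟩ := hcov ν hν
    have h1 := (hκ ν₀ (hSf _ hν₀)).sq_map hρ hp (hSf _ hν₀) (hκ _ hν)
    rw [(sq_eq_sq_iff_abs_eq_abs _ _).1 h1]
    rcases le_total |κ ν₀| |κ μ| with h | h
    · exact h
    · exact hμ hν₀ h
  have hμ0 : κ μ = 0 := by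
    rcases le_total 0 (κ μ) with h | h
    · refine le_antisymm (not_exists_max_twist hρ hp hκ hμf fun ν' hν' => ?_) h
      rw [← abs_of_nonneg h]
      exact (le_abs_self _).trans (hmax ν' hν')
    · have := not_exists_max_twist hρ hp (q := -q) (κ := fun ν => -κ ν)
        (fun ν hν => (hκ ν hν).neg) hμf fun ν' hν' => by
          rw [← abs_of_nonpos h]
          exact (neg_le_abs _).trans (hmax ν' hν')
      linarith
  have h1 := hmax ν hν
  rw [hμ0, abs_zero] at h1
  rw [← abs_eq_zero.1 (le_antisymm h1 (abs_nonneg _))]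
  exact hκ ν hν

/-- Infinitesimal rigidity: a variation which preserves the lengths of all edges is trivial. -/
theorem mem_trivialDirections_of_edgeDeriv_eq_zero {q : MarkedData ρ V}
    (hq : ∀ e ∈ edges T, edgeDeriv p e.1 e.2 q = 0) : q ∈ trivialDirections ρ V := by
  classical
  obtain ⟨C, c, hC, hc, hpg⟩ := exists_uniformGrowth hρ hp
  have hconst : ∀ n ∈ futureCone, ∀ a ∈ contact p n, ∀ b ∈ contact p n,
      liftedMarking q a = liftedMarking q b := by
    intro n hn a ha b hb
    obtain ⟨ν, hν, hsub⟩ := exists_facet hρ hp hT hn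
    exact hν.eq_of_twist_eq_zero hρ hp (fun ν hν => hasTwist_zero hρ hp hT hq hν) (hsub ha) (hsub hb)
  have hne : ∀ n : futureCone, (contact p n.1).Nonempty := fun n => contact_nonempty hρ hp n.2
  set F : futureCone → Mink := fun n => liftedMarking q (hne n).some with hF
  have hFeq : ∀ (n : futureCone) a, a ∈ contact p n.1 → liftedMarking q a = F n := fun n a ha =>
    hconst n n.2 a ha _ (hne n).some_mem
  -- Contact sets can only shrink near a given normal, so the common displacement of the contact
  -- points does not change locally. Every marked point is a contact point of some normal, and the
  -- cone of normals is connected.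
  have hFloc : IsLocallyConstant F := by
    rw [IsLocallyConstant.iff_eventually_eq]
    intro n
    have h1 : Filter.Tendsto (fun m : futureCone => (p, m.1)) (𝓝 n) (𝓝 (p, n.1)) :=
      tendsto_const_nhds.prodMk_nhds (continuous_subtype_val.tendsto n)
    filter_upwards [h1.eventually (eventually_contact_subset hρ hC hc hpg n.2)] with m hm
    exact hFeq n _ (hm (hne m).some_mem)
  have : PreconnectedSpace futureCone :=
    Subtype.preconnectedSpace convex_futureCone.isPreconnected
  obtain ⟨v⟩ := ‹Nonempty V›
  obtain ⟨n₀, hn₀, h0⟩ := exists_mem_contact hρ hp hC hc hpg (1, v)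
  have hall : ∀ a, liftedMarking q a = F ⟨n₀, hn₀⟩ := by
    intro a
    obtain ⟨n, hn, ha⟩ := exists_mem_contact hρ hp hC hc hpg a
    rw [hFeq ⟨n, hn⟩ a ha]
    exact hFloc.apply_eq_of_preconnectedSpace _ _
  have hbase : ∀ v, q.2 v = F ⟨n₀, hn₀⟩ := fun v => by
    rw [← hall (1, v), liftedMarking, affineAct_one]
  refine ⟨F ⟨n₀, hn₀⟩, fun γ => ?_, hbase⟩
  have h1 := hall (γ, v)
  rw [liftedMarking, affineAct, hbase] at h1
  exact eq_sub_of_add_eq' h1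

omit hρ hp hT [Finite V] [Nonempty V] in
theorem edgeDeriv_eq_zero_of_mem_trivialDirections {q : MarkedData ρ V}
    (hq : q ∈ trivialDirections ρ V) (a b : Γ × V) : edgeDeriv p a b q = 0 := by
  obtain ⟨w, h1, h2⟩ := hq
  have h3 : ∀ a, liftedMarking q a = w := fun a => by
    rw [liftedMarking, affineAct, h1, h2]; abel
  rw [edgeDeriv_apply, h3, h3, sub_self]
  simp [mink]

theorem hasInjectiveDifferential : HasInjectiveDifferential p T := by
  classical
  obtain ⟨Φ, hΦ, hloc⟩ := exists_eventually_lengths hρ hp hT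
  have hedge : ∀ e ∈ edges T, 0 < edgeSq p e.1 e.2 ∧ ∃ ν, IsFacet p ν ∧ e.1 ∈ contact p ν ∧
      e.2 ∈ contact p ν := by
    rintro ⟨a, b⟩ ⟨hab, t, ht, ha, hb⟩
    obtain ⟨ν, hν, htν⟩ := exists_facet_of_triangle hρ hp hT ht
    exact ⟨edgeSq_pos hp hν.1 (htν ha) (htν hb) hab, ν, hν, htν ha, htν hb⟩
  refine ⟨Φ, fun e => (√(edgeSq p e.1 e.2))⁻¹ • edgeDeriv p e.1 e.2, hΦ, fun e he => ?_,
    fun q => ⟨fun h => ?_, fun h e _ => ?_⟩⟩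
  · obtain ⟨h1, ν, hν, ha, hb⟩ := hedge e he
    obtain ⟨C, S, hCS⟩ := hloc ν hν _ ha _ hb
    exact hasFDerivAt_of_sq_sub_edgeSq h1 hCS
  · refine mem_trivialDirections_of_edgeDeriv_eq_zero hρ hp hT fun e he => ?_
    exact (mul_eq_zero.1 (h e he)).resolve_left (inv_ne_zero (Real.sqrt_pos.2 (hedge e he).1).ne')
  · change _ * edgeDeriv p e.1 e.2 q = 0
    rw [edgeDeriv_eq_zero_of_mem_trivialDirections h, mul_zero]

end

end HypRigidity

open HypRigidity
theorem mainTheorem6 {Γ : Type*} [Group Γ] (ρ : Γ →* (Mink ≃ₗ[ℝ] Mink))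
    (hρ : IsHyperbolicHolonomy ρ) :
    (∀ (V : Type*) [Finite V] [Nonempty V], ∀ p ∈ convexMarkedData ρ V,
      ∀ T : Set (Finset (Γ × V)), IsFaceTriangulation p T → HasInjectiveDifferential p T) ∧
    (∀ (W D : Type*) [MulAction Γ W] [MulAction Γ D] (G : GeodesicGraph ρ W D),
      G.IsConvexCellulation →
        (∀ e : D → Mink, G.IsEdgeField e → G.SolvesSystem e → ∀ d, e d = 0) ∧
        (∀ (u : W → Mink) (e : D → Mink), G.IsInfinitesimalDeformation u e →
          G.PreservesAngles e → (∀ v, u v = 0) ∧ ∀ d, e d = 0)) := by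
  refine ⟨fun V _ _ p hp T hT => hasInjectiveDifferential hρ hp hT,
    fun W D _ _ G hG => ⟨fun e hf he => hG.edgeField_eq_zero hρ hf he,
      fun u e h ha => hG.deformation_eq_zero hρ h ha⟩⟩
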